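/- **Setting.** Let $T=(V,E)$ be a finite tree embedded in the plane, given by the clockwise cyclic order of the edges around each vertex, and let $L$ be a set of *lines* on $T$, that is, simple paths in $T$ with at least one edge. Assume that lines end only at vertices of degree one and that no two lines end at the same vertex. For $e\in E$ let $L_e$ be the set of lines passing through $e$. A *block move* on a sequence $[\pi_1,\dots,\pi_n]$ exchanges two consecutive nonempty blocks $\pi_i,\dots,\pi_j$ and $\pi_{j+1},\dots,\pi_k$ ($i\le j<k$). A *solution* assigns to every edge $e=uv$ a sequence $\pi^0(e),\dots,\pi^{t(e)}(e)$ of orders of $L_e$, each obtained from its predecessor by a block move, where $\pi^0(e)$ is the order close to $u$ and $\pi^{t(e)}(e)$ the order close to $v$, such that the orders are *consistent*: for every vertex $v$ and every edge $e$ at $v$, the order close to $v$ on $e$ of the lines of $L_e$ that continue beyond $v$ equals their combined order, close to $v$, on the other edges at $v$, taken in their cyclic order (so two lines with a common edge at $v$ do not cross in $v$). The number of *block crossings* of the solution is $\sum_{e\in E}t(e)$. The solution is *monotone* if no two lines cross twice, i.e. for any two lines the total number of block moves, over all edges, that change their relative order is at most one. **Theorem.** (a) There is an algorithm that, for every such tree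 $T$ and set of lines $L$ with $|L|\ge 2$, computes in $O(|L|(|L|+|E|))$ time a monotone solution with at most $2|L|-3$ block crossings. (The algorithm is a unit-cost word RAM program with words of $O(\log N)$ bits, where $N$ is the length of the input, i.e. of the cyclic adjacency lists and the vertex sequences of the lines; it outputs all orders $\pi^0(e),\dots,\pi^{t(e)}(e)$ for all $e\in E$. The constants are absolute.) (b) The bound is tight: for every $m\ge 2$ there are such a tree $T$ and a set $L$ of $m$ lines on it for which every solution, monotone or not, has at least $2m-3$ block crossings. -/

import Mathlib

namespace BlockCrossing

/-! ### Networks, lines and line orders -/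

/-- An embedded graph on the vertices `0, …, n - 1` together with `m` lines.
The embedding is given by the clockwise cyclic order of the neighbours around each vertex
(the list `rot v` is read cyclically; the place where it is cut open is irrelevant),
and every line is a simple path with at least one edge, given by its vertex sequence. -/
structure Network (n m : ℕ) where
  graph : SimpleGraph (Fin n)
  rot : Fin n → List (Fin n)
  rot_nodup : ∀ v, (rot v).Nodup
  mem_rot : ∀ v w, w ∈ rot v ↔ graph.Adj v w
  line : Fin m → List (Fin n)
  line_nodup : ∀ i, (line i).Nodup
  line_chain : ∀ i, (line i).IsChain graph.Adj
  line_length : ∀ i, 2 ≤ (line i).length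

/-- A choice, for every edge `{u, v}` with `u < v`, of a sequence `π⁰, …, πᵗ` of orders of the
lines on that edge. Here `π⁰` is the order close to `u`, `πᵗ` is the order close to `v`, and every
order is read from left to right by a traveller going from `u` to `v`.
(Values at pairs that are not of this form are never used.) -/
abbrev LineOrders (n m : ℕ) := Fin n → Fin n → List (List (Fin m))

/-- One block move: the exchange of two neighbouring nonempty blocks `B` and `C`. -/
def BlockMove {α : Type*} (π π' : List α) : Prop :=
  ∃ A B C D : List α, B ≠ [] ∧ C ≠ [] ∧ π = A ++ B ++ C ++ D ∧ π' = A ++ C ++ B ++ D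

/-- The number of steps of a sequence of orders at which `a` and `b` change their relative order. -/
def crossCount {α : Type*} [DecidableEq α] (s : List (List α)) (a b : α) : ℕ :=
  (s.zip s.tail).countP fun p =>
    decide (p.1.idxOf a < p.1.idxOf b) != decide (p.2.idxOf a < p.2.idxOf b)

namespace Network

variable {n m : ℕ}

/-- The vertex `v` is a terminal (an endpoint) of the line `i`. -/
def IsTerminal (N : Network n m) (i : Fin m) (v : Fin n) : Prop :=
  (N.line i).head? = some v ∨ (N.line i).getLast? = some v

/-- The path terminal property: lines terminate only at vertices of degree one, and no two lines
terminate at the same vertex. -/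
def PathTerminal (N : Network n m) : Prop :=
  (∀ i v, N.IsTerminal i v → ∃! w, N.graph.Adj v w) ∧
  (∀ i j v, N.IsTerminal i v → N.IsTerminal j v → i = j)

/-- The line `i` passes through the edge `{u, v}` (in either direction). -/
def OnEdge (N : Network n m) (i : Fin m) (u v : Fin n) : Prop :=
  [u, v] <:+: N.line i ∨ [v, u] <:+: N.line i

instance (N : Network n m) (i : Fin m) (u v : Fin n) : Decidable (N.OnEdge i u v) :=
  inferInstanceAs (Decidable (_ ∨ _))

/-- All edges, each listed once as `(u, v)` with `u < v`. -/
def edges (N : Network n m) : List (Fin n × Fin n) :=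
  (List.finRange n).flatMap fun u => ((N.rot u).filter fun v => u < v).map fun v => (u, v)

/-- The neighbours of `v` other than `w`, in clockwise order starting after `w`. -/
def others (N : Network n m) (v w : Fin n) : List (Fin n) :=
  ((N.rot v).rotate ((N.rot v).idxOf w)).tail

/-- On every edge, the orders are orders of exactly the lines on that edge, there is at least
one of them, and each one arises from its predecessor by a block move. -/
def EdgeValid (N : Network n m) (S : LineOrders n m) : Prop :=
  ∀ e ∈ N.edges, S e.1 e.2 ≠ [] ∧ (S e.1 e.2).IsChain BlockMove ∧
    ∀ π ∈ S e.1 e.2, π.Nodup ∧ ∀ i, i ∈ π ↔ N.OnEdge i e.1 e.2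

/-- The order of the lines on the edge `{v, x}` close to `v`, from left to right for a traveller
that leaves `v` in the direction of `x`. -/
def outOrder (S : LineOrders n m) (v x : Fin n) : List (Fin m) :=
  if v < x then (S v x).head?.getD [] else ((S x v).getLast?.getD []).reverse

/-- The order of the lines on the edge `{w, v}` close to `v`, from left to right for a traveller
that arrives at `v` from `w`. -/
def inOrder (S : LineOrders n m) (w v : Fin n) : List (Fin m) :=
  (outOrder S v w).reverse

/-- The line orders are consistent: for each edge `{w, v}` at each vertex `v`, the order close to
`v` of those of its lines that continue beyond `v` is the combined order of the same lines on the
other edges at `v`, so that no two lines with a common edge at `v` cross in `v`.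
(To a traveller who arrives from `w`, the other edges at `v` appear from left to right in clockwise
order.) -/
def Consistent (N : Network n m) (S : LineOrders n m) : Prop :=
  ∀ v, ∀ w ∈ N.rot v,
    (inOrder S w v).filter (fun i => ∃ x ∈ N.others v w, N.OnEdge i v x) =
      (N.others v w).flatMap fun x => (outOrder S v x).filter fun i => N.OnEdge i w v

/-- `S` is a solution: a sequence of block moves on every edge, consistent in all vertices. -/
def Feasible (N : Network n m) (S : LineOrders n m) : Prop :=
  N.EdgeValid S ∧ N.Consistent S

/-- No two lines cross twice. -/
def Monotone (N : Network n m) (S : LineOrders n m) : Prop :=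
  ∀ i j, i ≠ j → (N.edges.map fun e => crossCount (S e.1 e.2) i j).sum ≤ 1

/-- The total number of block crossings, that is, of block moves on all edges. -/
def blockCrossings (N : Network n m) (S : LineOrders n m) : ℕ :=
  (N.edges.map fun e => (S e.1 e.2).length - 1).sum

/-! ### Input and output as sequences of numbers -/

/-- A list of indices, preceded by its length. -/
def encodeList {k : ℕ} (l : List (Fin k)) : List ℕ :=
  l.length :: l.map Fin.val

/-- The input: `n`, `m`, the clockwise adjacency list of every vertex, the vertex sequence of
every line. -/
def encode (N : Network n m) : List ℕ :=
  n :: m :: ((List.finRange n).flatMap fun v => encodeList (N.rot v)) ++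
    (List.finRange m).flatMap fun i => encodeList (N.line i)

/-- The output: for every edge (in the order of `edges`) the number of line orders on it,
followed by these line orders in full. -/
def encodeOrders (N : Network n m) (S : LineOrders n m) : List ℕ :=
  N.edges.flatMap fun e => (S e.1 e.2).length :: (S e.1 e.2).flatMap encodeList

end Network

/-! ### Random access machines

A word RAM with unit costs, programmed in a structured language: finitely many registers, finitely
many memory arrays (a program is a finite text and so mentions only finitely many of each),
an output tape, and the operations `+`, `-`, `*` (with `-` cut off at zero) on words. -/

namespace RAM

/-- Expressions: constants, registers, memory access, and arithmetic. -/
inductive Exp where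
  | const (c : ℕ)
  | reg (x : ℕ)
  | read (A : ℕ) (i : Exp)
  | add (a b : Exp)
  | sub (a b : Exp)
  | mul (a b : Exp)

/-- Tests: comparison of two expressions. -/
inductive Test where
  | lt (a b : Exp)
  | eq (a b : Exp)

/-- Programs. -/
inductive Prog where
  | skip
  | assign (x : ℕ) (e : Exp)
  | write (A : ℕ) (i e : Exp)
  | emit (e : Exp)
  | seq (p q : Prog)
  | cond (b : Test) (p q : Prog)
  | loop (b : Test) (p : Prog)

/-- A configuration: contents of the registers, of the memory arrays and of the output tape. -/
structure State where
  reg : ℕ → ℕ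
  mem : ℕ → ℕ → ℕ
  out : List ℕ

/-- The value of an expression. -/
def Exp.val (s : State) : Exp → ℕ
  | .const c => c
  | .reg x => s.reg x
  | .read A i => s.mem A (i.val s)
  | .add a b => a.val s + b.val s
  | .sub a b => a.val s - b.val s
  | .mul a b => a.val s * b.val s

/-- The number of operations (memory accesses included) in the evaluation of an expression. -/
def Exp.cost : Exp → ℕ
  | .const _ => 1
  | .reg _ => 1
  | .read _ i => i.cost + 1
  | .add a b => a.cost + b.cost + 1
  | .sub a b => a.cost + b.cost + 1
  | .mul a b => a.cost + b.cost + 1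

/-- All values in the evaluation of an expression, addresses included, are less than `W`. -/
def Exp.Fits (W : ℕ) (s : State) : Exp → Prop
  | .const c => c < W
  | .reg x => s.reg x < W
  | .read A i => i.Fits W s ∧ s.mem A (i.val s) < W
  | .add a b => a.Fits W s ∧ b.Fits W s ∧ a.val s + b.val s < W
  | .sub a b => a.Fits W s ∧ b.Fits W s
  | .mul a b => a.Fits W s ∧ b.Fits W s ∧ a.val s * b.val s < W

/-- The outcome of a test. -/
def Test.Holds (s : State) : Test → Prop
  | .lt a b => a.val s < b.val s
  | .eq a b => a.val s = b.val s

/-- The number of operations in the evaluation of a test. -/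
def Test.cost : Test → ℕ
  | .lt a b => a.cost + b.cost + 1
  | .eq a b => a.cost + b.cost + 1

/-- All values in the evaluation of a test are less than `W`. -/
def Test.Fits (W : ℕ) (s : State) : Test → Prop
  | .lt a b => a.Fits W s ∧ b.Fits W s
  | .eq a b => a.Fits W s ∧ b.Fits W s

/-- `Exec W p s s' t`: started in `s`, the program `p` halts in `s'` after exactly `t` steps,
and all numbers that it handles are less than `W`. -/
inductive Exec (W : ℕ) : Prog → State → State → ℕ → Prop where
  | skip (s : State) : Exec W .skip s s 1
  | assign (s : State) (x : ℕ) (e : Exp) (he : e.Fits W s) :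
      Exec W (.assign x e) s { s with reg := Function.update s.reg x (e.val s) } (e.cost + 1)
  | write (s : State) (A : ℕ) (i e : Exp) (hi : i.Fits W s) (he : e.Fits W s) :
      Exec W (.write A i e) s
        { s with mem := Function.update s.mem A (Function.update (s.mem A) (i.val s) (e.val s)) }
        (i.cost + e.cost + 1)
  | emit (s : State) (e : Exp) (he : e.Fits W s) :
      Exec W (.emit e) s { s with out := s.out ++ [e.val s] } (e.cost + 1)
  | seq (p q : Prog) (s s' s'' : State) (t t' : ℕ) (hp : Exec W p s s' t)
      (hq : Exec W q s' s'' t') : Exec W (.seq p q) s s'' (t + t')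
  | cond_true (b : Test) (p q : Prog) (s s' : State) (t : ℕ) (hf : b.Fits W s) (hb : b.Holds s)
      (hp : Exec W p s s' t) : Exec W (.cond b p q) s s' (b.cost + t)
  | cond_false (b : Test) (p q : Prog) (s s' : State) (t : ℕ) (hf : b.Fits W s) (hb : ¬ b.Holds s)
      (hq : Exec W q s s' t) : Exec W (.cond b p q) s s' (b.cost + t)
  | loop_done (b : Test) (p : Prog) (s : State) (hf : b.Fits W s) (hb : ¬ b.Holds s) :
      Exec W (.loop b p) s s b.cost
  | loop_step (b : Test) (p : Prog) (s s' s'' : State) (t t' : ℕ) (hf : b.Fits W s)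
      (hb : b.Holds s) (hp : Exec W p s s' t) (hl : Exec W (.loop b p) s' s'' t') :
      Exec W (.loop b p) s s'' (b.cost + t + t')

/-- The initial configuration: the input stands in array `0`, everything else is zero. -/
def State.init (input : List ℕ) : State where
  reg := fun _ => 0
  mem := fun A k => if A = 0 then input.getD k 0 else 0
  out := []

/-- On the given input, the program halts after exactly `t` steps with the given output, and it
handles only words less than `W`. -/
def Prog.Computes (p : Prog) (W : ℕ) (input output : List ℕ) (t : ℕ) : Prop :=
  ∃ s : State, Exec W p (State.init input) s t ∧ s.out = output

end RAM

end BlockCrossing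

namespace BlockCrossing

/-! Upper bound. Root the tree at an end of one line and number the line ends in the order in which
a walk around the tree meets them. The ends below a vertex `a` form an interval, the intervals of
siblings follow each other in the order of the embedding, and a line uses the edge above `a` exactly
if one of its two ends lies in the interval of `a` (`mem_iff`, `pairwise_children`,
`onEdge_iff_exists_strand`). On this edge the line is named by that end, a strand of `a`.

Close to `a` the strands stand in increasing order, which fits the increasing orders of the children
(`consistent_par`). Close to the parent, the strands that go on upwards stand in the middle, already
in increasing order; the new strands, whose lines turn at the parent, wait on the left if they turn
to an earlier sibling and on the right if they turn to a later one. Consistency prescribes the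
groups in which they wait (`top_reverse`). The common lines of two siblings may be arranged freely,
and they are sorted by their ends below the later sibling, so that only the earlier sibling has work
to do. The new strands are then inserted, innermost first; each exchanges places with one block of
strands already inserted (`Sorting.Good.order_step`), so an edge costs at most one block move per
new strand.

Every end is new on at most one edge and the root end on none, which gives at most `2m - 1` moves
(`sum_numNew_le`). If all strands of an edge are new, the first insertion is free, and there are two
such edges (`exists_two_free`): the one at the root, and one of the two on which a line other than
the root line turns as high as possible, since the root line can enter only one of them from above.
Hence `2m - 3`.

Monotonicity. An insertion never spoils a pair that is in the right order
(`Sorting.Good.place_lt_succ`), so two lines cross on an edge at most once, and only if they are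
inverted close to the parent. A pair of lines is inverted on at most one edge (`inverted_unique`).

Lower bound. Two lines that share an edge and leave it in the same cyclic order at both ends must
cross there (`Network.Feasible.one_le_length`). In a caterpillar-like tree, `Fan`, one long line
along the spine meets each of `m - 1` short lines on an edge of its own, and consecutive short lines
meet on `m - 2` further edges.

Algorithm. `RAM.solve` walks around the tree with a stack, finds the edge on which each end is new,
and treats the edges separately. On an edge only the new strands are compared with all others, and
only one order per new strand is written beyond the first, so the time is proportional to the number
of ends times one plus the number of new strands; summed over the edges this is within the bound
(`sum_edgeCost_le`). Correctness and time are proved in a small Hoare logic with running times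
(`RAM.Spec`). -/

theorem eq_of_pairwise_lt {α β : Type*} [Preorder β] {κ : α → β} {l l' : List α}
    (h : l.Pairwise fun x y => κ x < κ y) (h' : l'.Pairwise fun x y => κ x < κ y)
    (hm : ∀ x, x ∈ l ↔ x ∈ l') : l = l' := by
  have nd : l.Nodup := h.imp fun hxy => by rintro rfl; exact lt_irrefl _ hxy
  have nd' : l'.Nodup := h'.imp fun hxy => by rintro rfl; exact lt_irrefl _ hxy
  exact ((List.perm_ext_iff_of_nodup nd nd').2 hm).eq_of_pairwise
    (fun _ _ _ _ h1 h2 => absurd h1 (lt_asymm h2)) h h'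

/-- A tree with at least two lines that has the path terminal property. -/
structure TreeNetwork (n m : ℕ) where
  net : Network n m
  two_le : 2 ≤ m
  isTree : net.graph.IsTree
  pathTerminal : net.PathTerminal

namespace TreeNetwork

variable {n m : ℕ} (T : TreeNetwork n m)

theorem line_ne_nil (i : Fin m) : T.net.line i ≠ [] := by
  intro h
  have := T.net.line_length i
  simp [h] at this

/-- The first vertex of a line. -/
def fst (i : Fin m) : Fin n := (T.net.line i).head (T.line_ne_nil i)

/-- The last vertex of a line. -/
def lst (i : Fin m) : Fin n := (T.net.line i).getLast (T.line_ne_nil i)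

/-- The line at whose first vertex the tree is rooted. -/
def rootLine : Fin m := ⟨0, by have := T.two_le; omega⟩

def root : Fin n := T.fst T.rootLine

theorem isTerminal_iff (i : Fin m) (v : Fin n) :
    T.net.IsTerminal i v ↔ v = T.fst i ∨ v = T.lst i := by
  unfold Network.IsTerminal fst lst
  rw [List.head?_eq_some_head (T.line_ne_nil i), List.getLast?_eq_some_getLast (T.line_ne_nil i)]
  simp [eq_comm]

theorem fst_ne_lst (i : Fin m) : T.fst i ≠ T.lst i := by
  unfold fst lst
  have h2 := T.net.line_length i
  have hnd := T.net.line_nodup i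
  rw [List.head_eq_getElem, List.getLast_eq_getElem]
  intro h
  rw [hnd.getElem_inj_iff] at h
  omega

theorem eq_of_isTerminal {i j : Fin m} {v : Fin n} (hi : T.net.IsTerminal i v)
    (hj : T.net.IsTerminal j v) : i = j := T.pathTerminal.2 i j v hi hj

theorem exists_rot_of_isTerminal {i : Fin m} {v : Fin n} (hi : T.net.IsTerminal i v) :
    ∃ w, T.net.rot v = [w] := by
  obtain ⟨w, hw, hu⟩ := T.pathTerminal.1 i v hi
  refine ⟨w, ?_⟩
  have h1 : ∀ x ∈ T.net.rot v, x = w := fun x hx => hu x ((T.net.mem_rot v x).1 hx)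
  have h2 : w ∈ T.net.rot v := (T.net.mem_rot v w).2 hw
  have h3 := T.net.rot_nodup v
  match h : T.net.rot v with
  | [] => simp [h] at h2
  | [a] => rw [h] at h1; simp at h1; simp [h1]
  | a :: b :: l =>
    rw [h] at h1 h3
    have ha := h1 a (by simp)
    have hb := h1 b (by simp)
    simp [ha, hb] at h3

theorem isTerminal_root : T.net.IsTerminal T.rootLine T.root :=
  (T.isTerminal_iff _ _).2 (Or.inl rfl)

/-! ### Parents and ancestors -/

noncomputable def depth (v : Fin n) : ℕ := T.net.graph.dist T.root v

open Classical in
/-- The parent of a vertex; the root is its own parent. -/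
noncomputable def par (v : Fin n) : Fin n :=
  if h : ∃ w, T.net.graph.Adj v w ∧ T.depth v = T.depth w + 1 then h.choose else v

theorem depth_eq_zero {v : Fin n} : T.depth v = 0 ↔ v = T.root := by
  unfold depth
  rw [T.isTree.connected.dist_eq_zero_iff, eq_comm]

theorem par_root : T.par T.root = T.root := by
  unfold par
  rw [dif_neg]
  rintro ⟨w, -, h⟩
  rw [T.depth_eq_zero.2 rfl] at h
  omega

/-- Shortest walks from the root to `w` and to `w'`, prolonged to `v`, have the length of a shortest
walk and hence are paths. A tree has only one path from the root to `v`, so they agree in the last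
vertex but one. -/
theorem lower_unique {v w w' : Fin n} (h : T.net.graph.Adj w v) (h' : T.net.graph.Adj w' v)
    (hd : T.depth v = T.depth w + 1) (hd' : T.depth v = T.depth w' + 1) : w = w' := by
  obtain ⟨q, hq, hl⟩ := T.isTree.connected.exists_path_of_dist T.root w
  obtain ⟨q', hq', hl'⟩ := T.isTree.connected.exists_path_of_dist T.root w'
  have hp : (q.concat h).IsPath := by
    apply SimpleGraph.Walk.isPath_of_length_eq_dist
    rw [SimpleGraph.Walk.length_concat, hl]; exact hd.symm
  have hp' : (q'.concat h').IsPath := by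
    apply SimpleGraph.Walk.isPath_of_length_eq_dist
    rw [SimpleGraph.Walk.length_concat, hl']; exact hd'.symm
  have := (T.isTree.isAcyclic.subsingleton_path T.root v).elim ⟨_, hp⟩ ⟨_, hp'⟩
  have := congrArg (fun p => p.1.penultimate) this
  simpa using this

theorem par_spec {v w : Fin n} (h : T.net.graph.Adj v w) (hd : T.depth v = T.depth w + 1) :
    T.par v = w ∧ v ≠ T.root := by
  have hex : ∃ w, T.net.graph.Adj v w ∧ T.depth v = T.depth w + 1 := ⟨w, h, hd⟩
  constructor
  · unfold par
    rw [dif_pos hex]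
    exact T.lower_unique hex.choose_spec.1.symm h.symm hex.choose_spec.2 hd
  · rintro rfl
    rw [T.depth_eq_zero.2 rfl] at hd
    omega

theorem par_adj {v : Fin n} (hv : v ≠ T.root) :
    T.net.graph.Adj v (T.par v) ∧ T.depth v = T.depth (T.par v) + 1 := by
  obtain ⟨p, hp⟩ := T.isTree.connected.exists_walk_length_eq_dist v T.root
  cases p with
  | nil => exact absurd rfl hv
  | @cons _ w _ h q =>
    have h1 := SimpleGraph.dist_le q
    rw [SimpleGraph.Walk.length_cons, SimpleGraph.dist_comm] at hp
    rw [SimpleGraph.dist_comm] at h1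
    have hd : T.depth v = T.depth w + 1 := by
      have := T.isTree.dist_eq_dist_add_one_of_adj T.root h
      unfold depth
      omega
    rw [(T.par_spec h hd).1]
    exact ⟨h, hd⟩

theorem depth_par {v : Fin n} (hv : v ≠ T.root) : T.depth v = T.depth (T.par v) + 1 :=
  (T.par_adj hv).2

/-- In a tree the distances of adjacent vertices to the root differ by exactly one, so the farther
vertex has the nearer one as its parent. -/
theorem adj_iff {u v : Fin n} : T.net.graph.Adj u v ↔
    (u ≠ T.root ∧ T.par u = v) ∨ (v ≠ T.root ∧ T.par v = u) := by
  constructor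
  · intro h
    rcases T.isTree.dist_eq_dist_add_one_of_adj T.root h with hd | hd
    · exact Or.inl (T.par_spec h hd).symm
    · exact Or.inr (T.par_spec h.symm hd).symm
  · rintro (⟨h, rfl⟩ | ⟨h, rfl⟩)
    · exact (T.par_adj h).1
    · exact (T.par_adj h).1.symm

theorem par_par_ne {v : Fin n} (hv : v ≠ T.root) : T.par (T.par v) ≠ v := by
  intro h
  by_cases hp : T.par v = T.root
  · rw [hp, T.par_root] at h; exact hv h.symm
  · have h1 := T.depth_par hv
    have h2 := T.depth_par hp
    rw [h] at h2
    omega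

/-- `a` lies on the way from `z` to the root. -/
def Anc (a z : Fin n) : Prop := ∃ k, T.par^[k] z = a

variable {T}

theorem Anc.refl (a : Fin n) : T.Anc a a := ⟨0, rfl⟩

theorem anc_iff {a z : Fin n} : T.Anc a z ↔ z = a ∨ T.Anc a (T.par z) := by
  constructor
  · rintro ⟨k, hk⟩
    cases k with
    | zero => exact Or.inl hk
    | succ k => exact Or.inr ⟨k, by rwa [Function.iterate_succ_apply] at hk⟩
  · rintro (rfl | ⟨k, hk⟩)
    · exact Anc.refl _
    · exact ⟨k + 1, by rwa [Function.iterate_succ_apply]⟩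

theorem Anc.trans {a b z : Fin n} (h : T.Anc a b) (h' : T.Anc b z) : T.Anc a z := by
  obtain ⟨k, rfl⟩ := h
  obtain ⟨l, rfl⟩ := h'
  exact ⟨k + l, by rw [Function.iterate_add_apply]⟩

theorem anc_par (a : Fin n) : T.Anc (T.par a) a := ⟨1, rfl⟩

theorem Anc.comparable {a b z : Fin n} (h : T.Anc a z) (h' : T.Anc b z) :
    T.Anc a b ∨ T.Anc b a := by
  obtain ⟨k, rfl⟩ := h
  obtain ⟨l, rfl⟩ := h'
  rcases le_total k l with hkl | hkl
  · right; exact ⟨l - k, by rw [← Function.iterate_add_apply]; congr 2; omega⟩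
  · left; exact ⟨k - l, by rw [← Function.iterate_add_apply]; congr 2; omega⟩

theorem depth_par_le (v : Fin n) : T.depth (T.par v) ≤ T.depth v := by
  by_cases hv : v = T.root
  · rw [hv, T.par_root]
  · rw [T.depth_par hv]; omega

theorem Anc.depth_le {a z : Fin n} (h : T.Anc a z) : T.depth a ≤ T.depth z := by
  obtain ⟨k, rfl⟩ := h
  induction k with
  | zero => rfl
  | succ k ih => rw [Function.iterate_succ_apply']; exact (depth_par_le _).trans ih

theorem not_anc_par {a : Fin n} (ha : a ≠ T.root) : ¬ T.Anc a (T.par a) := fun h => by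
  have := h.depth_le
  rw [T.depth_par ha] at this
  omega

theorem Anc.eq_of_depth_le {a z : Fin n} (h : T.Anc a z) (hd : T.depth z ≤ T.depth a) : z = a := by
  rcases anc_iff.1 h with h | h
  · exact h
  · by_cases hz : z = T.root
    · subst hz
      rw [T.par_root] at h
      have := h.depth_le
      rw [T.depth_eq_zero.2 rfl] at this
      exact (T.depth_eq_zero.1 (by omega)).symm
    · have := h.depth_le
      rw [T.depth_par hz] at hd
      omega

theorem root_anc (z : Fin n) : T.Anc T.root z := by
  induction h : T.depth z generalizing z with
  | zero => rw [T.depth_eq_zero.1 h]; exact Anc.refl _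
  | succ k ih =>
    have hz : z ≠ T.root := fun hz => by rw [T.depth_eq_zero.2 hz] at h; omega
    exact anc_iff.2 (Or.inr (ih _ (by have := T.depth_par hz; omega)))

/-- Proper ancestors of `z` are ancestors of its parent. -/
theorem Anc.par_of_ne {a z : Fin n} (h : T.Anc a z) (hne : a ≠ z) : T.Anc a (T.par z) :=
  (anc_iff.1 h).resolve_left hne.symm

variable (T)

/-! ### Children -/

/-- The children of a vertex, in clockwise order starting after its parent. -/
noncomputable def children (v : Fin n) : List (Fin n) :=
  if v = T.root then T.net.rot v else T.net.others v (T.par v)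

/-- Undoes the removal of `w` in `others`; facts about `others` are reduced in this way to facts
about rotations of `rot v`. -/
theorem rot_rotate {v w : Fin n} (hw : w ∈ T.net.rot v) :
    (T.net.rot v).rotate ((T.net.rot v).idxOf w) = w :: T.net.others v w := by
  unfold Network.others
  have hlt := List.idxOf_lt_length_of_mem hw
  have hlen : ((T.net.rot v).rotate ((T.net.rot v).idxOf w)) ≠ [] := by
    intro h
    rw [List.rotate_eq_nil_iff] at h
    simp [h] at hw
  conv_lhs => rw [← List.cons_head_tail hlen]
  congr 1
  rw [List.head_eq_getElem, List.getElem_rotate]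
  simp only [zero_add, Nat.mod_eq_of_lt hlt, List.getElem_idxOf]

theorem mem_others {v w x : Fin n} (hw : w ∈ T.net.rot v) :
    x ∈ T.net.others v w ↔ T.net.graph.Adj v x ∧ x ≠ w := by
  have h := T.rot_rotate hw
  have hnd : (w :: T.net.others v w).Nodup := by
    rw [← h, List.nodup_rotate]; exact T.net.rot_nodup v
  have hm : x ∈ w :: T.net.others v w ↔ x ∈ T.net.rot v := by rw [← h, List.mem_rotate]
  rw [T.net.mem_rot] at hm
  rw [← hm, List.mem_cons]
  constructor
  · intro hx
    refine ⟨Or.inr hx, ?_⟩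
    rintro rfl
    exact (List.nodup_cons.1 hnd).1 hx
  · rintro ⟨h1 | h1, h2⟩
    · exact absurd h1 h2
    · exact h1

theorem nodup_others (v w : Fin n) : (T.net.others v w).Nodup := by
  unfold Network.others
  exact ((List.nodup_rotate).2 (T.net.rot_nodup v)).tail

theorem par_mem_rot {v : Fin n} (hv : v ≠ T.root) : T.par v ∈ T.net.rot v :=
  (T.net.mem_rot _ _).2 (T.par_adj hv).1

theorem mem_children {v w : Fin n} : w ∈ T.children v ↔ w ≠ T.root ∧ T.par w = v := by
  unfold children
  split_ifs with hv
  · rw [T.net.mem_rot, T.adj_iff]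
    constructor
    · rintro (⟨h, -⟩ | h)
      · exact absurd hv h
      · exact h
    · exact Or.inr
  · rw [T.mem_others (T.par_mem_rot hv), T.adj_iff]
    constructor
    · rintro ⟨⟨-, h⟩ | h, h2⟩
      · exact absurd h.symm h2
      · exact h
    · intro h
      refine ⟨Or.inr h, ?_⟩
      rintro rfl
      exact T.par_par_ne hv h.2

theorem nodup_children (v : Fin n) : (T.children v).Nodup := by
  unfold children
  split_ifs
  · exact T.net.rot_nodup v
  · exact T.nodup_others _ _

theorem depth_child {v w : Fin n} (h : w ∈ T.children v) : T.depth w = T.depth v + 1 := by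
  obtain ⟨h1, rfl⟩ := T.mem_children.1 h
  exact T.depth_par h1

/-- Seen from a child, the clockwise order of the other edges is: later children, parent,
earlier children. -/
theorem exists_children_split {v a : Fin n} (hv : v ≠ T.root) (ha : a ∈ T.children v) :
    ∃ L R, T.children v = L ++ a :: R ∧ T.net.others v a = R ++ T.par v :: L := by
  obtain ⟨L, R, h⟩ := List.append_of_mem ha
  refine ⟨L, R, h, ?_⟩
  have hrot := T.rot_rotate (T.par_mem_rot hv)
  have hc : T.children v = T.net.others v (T.par v) := by unfold children; rw [if_neg hv]
  rw [← hc, h] at hrot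
  have har : a ∈ T.net.rot v := by
    rw [← List.mem_rotate, hrot]; simp
  have h1 := T.rot_rotate har
  have h2 : (w : List (Fin n)) → w = R ++ T.par v :: L → (a :: w) ~r T.net.rot v := by
    rintro w rfl
    have : (T.par v :: (L ++ a :: R)) ~r T.net.rot v := by
      rw [← hrot]; exact (List.IsRotated.forall _ _)
    refine List.IsRotated.trans ?_ this
    have := List.isRotated_append (l := a :: R) (l' := T.par v :: L)
    simpa using this
  have h3 : (a :: T.net.others v a) ~r (a :: (R ++ T.par v :: L)) := by
    refine List.IsRotated.trans ?_ (h2 _ rfl).symm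
    rw [← h1]
    exact (List.IsRotated.forall _ _)
  have hnd : (a :: T.net.others v a).Nodup := by
    rw [← h1, List.nodup_rotate]; exact T.net.rot_nodup v
  -- Both lists begin with `a` and have no repetitions, so a rotation that carries one to the other
  -- is trivial.
  obtain ⟨k, hk⟩ := h3
  have hlt : k % (a :: T.net.others v a).length < (a :: T.net.others v a).length :=
    Nat.mod_lt _ (by simp)
  have h0 : ((a :: T.net.others v a).rotate k)[0]'(by simp) = a := by simp [hk]
  rw [List.getElem_rotate] at h0
  have h00 : (a :: T.net.others v a)[0] = a := rfl
  rw [← List.rotate_mod] at hk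
  have hz : k % (a :: T.net.others v a).length = 0 := by
    have := hnd.getElem_inj_iff.1 (h0.trans h00.symm)
    simpa using this
  rw [hz] at hk
  simpa using hk

end TreeNetwork
end BlockCrossing

namespace BlockCrossing
namespace TreeNetwork

variable {n m : ℕ} {T : TreeNetwork n m}

/-! ### The tour around the tree -/

theorem anc_child {v z : Fin n} : T.Anc v z ↔ z = v ∨ ∃ c ∈ T.children v, T.Anc c z := by
  constructor
  · intro h
    by_cases hz : z = v
    · exact Or.inl hz
    right
    induction hd : T.depth z using Nat.strong_induction_on generalizing z with
    | _ d ih =>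
      have hr : z ≠ T.root := by
        rintro rfl
        exact hz (h.eq_of_depth_le (by rw [T.depth_eq_zero.2 rfl]; omega))
      have h' := h.par_of_ne (Ne.symm hz)
      by_cases hp : T.par z = v
      · exact ⟨z, T.mem_children.2 ⟨hr, hp⟩, Anc.refl _⟩
      · obtain ⟨c, hc, hca⟩ := ih _ (by have := T.depth_par hr; omega) h' hp rfl
        exact ⟨c, hc, hca.trans (anc_par z)⟩
  · rintro (rfl | ⟨c, hc, h⟩)
    · exact Anc.refl _
    · obtain ⟨-, rfl⟩ := T.mem_children.1 hc
      exact (anc_par c).trans h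

/-- Ancestors of `z` are comparable, so one of the siblings would lie above the other and therefore
above their common parent. -/
theorem not_anc_of_sibling {v c c' z : Fin n} (hc : c ∈ T.children v) (hc' : c' ∈ T.children v)
    (hne : c ≠ c') (h : T.Anc c z) : ¬ T.Anc c' z := by
  intro h'
  obtain ⟨h1, h2⟩ := T.mem_children.1 hc
  obtain ⟨h3, h4⟩ := T.mem_children.1 hc'
  rcases h.comparable h' with h5 | h5
  · have := h5.par_of_ne hne
    rw [h4, ← h2] at this
    exact not_anc_par h1 this
  · have := h5.par_of_ne hne.symm
    rw [h2, ← h4] at this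
    exact not_anc_par h3 this

variable (T)

/-- Strictly above all depths: `height - depth` is positive and decreases from parent to child,
which makes it the measure for recursion and induction down the tree. -/
noncomputable def height : ℕ := Finset.univ.sup T.depth + 1

theorem depth_lt_height (v : Fin n) : T.depth v < T.height :=
  Nat.lt_succ_of_le (Finset.le_sup (f := T.depth) (Finset.mem_univ v))

theorem children_induction {P : Fin n → Prop} (h : ∀ v, (∀ c ∈ T.children v, P c) → P v) (v : Fin n) :
    P v := by
  induction hk : T.height - T.depth v using Nat.strong_induction_on generalizing v with
  | _ k ih =>
    refine h v fun c hc => ih _ ?_ c rfl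
    have := T.depth_child hc
    have := T.depth_lt_height v
    omega

/-- The first argument is fuel, since the children of a vertex are not structurally smaller. -/
noncomputable def tourAux : ℕ → Fin n → List (Bool × Fin n)
  | 0, _ => []
  | k + 1, v => (true, v) :: ((T.children v).flatMap (tourAux k) ++ [(false, v)])

/-- The walk around the subtree of `v`: every vertex is entered (`true`) and left (`false`). -/
noncomputable def tour (v : Fin n) : List (Bool × Fin n) := T.tourAux (T.height - T.depth v) v

/-- The fuel `height - depth v` is positive, and what remains of it is exactly the fuel of a child.
The recursion therefore never runs dry. -/
theorem tour_eq (v : Fin n) :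
    T.tour v = (true, v) :: ((T.children v).flatMap T.tour ++ [(false, v)]) := by
  have h := T.depth_lt_height v
  obtain ⟨k, hk⟩ : ∃ k, T.height - T.depth v = k + 1 := ⟨T.height - T.depth v - 1, by omega⟩
  conv_lhs => rw [tour, hk, tourAux]
  congr 2
  apply List.flatMap_congr
  intro c hc
  have := T.depth_child hc
  rw [tour]
  congr 1
  omega

theorem mem_tour {v z : Fin n} {b : Bool} : (b, z) ∈ T.tour v ↔ T.Anc v z := by
  induction v using T.children_induction with
  | _ v ih =>
    rw [tour_eq, anc_child]
    simp only [List.mem_cons, List.mem_append, List.mem_flatMap, List.not_mem_nil, or_false,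
      Prod.mk.injEq]
    constructor
    · rintro (⟨-, h⟩ | ⟨c, hc, h⟩ | ⟨-, h⟩)
      · exact Or.inl h
      · exact Or.inr ⟨c, hc, (ih c hc).1 h⟩
      · exact Or.inl h
    · rintro (h | ⟨c, hc, h⟩)
      · cases b
        · exact Or.inr (Or.inr ⟨rfl, h⟩)
        · exact Or.inl ⟨rfl, h⟩
      · exact Or.inr (Or.inl ⟨c, hc, (ih c hc).2 h⟩)

theorem nodup_tour (v : Fin n) : (T.tour v).Nodup := by
  induction v using T.children_induction with
  | _ v ih =>
    have hv : ∀ b, (b, v) ∉ (T.children v).flatMap T.tour := by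
      intro b h
      obtain ⟨c, hc, h⟩ := List.mem_flatMap.1 h
      have := ((T.mem_tour).1 h).depth_le
      have := T.depth_child hc
      omega
    rw [tour_eq, List.nodup_cons, List.nodup_append]
    refine ⟨?_, ?_, by simp, ?_⟩
    · simp only [List.mem_append, not_or]
      exact ⟨hv _, by simp⟩
    · rw [List.nodup_flatMap]
      refine ⟨ih, ?_⟩
      refine (List.Pairwise.and_mem.1 (T.nodup_children v)).imp ?_
      rintro c c' ⟨hc, hc', hne⟩
      rintro ⟨b, z⟩ h h'
      exact not_anc_of_sibling hc hc' hne (T.mem_tour.1 h) (T.mem_tour.1 h')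
    · intro a ha b hb
      rw [List.mem_singleton] at hb
      rintro rfl
      subst hb
      exact hv _ ha

/-- The walk around a subtree is a contiguous piece of the whole walk; this is why the line ends
below a vertex form an interval. -/
theorem exists_tour_split (v : Fin n) : ∃ X Y, T.tour T.root = X ++ T.tour v ++ Y := by
  induction hd : T.depth v generalizing v with
  | zero => rw [T.depth_eq_zero.1 hd]; exact ⟨[], [], by simp⟩
  | succ k ih =>
    have hv : v ≠ T.root := fun h => by rw [T.depth_eq_zero.2 h] at hd; omega
    obtain ⟨X, Y, h⟩ := ih (T.par v) (by have := T.depth_par hv; omega)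
    obtain ⟨L, R, hc⟩ := List.append_of_mem ((T.mem_children (v := T.par v)).2 ⟨hv, rfl⟩)
    rw [h, tour_eq, hc]
    refine ⟨X ++ (true, T.par v) :: L.flatMap T.tour,
      R.flatMap T.tour ++ (false, T.par v) :: Y, by simp⟩

/-! ### Line ends -/

def IsEnd (z : Fin n) : Prop := ∃ i, T.net.IsTerminal i z

open Classical in
/-- The line ends that are entered in a part of the tour. -/
noncomputable def endsIn (E : List (Bool × Fin n)) : List (Fin n) :=
  (E.filter fun e => e.1 = true ∧ T.IsEnd e.2).map Prod.snd

theorem endsIn_append (E F : List (Bool × Fin n)) :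
    T.endsIn (E ++ F) = T.endsIn E ++ T.endsIn F := by simp [endsIn]

theorem mem_endsIn {E : List (Bool × Fin n)} {z : Fin n} :
    z ∈ T.endsIn E ↔ (true, z) ∈ E ∧ T.IsEnd z := by
  simp [endsIn]

theorem nodup_endsIn {E : List (Bool × Fin n)} (h : E.Nodup) : (T.endsIn E).Nodup := by
  unfold endsIn
  refine (h.filter _).map_on ?_
  rintro ⟨b, z⟩ h1 ⟨b', z'⟩ h2 h3
  simp only [List.mem_filter, decide_eq_true_eq] at h1 h2
  obtain ⟨-, rfl, -⟩ := h1
  obtain ⟨-, rfl, -⟩ := h2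
  exact Prod.ext rfl h3

/-- All line ends in the order of the tour. -/
noncomputable def ends : List (Fin n) := T.endsIn (T.tour T.root)

/-- The number of line ends before the subtree of `v`. -/
noncomputable def lo (v : Fin n) : ℕ :=
  (T.endsIn ((T.tour T.root).take ((T.tour T.root).idxOf (true, v)))).length

/-- The number of line ends up to the end of the subtree of `v`. -/
noncomputable def hi (v : Fin n) : ℕ :=
  (T.endsIn ((T.tour T.root).take ((T.tour T.root).idxOf (false, v)))).length

noncomputable def numEnds : ℕ := T.ends.length

/-- The `g`-th line end. -/
noncomputable def endAt (g : ℕ) : Fin n := T.ends.getD g T.root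

theorem nodup_ends : T.ends.Nodup := T.nodup_endsIn (T.nodup_tour _)

theorem mem_ends {z : Fin n} : z ∈ T.ends ↔ T.IsEnd z := by
  unfold ends
  rw [mem_endsIn, mem_tour]
  exact and_iff_right (root_anc z)

theorem take_idxOf_tour {e : Bool × Fin n} {X Y : List (Bool × Fin n)}
    (h : T.tour T.root = X ++ e :: Y) :
    (T.tour T.root).take ((T.tour T.root).idxOf e) = X := by
  have hnd := T.nodup_tour T.root
  rw [h] at hnd ⊢
  have : e ∉ X := fun hX => (List.nodup_append.1 hnd).2.2 e hX e (by simp) rfl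
  rw [List.idxOf_append_of_notMem this, List.idxOf_cons_self]
  simp

theorem lo_eq {v : Fin n} {X Y : List (Bool × Fin n)} (h : T.tour T.root = X ++ (true, v) :: Y) :
    T.lo v = (T.endsIn X).length := by rw [lo, T.take_idxOf_tour h]

theorem hi_eq {v : Fin n} {X Y : List (Bool × Fin n)} (h : T.tour T.root = X ++ (false, v) :: Y) :
    T.hi v = (T.endsIn X).length := by rw [hi, T.take_idxOf_tour h]

/-- The whole walk has no repetitions, so any such splitting shows the positions where `v` is
entered and left; the leaving event adds no line end. -/
theorem lo_hi_eq {v : Fin n} {X Y : List (Bool × Fin n)} (h : T.tour T.root = X ++ T.tour v ++ Y) :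
    T.lo v = (T.endsIn X).length ∧ T.hi v = (T.endsIn X).length + (T.endsIn (T.tour v)).length := by
  constructor
  · rw [T.lo_eq (X := X) (by rw [h, tour_eq, List.append_assoc, List.cons_append])]
  · rw [T.hi_eq (X := X ++ (true, v) :: (T.children v).flatMap T.tour) (Y := Y)
      (by rw [h, tour_eq]; simp)]
    conv_rhs => rw [tour_eq]
    have : T.endsIn [(false, v)] = [] := by simp [endsIn]
    rw [← List.cons_append, endsIn_append, endsIn_append, this]
    simp

theorem lo_root : T.lo T.root = 0 := by
  rw [(T.lo_hi_eq (X := []) (Y := []) (by simp)).1]; simp [endsIn]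

theorem hi_root : T.hi T.root = T.numEnds := by
  rw [(T.lo_hi_eq (X := []) (Y := []) (by simp)).2]; simp [endsIn, numEnds, ends]

theorem lo_le_hi (v : Fin n) : T.lo v ≤ T.hi v := by
  obtain ⟨X, Y, h⟩ := T.exists_tour_split v
  obtain ⟨h1, h2⟩ := T.lo_hi_eq h
  omega

theorem hi_le (v : Fin n) : T.hi v ≤ T.numEnds := by
  obtain ⟨X, Y, h⟩ := T.exists_tour_split v
  obtain ⟨h1, h2⟩ := T.lo_hi_eq h
  rw [h2, numEnds, ends, h, endsIn_append, endsIn_append]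
  simp only [List.length_append]
  omega

/-- The `g`-th line end lies in the subtree of `v`. -/
def Mem (v : Fin n) (g : ℕ) : Prop := T.lo v ≤ g ∧ g < T.hi v

noncomputable instance (v : Fin n) (g : ℕ) : Decidable (T.Mem v g) := inferInstanceAs (Decidable (_ ∧ _))

variable {T}

theorem Mem.lt {v : Fin n} {g : ℕ} (h : T.Mem v g) : g < T.numEnds := h.2.trans_le (T.hi_le v)

theorem endAt_eq {g : ℕ} (hg : g < T.numEnds) : T.endAt g = T.ends[g]'hg := by
  unfold endAt
  exact List.getD_eq_getElem _ _ hg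

theorem isEnd_endAt {g : ℕ} (hg : g < T.numEnds) : T.IsEnd (T.endAt g) := by
  rw [endAt_eq hg, ← T.mem_ends]; exact List.getElem_mem _

theorem endAt_inj {g h : ℕ} (hg : g < T.numEnds) (hh : h < T.numEnds)
    (he : T.endAt g = T.endAt h) : g = h := by
  rw [endAt_eq hg, endAt_eq hh] at he
  exact T.nodup_ends.getElem_inj_iff.1 he

/-- The bridge between the arithmetic of intervals and ancestry in the tree. The list of ends splits
into those before, in and after the piece of `v`; backwards, the injectivity of the numbering places
`g` in the middle part. -/
theorem mem_iff {v : Fin n} {g : ℕ} (hg : g < T.numEnds) : T.Mem v g ↔ T.Anc v (T.endAt g) := by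
  obtain ⟨X, Y, h⟩ := T.exists_tour_split v
  obtain ⟨h1, h2⟩ := T.lo_hi_eq h
  have hE : T.ends = T.endsIn X ++ T.endsIn (T.tour v) ++ T.endsIn Y := by
    rw [ends, h, endsIn_append, endsIn_append]
  unfold Mem
  rw [h1, h2]
  constructor
  · rintro ⟨ha, hb⟩
    have : T.endAt g ∈ T.endsIn (T.tour v) := by
      unfold endAt
      rw [hE, List.append_assoc, List.getD_append_right _ _ _ _ ha, List.getD_append _ _ _ _ (by omega),
        List.getD_eq_getElem _ _ (by omega)]
      exact List.getElem_mem _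
    exact T.mem_tour.1 (T.mem_endsIn.1 this).1
  · intro hv
    have : T.endAt g ∈ T.endsIn (T.tour v) := T.mem_endsIn.2 ⟨T.mem_tour.2 hv, isEnd_endAt hg⟩
    obtain ⟨k, hk, hk'⟩ := List.getElem_of_mem this
    have hl : (T.endsIn X).length + k < T.numEnds := by
      rw [numEnds, hE]; simp only [List.length_append]; omega
    have : T.endAt ((T.endsIn X).length + k) = T.endAt g := by
      rw [← hk']
      unfold endAt
      rw [hE, List.append_assoc, List.getD_append_right _ _ _ _ (by omega),
        List.getD_append _ _ _ _ (by omega), List.getD_eq_getElem _ _ (by omega)]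
      simp
    have := endAt_inj hl hg this
    omega

variable (T)

/-- In the walk the pieces of the children follow each other in the order of `children`. -/
theorem pairwise_children (v : Fin n) : (T.children v).Pairwise fun c c' => T.hi c ≤ T.lo c' := by
  rw [List.pairwise_iff_forall_sublist]
  intro c c' hs
  obtain ⟨L, R, h1, h2, h3⟩ : ∃ L R, T.children v = L ++ R ∧ [c].Sublist L ∧ [c'].Sublist R := by
    have : ([c] ++ [c']).Sublist (T.children v) := hs
    obtain ⟨L, R, h1, h2, h3⟩ := List.append_sublist_iff.1 this
    exact ⟨L, R, h1, h2, h3⟩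
  obtain ⟨L1, L2, rfl⟩ := List.append_of_mem (List.singleton_sublist.1 h2)
  obtain ⟨R1, R2, rfl⟩ := List.append_of_mem (List.singleton_sublist.1 h3)
  obtain ⟨X, Y, h⟩ := T.exists_tour_split v
  have e1 := (T.lo_hi_eq (v := c) (X := X ++ (true, v) :: L1.flatMap T.tour)
    (Y := (L2 ++ R1 ++ c' :: R2).flatMap T.tour ++ (false, v) :: Y)
    (by rw [h, tour_eq, h1]; simp)).2
  have e2 := (T.lo_hi_eq (v := c') (X := X ++ (true, v) :: (L1 ++ c :: L2 ++ R1).flatMap T.tour)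
    (Y := R2.flatMap T.tour ++ (false, v) :: Y)
    (by rw [h, tour_eq, h1]; simp)).1
  rw [e1, e2]
  have : X ++ (true, v) :: (L1 ++ c :: L2 ++ R1).flatMap T.tour =
    (X ++ (true, v) :: L1.flatMap T.tour) ++ T.tour c ++ (L2 ++ R1).flatMap T.tour := by simp
  rw [this, endsIn_append _ (_ ++ T.tour c), endsIn_append _ _ (T.tour c)]
  simp only [List.length_append]
  omega

theorem endAt_zero : 0 < T.numEnds ∧ T.endAt 0 = T.root := by
  have : ∃ E, T.ends = T.root :: E := by
    refine ⟨T.endsIn ((T.children T.root).flatMap T.tour ++ [(false, T.root)]), ?_⟩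
    have hr : T.IsEnd T.root := ⟨_, T.isTerminal_root⟩
    rw [ends, tour_eq]
    simp [endsIn, hr]
  obtain ⟨E, hE⟩ := this
  simp [numEnds, endAt, hE]

-- By the path terminal property the choice is unique at line ends; elsewhere the value is a default
-- that plays no role.
open Classical in
noncomputable def lineOf (z : Fin n) : Fin m :=
  if h : ∃ i, T.net.IsTerminal i z then h.choose else T.rootLine

theorem lineOf_eq {i : Fin m} {z : Fin n} (h : T.net.IsTerminal i z) : T.lineOf z = i := by
  have hex : ∃ i, T.net.IsTerminal i z := ⟨i, h⟩
  unfold lineOf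
  rw [dif_pos hex]
  exact T.eq_of_isTerminal hex.choose_spec h

theorem isTerminal_fst (i : Fin m) : T.net.IsTerminal i (T.fst i) := (T.isTerminal_iff _ _).2 (Or.inl rfl)

/-- The line of the `g`-th line end. -/
noncomputable def lineAt (g : ℕ) : Fin m := T.lineOf (T.endAt g)

noncomputable def otherEnd (z : Fin n) : Fin n :=
  if z = T.fst (T.lineOf z) then T.lst (T.lineOf z) else T.fst (T.lineOf z)

/-- The number of the other end of the line of the `g`-th line end. -/
noncomputable def mate (g : ℕ) : ℕ := T.ends.idxOf (T.otherEnd (T.endAt g))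

variable {T}

theorem isTerminal_lineAt {g : ℕ} (hg : g < T.numEnds) : T.net.IsTerminal (T.lineAt g) (T.endAt g) := by
  obtain ⟨i, hi⟩ := isEnd_endAt hg
  rwa [lineAt, T.lineOf_eq hi]

theorem endAt_eq_or {g : ℕ} (hg : g < T.numEnds) :
    (T.endAt g = T.fst (T.lineAt g) ∧ T.otherEnd (T.endAt g) = T.lst (T.lineAt g)) ∨
    (T.endAt g = T.lst (T.lineAt g) ∧ T.otherEnd (T.endAt g) = T.fst (T.lineAt g)) := by
  have h := (T.isTerminal_iff _ _).1 (isTerminal_lineAt hg)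
  unfold otherEnd
  rw [← lineAt]
  rcases h with h | h
  · left; exact ⟨h, by rw [if_pos h]⟩
  · right
    refine ⟨h, ?_⟩
    rw [if_neg]
    intro h'
    exact T.fst_ne_lst _ (h'.symm.trans h)

theorem isTerminal_otherEnd {g : ℕ} (hg : g < T.numEnds) :
    T.net.IsTerminal (T.lineAt g) (T.otherEnd (T.endAt g)) := by
  rw [isTerminal_iff]
  rcases endAt_eq_or hg with h | h
  · exact Or.inr h.2
  · exact Or.inl h.2

theorem exists_endAt {z : Fin n} (hz : T.IsEnd z) : T.ends.idxOf z < T.numEnds ∧ T.endAt (T.ends.idxOf z) = z := by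
  have h := List.idxOf_lt_length_of_mem (T.mem_ends.2 hz)
  refine ⟨h, ?_⟩
  rw [endAt_eq h, List.getElem_idxOf]

theorem mate_lt {g : ℕ} (hg : g < T.numEnds) : T.mate g < T.numEnds :=
  (exists_endAt ⟨_, isTerminal_otherEnd hg⟩).1

theorem endAt_mate {g : ℕ} (hg : g < T.numEnds) : T.endAt (T.mate g) = T.otherEnd (T.endAt g) :=
  (exists_endAt ⟨_, isTerminal_otherEnd hg⟩).2

theorem lineAt_mate {g : ℕ} (hg : g < T.numEnds) : T.lineAt (T.mate g) = T.lineAt g := by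
  conv_lhs => rw [lineAt, endAt_mate hg]
  exact T.lineOf_eq (isTerminal_otherEnd hg)

theorem mate_ne {g : ℕ} (hg : g < T.numEnds) : T.mate g ≠ g := by
  intro h
  have h1 := endAt_mate hg
  rw [h] at h1
  have := T.fst_ne_lst (T.lineAt g)
  rcases endAt_eq_or hg with h2 | h2
  · exact this (h2.1.symm.trans (h1.trans h2.2))
  · exact this ((h2.1.symm.trans (h1.trans h2.2)).symm)

theorem eq_or_eq_mate {g h : ℕ} (hg : g < T.numEnds) (hh : h < T.numEnds)
    (hl : T.lineAt h = T.lineAt g) : h = g ∨ h = T.mate g := by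
  have h1 := (T.isTerminal_iff _ _).1 (isTerminal_lineAt hh)
  rw [hl] at h1
  have key : T.endAt h = T.endAt g ∨ T.endAt h = T.endAt (T.mate g) := by
    rw [endAt_mate hg]
    rcases endAt_eq_or hg with h2 | h2
    · rw [h2.2, h2.1]; exact h1
    · rw [h2.2, h2.1]; exact h1.symm
  rcases key with h3 | h3
  · exact Or.inl (endAt_inj hh hg h3)
  · exact Or.inr (endAt_inj hh (mate_lt hg) h3)

theorem mate_mate {g : ℕ} (hg : g < T.numEnds) : T.mate (T.mate g) = g := by
  rcases eq_or_eq_mate (mate_lt hg) hg (lineAt_mate hg).symm with h | h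
  · exact absurd h.symm (mate_ne hg)
  · exact h.symm

theorem exists_lineAt (i : Fin m) : ∃ g, g < T.numEnds ∧ T.lineAt g = i ∧ T.endAt g = T.fst i ∧
    T.endAt (T.mate g) = T.lst i := by
  obtain ⟨h1, h2⟩ := exists_endAt (T := T) ⟨i, T.isTerminal_fst i⟩
  have h3 : T.lineAt (T.ends.idxOf (T.fst i)) = i := by
    rw [lineAt, h2]; exact T.lineOf_eq (T.isTerminal_fst i)
  refine ⟨_, h1, h3, h2, ?_⟩
  rw [endAt_mate h1]
  rcases endAt_eq_or h1 with h | h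
  · rw [h.2, h3]
  · rw [h2, h3] at h
    exact absurd h.1 (T.fst_ne_lst i)

theorem lineAt_zero : T.lineAt 0 = T.rootLine := by
  rw [lineAt, T.endAt_zero.2]; exact T.lineOf_eq T.isTerminal_root

variable (T)

theorem numEnds_le : T.numEnds ≤ 2 * m := by
  classical
  rw [numEnds, ← List.toFinset_card_of_nodup T.nodup_ends]
  have : T.ends.toFinset ⊆ Finset.univ.image T.fst ∪ Finset.univ.image T.lst := by
    intro z hz
    obtain ⟨i, hi⟩ := T.mem_ends.1 (List.mem_toFinset.1 hz)
    rw [isTerminal_iff] at hi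
    rw [Finset.mem_union, Finset.mem_image, Finset.mem_image]
    rcases hi with h | h
    · exact Or.inl ⟨i, Finset.mem_univ _, h.symm⟩
    · exact Or.inr ⟨i, Finset.mem_univ _, h.symm⟩
  refine (Finset.card_le_card this).trans ((Finset.card_union_le _ _).trans ?_)
  have h1 := Finset.card_image_le (s := Finset.univ) (f := T.fst)
  have h2 := Finset.card_image_le (s := Finset.univ) (f := T.lst)
  simp only [Finset.card_univ, Fintype.card_fin] at h1 h2
  omega

/-! ### Lines on edges -/

/-- A step of the path enters or leaves the subtree of `a` exactly if it runs along the edge above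
`a`. Since no vertex is repeated this happens at most once, so it happens exactly if the two ends
lie on different sides. -/
theorem edge_iff_of_chain {a : Fin n} (ha : a ≠ T.root) (l : List (Fin n)) (x : Fin n)
    (hc : (x :: l).IsChain T.net.graph.Adj) (hn : (x :: l).Nodup) :
    ([T.par a, a] <:+: x :: l ∨ [a, T.par a] <:+: x :: l) ↔
      ¬ (T.Anc a x ↔ T.Anc a ((x :: l).getLast (by simp))) := by
  induction l generalizing x with
  | nil =>
    simp only [List.getLast_singleton, not_true_eq_false, iff_false, not_or]
    constructor <;> intro h <;> simpa using h.length_le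
  | cons y l ih =>
    rw [List.isChain_cons_cons] at hc
    have ih := ih y hc.2 hn.of_cons
    rw [List.infix_cons_iff, List.infix_cons_iff (l₁ := [a, T.par a])]
    simp only [List.cons_prefix_cons, List.nil_prefix, and_true]
    rw [List.getLast_cons (by simp)]
    have hna := not_anc_par ha
    have hx : x ∉ y :: l := (List.nodup_cons.1 hn).1
    by_cases h1 : T.par a = x ∧ a = y
    · obtain ⟨rfl, rfl⟩ := h1
      -- The edge is used right now, and `x` does not occur again; by the induction hypothesis the
      -- rest of the path stays on one side.
      have : ¬ ([T.par a, a] <:+: a :: l ∨ [a, T.par a] <:+: a :: l) := by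
        rintro (h | h) <;> exact hx (h.subset (by simp))
      rw [ih, not_not] at this
      simp [hna, ← this, Anc.refl]
    by_cases h2 : a = x ∧ T.par a = y
    · obtain ⟨rfl, rfl⟩ := h2
      have : ¬ ([T.par a, a] <:+: T.par a :: l ∨ [a, T.par a] <:+: T.par a :: l) := by
        rintro (h | h) <;> exact hx (h.subset (by simp))
      rw [ih, not_not] at this
      simp [hna, ← this, Anc.refl]
    · have hxy : T.Anc a x ↔ T.Anc a y := by
        rcases T.adj_iff.1 hc.1 with ⟨hr, rfl⟩ | ⟨hr, rfl⟩
        · rw [anc_iff]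
          refine or_iff_right ?_
          rintro rfl
          exact h2 ⟨rfl, rfl⟩
        · rw [anc_iff (z := y)]
          refine (or_iff_right ?_).symm
          rintro rfl
          exact h1 ⟨rfl, rfl⟩
      simp only [h1, h2, false_or]
      rw [ih, hxy]

theorem onEdge_par_iff {a : Fin n} (ha : a ≠ T.root) (i : Fin m) :
    T.net.OnEdge i (T.par a) a ↔ ¬ (T.Anc a (T.fst i) ↔ T.Anc a (T.lst i)) := by
  unfold Network.OnEdge fst lst
  have key : ∀ (l : List (Fin n)) (hne : l ≠ []), l.IsChain T.net.graph.Adj → l.Nodup →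
      (([T.par a, a] <:+: l ∨ [a, T.par a] <:+: l) ↔
        ¬ (T.Anc a (l.head hne) ↔ T.Anc a (l.getLast hne))) := by
    intro l hne hc hn
    match l, hne with
    | x :: l, _ => exact T.edge_iff_of_chain ha l x hc hn
  exact key _ _ (T.net.line_chain i) (T.net.line_nodup i)

theorem onEdge_comm (i : Fin m) (u v : Fin n) : T.net.OnEdge i u v ↔ T.net.OnEdge i v u := Or.comm

variable {T}

theorem onEdge_lineAt_iff {a : Fin n} (ha : a ≠ T.root) {g : ℕ} (hg : g < T.numEnds) :
    T.net.OnEdge (T.lineAt g) (T.par a) a ↔ ¬ (T.Mem a g ↔ T.Mem a (T.mate g)) := by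
  rw [T.onEdge_par_iff ha, mem_iff hg, mem_iff (mate_lt hg), endAt_mate hg]
  rcases endAt_eq_or hg with h | h
  · rw [h.2, h.1]
  · rw [h.2, h.1, iff_comm (a := T.Anc a (T.lst _))]

/-- The `g`-th line end lies in the subtree of `a`, and its line leaves this subtree. -/
def Strand (T : TreeNetwork n m) (a : Fin n) (g : ℕ) : Prop := T.Mem a g ∧ ¬ T.Mem a (T.mate g)

/-- Exactly one end of a line through this edge lies below `a`; it serves as the name of the line on
the edge, unique by `Strand.inj`. -/
theorem onEdge_iff_exists_strand {a : Fin n} (ha : a ≠ T.root) (i : Fin m) :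
    T.net.OnEdge i (T.par a) a ↔ ∃ g, T.lineAt g = i ∧ T.Strand a g := by
  constructor
  · intro h
    obtain ⟨g, hg, rfl, -⟩ := exists_lineAt (T := T) i
    rw [onEdge_lineAt_iff ha hg] at h
    by_cases hm : T.Mem a g
    · exact ⟨g, rfl, hm, fun h' => h (by simp [hm, h'])⟩
    · refine ⟨T.mate g, lineAt_mate hg, ?_, by rwa [mate_mate hg]⟩
      by_contra h'
      exact h (by simp [hm, h'])
  · rintro ⟨g, rfl, h⟩
    rw [onEdge_lineAt_iff ha h.1.lt]
    intro h'
    exact h.2 (h'.1 h.1)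

theorem Strand.inj {a : Fin n} {g h : ℕ} (hg : T.Strand a g) (hh : T.Strand a h)
    (hl : T.lineAt h = T.lineAt g) : h = g := by
  rcases eq_or_eq_mate hg.1.lt hh.1.lt hl with h1 | h1
  · exact h1
  · exact absurd (h1 ▸ hh.1) hg.2

theorem Mem.par {a : Fin n} {g : ℕ} (h : T.Mem a g) : T.Mem (T.par a) g := by
  have hg := h.lt
  rw [mem_iff hg] at h ⊢
  exact (anc_par a).trans h

theorem Mem.of_child {v c : Fin n} {g : ℕ} (hc : c ∈ T.children v) (h : T.Mem c g) : T.Mem v g := by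
  obtain ⟨-, rfl⟩ := T.mem_children.1 hc
  exact h.par

theorem Mem.not_sibling {v c c' : Fin n} {g : ℕ} (hc : c ∈ T.children v) (hc' : c' ∈ T.children v)
    (hne : c ≠ c') (h : T.Mem c g) : ¬ T.Mem c' g := by
  have hg := h.lt
  rw [mem_iff hg] at h ⊢
  exact not_anc_of_sibling hc hc' hne h

/-- A line end has degree one, but `v` has both a parent and a child, which are different. -/
theorem not_isEnd_of_child {v a : Fin n} (hv : v ≠ T.root) (ha : a ∈ T.children v) : ¬ T.IsEnd v := by
  rintro ⟨i, hi⟩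
  obtain ⟨w, hw⟩ := T.exists_rot_of_isTerminal hi
  obtain ⟨h1, h2⟩ := T.mem_children.1 ha
  have e1 := T.par_mem_rot hv
  have e2 : a ∈ T.net.rot v := (T.net.mem_rot _ _).2 (T.adj_iff.2 (Or.inr ⟨h1, h2⟩))
  rw [hw, List.mem_singleton] at e1 e2
  have := T.par_par_ne h1
  rw [h2, e1, e2] at this
  exact this rfl

theorem Mem.exists_child {v a : Fin n} {g : ℕ} (hv : v ≠ T.root) (ha : a ∈ T.children v)
    (h : T.Mem v g) : ∃ c ∈ T.children v, T.Mem c g := by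
  have hg := h.lt
  rw [mem_iff hg, anc_child] at h
  rcases h with h | ⟨c, hc, h⟩
  · exact absurd (h ▸ isEnd_endAt hg) (not_isEnd_of_child hv ha)
  · exact ⟨c, hc, (mem_iff hg).2 h⟩

theorem exists_children_root : ∃ x, T.children T.root = [x] := by
  unfold children
  rw [if_pos rfl]
  exact T.exists_rot_of_isTerminal T.isTerminal_root

theorem mem_root {g : ℕ} : T.Mem T.root g ↔ g < T.numEnds := by
  unfold Mem
  rw [T.lo_root, T.hi_root]
  simp

/-- The root is itself a line end, number `0`, and hence has a single child; all other ends lie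
below this child. -/
theorem mem_root_child {x : Fin n} {g : ℕ} (hx : x ∈ T.children T.root) :
    T.Mem x g ↔ g < T.numEnds ∧ g ≠ 0 := by
  constructor
  · intro h
    refine ⟨h.lt, ?_⟩
    rintro rfl
    rw [mem_iff h.lt, T.endAt_zero.2] at h
    have := h.depth_le
    have := T.depth_child hx
    omega
  · rintro ⟨hg, h0⟩
    obtain ⟨y, hy⟩ := T.exists_children_root
    have h := root_anc (T := T) (T.endAt g)
    rw [mem_iff hg]
    rcases anc_child.1 h with h | ⟨c, hc, h⟩
    · exact absurd (endAt_inj hg T.endAt_zero.1 (h.trans T.endAt_zero.2.symm)) h0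
    · rw [hy, List.mem_singleton] at hc hx
      rwa [hx, ← hc]

end TreeNetwork
end BlockCrossing

namespace BlockCrossing

theorem ne_nil_iff_exists_mem {α : Type*} {l : List α} : l ≠ [] ↔ ∃ y, y ∈ l :=
  ⟨List.exists_mem_of_ne_nil l, fun ⟨_, hy⟩ => List.ne_nil_of_mem hy⟩

/-! ### Sequences with repetitions skipped -/

/-- The values `f 0, …, f q`, where only the marked ones (and `f 0`) are kept. -/
def sieve {α : Type*} (f : ℕ → α) (c : ℕ → Bool) (q : ℕ) : List α :=
  ((List.range (q + 1)).filter fun k => k = 0 ∨ c k = true).map f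

theorem sieve_zero {α : Type*} (f : ℕ → α) (c : ℕ → Bool) : sieve f c 0 = [f 0] := by
  simp [sieve]

theorem sieve_succ {α : Type*} (f : ℕ → α) (c : ℕ → Bool) (q : ℕ) :
    sieve f c (q + 1) = sieve f c q ++ if c (q + 1) = true then [f (q + 1)] else [] := by
  unfold sieve
  rw [List.range_succ, List.filter_append, List.map_append]
  congr 1
  by_cases h : c (q + 1) = true <;> simp [h]

theorem head?_sieve {α : Type*} (f : ℕ → α) (c : ℕ → Bool) (q : ℕ) :
    (sieve f c q).head? = some (f 0) := by
  induction q with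
  | zero => simp [sieve_zero]
  | succ q ih => rw [sieve_succ, List.head?_append, ih]; rfl

/-- An unmarked value repeats its predecessor, so the last value that is kept equals `f q` even if
`q` is not marked. -/
theorem getLast?_sieve {α : Type*} (f : ℕ → α) (c : ℕ → Bool) (q : ℕ)
    (h : ∀ k < q, c (k + 1) = false → f (k + 1) = f k) :
    (sieve f c q).getLast? = some (f q) := by
  induction q with
  | zero => simp [sieve_zero]
  | succ q ih =>
    rw [sieve_succ, List.getLast?_append, ih fun k hk => h k (by omega)]
    cases hc : c (q + 1) with
    | true => simp
    | false => simp [h q (by omega) hc]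

theorem isChain_sieve {α : Type*} {R : α → α → Prop} (f : ℕ → α) (c : ℕ → Bool) (q : ℕ)
    (h : ∀ k < q, c (k + 1) = false → f (k + 1) = f k)
    (h' : ∀ k < q, c (k + 1) = true → R (f k) (f (k + 1))) :
    (sieve f c q).IsChain R := by
  induction q with
  | zero => simp [sieve_zero]
  | succ q ih =>
    rw [sieve_succ]
    have ih := ih (fun k hk => h k (by omega)) fun k hk => h' k (by omega)
    cases hc : c (q + 1) with
    | false => simpa using ih
    | true =>
      rw [if_pos rfl, List.isChain_append]
      refine ⟨ih, by simp, ?_⟩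
      intro x hx y hy
      rw [getLast?_sieve f c q fun k hk => h k (by omega)] at hx
      simp at hx hy
      subst hx hy
      exact h' q (by omega) hc

theorem length_sieve {α : Type*} (f : ℕ → α) (c : ℕ → Bool) (q : ℕ) :
    (sieve f c q).length = 1 + (List.range q).countP fun k => c (k + 1) := by
  induction q with
  | zero => simp [sieve_zero]
  | succ q ih =>
    rw [sieve_succ, List.length_append, ih, List.range_succ, List.countP_append]
    cases hc : c (q + 1) <;> simp [hc, add_assoc]

theorem mem_sieve {α : Type*} {f : ℕ → α} {c : ℕ → Bool} {q : ℕ} {x : α} (h : x ∈ sieve f c q) :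
    ∃ k ≤ q, f k = x := by
  obtain ⟨k, hk, rfl⟩ := List.mem_map.1 h
  exact ⟨k, Nat.lt_succ_iff.1 (List.mem_range.1 (List.mem_filter.1 hk).1), rfl⟩

theorem pairwise_sieve {α : Type*} {R : α → α → Prop} (f : ℕ → α) (c : ℕ → Bool) (q : ℕ)
    (h : ∀ k k', k < k' → k' ≤ q → R (f k) (f k')) : (sieve f c q).Pairwise R := by
  unfold sieve
  rw [List.pairwise_map]
  refine List.Pairwise.imp_of_mem ?_ ((List.pairwise_lt_range (n := q + 1)).filter _)
  intro a b _ hb hab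
  exact h a b hab (Nat.lt_succ_iff.1 (List.mem_range.1 (List.mem_filter.1 hb).1))

/-! ### Relative orders -/

theorem idxOf_lt_iff {α β : Type*} [DecidableEq α] [LinearOrder β] {κ : α → β} {l : List α}
    (h : l.Pairwise fun x y => κ x < κ y) {x y : α} (hx : x ∈ l) (hy : y ∈ l) :
    l.idxOf x < l.idxOf y ↔ κ x < κ y := by
  have key : ∀ x y, x ∈ l → y ∈ l → l.idxOf x < l.idxOf y → κ x < κ y := by
    intro x y hx hy hlt
    have := List.pairwise_iff_getElem.1 h _ _ (List.idxOf_lt_length_of_mem hx)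
      (List.idxOf_lt_length_of_mem hy) hlt
    simpa using this
  refine ⟨key x y hx hy, fun hk => ?_⟩
  rcases lt_trichotomy (l.idxOf x) (l.idxOf y) with h1 | h1 | h1
  · exact h1
  · have := (List.idxOf_inj hx).1 h1
    subst this
    exact absurd hk (lt_irrefl _)
  · exact absurd (key y x hy hx h1) (lt_asymm hk)

theorem idxOf_reverse_lt_iff {α : Type*} [DecidableEq α] {l : List α} (hn : l.Nodup) {x y : α}
    (hx : x ∈ l) (hy : y ∈ l) : l.reverse.idxOf x < l.reverse.idxOf y ↔ l.idxOf y < l.idxOf x := by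
  have h : l.Pairwise fun x y => l.idxOf x < l.idxOf y := by
    rw [List.pairwise_iff_getElem]
    intro i j hi hj hij
    rwa [hn.idxOf_getElem, hn.idxOf_getElem]
  have h' : l.reverse.Pairwise fun x y =>
      OrderDual.toDual (l.idxOf x) < OrderDual.toDual (l.idxOf y) := by
    rw [List.pairwise_reverse]
    exact h
  exact idxOf_lt_iff h' (List.mem_reverse.2 hx) (List.mem_reverse.2 hy)

theorem idxOf_map_of_injOn {α β : Type*} [DecidableEq α] [DecidableEq β] {f : α → β} {l : List α}
    {x : α} (hf : ∀ y ∈ l, f y = f x → y = x) : (l.map f).idxOf (f x) = l.idxOf x := by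
  induction l with
  | nil => rfl
  | cons a l ih =>
    by_cases hax : a = x
    · subst hax; simp
    · have : f a ≠ f x := fun h => hax (hf a (by simp) h)
      rw [List.map_cons, List.idxOf_cons_ne _ this, List.idxOf_cons_ne _ hax,
        ih fun y hy => hf y (List.mem_cons_of_mem _ hy)]

theorem crossCount_eq_zero {α : Type*} [DecidableEq α] {s : List (List α)} {i j : α} {v : Bool}
    (h : ∀ π ∈ s, decide (π.idxOf i < π.idxOf j) = v) : crossCount s i j = 0 := by
  unfold crossCount
  rw [List.countP_eq_zero]
  rintro ⟨π, π'⟩ hp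
  have h1 := h π (List.of_mem_zip hp).1
  have h2 := h π' (List.mem_of_mem_tail (List.of_mem_zip hp).2)
  simp only [h1, h2, bne_self_eq_false, Bool.false_eq_true, not_false_eq_true]

/-- The truth value `v` of the comparison is absorbing, so along the sequence it can change only
once. -/
theorem crossCount_le_one {α : Type*} [DecidableEq α] {s : List (List α)} {i j : α} {v : Bool}
    (h : s.Pairwise fun π π' => decide (π.idxOf i < π.idxOf j) = v →
      decide (π'.idxOf i < π'.idxOf j) = v) : crossCount s i j ≤ 1 := by
  induction s with
  | nil => simp [crossCount]
  | cons π s ih =>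
    rw [List.pairwise_cons] at h
    have ih := ih h.2
    match s with
    | [] => simp [crossCount]
    | π' :: s =>
      have e : crossCount (π :: π' :: s) i j =
          crossCount (π' :: s) i j + if (decide (π.idxOf i < π.idxOf j) !=
            decide (π'.idxOf i < π'.idxOf j)) = true then 1 else 0 := by
        unfold crossCount
        rw [List.tail_cons, List.zip_cons_cons, List.countP_cons, List.tail_cons]
      rw [e]
      split_ifs with hb
      · by_cases hv : decide (π'.idxOf i < π'.idxOf j) = v
        · rw [crossCount_eq_zero (s := π' :: s) (v := v)]
          intro ρ hρ
          rcases List.mem_cons.1 hρ with rfl | hρ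
          · exact hv
          · exact (List.pairwise_cons.1 h.2).1 ρ hρ hv
        · have : decide (π.idxOf i < π.idxOf j) = v := by
            cases h1 : decide (π.idxOf i < π.idxOf j) <;>
            cases h2 : decide (π'.idxOf i < π'.idxOf j) <;> cases v <;> simp_all
          exact absurd (h.1 π' (by simp) this) hv
      · omega

/-- For the edges whose lower vertex has the smaller number: there the sequence and each of its
orders are read backwards. -/
theorem BlockMove.reverse {α : Type*} {π π' : List α} (h : BlockMove π π') :
    BlockMove π'.reverse π.reverse := by
  obtain ⟨A, B, C, D, hB, hC, rfl, rfl⟩ := h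
  exact ⟨D.reverse, B.reverse, C.reverse, A.reverse, by simpa, by simpa, by simp, by simp⟩

theorem BlockMove.map {α β : Type*} (f : α → β) {π π' : List α} (h : BlockMove π π') :
    BlockMove (π.map f) (π'.map f) := by
  obtain ⟨A, B, C, D, hB, hC, rfl, rfl⟩ := h
  exact ⟨A.map f, B.map f, C.map f, D.map f, by simpa, by simpa, by simp, by simp⟩

/-! ### Insertion sort by block moves

The elements of a sorted list `D` with key `0` stand in the middle. The elements with a positive
key are inserted one by one, by increasing key; before that, they wait on the left or on the
right, depending on whether the key exceeds `P`. -/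

namespace Sorting

section

variable (D : List ℕ) (key : ℕ → ℕ) (P : ℕ)

/-- The number of elements with a positive key up to `t`. -/
def below (t : ℕ) : ℕ := D.countP fun y => 0 < key y ∧ key y ≤ t

def rank (g : ℕ) : ℕ := below D key (key g)

def numLeft : ℕ := below D key P

def numNew : ℕ := D.countP fun y => 0 < key y

def atRank (t : ℕ) : ℕ := (D.find? fun y => rank D key y = t).getD 0

/-- The order after the insertion of `k` elements. -/
def order (k : ℕ) : List ℕ :=
  (List.range' (k + 1) (numLeft D key P - k)).reverse.map (atRank D key) ++
    (D.filter fun y => rank D key y ≤ k) ++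
    (List.range' (max k (numLeft D key P) + 1) (numNew D key - max k (numLeft D key P))).map
      (atRank D key)

/-- The insertion of `x` changes the order. -/
def moved (x : ℕ) : Bool :=
  if key x ≤ P then decide (∃ y ∈ D, key y < key x ∧ y < x)
  else decide (∃ y ∈ D, key y < key x ∧ x < y)

def orders : List (List ℕ) :=
  sieve (order D key P) (fun k => moved D key P (atRank D key k)) (numNew D key)

/-- The orders are sorted with respect to this function. -/
def place (M k g : ℕ) : ℕ :=
  if rank D key g ≤ k then P + 1 + g else if key g ≤ P then P + 1 - key g else P + 1 + M + key g

end

variable {D : List ℕ} {key : ℕ → ℕ} {P M : ℕ}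

theorem below_mono {s t : ℕ} (h : s ≤ t) : below D key s ≤ below D key t := by
  apply List.countP_mono_left
  intro x _
  simp only [decide_eq_true_eq]
  omega

theorem below_lt {s t x : ℕ} (hx : x ∈ D) (h0 : 0 < key x) (hs : s < key x) (ht : key x ≤ t) :
    below D key s < below D key t := by
  obtain ⟨A, B, rfl⟩ := List.append_of_mem hx
  have hA : below A key s ≤ below A key t := below_mono (by omega)
  have hB : below B key s ≤ below B key t := below_mono (by omega)
  unfold below at *
  rw [List.countP_append, List.countP_append, List.countP_cons_of_neg (by simp; omega),
    List.countP_cons_of_pos (by simp; omega)]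
  omega

theorem rank_lt_iff {x y : ℕ} (hy : y ∈ D) (h0 : 0 < key y) :
    rank D key x < rank D key y ↔ key x < key y := by
  constructor
  · intro h
    by_contra h'
    have : rank D key y ≤ rank D key x := below_mono (by omega)
    omega
  · intro h
    exact below_lt hy h0 h le_rfl

theorem rank_eq_zero {x : ℕ} (h : key x = 0) : rank D key x = 0 := by
  unfold rank below
  rw [List.countP_eq_zero]
  intro a _
  simp
  omega

theorem rank_pos {x : ℕ} (hx : x ∈ D) (h0 : 0 < key x) : 0 < rank D key x := by
  have : below D key 0 < rank D key x := below_lt hx h0 h0 le_rfl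
  omega

theorem numLeft_le : numLeft D key P ≤ numNew D key := by
  apply List.countP_mono_left
  intro x _
  simp only [decide_eq_true_eq]
  omega

theorem rank_le {x : ℕ} : rank D key x ≤ numNew D key := numLeft_le

theorem rank_le_numLeft_iff {x : ℕ} (hx : x ∈ D) (h0 : 0 < key x) :
    rank D key x ≤ numLeft D key P ↔ key x ≤ P := by
  constructor
  · intro h
    by_contra h'
    have : numLeft D key P < rank D key x := below_lt hx h0 (by omega) le_rfl
    omega
  · exact fun h => below_mono h

/-- The list `D` is increasing, and positive keys are distinct. -/
structure Good (D : List ℕ) (key : ℕ → ℕ) (M : ℕ) : Prop where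
  lt : D.Pairwise (· < ·)
  bound : ∀ x ∈ D, x < M
  inj : ∀ x ∈ D, ∀ y ∈ D, 0 < key x → key x = key y → x = y

theorem Good.nodup (hG : Good D key M) : D.Nodup := hG.lt.imp fun h => h.ne

theorem Good.eq_of_rank_eq (hG : Good D key M) {x y : ℕ} (hx : x ∈ D) (hy : y ∈ D)
    (h0 : 0 < key y) (h : rank D key x = rank D key y) : x = y := by
  have h1 : ¬ key x < key y := fun h' => by have := (rank_lt_iff (x := x) hy h0).2 h'; omega
  have hx0 : 0 < key x := by omega
  have h2 : ¬ key y < key x := fun h' => by have := (rank_lt_iff (x := y) hx hx0).2 h'; omega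
  exact hG.inj x hx y hy hx0 (by omega)

/-- By counting: `rank` maps the elements with a positive key injectively into `1, …, numNew`, and
there are `numNew` of them. -/
theorem Good.exists_rank (hG : Good D key M) {t : ℕ} (h1 : 1 ≤ t) (ht : t ≤ numNew D key) :
    ∃ x ∈ D, 0 < key x ∧ rank D key x = t := by
  have himg : ((D.filter fun y => 0 < key y).toFinset.image (rank D key)) =
      Finset.Icc 1 (numNew D key) := by
    apply Finset.eq_of_subset_of_card_le
    · intro s hs
      obtain ⟨x, hx, rfl⟩ := Finset.mem_image.1 hs
      simp only [List.mem_toFinset, List.mem_filter, decide_eq_true_eq] at hx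
      exact Finset.mem_Icc.2 ⟨rank_pos hx.1 hx.2, rank_le⟩
    · rw [Finset.card_image_of_injOn, List.toFinset_card_of_nodup (hG.nodup.filter _)]
      · simp [numNew, List.countP_eq_length_filter]
      · intro x hx y hy hxy
        simp only [List.coe_toFinset, List.mem_filter, decide_eq_true_eq, Set.mem_ofPred_eq] at hx hy
        exact hG.eq_of_rank_eq hx.1 hy.1 hy.2 hxy
  have : t ∈ Finset.Icc 1 (numNew D key) := Finset.mem_Icc.2 ⟨h1, ht⟩
  rw [← himg, Finset.mem_image] at this
  obtain ⟨x, hx, hr⟩ := this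
  simp only [List.mem_toFinset, List.mem_filter, decide_eq_true_eq] at hx
  exact ⟨x, hx.1, hx.2, hr⟩

theorem Good.atRank_rank (hG : Good D key M) {x : ℕ} (hx : x ∈ D) (h0 : 0 < key x) :
    atRank D key (rank D key x) = x := by
  unfold atRank
  cases h : D.find? fun y => rank D key y = rank D key x with
  | none =>
    have := List.find?_eq_none.1 h x hx
    simp at this
  | some y =>
    have h1 := List.mem_of_find?_eq_some h
    have h2 := List.find?_some h
    simp only [decide_eq_true_eq] at h2
    exact hG.eq_of_rank_eq h1 hx h0 h2

theorem Good.atRank_spec (hG : Good D key M) {t : ℕ} (h1 : 1 ≤ t) (ht : t ≤ numNew D key) :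
    atRank D key t ∈ D ∧ 0 < key (atRank D key t) ∧ rank D key (atRank D key t) = t := by
  obtain ⟨x, hx, h0, rfl⟩ := hG.exists_rank h1 ht
  rw [hG.atRank_rank hx h0]
  exact ⟨hx, h0, rfl⟩

theorem Good.mem_order (hG : Good D key M) {k : ℕ} {x : ℕ} :
    x ∈ order D key P k ↔ x ∈ D := by
  have hpq : numLeft D key P ≤ numNew D key := numLeft_le
  unfold order
  simp only [List.mem_append, List.mem_map, List.mem_reverse, List.mem_range'_1, List.mem_filter,
    decide_eq_true_eq]
  constructor
  · rintro ((⟨t, ht, rfl⟩ | h) | ⟨t, ht, rfl⟩)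
    · exact (hG.atRank_spec (by omega) (by omega)).1
    · exact h.1
    · exact (hG.atRank_spec (by omega) (by omega)).1
  · intro hx
    by_cases hk : rank D key x ≤ k
    · exact Or.inl (Or.inr ⟨hx, hk⟩)
    · have h0 : 0 < key x := by
        by_contra h
        rw [rank_eq_zero (by omega)] at hk
        omega
      have hq : rank D key x ≤ numNew D key := rank_le
      by_cases hp : rank D key x ≤ numLeft D key P
      · exact Or.inl (Or.inl ⟨rank D key x, by omega, hG.atRank_rank hx h0⟩)
      · exact Or.inr ⟨rank D key x, by omega, hG.atRank_rank hx h0⟩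

/-- `place` sends the elements waiting on the left to `1, …, P`, the inserted ones to `P + 1, …, P +
M` and those waiting on the right beyond `P + 1 + M`. The waiting elements stand farther out the
larger their key is. -/
theorem Good.pairwise_order (hG : Good D key M) (k : ℕ) :
    (order D key P k).Pairwise fun x y => place D key P M k x < place D key P M k y := by
  have hpq : numLeft D key P ≤ numNew D key := numLeft_le
  have hL : ∀ t ∈ List.range' (k + 1) (numLeft D key P - k),
      place D key P M k (atRank D key t) = P + 1 - key (atRank D key t) ∧
      0 < key (atRank D key t) ∧ key (atRank D key t) ≤ P := by
    intro t ht
    rw [List.mem_range'_1] at ht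
    obtain ⟨h1, h2, h3⟩ := hG.atRank_spec (t := t) (by omega) (by omega)
    have h4 : key (atRank D key t) ≤ P := (rank_le_numLeft_iff h1 h2).1 (by omega)
    unfold place
    rw [if_neg (by omega), if_pos h4]
    exact ⟨rfl, h2, h4⟩
  have hR : ∀ t ∈ List.range' (max k (numLeft D key P) + 1) (numNew D key - max k (numLeft D key P)),
      place D key P M k (atRank D key t) = P + 1 + M + key (atRank D key t) := by
    intro t ht
    rw [List.mem_range'_1] at ht
    obtain ⟨h1, h2, h3⟩ := hG.atRank_spec (t := t) (by omega) (by omega)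
    have h4 : ¬ key (atRank D key t) ≤ P := fun h => by
      have := (rank_le_numLeft_iff h1 h2).2 h
      omega
    unfold place
    rw [if_neg (by omega), if_neg h4]
  have hM : ∀ x ∈ D.filter (fun y => rank D key y ≤ k),
      place D key P M k x = P + 1 + x ∧ x < M := by
    intro x hx
    rw [List.mem_filter, decide_eq_true_eq] at hx
    unfold place
    rw [if_pos hx.2]
    exact ⟨rfl, hG.bound x hx.1⟩
  have hkey : ∀ s t, 1 ≤ s → s < t → t ≤ numNew D key →
      key (atRank D key s) < key (atRank D key t) := by
    intro s t h1 hst ht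
    obtain ⟨-, -, a3⟩ := hG.atRank_spec (t := s) (by omega) (by omega)
    obtain ⟨b1, b2, b3⟩ := hG.atRank_spec (t := t) (by omega) (by omega)
    rw [← rank_lt_iff b1 b2]
    omega
  unfold order
  rw [List.pairwise_append, List.pairwise_append, List.pairwise_map, List.pairwise_reverse,
    List.pairwise_map]
  refine ⟨⟨?_, ?_, ?_⟩, ?_, ?_⟩
  · refine List.Pairwise.imp_of_mem ?_ (List.pairwise_lt_range' ..)
    intro s t hs ht hst
    have h1 := hL s hs
    have h2 := hL t ht
    rw [List.mem_range'_1] at hs ht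
    have := hkey s t (by omega) hst (by omega)
    omega
  · refine List.Pairwise.imp_of_mem ?_ (hG.lt.filter _)
    intro x y hx hy hxy
    have := hM x hx
    have := hM y hy
    omega
  · intro x hx y hy
    obtain ⟨t, ht, rfl⟩ := List.mem_map.1 hx
    have := hL t (List.mem_reverse.1 ht)
    have := hM y hy
    omega
  · refine List.Pairwise.imp_of_mem ?_ (List.pairwise_lt_range' ..)
    intro s t hs ht hst
    have h1 := hR s hs
    have h2 := hR t ht
    rw [List.mem_range'_1] at hs ht
    have := hkey s t (by omega) hst (by omega)
    omega
  · intro x hx y hy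
    obtain ⟨t, ht, rfl⟩ := List.mem_map.1 hy
    have h1 := hR t ht
    rcases List.mem_append.1 hx with hx | hx
    · obtain ⟨s, hs, rfl⟩ := List.mem_map.1 hx
      have := hL s (List.mem_reverse.1 hs)
      omega
    · have := hM x hx
      omega

theorem Good.nodup_order (hG : Good D key M) (k : ℕ) : (order D key P k).Nodup :=
  (hG.pairwise_order (P := P) k).imp fun h => by rintro rfl; exact lt_irrefl _ h

theorem order_numNew : order D key P (numNew D key) = D := by
  have hpq : numLeft D key P ≤ numNew D key := numLeft_le
  unfold order
  rw [max_eq_left hpq, Nat.sub_eq_zero_of_le hpq, Nat.sub_self]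
  simp [rank_le]

/-- Pairs in the right order stay so. -/
theorem Good.place_lt_succ (hG : Good D key M) {x y k : ℕ} (hx : x ∈ D) (hy : y ∈ D) (hxy : x < y)
    (h : place D key P M k x < place D key P M k y) :
    place D key P M (k + 1) x < place D key P M (k + 1) y := by
  have hpos : ∀ z ∈ D, k < rank D key z → 0 < key z := by
    intro z _ hz
    by_contra h'
    rw [rank_eq_zero (by omega)] at hz
    omega
  have bx := hG.bound x hx
  have by' := hG.bound y hy
  -- An element inserted by now does not have a larger key than one still waiting. Hence of two
  -- elements waiting on the same side the inner one goes first and only moves away from the other;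
  -- elements of different sides that are in the right order keep it.
  have e1 : rank D key x ≤ k + 1 → ¬ rank D key y ≤ k + 1 → ¬ key y < key x := by
    intro h1 h2 h3
    have := (rank_lt_iff (x := y) hx (by omega)).2 h3
    omega
  have e2 : rank D key y ≤ k + 1 → ¬ rank D key x ≤ k + 1 → ¬ key x < key y := by
    intro h1 h2 h3
    have := (rank_lt_iff (x := x) hy (by omega)).2 h3
    omega
  have px := hpos x hx
  have py := hpos y hy
  unfold place at *
  split_ifs at * <;> omega

theorem Good.place_lt_of_le (hG : Good D key M) {x y k l : ℕ} (hx : x ∈ D) (hy : y ∈ D) (hxy : x < y)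
    (hkl : k ≤ l) (h : place D key P M k x < place D key P M k y) :
    place D key P M l x < place D key P M l y := by
  induction l, hkl using Nat.le_induction with
  | base => exact h
  | succ l _ ih => exact hG.place_lt_succ hx hy hxy ih

/-- Ranks of positive keys are distinct, so just one element joins the inserted ones. `A` and `B`
are the inserted elements on its two sides, that is, the blocks it may have to pass. -/
theorem Good.filter_split (hG : Good D key M) {k : ℕ} (hk : k < numNew D key) :
    ∃ A B, (D.filter fun y => rank D key y ≤ k) = A ++ B ∧
      (D.filter fun y => rank D key y ≤ k + 1) = A ++ atRank D key (k + 1) :: B ∧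
      (A ≠ [] ↔ ∃ y ∈ D, key y < key (atRank D key (k + 1)) ∧ y < atRank D key (k + 1)) ∧
      (B ≠ [] ↔ ∃ y ∈ D, key y < key (atRank D key (k + 1)) ∧ atRank D key (k + 1) < y) := by
  obtain ⟨h1, h2, h3⟩ := hG.atRank_spec (t := k + 1) (by omega) (by omega)
  generalize hx : atRank D key (k + 1) = x at *
  obtain ⟨A, B, hD⟩ := List.append_of_mem h1
  have hlt := hG.lt
  have hn := hG.nodup
  have hne : ∀ y ∈ D, y ≠ x → (rank D key y ≤ k + 1 ↔ rank D key y ≤ k) := by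
    intro y hy hyx
    have : rank D key y ≠ k + 1 := fun h => hyx (hG.eq_of_rank_eq hy h1 h2 (by omega))
    omega
  have hr : ∀ y, rank D key y ≤ k ↔ key y < key x := by
    intro y
    rw [← rank_lt_iff h1 h2]
    omega
  have hAx : ∀ y ∈ A, y ∈ D ∧ y < x := by
    intro y hy
    refine ⟨by rw [hD]; simp [hy], ?_⟩
    rw [hD, List.pairwise_append] at hlt
    exact hlt.2.2 y hy x (by simp)
  have hBx : ∀ y ∈ B, y ∈ D ∧ x < y := by
    intro y hy
    refine ⟨by rw [hD]; simp [hy], ?_⟩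
    rw [hD, List.pairwise_append, List.pairwise_cons] at hlt
    exact hlt.2.1.1 y hy
  refine ⟨A.filter fun y => rank D key y ≤ k, B.filter fun y => rank D key y ≤ k, ?_, ?_, ?_, ?_⟩
  · have : ∀ p : ℕ → Bool, p x = false → D.filter p = A.filter p ++ B.filter p := by
      intro p hp
      rw [hD, List.filter_append, List.filter_cons_of_neg (by simp [hp])]
    exact this _ (by simp; omega)
  · have : ∀ p : ℕ → Bool, p x = true → D.filter p = A.filter p ++ x :: B.filter p := by
      intro p hp
      rw [hD, List.filter_append, List.filter_cons_of_pos (by simp [hp])]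
    rw [this _ (by simp; omega)]
    congr 1
    · apply List.filter_congr
      intro y hy
      rw [decide_eq_decide]
      exact hne y (hAx y hy).1 (hAx y hy).2.ne
    · congr 1
      apply List.filter_congr
      intro y hy
      rw [decide_eq_decide]
      exact hne y (hBx y hy).1 (hBx y hy).2.ne'
  · rw [ne_nil_iff_exists_mem]
    simp only [List.mem_filter, decide_eq_true_eq, hr]
    constructor
    · rintro ⟨y, hy, h⟩
      exact ⟨y, (hAx y hy).1, h, (hAx y hy).2⟩
    · rintro ⟨y, hy, h, h'⟩
      refine ⟨y, ?_, h⟩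
      rw [hD, List.mem_append, List.mem_cons] at hy
      rcases hy with hy | rfl | hy
      · exact hy
      · omega
      · have := (hBx y hy).2; omega
  · rw [ne_nil_iff_exists_mem]
    simp only [List.mem_filter, decide_eq_true_eq, hr]
    constructor
    · rintro ⟨y, hy, h⟩
      exact ⟨y, (hBx y hy).1, h, (hBx y hy).2⟩
    · rintro ⟨y, hy, h, h'⟩
      refine ⟨y, ?_, h⟩
      rw [hD, List.mem_append, List.mem_cons] at hy
      rcases hy with hy | rfl | hy
      · have := (hAx y hy).2; omega
      · omega
      · exact hy

/-- The element that is due stands next to the inserted ones. Coming from the left it passes the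
block of the smaller ones, coming from the right the block of the larger ones, and `moved` records
whether this block is nonempty. -/
theorem Good.order_step (hG : Good D key M) {k : ℕ} (hk : k < numNew D key) :
    (moved D key P (atRank D key (k + 1)) = false → order D key P (k + 1) = order D key P k) ∧
    (moved D key P (atRank D key (k + 1)) = true →
      BlockMove (order D key P k) (order D key P (k + 1))) := by
  obtain ⟨h1, h2, h3⟩ := hG.atRank_spec (t := k + 1) (by omega) (by omega)
  obtain ⟨A, B, hf, hf', hA, hB⟩ := hG.filter_split hk
  have hleft := rank_le_numLeft_iff (P := P) h1 h2
  have hpq : numLeft D key P ≤ numNew D key := numLeft_le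
  rw [h3] at hleft
  unfold moved
  by_cases hp : k + 1 ≤ numLeft D key P
  · rw [if_pos (hleft.1 hp)]
    obtain ⟨l, hl⟩ : ∃ l, numLeft D key P - k = l + 1 := ⟨numLeft D key P - k - 1, by omega⟩
    have e1 : numLeft D key P - (k + 1) = l := by omega
    have e2 : order D key P k = (List.range' (k + 1 + 1) l).reverse.map (atRank D key) ++
        [atRank D key (k + 1)] ++ A ++ (B ++
        (List.range' (numLeft D key P + 1) (numNew D key - numLeft D key P)).map (atRank D key)) := by
      unfold order
      rw [hf, hl, max_eq_right (by omega), List.range'_succ]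
      simp
    have e3 : order D key P (k + 1) = (List.range' (k + 1 + 1) l).reverse.map (atRank D key) ++
        A ++ [atRank D key (k + 1)] ++ (B ++
        (List.range' (numLeft D key P + 1) (numNew D key - numLeft D key P)).map (atRank D key)) := by
      unfold order
      rw [hf', e1, max_eq_right (by omega)]
      simp
    rw [e2, e3]
    constructor
    · intro h
      have : A = [] := by
        by_contra hne
        rw [decide_eq_false_iff_not] at h
        exact h (hA.1 hne)
      simp [this]
    · intro h
      rw [decide_eq_true_eq] at h
      exact ⟨_, _, _, _, by simp, hA.2 h, rfl, rfl⟩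
  -- The keys of the elements on the left are smaller than those on the right, so the left part is
  -- empty by now.
  · rw [if_neg fun h => hp (hleft.2 h)]
    obtain ⟨l, hl⟩ : ∃ l, numNew D key - k = l + 1 := ⟨numNew D key - k - 1, by omega⟩
    have e1 : numNew D key - (k + 1) = l := by omega
    have e2 : order D key P k = A ++ B ++ [atRank D key (k + 1)] ++
        (List.range' (k + 1 + 1) l).map (atRank D key) := by
      unfold order
      rw [hf, Nat.sub_eq_zero_of_le (by omega), max_eq_left (by omega), hl, List.range'_succ]
      simp
    have e3 : order D key P (k + 1) = A ++ [atRank D key (k + 1)] ++ B ++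
        (List.range' (k + 1 + 1) l).map (atRank D key) := by
      unfold order
      rw [hf', Nat.sub_eq_zero_of_le (by omega), max_eq_left (by omega), e1]
      simp
    rw [e2, e3]
    constructor
    · intro h
      have : B = [] := by
        by_contra hne
        rw [decide_eq_false_iff_not] at h
        exact h (hB.1 hne)
      simp [this]
    · intro h
      rw [decide_eq_true_eq] at h
      exact ⟨_, _, _, _, hB.2 h, by simp, rfl, rfl⟩

theorem Good.isChain_orders (hG : Good D key M) : (orders D key P).IsChain BlockMove :=
  isChain_sieve _ _ _ (fun _ hk => (hG.order_step hk).1) fun _ hk => (hG.order_step hk).2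

theorem head?_orders : (orders D key P).head? = some (order D key P 0) := head?_sieve _ _ _

theorem Good.getLast?_orders (hG : Good D key M) : (orders D key P).getLast? = some D := by
  rw [orders, getLast?_sieve _ _ _ fun _ hk => (hG.order_step hk).1, order_numNew]

theorem length_orders_le : (orders D key P).length - 1 ≤ numNew D key := by
  rw [orders, length_sieve]
  have := List.countP_le_length (p := fun k => moved D key P (atRank D key (k + 1)))
    (l := List.range (numNew D key))
  rw [List.length_range] at this
  omega

/-- If there are only new elements, then the insertion of the first one costs nothing. -/
theorem Good.length_orders_lt (hG : Good D key M) (hne : D ≠ []) (hnew : ∀ x ∈ D, 0 < key x) :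
    (orders D key P).length - 1 + 1 ≤ numNew D key := by
  have hpos : 0 < numNew D key := by
    obtain ⟨x, hx⟩ := List.exists_mem_of_ne_nil _ hne
    exact List.countP_pos_iff.2 ⟨x, hx, by simpa using hnew x hx⟩
  obtain ⟨q, hq⟩ : ∃ q, numNew D key = q + 1 := ⟨numNew D key - 1, by omega⟩
  obtain ⟨h1, h2, h3⟩ := hG.atRank_spec (t := 1) le_rfl hpos
  have hno : ∀ y ∈ D, ¬ key y < key (atRank D key 1) := by
    intro y hy h
    have := (rank_lt_iff (x := y) h1 h2).2 h
    have := rank_pos hy (hnew y hy)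
    omega
  -- No element has a smaller key than the first one, so there is nothing that it could pass.
  have hm : moved D key P (atRank D key 1) = false := by
    unfold moved
    split_ifs
    · rw [decide_eq_false_iff_not]
      rintro ⟨y, hy, h, -⟩
      exact hno y hy h
    · rw [decide_eq_false_iff_not]
      rintro ⟨y, hy, h, -⟩
      exact hno y hy h
  rw [orders, length_sieve, hq, List.range_succ_eq_map, List.countP_cons_of_neg (by simp [hm]),
    List.countP_map]
  have := List.countP_le_length (p := (fun k => moved D key P (atRank D key (k + 1))) ∘ Nat.succ)
    (l := List.range q)
  rw [List.length_range] at this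
  omega

end Sorting
end BlockCrossing

namespace BlockCrossing
namespace TreeNetwork

open Sorting

variable {n m : ℕ} (T : TreeNetwork n m)

/-! ### The solution -/

/-- The line ends in the subtree of `a` whose lines leave this subtree. -/
noncomputable def strands (a : Fin n) : List ℕ :=
  (List.range' (T.lo a) (T.hi a - T.lo a)).filter fun g => T.mate g < T.lo a ∨ T.hi a ≤ T.mate g

/-- The line of the strand `g` of `a` has its topmost vertex in the parent of `a`. -/
def IsNew (a : Fin n) (g : ℕ) : Prop := T.Strand a g ∧ T.Mem (T.par a) (T.mate g)

open Classical in
/-- For a line end: the value of `lo` in the topmost edge on this side of the line. -/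
noncomputable def topLo (g : ℕ) : ℕ := if h : ∃ a, a ≠ T.root ∧ T.IsNew a g then T.lo h.choose else 0

/-- The threshold between the keys of strands waiting on the left and on the right, see
`key_left_le`. -/
noncomputable def bound : ℕ := T.numEnds * T.numEnds

/-- The key is `0` for a line that goes on above the parent. If the line comes from an earlier
sibling, `topLo` of its mate is the value of `lo` at this sibling: a later one of these siblings
waits farther to the left, and strands from the same one wait in increasing order of `g`, which is
already the right order. If the line goes to a later sibling, the strands wait in decreasing order
of their mates. -/
noncomputable def key (a : Fin n) (g : ℕ) : ℕ :=
  if T.mate g < T.lo (T.par a) ∨ T.hi (T.par a) ≤ T.mate g then 0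
  else if T.mate g < T.lo a then T.topLo (T.mate g) * T.numEnds + (T.numEnds - g)
  else T.bound + (T.numEnds - T.mate g)

noncomputable def seq (a : Fin n) : List (List ℕ) := orders (T.strands a) (T.key a) T.bound

/-- The order of the strands close to the parent. -/
noncomputable def top (a : Fin n) : List ℕ := order (T.strands a) (T.key a) T.bound 0

noncomputable def lineSeq (a : Fin n) : List (List (Fin m)) := (T.seq a).map fun π => π.map T.lineAt

/-- `lineSeq` describes an edge from the parent to the child, so it is read backwards, together with
each order in it, when the traveller from `u` to `v` goes up. -/
noncomputable def solution : LineOrders n m := fun u v =>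
  if v ≠ T.root ∧ T.par v = u then T.lineSeq v else (T.lineSeq u).reverse.map List.reverse

variable {T}

theorem mem_strands {a : Fin n} {g : ℕ} : g ∈ T.strands a ↔ T.Strand a g := by
  unfold strands Strand Mem
  rw [List.mem_filter, List.mem_range'_1, decide_eq_true_eq]
  have := T.lo_le_hi a
  omega

theorem pairwise_strands (a : Fin n) : (T.strands a).Pairwise (· < ·) :=
  (List.pairwise_lt_range' ..).filter _

/-- Otherwise one of the two vertices lies strictly above the other, hence above the parent of the
other, and its subtree contains the mate as well. -/
theorem IsNew.unique {a b : Fin n} {g : ℕ} (h : T.IsNew a g) (h' : T.IsNew b g) : a = b := by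
  have hg := h.1.1.lt
  have hm := mate_lt hg
  obtain ⟨⟨h1, h2⟩, h3⟩ := h
  obtain ⟨⟨h1', h2'⟩, h3'⟩ := h'
  rw [mem_iff hg] at h1 h1'
  rw [mem_iff hm] at h2 h3 h2' h3'
  by_contra hne
  rcases h1.comparable h1' with h | h
  · exact h2 ((h.par_of_ne hne).trans h3')
  · exact h2' ((h.par_of_ne (Ne.symm hne)).trans h3)

theorem topLo_eq {a : Fin n} (ha : a ≠ T.root) {g : ℕ} (h : T.IsNew a g) : T.topLo g = T.lo a := by
  have hex : ∃ a, a ≠ T.root ∧ T.IsNew a g := ⟨a, ha, h⟩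
  unfold topLo
  rw [dif_pos hex, hex.choose_spec.2.unique h]

theorem topLo_lt (g : ℕ) : T.topLo g < T.numEnds := by
  unfold topLo
  split_ifs with h
  · exact h.choose_spec.2.1.1.1.trans_lt h.choose_spec.2.1.1.lt
  · exact T.endAt_zero.1

/-- Lexicographic comparison, with lower digits `1, …, M` in place of `0, …, M - 1`. -/
theorem mul_add_lt {a b M r s : ℕ} (hab : a < b) (hr : r ≤ M) (hs : 0 < s) :
    a * M + r < b * M + s := by
  have := Nat.mul_le_mul_right M (Nat.succ_le_of_lt hab)
  rw [Nat.succ_mul] at this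
  omega

theorem key_old {a : Fin n} {g : ℕ} (h : ¬ T.Mem (T.par a) (T.mate g)) : T.key a g = 0 := by
  unfold key
  unfold Mem at h
  rw [if_pos (by omega)]

theorem key_left {a : Fin n} {g : ℕ} (h : T.Mem (T.par a) (T.mate g)) (hl : T.mate g < T.lo a) :
    T.key a g = T.topLo (T.mate g) * T.numEnds + (T.numEnds - g) := by
  unfold key
  unfold Mem at h
  rw [if_neg (by omega), if_pos hl]

theorem key_right {a : Fin n} {g : ℕ} (h : T.Mem (T.par a) (T.mate g)) (hl : ¬ T.mate g < T.lo a) :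
    T.key a g = T.bound + (T.numEnds - T.mate g) := by
  unfold key
  unfold Mem at h
  rw [if_neg (by omega), if_neg hl]

theorem key_left_le {g h : ℕ} :
    T.topLo g * T.numEnds + (T.numEnds - h) ≤ T.bound := by
  have := mul_add_lt (T.topLo_lt g) (M := T.numEnds) (r := T.numEnds - h) (s := 1) (by omega) one_pos
  unfold bound
  omega

theorem key_pos_iff {a : Fin n} {g : ℕ} (hg : g < T.numEnds) :
    0 < T.key a g ↔ T.Mem (T.par a) (T.mate g) := by
  constructor
  · intro h
    by_contra h'
    rw [key_old h'] at h
    omega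
  · intro h
    have := mate_lt hg
    by_cases hl : T.mate g < T.lo a
    · rw [key_left h hl]; omega
    · rw [key_right h hl]; omega

/-- Left and right keys are separated by `bound`. A left key determines `g` as its lower digit; a
right key determines the mate, and `mate` is an involution. -/
theorem good (a : Fin n) : Good (T.strands a) (T.key a) T.numEnds := by
  refine ⟨pairwise_strands a, fun g hg => (mem_strands.1 hg).1.lt, ?_⟩
  intro g hg h hh h0 he
  have hg' := (mem_strands.1 hg).1.lt
  have hh' := (mem_strands.1 hh).1.lt
  have mg := (key_pos_iff hg').1 h0
  have mh := (key_pos_iff hh').1 (he ▸ h0)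
  have lg := mate_lt hg'
  have lh := mate_lt hh'
  by_cases h1 : T.mate g < T.lo a <;> by_cases h2 : T.mate h < T.lo a
  · rw [key_left mg h1, key_left mh h2] at he
    rcases lt_trichotomy (T.topLo (T.mate g)) (T.topLo (T.mate h)) with h3 | h3 | h3
    · have := mul_add_lt h3 (M := T.numEnds) (r := T.numEnds - g) (s := T.numEnds - h)
        (by omega) (by omega)
      omega
    · rw [h3] at he; omega
    · have := mul_add_lt h3 (M := T.numEnds) (r := T.numEnds - h) (s := T.numEnds - g)
        (by omega) (by omega)
      omega
  · rw [key_left mg h1, key_right mh h2] at he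
    have := key_left_le (T := T) (g := T.mate g) (h := g)
    omega
  · rw [key_right mg h1, key_left mh h2] at he
    have := key_left_le (T := T) (g := T.mate h) (h := h)
    omega
  · rw [key_right mg h1, key_right mh h2] at he
    have : T.mate g = T.mate h := by omega
    rw [← mate_mate hg', this, mate_mate hh']

/-- The order close to the parent is sorted with respect to this function. -/
noncomputable def place (T : TreeNetwork n m) (a : Fin n) (g : ℕ) : ℕ :=
  Sorting.place (T.strands a) (T.key a) T.bound T.numEnds 0 g

theorem place_old {a : Fin n} {g : ℕ} (h : ¬ T.Mem (T.par a) (T.mate g)) :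
    T.place a g = T.bound + 1 + g := by
  unfold place Sorting.place
  rw [if_pos (by rw [rank_eq_zero (key_old h)])]

theorem place_left {a : Fin n} {g : ℕ} (hg : T.IsNew a g) (hl : T.mate g < T.lo a) :
    T.place a g = T.bound + 1 - (T.topLo (T.mate g) * T.numEnds + (T.numEnds - g)) := by
  have := rank_pos (mem_strands.2 hg.1) ((key_pos_iff hg.1.1.lt).2 hg.2)
  unfold place Sorting.place
  rw [if_neg (by omega), key_left hg.2 hl, if_pos key_left_le]

theorem place_right {a : Fin n} {g : ℕ} (hg : T.IsNew a g) (hl : ¬ T.mate g < T.lo a) :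
    T.place a g = T.bound + 1 + T.numEnds + (T.bound + (T.numEnds - T.mate g)) := by
  have := rank_pos (mem_strands.2 hg.1) ((key_pos_iff hg.1.1.lt).2 hg.2)
  have := mate_lt hg.1.1.lt
  unfold place Sorting.place
  rw [if_neg (by omega), key_right hg.2 hl, if_neg (by omega)]

theorem mem_top {a : Fin n} {g : ℕ} : g ∈ T.top a ↔ T.Strand a g :=
  (good a).mem_order.trans mem_strands

theorem pairwise_top (a : Fin n) : (T.top a).Pairwise fun g h => T.place a g < T.place a h :=
  (good a).pairwise_order 0

theorem head?_lineSeq (a : Fin n) : (T.lineSeq a).head? = some ((T.top a).map T.lineAt) := by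
  unfold lineSeq seq
  rw [List.head?_map, head?_orders]
  rfl

theorem getLast?_lineSeq (a : Fin n) :
    (T.lineSeq a).getLast? = some ((T.strands a).map T.lineAt) := by
  unfold lineSeq seq
  rw [List.getLast?_map, (good a).getLast?_orders]
  rfl

theorem solution_down {a : Fin n} (ha : a ≠ T.root) : T.solution (T.par a) a = T.lineSeq a := by
  unfold solution
  rw [if_pos ⟨ha, rfl⟩]

theorem solution_up {a : Fin n} (ha : a ≠ T.root) :
    T.solution a (T.par a) = (T.lineSeq a).reverse.map List.reverse := by
  unfold solution
  rw [if_neg fun h => T.par_par_ne ha h.2]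

theorem outOrder_child {v c : Fin n} (hc : c ∈ T.children v) :
    Network.outOrder T.solution v c = (T.top c).map T.lineAt := by
  obtain ⟨h1, rfl⟩ := T.mem_children.1 hc
  unfold Network.outOrder
  split_ifs
  · rw [solution_down h1, head?_lineSeq]; rfl
  · rw [solution_up h1, List.getLast?_map, List.getLast?_reverse, head?_lineSeq]
    simp

theorem outOrder_par {v : Fin n} (hv : v ≠ T.root) :
    Network.outOrder T.solution v (T.par v) = ((T.strands v).map T.lineAt).reverse := by
  unfold Network.outOrder
  split_ifs
  · rw [solution_up hv, List.head?_map, List.head?_reverse, getLast?_lineSeq]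
    simp
  · rw [solution_down hv, getLast?_lineSeq]; rfl

variable (T)

theorem mem_edges {u v : Fin n} : (u, v) ∈ T.net.edges ↔ v ∈ T.net.rot u ∧ u < v := by
  unfold Network.edges
  simp

/-- The lower vertex of an edge. -/
noncomputable def child (e : Fin n × Fin n) : Fin n :=
  if e.2 ≠ T.root ∧ T.par e.2 = e.1 then e.2 else e.1

theorem edge_cases {e : Fin n × Fin n} (he : e ∈ T.net.edges) : T.child e ≠ T.root ∧
    ((e = (T.par (T.child e), T.child e)) ∨ (e = (T.child e, T.par (T.child e)))) := by
  obtain ⟨u, v⟩ := e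
  rw [mem_edges, T.net.mem_rot, adj_iff] at he
  unfold child
  rcases he.1 with ⟨h1, rfl⟩ | ⟨h1, rfl⟩
  · rw [if_neg fun h => T.par_par_ne h1 h.2]
    exact ⟨h1, Or.inr rfl⟩
  · rw [if_pos ⟨h1, rfl⟩]
    exact ⟨h1, Or.inl rfl⟩

theorem child_inj {e e' : Fin n × Fin n} (he : e ∈ T.net.edges) (he' : e' ∈ T.net.edges)
    (h : T.child e = T.child e') : e = e' := by
  have h1 := (T.mem_edges.1 (show (e.1, e.2) ∈ _ from he)).2
  have h2 := (T.mem_edges.1 (show (e'.1, e'.2) ∈ _ from he')).2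
  rcases (T.edge_cases he).2 with h3 | h3 <;> rcases (T.edge_cases he').2 with h4 | h4
  · rw [h3, h4, h]
  · rw [h3] at h1
    rw [h4] at h2
    rw [h] at h1
    exact absurd h1 (lt_asymm h2)
  · rw [h3] at h1
    rw [h4] at h2
    rw [h] at h1
    exact absurd h1 (lt_asymm h2)
  · rw [h3, h4, h]

theorem nodup_edges : T.net.edges.Nodup := by
  unfold Network.edges
  rw [List.nodup_flatMap]
  constructor
  · intro u _
    refine ((T.net.rot_nodup u).filter _).map ?_
    intro v w h
    exact (Prod.mk.inj h).2
  · refine (List.nodup_finRange n).imp ?_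
    intro u v huv e he he'
    obtain ⟨x, -, rfl⟩ := List.mem_map.1 he
    obtain ⟨y, -, h⟩ := List.mem_map.1 he'
    exact huv (Prod.mk.inj h).1.symm

theorem solution_edge {e : Fin n × Fin n} (he : e ∈ T.net.edges) :
    (T.solution e.1 e.2 = T.lineSeq (T.child e) ∨
      T.solution e.1 e.2 = (T.lineSeq (T.child e)).reverse.map List.reverse) ∧
    ∀ i, T.net.OnEdge i e.1 e.2 ↔ T.net.OnEdge i (T.par (T.child e)) (T.child e) := by
  obtain ⟨h, h1 | h1⟩ := T.edge_cases he
  · refine ⟨Or.inl ?_, ?_⟩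
    · conv_lhs => rw [h1]
      exact solution_down h
    · intro i
      conv_lhs => rw [h1]
  · refine ⟨Or.inr ?_, ?_⟩
    · conv_lhs => rw [h1]
      exact solution_up h
    · intro i
      conv_lhs => rw [h1]
      exact T.onEdge_comm _ _ _

variable {T}

theorem mem_of_mem_seq {a : Fin n} {π : List ℕ} (h : π ∈ T.seq a) :
    π.Nodup ∧ ∀ g, g ∈ π ↔ T.Strand a g := by
  obtain ⟨k, -, rfl⟩ := mem_sieve h
  exact ⟨(good a).nodup_order k, fun g => (good a).mem_order.trans mem_strands⟩

theorem lineSeq_valid {a : Fin n} (ha : a ≠ T.root) : T.lineSeq a ≠ [] ∧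
    (T.lineSeq a).IsChain BlockMove ∧
    ∀ π ∈ T.lineSeq a, π.Nodup ∧ ∀ i, i ∈ π ↔ T.net.OnEdge i (T.par a) a := by
  refine ⟨?_, ?_, ?_⟩
  · intro h
    have := head?_lineSeq (T := T) a
    simp [h] at this
  · unfold lineSeq
    rw [List.isChain_map]
    exact (good a).isChain_orders.imp fun _ _ h => h.map _
  · intro π' hπ'
    obtain ⟨π, hπ, rfl⟩ := List.mem_map.1 hπ'
    obtain ⟨h1, h2⟩ := mem_of_mem_seq hπ
    refine ⟨h1.map_on ?_, ?_⟩
    · intro g hg h hh he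
      exact Strand.inj ((h2 h).1 hh) ((h2 g).1 hg) he
    · intro i
      rw [List.mem_map, onEdge_iff_exists_strand ha]
      constructor
      · rintro ⟨g, hg, rfl⟩
        exact ⟨g, rfl, (h2 g).1 hg⟩
      · rintro ⟨g, rfl, hg⟩
        exact ⟨g, (h2 g).2 hg, rfl⟩

theorem edgeValid_solution : T.net.EdgeValid T.solution := by
  intro e he
  obtain ⟨hs, hon⟩ := T.solution_edge he
  obtain ⟨h1, h2, h3⟩ := lineSeq_valid (T.edge_cases he).1
  rcases hs with hs | hs
  · rw [hs]
    refine ⟨h1, h2, fun π hπ => ?_⟩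
    refine ⟨(h3 π hπ).1, fun i => ?_⟩
    rw [hon]
    exact (h3 π hπ).2 i
  · rw [hs]
    refine ⟨by simpa using h1, ?_, ?_⟩
    · rw [List.isChain_map, List.isChain_reverse]
      exact h2.imp fun _ _ h => h.reverse
    · intro π' hπ'
      obtain ⟨π, hπ, rfl⟩ := List.mem_map.1 hπ'
      rw [List.mem_reverse] at hπ
      refine ⟨List.nodup_reverse.2 (h3 π hπ).1, fun i => ?_⟩
      rw [hon, List.mem_reverse]
      exact (h3 π hπ).2 i

/-! ### Consistency -/

theorem not_iff_of_left {p q : Prop} (h : p) : ¬ (p ↔ q) ↔ ¬ q := by simp [h]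

theorem not_iff_of_right {p q : Prop} (h : ¬ q) : ¬ (p ↔ q) ↔ p := by simp [h]

theorem not_iff_of_not_left {p q : Prop} (h : ¬ p) : ¬ (p ↔ q) ↔ q := by simp [h]

/-- Strands with key `0` count as inserted from the beginning, so they stand in increasing order at
both ends of the edge. -/
theorem top_filter_old {v c : Fin n} (hc : c ∈ T.children v) :
    ((T.top c).filter fun g => ¬ T.Mem v (T.mate g)) =
      (T.strands c).filter fun g => ¬ T.Mem v (T.mate g) := by
  obtain ⟨h1, rfl⟩ := T.mem_children.1 hc
  refine eq_of_pairwise_lt (κ := T.place c) ((pairwise_top c).filter _) ?_ ?_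
  · refine List.Pairwise.imp_of_mem ?_ ((pairwise_strands c).filter _)
    intro g h hg hh hgh
    simp only [List.mem_filter, decide_eq_true_eq] at hg hh
    rw [place_old hg.2, place_old hh.2]
    omega
  · intro g
    rw [List.mem_filter, List.mem_filter, mem_top, mem_strands]

/-- The children own consecutive intervals, so the increasing lists of their old strands concatenate
to one increasing list. It has the same members as the strands of `v` that come from a child, and
these increase as well. -/
theorem consistent_par {v : Fin n} (hv : v ≠ T.root) :
    (Network.inOrder T.solution (T.par v) v).filter
        (fun i => ∃ x ∈ T.net.others v (T.par v), T.net.OnEdge i v x) =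
      (T.net.others v (T.par v)).flatMap fun x =>
        (Network.outOrder T.solution v x).filter fun i => T.net.OnEdge i (T.par v) v := by
  have ho : T.net.others v (T.par v) = T.children v := by unfold children; rw [if_neg hv]
  rw [ho]
  have hr : ((T.children v).flatMap fun x =>
      (Network.outOrder T.solution v x).filter fun i => T.net.OnEdge i (T.par v) v) =
      ((T.children v).flatMap fun c =>
        (T.strands c).filter fun g => ¬ T.Mem v (T.mate g)).map T.lineAt := by
    rw [List.map_flatMap]
    apply List.flatMap_congr
    intro c hc
    rw [outOrder_child hc, List.filter_map, ← top_filter_old hc]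
    refine congrArg (List.map T.lineAt) ?_
    apply List.filter_congr
    intro g hg
    rw [mem_top] at hg
    simp only [Function.comp_apply, decide_eq_decide]
    rw [onEdge_lineAt_iff hv hg.1.lt, not_iff_of_left (hg.1.of_child hc)]
  rw [hr, Network.inOrder, outOrder_par hv, List.reverse_reverse, List.filter_map]
  refine congrArg (List.map T.lineAt) ?_
  refine eq_of_pairwise_lt (κ := id) ((pairwise_strands v).filter _) ?_ ?_
  · rw [List.pairwise_flatMap]
    refine ⟨fun c _ => (pairwise_strands c).filter _, (T.pairwise_children v).imp ?_⟩
    intro c c' hcc g hg h hh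
    rw [List.mem_filter, mem_strands] at hg hh
    exact (hg.1.1.2.trans_le hcc).trans_le hh.1.1.1
  · intro g
    simp only [List.mem_filter, List.mem_flatMap, mem_strands, decide_eq_true_eq,
      Function.comp_apply]
    constructor
    · rintro ⟨hg, c, hc, hon⟩
      obtain ⟨hcr, hcv⟩ := T.mem_children.1 hc
      have hm : ¬ T.Mem c (T.mate g) := fun h => hg.2 (h.of_child hc)
      rw [← hcv, onEdge_lineAt_iff hcr hg.1.lt, not_iff_of_right hm] at hon
      exact ⟨c, hc, ⟨hon, hm⟩, hg.2⟩
    · rintro ⟨c, hc, hg, hm⟩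
      obtain ⟨hcr, hcv⟩ := T.mem_children.1 hc
      refine ⟨⟨hg.1.of_child hc, hm⟩, c, hc, ?_⟩
      rw [← hcv, onEdge_lineAt_iff hcr hg.1.lt, not_iff_of_right hg.2]
      exact hg.1

/-- The strands of `a` that continue on the edge from the parent `v` of `a` to `x`, in the order
on that edge. -/
noncomputable def continuing (T : TreeNetwork n m) (v a x : Fin n) : List ℕ :=
  if x = T.par v then ((T.strands v).filter fun g => T.Mem a g).reverse
  else ((T.top x).filter fun h => T.Mem a (T.mate h)).map T.mate

theorem continuing_map {v a x : Fin n} (hv : v ≠ T.root) (ha : a ∈ T.children v)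
    (hx : x = T.par v ∨ x ∈ T.children v ∧ x ≠ a) :
    ((Network.outOrder T.solution v x).filter fun i => T.net.OnEdge i a v) =
      (T.continuing v a x).map T.lineAt := by
  obtain ⟨har, hav⟩ := T.mem_children.1 ha
  by_cases hp : x = T.par v
  · subst hp
    unfold continuing
    rw [if_pos rfl, outOrder_par hv, ← List.map_reverse, List.filter_map, ← List.filter_reverse]
    refine congrArg (List.map T.lineAt) ?_
    apply List.filter_congr
    intro g hg
    rw [List.mem_reverse, mem_strands] at hg
    simp only [Function.comp_apply, decide_eq_decide]
    rw [T.onEdge_comm, ← hav, onEdge_lineAt_iff har hg.1.lt,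
      not_iff_of_right fun h => hg.2 (h.of_child ha)]
  · obtain ⟨hx, hxa⟩ := hx.resolve_left hp
    unfold continuing
    rw [if_neg hp, outOrder_child hx, List.filter_map, List.map_map]
    have : ∀ l : List ℕ, (∀ g ∈ l, g < T.numEnds) → l.map T.lineAt = l.map (T.lineAt ∘ T.mate) := by
      intro l hl
      apply List.map_congr_left
      intro g hg
      exact (lineAt_mate (hl g hg)).symm
    rw [← this _ fun g hg => (mem_top.1 (List.mem_of_mem_filter hg)).1.lt]
    refine congrArg (List.map T.lineAt) ?_
    apply List.filter_congr
    intro g hg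
    rw [mem_top] at hg
    simp only [Function.comp_apply, decide_eq_decide]
    rw [T.onEdge_comm, ← hav, onEdge_lineAt_iff har hg.1.lt,
      not_iff_of_not_left (hg.1.not_sibling hx ha hxa)]

theorem mem_continuing_child {v a x : Fin n} (ha : a ∈ T.children v)
    (hx : x ∈ T.children v) (hxa : x ≠ a) (hp : x ≠ T.par v) {g : ℕ} :
    g ∈ T.continuing v a x ↔ T.Mem a g ∧ T.Mem x (T.mate g) := by
  unfold continuing
  rw [if_neg hp]
  simp only [List.mem_map, List.mem_filter, mem_top, decide_eq_true_eq]
  constructor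
  · rintro ⟨h, ⟨h1, h2⟩, rfl⟩
    rw [mate_mate h1.1.lt]
    exact ⟨h2, h1.1⟩
  · rintro ⟨h1, h2⟩
    have h3 := mate_mate h1.lt
    refine ⟨T.mate g, ⟨⟨h2, ?_⟩, ?_⟩, h3⟩
    · rw [h3]; exact h1.not_sibling ha hx hxa.symm
    · rwa [h3]

theorem isNew_of_siblings {v a x : Fin n} (ha : a ∈ T.children v)
    (hx : x ∈ T.children v) (hxa : x ≠ a) {g : ℕ} (h1 : T.Mem a g) (h2 : T.Mem x (T.mate g)) :
    T.IsNew a g ∧ T.IsNew x (T.mate g) := by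
  have h3 := mate_mate h1.lt
  have hav := (T.mem_children.1 ha).2
  have hxv := (T.mem_children.1 hx).2
  refine ⟨⟨⟨h1, h2.not_sibling hx ha hxa⟩, ?_⟩, ⟨⟨h2, ?_⟩, ?_⟩⟩
  · rw [hav]; exact h2.of_child hx
  · rw [h3]; exact h1.not_sibling ha hx hxa.symm
  · rw [hxv, h3]; exact h1.of_child ha

/-- The place of a strand that comes from a later sibling, respectively from an earlier one. -/
theorem place_of_siblings {v a x : Fin n} (ha : a ∈ T.children v)
    (hx : x ∈ T.children v) {g : ℕ} (h1 : T.Mem a g) (h2 : T.Mem x (T.mate g)) :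
    (T.hi a ≤ T.lo x → T.place a g = T.bound + 1 + T.numEnds + (T.bound + (T.numEnds - T.mate g))) ∧
    (T.hi x ≤ T.lo a → T.place a g = T.bound + 1 - (T.lo x * T.numEnds + (T.numEnds - g)) ∧
      T.lo x * T.numEnds + (T.numEnds - g) ≤ T.bound) := by
  constructor
  · intro h
    have hxa : x ≠ a := by
      rintro rfl
      have := h1.1.trans_lt h1.2
      omega
    obtain ⟨n1, n2⟩ := isNew_of_siblings ha hx hxa h1 h2
    refine place_right n1 ?_
    have := h2.1
    have := h1.1.trans_lt h1.2
    omega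
  · intro h
    have hxa : x ≠ a := by
      rintro rfl
      have := h1.1.trans_lt h1.2
      omega
    obtain ⟨n1, n2⟩ := isNew_of_siblings ha hx hxa h1 h2
    have h3 := topLo_eq (T.mem_children.1 hx).1 n2
    have h4 := key_left_le (T := T) (g := T.mate g) (h := g)
    have h5 := place_left n1 (h2.2.trans_le h)
    rw [h3] at h4 h5
    exact ⟨h5, h4⟩

/-- The keys on the two edges match: both siblings sort their common lines by the ends below the
later one of them, the earlier sibling through the mates and the later one through its own strands.
The orders are opposite, as one is read towards `v` and the other away from it. -/
theorem pairwise_continuing {v a x : Fin n} (ha : a ∈ T.children v)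
    (hx : x = T.par v ∨ x ∈ T.children v ∧ (T.hi a ≤ T.lo x ∨ T.hi x ≤ T.lo a)) :
    (T.continuing v a x).Pairwise fun g h => T.place a h < T.place a g := by
  have hav := (T.mem_children.1 ha).2
  by_cases hp : x = T.par v
  · unfold continuing
    rw [if_pos hp, List.pairwise_reverse]
    refine List.Pairwise.imp_of_mem ?_ ((pairwise_strands v).filter _)
    intro g h hg hh hgh
    rw [List.mem_filter, mem_strands] at hg hh
    rw [place_old (by rw [hav]; exact hg.1.2), place_old (by rw [hav]; exact hh.1.2)]
    omega
  · obtain ⟨hx, hs⟩ := hx.resolve_left hp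
    unfold continuing
    rw [if_neg hp, List.pairwise_map]
    refine List.Pairwise.imp_of_mem ?_ ((pairwise_top x).filter _)
    intro g h hg hh hgh
    rw [List.mem_filter, mem_top, decide_eq_true_eq] at hg hh
    have g3 := mate_mate hg.1.1.lt
    have h3 := mate_mate hh.1.1.lt
    have lg := hg.1.1.lt
    have lh := hh.1.1.lt
    have lg' := hg.2.lt
    have lh' := hh.2.lt
    have pg := place_of_siblings ha hx hg.2 (by rw [g3]; exact hg.1.1)
    have ph := place_of_siblings ha hx hh.2 (by rw [h3]; exact hh.1.1)
    have pg' := place_of_siblings hx ha hg.1.1 hg.2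
    have ph' := place_of_siblings hx ha hh.1.1 hh.2
    rw [g3] at pg
    rw [h3] at ph
    rcases hs with hs | hs
    · have e1 := pg.1 hs
      have e2 := ph.1 hs
      have e3 := pg'.2 hs
      have e4 := ph'.2 hs
      omega
    · have e1 := pg.2 hs
      have e2 := ph.2 hs
      have e3 := pg'.1 hs
      have e4 := ph'.1 hs
      omega

theorem mem_others_child {v a x : Fin n} (hv : v ≠ T.root) (ha : a ∈ T.children v) :
    x ∈ T.net.others v a ↔ x = T.par v ∨ x ∈ T.children v ∧ x ≠ a := by
  obtain ⟨har, hav⟩ := T.mem_children.1 ha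
  have hva : a ∈ T.net.rot v := (T.net.mem_rot _ _).2 (T.adj_iff.2 (Or.inr ⟨har, hav⟩))
  rw [T.mem_others hva, T.adj_iff, T.mem_children]
  constructor
  · rintro ⟨⟨-, h⟩ | h, h'⟩
    · exact Or.inl h.symm
    · exact Or.inr ⟨h, h'⟩
  · rintro (rfl | h)
    · refine ⟨Or.inl ⟨hv, rfl⟩, ?_⟩
      intro h
      rw [← h] at hav
      exact T.par_par_ne hv hav
    · exact ⟨Or.inr h.1, h.2⟩

theorem eq_of_pairwise_gt {κ : ℕ → ℕ} {l l' : List ℕ}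
    (h : l.Pairwise fun x y => κ y < κ x) (h' : l'.Pairwise fun x y => κ y < κ x)
    (hm : ∀ x, x ∈ l ↔ x ∈ l') : l = l' := by
  apply List.reverse_injective
  exact eq_of_pairwise_lt (List.pairwise_reverse.2 h) (List.pairwise_reverse.2 h')
    (by simpa using hm)

/-- Seen from `a` there follow the later siblings, the parent and the earlier siblings
(`exists_children_split`). The strands of these groups lie in descending ranges of `place a`. So
both lists are sorted by the same function, and they have the same members. -/
theorem top_reverse {v a : Fin n} (hv : v ≠ T.root) (ha : a ∈ T.children v) :
    (T.top a).reverse = (T.net.others v a).flatMap (T.continuing v a) := by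
  obtain ⟨har, hav⟩ := T.mem_children.1 ha
  obtain ⟨L, R, hc, ho⟩ := T.exists_children_split hv ha
  have hpc : ∀ x ∈ T.children v, x ≠ T.par v := by
    rintro x hx rfl
    have := (T.mem_children.1 hx).2
    exact T.par_par_ne hv this
  have hmem : ∀ x, x ∈ T.net.others v a ↔ x = T.par v ∨ x ∈ T.children v ∧ x ≠ a :=
    fun x => mem_others_child hv ha
  have hpw := T.pairwise_children v
  rw [hc, List.pairwise_append, List.pairwise_cons] at hpw
  obtain ⟨hpL, ⟨hpa, hpR⟩, hpLR⟩ := hpw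
  have hRc : ∀ x ∈ R, x ∈ T.children v ∧ T.hi a ≤ T.lo x := fun x hx =>
    ⟨by rw [hc]; simp [hx], hpa x hx⟩
  have hLc : ∀ x ∈ L, x ∈ T.children v ∧ T.hi x ≤ T.lo a := fun x hx =>
    ⟨by rw [hc]; simp [hx], hpLR x hx a (by simp)⟩
  have hsib : ∀ x ∈ T.children v, x ≠ a → T.hi a ≤ T.lo x ∨ T.hi x ≤ T.lo a := by
    intro x hx hxa
    rw [hc, List.mem_append, List.mem_cons] at hx
    rcases hx with h | h | h
    · exact Or.inr (hLc x h).2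
    · exact absurd h hxa
    · exact Or.inl (hRc x h).2
  have hpar : ∀ g ∈ T.continuing v a (T.par v), T.place a g = T.bound + 1 + g ∧ g < T.numEnds := by
    intro g hg
    unfold continuing at hg
    rw [if_pos rfl, List.mem_reverse, List.mem_filter, mem_strands] at hg
    exact ⟨place_old (by rw [hav]; exact hg.1.2), hg.1.1.lt⟩
  have hchild : ∀ x ∈ T.children v, x ≠ a → ∀ g ∈ T.continuing v a x,
      T.Mem a g ∧ T.Mem x (T.mate g) := fun x hx hxa g hg =>
    (mem_continuing_child ha hx hxa (hpc x hx)).1 hg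
  have hne : ∀ x ∈ T.net.others v a, x ≠ a := by
    rintro x hx rfl
    rcases (hmem x).1 hx with h | h
    · exact hpc x ha h
    · exact h.2 rfl
  refine eq_of_pairwise_gt (κ := T.place a) ?_ ?_ ?_
  · rw [List.pairwise_reverse]
    exact pairwise_top a
  · rw [List.pairwise_flatMap]
    constructor
    · intro x hx
      refine pairwise_continuing ha ?_
      rcases (hmem x).1 hx with h | h
      · exact Or.inl h
      · exact Or.inr ⟨h.1, hsib x h.1 h.2⟩
    · have hneR : ∀ x ∈ R, x ≠ a := fun x hx => hne x (by rw [ho]; simp [hx])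
      have hneL : ∀ x ∈ L, x ≠ a := fun x hx => hne x (by rw [ho]; simp [hx])
      have pR : ∀ x ∈ R, ∀ g ∈ T.continuing v a x, T.Mem x (T.mate g) ∧
          T.place a g = T.bound + 1 + T.numEnds + (T.bound + (T.numEnds - T.mate g)) := by
        intro x hx g hg
        obtain ⟨h1, h2⟩ := hchild x (hRc x hx).1 (hneR x hx) g hg
        exact ⟨h2, (place_of_siblings ha (hRc x hx).1 h1 h2).1 (hRc x hx).2⟩
      have pL : ∀ x ∈ L, ∀ g ∈ T.continuing v a x, g < T.numEnds ∧ T.Mem x (T.mate g) ∧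
          T.place a g = T.bound + 1 - (T.lo x * T.numEnds + (T.numEnds - g)) ∧
          T.lo x * T.numEnds + (T.numEnds - g) ≤ T.bound := by
        intro x hx g hg
        obtain ⟨h1, h2⟩ := hchild x (hLc x hx).1 (hneL x hx) g hg
        exact ⟨h1.lt, h2, (place_of_siblings ha (hLc x hx).1 h1 h2).2 (hLc x hx).2⟩
      rw [ho, List.pairwise_append, List.pairwise_cons]
      refine ⟨List.Pairwise.imp_of_mem ?_ hpR, ⟨?_, List.Pairwise.imp_of_mem ?_ hpL⟩, ?_⟩
      · intro x y hx hy hxy g hg h hh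
        obtain ⟨a1, a2⟩ := pR x hx g hg
        obtain ⟨b1, b2⟩ := pR y hy h hh
        have := a1.2
        have := b1.1
        have := b1.lt
        rw [a2, b2]
        omega
      · intro y hy g hg h hh
        obtain ⟨a1, a2⟩ := hpar g hg
        obtain ⟨b1, b2, b3, b4⟩ := pL y hy h hh
        rw [a1, b3]
        omega
      · intro x y hx hy hxy g hg h hh
        obtain ⟨a1, a2, a3, a4⟩ := pL x hx g hg
        obtain ⟨b1, b2, b3, b4⟩ := pL y hy h hh
        have := a2.1.trans_lt a2.2
        have := mul_add_lt (a := T.lo x) (b := T.lo y) (M := T.numEnds) (r := T.numEnds - g)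
          (s := T.numEnds - h) (by omega) (by omega) (by omega)
        rw [a3, b3]
        omega
      · intro x hx y hy g hg h hh
        obtain ⟨a1, a2⟩ := pR x hx g hg
        rw [a2]
        rcases List.mem_cons.1 hy with rfl | hy
        · have := hpar h hh
          omega
        · have := pL y hy h hh
          omega
  · intro g
    rw [List.mem_reverse, mem_top, List.mem_flatMap]
    constructor
    · intro hg
      by_cases hm : T.Mem v (T.mate g)
      · obtain ⟨c, hcv, hcm⟩ := hm.exists_child hv ha
        have hca : c ≠ a := by rintro rfl; exact hg.2 hcm
        exact ⟨c, (hmem c).2 (Or.inr ⟨hcv, hca⟩),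
          (mem_continuing_child ha hcv hca (hpc c hcv)).2 ⟨hg.1, hcm⟩⟩
      · refine ⟨T.par v, (hmem _).2 (Or.inl rfl), ?_⟩
        unfold continuing
        rw [if_pos rfl, List.mem_reverse, List.mem_filter, mem_strands]
        exact ⟨⟨hg.1.of_child ha, hm⟩, by simpa using hg.1⟩
    · rintro ⟨x, hx, hg⟩
      rcases (hmem x).1 hx with rfl | ⟨h1, h2⟩
      · unfold continuing at hg
        rw [if_pos rfl, List.mem_reverse, List.mem_filter, mem_strands, decide_eq_true_eq] at hg
        exact ⟨hg.2, fun h => hg.1.2 (h.of_child ha)⟩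
      · obtain ⟨h3, h4⟩ := hchild x h1 h2 g hg
        exact ⟨h3, h4.not_sibling h1 ha h2⟩

/-- No line ends in `v`, so all lines of the edge continue, the filter on the left removes nothing,
and `top_reverse` is the claim. -/
theorem consistent_child {v a : Fin n} (hv : v ≠ T.root) (ha : a ∈ T.children v) :
    (Network.inOrder T.solution a v).filter
        (fun i => ∃ x ∈ T.net.others v a, T.net.OnEdge i v x) =
      (T.net.others v a).flatMap fun x =>
        (Network.outOrder T.solution v x).filter fun i => T.net.OnEdge i a v := by
  obtain ⟨har, hav⟩ := T.mem_children.1 ha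
  have hmem : ∀ x, x ∈ T.net.others v a ↔ x = T.par v ∨ x ∈ T.children v ∧ x ≠ a :=
    fun x => mem_others_child hv ha
  have hr : ((T.net.others v a).flatMap fun x =>
      (Network.outOrder T.solution v x).filter fun i => T.net.OnEdge i a v) =
      ((T.net.others v a).flatMap (T.continuing v a)).map T.lineAt := by
    rw [List.map_flatMap]
    apply List.flatMap_congr
    intro x hx
    exact continuing_map hv ha ((hmem x).1 hx)
  rw [hr, ← top_reverse hv ha, Network.inOrder, outOrder_child ha, ← List.map_reverse,
    List.filter_eq_self]
  intro i hi
  obtain ⟨g, hg, rfl⟩ := List.mem_map.1 hi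
  rw [List.mem_reverse, mem_top] at hg
  rw [decide_eq_true_eq]
  by_cases hm : T.Mem v (T.mate g)
  · obtain ⟨c, hcv, hcm⟩ := hm.exists_child hv ha
    have hca : c ≠ a := by rintro rfl; exact hg.2 hcm
    refine ⟨c, (hmem c).2 (Or.inr ⟨hcv, hca⟩), ?_⟩
    obtain ⟨h1, h2⟩ := T.mem_children.1 hcv
    rw [← h2, onEdge_lineAt_iff h1 hg.1.lt, not_iff_of_not_left (hg.1.not_sibling ha hcv hca.symm)]
    exact hcm
  · refine ⟨T.par v, (hmem _).2 (Or.inl rfl), ?_⟩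
    rw [T.onEdge_comm, onEdge_lineAt_iff hv hg.1.lt, not_iff_of_left (hg.1.of_child ha)]
    exact hm

theorem consistent_solution : T.net.Consistent T.solution := by
  intro v w hw
  by_cases hv : v = T.root
  -- The root has degree one, so no line continues there and both sides are empty.
  · obtain ⟨x, hx⟩ := T.exists_rot_of_isTerminal T.isTerminal_root
    have : T.net.others v w = [] := by
      rw [List.eq_nil_iff_forall_not_mem]
      intro y hy
      rw [T.mem_others hw, ← T.net.mem_rot] at hy
      rw [hv, hx, List.mem_singleton] at hy hw
      exact hy.2 (hy.1.trans hw.symm)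
    rw [this]
    simp
  · have hadj := (T.net.mem_rot _ _).1 hw
    rcases T.adj_iff.1 hadj with ⟨-, rfl⟩ | h
    · exact consistent_par hv
    · exact consistent_child hv (T.mem_children.2 h)

theorem feasible_solution : T.net.Feasible T.solution := ⟨edgeValid_solution, consistent_solution⟩

end TreeNetwork
end BlockCrossing

namespace BlockCrossing
namespace TreeNetwork

open Sorting

variable {n m : ℕ} {T : TreeNetwork n m}

/-! ### Monotonicity -/

/-- The strands `g < h` stand in the wrong order close to the parent of `a`. -/
def Inverted (T : TreeNetwork n m) (a : Fin n) (g h : ℕ) : Prop :=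
  T.Strand a g ∧ T.Strand a h ∧ g < h ∧ T.place a h < T.place a g

theorem mem_of_anc {a b : Fin n} {g : ℕ} (h : T.Anc a b) (hb : T.Mem b g) : T.Mem a g := by
  have hg := hb.lt
  rw [mem_iff hg] at hb ⊢
  exact h.trans hb

theorem anc_or_anc {a b : Fin n} {g : ℕ} (ha : T.Mem a g) (hb : T.Mem b g) :
    T.Anc a b ∨ T.Anc b a := by
  have hg := ha.lt
  rw [mem_iff hg] at ha hb
  exact ha.comparable hb

theorem Anc.antisymm {a b : Fin n} (h : T.Anc a b) (h' : T.Anc b a) : a = b :=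
  h'.eq_of_depth_le h.depth_le

/-- A line that is new on two edges turns from one to the other. -/
theorem IsNew.siblings {a b : Fin n} {x y : ℕ} (hx : T.IsNew a x) (hy : T.IsNew b y)
    (hxy : y = x ∨ y = T.mate x) (hab : a ≠ b) : y = T.mate x ∧ T.par a = T.par b := by
  rcases hxy with rfl | rfl
  · exact absurd (hx.unique hy) hab
  refine ⟨rfl, ?_⟩
  have hm := mate_mate hx.1.1.lt
  obtain ⟨⟨h1, h2⟩, h3⟩ := hx
  obtain ⟨⟨h4, h5⟩, h6⟩ := hy
  rw [hm] at h5 h6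
  have e1 : T.Anc (T.par a) (T.par b) := by
    rcases anc_or_anc h3 h4 with h | h
    · exact h.par_of_ne fun h' => h5 (h' ▸ h1.par)
    · exact absurd (mem_of_anc h h1.par) h5
  have e2 : T.Anc (T.par b) (T.par a) := by
    rcases anc_or_anc h6 h1 with h | h
    · exact h.par_of_ne fun h' => h2 (h' ▸ h4.par)
    · exact absurd (mem_of_anc h h4.par) h2
  exact e1.antisymm e2

/-- Two lines with different topmost vertices: on a common edge, only one of them is new, and it
is the same one on all common edges. -/
theorem new_old_false {a b : Fin n} {x y x' y' : ℕ} (hx : T.IsNew a x) (hy : T.Strand a y)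
    (hyn : ¬ T.IsNew a y) (hy' : T.IsNew b y') (hx' : T.Strand b x') (hxn : ¬ T.IsNew b x')
    (hxx : x' = x ∨ x' = T.mate x) (hyy : y' = y ∨ y' = T.mate y) : False := by
  have hm : ¬ T.Mem (T.par a) (T.mate y) := fun h => hyn ⟨hy, h⟩
  -- The subtree of `par b` contains both ends of the second line, one of which is outside the
  -- subtree of `a`; so `par b` lies strictly above `a`. Then it also contains both ends of the
  -- first line, which is thus new on the edge above `b`.
  have hp : T.Anc (T.par b) (T.par a) := by
    have hpb : T.Mem (T.par b) y ∧ T.Mem (T.par b) (T.mate y) := by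
      rcases hyy with rfl | rfl
      · exact ⟨hy'.1.1.par, hy'.2⟩
      · have := hy'.2
        rw [mate_mate hy.1.lt] at this
        exact ⟨this, hy'.1.1.par⟩
    rcases anc_or_anc hy.1 hpb.1 with h | h
    · exact absurd (mem_of_anc h hpb.2) hy.2
    · exact h.par_of_ne fun h' => hy.2 (h' ▸ hpb.2)
  refine hxn ⟨hx', ?_⟩
  rcases hxx with rfl | rfl
  · exact mem_of_anc hp hx.2
  · rw [mate_mate hx.1.1.lt]
    exact mem_of_anc hp hx.1.1.par

/-- The place on the left is `bound + 1` minus a key that decreases with the strand, for a fixed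
earlier sibling. So strands from this sibling wait in increasing order. -/
theorem not_inverted_of_earlier {v a b : Fin n} (ha : a ∈ T.children v) (hb : b ∈ T.children v)
    (hab : T.hi a ≤ T.lo b) {g h : ℕ} (hg : T.Mem a (T.mate g)) (hh : T.Mem a (T.mate h)) :
    ¬ T.Inverted b g h := by
  rintro ⟨h1, h2, h3, h4⟩
  have e1 := (place_of_siblings hb ha h1.1 hg).2 hab
  have e2 := (place_of_siblings hb ha h2.1 hh).2 hab
  have := h1.1.lt
  have := h2.1.lt
  omega

theorem Inverted.exists_new {a : Fin n} {g h : ℕ} (hi : T.Inverted a g h) :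
    T.IsNew a g ∨ T.IsNew a h := by
  by_contra hn
  rw [not_or] at hn
  obtain ⟨h1, h2, h3, h4⟩ := hi
  rw [place_old fun h' => hn.1 ⟨h1, h'⟩, place_old fun h' => hn.2 ⟨h2, h'⟩] at h4
  omega

theorem children_hi_le_lo {v a b : Fin n} (ha : a ∈ T.children v) (hb : b ∈ T.children v)
    (hab : a ≠ b) : T.hi a ≤ T.lo b ∨ T.hi b ≤ T.lo a := by
  have h := T.pairwise_children v
  obtain ⟨L, R, hc⟩ := List.append_of_mem ha
  rw [hc, List.pairwise_append, List.pairwise_cons] at h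
  rw [hc, List.mem_append, List.mem_cons] at hb
  rcases hb with hb | hb | hb
  · exact Or.inr (h.2.2 b hb a (by simp))
  · exact absurd hb.symm hab
  · exact Or.inl (h.2.1.1 b hb)

/-- Two lines that both turn from `a` to its sibling `b` are in the wrong order in at most one of
these places. -/
theorem siblings_false {a b : Fin n} {x y g h g' h' : ℕ} (ha : a ≠ T.root) (hb : b ≠ T.root)
    (hab : a ≠ b) (hp : T.par a = T.par b) (hi : T.Inverted a g h) (hi' : T.Inverted b g' h')
    (hx : T.Mem b (T.mate x)) (hy : T.Mem b (T.mate y))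
    (hgh : (g = x ∧ h = y) ∨ (g = y ∧ h = x))
    (hgh' : (g' = T.mate x ∧ h' = T.mate y) ∨ (g' = T.mate y ∧ h' = T.mate x)) : False := by
  have hac := (T.mem_children (v := T.par a)).2 ⟨ha, rfl⟩
  have hbc := (T.mem_children (v := T.par a)).2 ⟨hb, hp.symm⟩
  have hgb : T.Mem b (T.mate g) ∧ T.Mem b (T.mate h) := by
    rcases hgh with ⟨rfl, rfl⟩ | ⟨rfl, rfl⟩
    · exact ⟨hx, hy⟩
    · exact ⟨hy, hx⟩
  have hga : T.Mem a (T.mate g') ∧ T.Mem a (T.mate h') := by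
    have lg := hi.1.1.lt
    have lh := hi.2.1.1.lt
    have mg := hi.1.1
    have mh := hi.2.1.1
    rcases hgh with ⟨rfl, rfl⟩ | ⟨rfl, rfl⟩ <;> rcases hgh' with ⟨rfl, rfl⟩ | ⟨rfl, rfl⟩ <;>
      simp only [mate_mate lg, mate_mate lh] <;> tauto
  rcases children_hi_le_lo hac hbc hab with hs | hs
  · exact not_inverted_of_earlier hac hbc hs hga.1 hga.2 hi'
  · exact not_inverted_of_earlier hbc hac hs hgb.1 hgb.2 hi

/-- A pair of lines is in the wrong order on at most one edge. -/
theorem inverted_unique {a b : Fin n} {g h g' h' : ℕ} (ha : a ≠ T.root) (hb : b ≠ T.root)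
    (hi : T.Inverted a g h) (hi' : T.Inverted b g' h')
    (hl : (T.lineAt g' = T.lineAt g ∧ T.lineAt h' = T.lineAt h) ∨
      (T.lineAt g' = T.lineAt h ∧ T.lineAt h' = T.lineAt g)) : a = b := by
  by_contra hab
  have lg := hi.1.1.lt
  have lh := hi.2.1.1.lt
  -- a line that is new on both edges
  have both : ∀ x y x' y', T.IsNew a x → T.IsNew b x' → T.Strand a y → T.Strand b y' →
      (x' = x ∨ x' = T.mate x) → (y' = y ∨ y' = T.mate y) →
      ((g = x ∧ h = y) ∨ (g = y ∧ h = x)) → ((g' = x' ∧ h' = y') ∨ (g' = y' ∧ h' = x')) →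
      False := by
    intro x y x' y' hx hx' hy hy' hxx hyy hgh hgh'
    obtain ⟨rfl, hp⟩ := hx.siblings hx' hxx hab
    have hac := (T.mem_children (v := T.par a)).2 ⟨ha, rfl⟩
    have hbc := (T.mem_children (v := T.par a)).2 ⟨hb, hp.symm⟩
    have hyy' : y' = T.mate y := by
      refine hyy.resolve_left ?_
      rintro rfl
      exact hy.1.not_sibling hac hbc hab hy'.1
    subst hyy'
    exact siblings_false ha hb hab hp hi hi' hx'.1.1 hy'.1 hgh hgh'
  -- If one of the lines is new on both edges, it turns from one edge to the other, and the second
  -- line does so too. Otherwise one line is new on one edge only and the second on the other only,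
  -- which `new_old_false` excludes.
  have main : ∀ x y x' y', T.IsNew a x → T.Strand a y → T.Strand b x' → T.Strand b y' →
      (T.IsNew b x' ∨ T.IsNew b y') →
      (x' = x ∨ x' = T.mate x) → (y' = y ∨ y' = T.mate y) →
      ((g = x ∧ h = y) ∨ (g = y ∧ h = x)) → ((g' = x' ∧ h' = y') ∨ (g' = y' ∧ h' = x')) →
      False := by
    intro x y x' y' hx hy hx' hy' hn hxx hyy hgh hgh'
    by_cases h1 : T.IsNew b x'
    · exact both x y x' y' hx h1 hy hy' hxx hyy hgh hgh'
    have h2 := hn.resolve_left h1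
    by_cases h3 : T.IsNew a y
    · exact both y x y' x' h3 h2 hx.1 hx' hyy hxx hgh.symm hgh'.symm
    · exact new_old_false hx hy h3 h2 hx' h1 hxx hyy
  have hn' := hi'.exists_new
  rcases hl with ⟨l1, l2⟩ | ⟨l1, l2⟩
  · have e1 := eq_or_eq_mate lg hi'.1.1.lt l1
    have e2 := eq_or_eq_mate lh hi'.2.1.1.lt l2
    rcases hi.exists_new with hn | hn
    · exact main g h g' h' hn hi.2.1 hi'.1 hi'.2.1 hn' e1 e2 (Or.inl ⟨rfl, rfl⟩) (Or.inl ⟨rfl, rfl⟩)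
    · exact main h g h' g' hn hi.1 hi'.2.1 hi'.1 hn'.symm e2 e1 (Or.inr ⟨rfl, rfl⟩)
        (Or.inr ⟨rfl, rfl⟩)
  · have e1 := eq_or_eq_mate lh hi'.1.1.lt l1
    have e2 := eq_or_eq_mate lg hi'.2.1.1.lt l2
    rcases hi.exists_new with hn | hn
    · exact main g h h' g' hn hi.2.1 hi'.2.1 hi'.1 hn'.symm e2 e1 (Or.inl ⟨rfl, rfl⟩)
        (Or.inr ⟨rfl, rfl⟩)
    · exact main h g g' h' hn hi.1 hi'.1 hi'.2.1 hn' e1 e2 (Or.inr ⟨rfl, rfl⟩)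
        (Or.inl ⟨rfl, rfl⟩)

theorem idxOf_lineAt {a : Fin n} {π : List ℕ} (hπ : ∀ g, g ∈ π ↔ T.Strand a g) {g : ℕ}
    (hg : T.Strand a g) : (π.map T.lineAt).idxOf (T.lineAt g) = π.idxOf g :=
  idxOf_map_of_injOn fun _ hy h => Strand.inj hg ((hπ _).1 hy) h

/-- The comparisons yield `!v, …, !v, v, …, v`. Reversing this sequence and negating its members
gives a sequence of the same shape, so both directions of reading an edge can be treated together.
-/
theorem crossCount_sieve {α : Type*} [DecidableEq α] {f : ℕ → List α} {c : ℕ → Bool} {q : ℕ}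
    {i j : α} {v : Bool}
    (hpw : ∀ k k', k < k' → k' ≤ q → decide ((f k).idxOf i < (f k).idxOf j) = v →
      decide ((f k').idxOf i < (f k').idxOf j) = v)
    (hrev : ∀ k ≤ q, decide ((f k).reverse.idxOf i < (f k).reverse.idxOf j) =
      !decide ((f k).idxOf i < (f k).idxOf j)) {s : List (List α)}
    (hs : s = sieve f c q ∨ s = (sieve f c q).reverse.map List.reverse) :
    crossCount s i j ≤ 1 ∧
      (decide ((f 0).idxOf i < (f 0).idxOf j) = v → crossCount s i j = 0) := by
  have hconst : decide ((f 0).idxOf i < (f 0).idxOf j) = v →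
      ∀ k ≤ q, decide ((f k).idxOf i < (f k).idxOf j) = v := by
    intro h k hk
    rcases Nat.eq_zero_or_pos k with rfl | h0
    · exact h
    · exact hpw 0 k h0 hk h
  have hpw' : (sieve f c q).Pairwise fun π π' => decide (π.idxOf i < π.idxOf j) = v →
      decide (π'.idxOf i < π'.idxOf j) = v := pairwise_sieve _ _ _ hpw
  rcases hs with rfl | rfl
  · refine ⟨crossCount_le_one (v := v) hpw', fun h => ?_⟩
    apply crossCount_eq_zero (v := v)
    intro π hπ
    obtain ⟨k, hk, rfl⟩ := mem_sieve hπ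
    exact hconst h k hk
  · constructor
    · apply crossCount_le_one (v := v)
      rw [List.pairwise_map, List.pairwise_reverse]
      refine List.Pairwise.imp_of_mem ?_ hpw'
      intro π π' hπ hπ' h1
      obtain ⟨k, hk, rfl⟩ := mem_sieve hπ
      obtain ⟨k', hk', rfl⟩ := mem_sieve hπ'
      rw [hrev k hk, hrev k' hk']
      cases h2 : decide ((f k).idxOf i < (f k).idxOf j) <;>
        cases h3 : decide ((f k').idxOf i < (f k').idxOf j) <;> cases v <;> simp_all
    · intro h
      apply crossCount_eq_zero (v := !v)
      intro π' hπ'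
      obtain ⟨π, hπ, rfl⟩ := List.mem_map.1 hπ'
      obtain ⟨k, hk, rfl⟩ := mem_sieve (List.mem_reverse.1 hπ)
      rw [hrev k hk, hconst h k hk]

theorem lineSeq_eq_sieve (a : Fin n) : T.lineSeq a =
    sieve (fun k => (order (T.strands a) (T.key a) T.bound k).map T.lineAt)
      (fun k => moved (T.strands a) (T.key a) T.bound (atRank (T.strands a) (T.key a) k))
      (numNew (T.strands a) (T.key a)) := by
  unfold lineSeq seq orders sieve
  rw [List.map_map]
  rfl

theorem lineAt_idxOf_lt_iff {a : Fin n} {x y : ℕ} (hx : T.Strand a x) (hy : T.Strand a y) (k : ℕ) :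
    ((order (T.strands a) (T.key a) T.bound k).map T.lineAt).idxOf (T.lineAt x) <
      ((order (T.strands a) (T.key a) T.bound k).map T.lineAt).idxOf (T.lineAt y) ↔
    Sorting.place (T.strands a) (T.key a) T.bound T.numEnds k x <
      Sorting.place (T.strands a) (T.key a) T.bound T.numEnds k y := by
  have hmem : ∀ x, x ∈ order (T.strands a) (T.key a) T.bound k ↔ T.Strand a x :=
    fun x => (good a).mem_order.trans mem_strands
  rw [idxOf_lineAt hmem hx, idxOf_lineAt hmem hy]
  exact idxOf_lt_iff ((good a).pairwise_order k) ((hmem x).2 hx) ((hmem y).2 hy)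

theorem place_ne {a : Fin n} {x y : ℕ} (hx : T.Strand a x) (hy : T.Strand a y) (hxy : x ≠ y) (k : ℕ) :
    Sorting.place (T.strands a) (T.key a) T.bound T.numEnds k x ≠
      Sorting.place (T.strands a) (T.key a) T.bound T.numEnds k y := by
  have hmem : ∀ x, x ∈ order (T.strands a) (T.key a) T.bound k ↔ T.Strand a x :=
    fun x => (good a).mem_order.trans mem_strands
  intro he
  have e1 := idxOf_lt_iff ((good a).pairwise_order (P := T.bound) k) ((hmem x).2 hx) ((hmem y).2 hy)
  have e2 := idxOf_lt_iff ((good a).pairwise_order (P := T.bound) k) ((hmem y).2 hy) ((hmem x).2 hx)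
  rw [he] at e1 e2
  refine hxy ((List.idxOf_inj ((hmem x).2 hx)).1 (le_antisymm ?_ ?_))
  · exact not_lt.1 fun h => lt_irrefl _ (e2.1 h)
  · exact not_lt.1 fun h => lt_irrefl _ (e1.1 h)

/-- Two lines on an edge cross at most once there, and only if they are in the wrong order close
to the parent. -/
theorem crossCount_lineSeq {a : Fin n} {g h : ℕ} (hg : T.Strand a g) (hh : T.Strand a h)
    (hgh : g < h) (i j : Fin m) (hij : (i = T.lineAt g ∧ j = T.lineAt h) ∨
      (i = T.lineAt h ∧ j = T.lineAt g)) {s : List (List (Fin m))}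
    (hs : s = T.lineSeq a ∨ s = (T.lineSeq a).reverse.map List.reverse) :
    crossCount s i j ≤ 1 ∧ (¬ T.Inverted a g h → crossCount s i j = 0) := by
  have hne : T.lineAt g ≠ T.lineAt h := fun h' => hgh.ne (Strand.inj hh hg h')
  obtain ⟨v, hv⟩ : ∃ v : Bool, ∀ k,
      (decide (((order (T.strands a) (T.key a) T.bound k).map T.lineAt).idxOf i <
        ((order (T.strands a) (T.key a) T.bound k).map T.lineAt).idxOf j) = v ↔
      Sorting.place (T.strands a) (T.key a) T.bound T.numEnds k g <
        Sorting.place (T.strands a) (T.key a) T.bound T.numEnds k h) := by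
    rcases hij with ⟨rfl, rfl⟩ | ⟨rfl, rfl⟩
    · exact ⟨true, fun k => by rw [decide_eq_true_eq, lineAt_idxOf_lt_iff hg hh]⟩
    · refine ⟨false, fun k => ?_⟩
      rw [decide_eq_false_iff_not, lineAt_idxOf_lt_iff hh hg, not_lt]
      exact ⟨fun h' => lt_of_le_of_ne h' (place_ne hg hh hgh.ne k), le_of_lt⟩
  rw [lineSeq_eq_sieve] at hs
  have key := crossCount_sieve (i := i) (j := j) (v := v) (s := s) ?_ ?_ hs
  · refine ⟨key.1, fun hni => key.2 ((hv 0).2 ?_)⟩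
    rcases lt_or_gt_of_ne (place_ne hg hh hgh.ne 0) with h1 | h1
    · exact h1
    · exact absurd ⟨hg, hh, hgh, h1⟩ hni
  · intro k k' hk _ h1
    rw [hv] at h1 ⊢
    exact (good a).place_lt_of_le (mem_strands.2 hg) (mem_strands.2 hh) hgh hk.le h1
  · intro k _
    have hmem : ∀ x, x ∈ order (T.strands a) (T.key a) T.bound k ↔ T.Strand a x :=
      fun x => (good a).mem_order.trans mem_strands
    have hnd : ((order (T.strands a) (T.key a) T.bound k).map T.lineAt).Nodup := by
      refine ((good a).nodup_order k).map_on ?_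
      intro x hx y hy he
      exact Strand.inj ((hmem y).1 hy) ((hmem x).1 hx) he
    have m1 := List.mem_map_of_mem (f := T.lineAt) ((hmem g).2 hg)
    have m2 := List.mem_map_of_mem (f := T.lineAt) ((hmem h).2 hh)
    obtain ⟨hi, hj, hij'⟩ : i ∈ (order (T.strands a) (T.key a) T.bound k).map T.lineAt ∧
        j ∈ (order (T.strands a) (T.key a) T.bound k).map T.lineAt ∧ i ≠ j := by
      rcases hij with ⟨rfl, rfl⟩ | ⟨rfl, rfl⟩
      · exact ⟨m1, m2, hne⟩
      · exact ⟨m2, m1, hne.symm⟩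
    rw [← decide_not, decide_eq_decide, idxOf_reverse_lt_iff hnd hi hj, not_lt]
    exact ⟨le_of_lt, fun h' => lt_of_le_of_ne h' fun h'' => hij' ((List.idxOf_inj hj).1 h'').symm⟩

theorem sum_le_one {α : Type*} {l : List α} (hn : l.Nodup) {f : α → ℕ} (h1 : ∀ x ∈ l, f x ≤ 1)
    (h2 : ∀ x ∈ l, ∀ y ∈ l, f x ≠ 0 → f y ≠ 0 → x = y) : (l.map f).sum ≤ 1 := by
  induction l with
  | nil => simp
  | cons a l ih =>
    rw [List.nodup_cons] at hn
    rw [List.map_cons, List.sum_cons]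
    by_cases ha : f a = 0
    · rw [ha, zero_add]
      exact ih hn.2 (fun x hx => h1 x (by simp [hx])) fun x hx y hy =>
        h2 x (by simp [hx]) y (by simp [hy])
    · have : (l.map f).sum = 0 := by
        rw [List.sum_eq_zero_iff]
        intro z hz
        obtain ⟨x, hx, rfl⟩ := List.mem_map.1 hz
        by_contra hfx
        have := h2 a (by simp) x (by simp [hx]) ha hfx
        exact hn.1 (this ▸ hx)
      rw [this]
      exact h1 a (by simp)

/-- For a line that is not on the edge, `idxOf` is the length of the order, so a pair that is not
entirely on the edge has a constant comparison and counts as no crossing. -/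
theorem crossCount_edge {e : Fin n × Fin n} (he : e ∈ T.net.edges) {i j : Fin m} (hij : i ≠ j) :
    crossCount (T.solution e.1 e.2) i j ≤ 1 ∧
    (crossCount (T.solution e.1 e.2) i j ≠ 0 → ∃ g h, T.Inverted (T.child e) g h ∧
      ((i = T.lineAt g ∧ j = T.lineAt h) ∨ (i = T.lineAt h ∧ j = T.lineAt g))) := by
  have ha := (T.edge_cases he).1
  have hs := (T.solution_edge he).1
  have hval := edgeValid_solution e he
  have hon := (T.solution_edge he).2
  by_cases hi : T.net.OnEdge i e.1 e.2
  · by_cases hj : T.net.OnEdge j e.1 e.2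
    · obtain ⟨g, rfl, hg⟩ := (onEdge_iff_exists_strand ha i).1 ((hon i).1 hi)
      obtain ⟨h, rfl, hh⟩ := (onEdge_iff_exists_strand ha j).1 ((hon j).1 hj)
      rcases lt_trichotomy g h with hgh | hgh | hgh
      · have := crossCount_lineSeq hg hh hgh _ _ (Or.inl ⟨rfl, rfl⟩) hs
        refine ⟨this.1, fun h0 => ⟨g, h, ?_, Or.inl ⟨rfl, rfl⟩⟩⟩
        by_contra hni
        exact h0 (this.2 hni)
      · exact absurd (congrArg _ hgh) hij
      · have := crossCount_lineSeq hh hg hgh _ _ (Or.inr ⟨rfl, rfl⟩) hs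
        refine ⟨this.1, fun h0 => ⟨h, g, ?_, Or.inr ⟨rfl, rfl⟩⟩⟩
        by_contra hni
        exact h0 (this.2 hni)
    · have : crossCount (T.solution e.1 e.2) i j = 0 := by
        apply crossCount_eq_zero (v := true)
        intro π hπ
        rw [decide_eq_true_eq]
        have h1 : j ∉ π := fun h => hj (((hval.2.2 π hπ).2 j).1 h)
        have h2 := ((hval.2.2 π hπ).2 i).2 hi
        rw [List.idxOf_of_notMem h1]
        exact List.idxOf_lt_length_of_mem h2
      rw [this]
      exact ⟨by omega, fun h => absurd rfl h⟩
  · have : crossCount (T.solution e.1 e.2) i j = 0 := by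
      apply crossCount_eq_zero (v := false)
      intro π hπ
      rw [decide_eq_false_iff_not]
      have h1 : i ∉ π := fun h => hi (((hval.2.2 π hπ).2 i).1 h)
      rw [List.idxOf_of_notMem h1]
      exact not_lt.2 List.idxOf_le_length
    rw [this]
    exact ⟨by omega, fun h => absurd rfl h⟩

theorem monotone_solution : T.net.Monotone T.solution := by
  intro i j hij
  refine sum_le_one T.nodup_edges (fun e he => (crossCount_edge he hij).1) ?_
  intro e he e' he' h h'
  obtain ⟨g, h, hi, hl⟩ := (crossCount_edge he hij).2 h
  obtain ⟨g', h', hi', hl'⟩ := (crossCount_edge he' hij).2 h'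
  refine T.child_inj he he' (inverted_unique (T.edge_cases he).1 (T.edge_cases he').1 hi hi' ?_)
  rcases hl with ⟨rfl, rfl⟩ | ⟨rfl, rfl⟩ <;> rcases hl' with ⟨h1, h2⟩ | ⟨h1, h2⟩ <;> simp [h1, h2]

/-! ### The number of block crossings -/

/-- Climb until the mate lies below the parent; this happens at the latest below the root, whose
subtree contains all ends. -/
theorem exists_new_above {v : Fin n} {h : ℕ} (hs : T.Strand v h) :
    ∃ c, T.Anc c v ∧ c ≠ T.root ∧ T.IsNew c h := by
  induction hd : T.depth v generalizing v with
  | zero =>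
    rw [T.depth_eq_zero] at hd
    subst hd
    exact absurd (mem_root.2 (mate_lt hs.1.lt)) hs.2
  | succ k ih =>
    have hv : v ≠ T.root := fun h => by rw [T.depth_eq_zero.2 h] at hd; omega
    by_cases hm : T.Mem (T.par v) (T.mate h)
    · exact ⟨v, Anc.refl _, hv, hs, hm⟩
    · obtain ⟨c, hc, hcr, hn⟩ := ih ⟨hs.1.par, hm⟩ (by have := T.depth_par hv; omega)
      exact ⟨c, hc.trans (anc_par v), hcr, hn⟩

theorem not_mem_zero {a : Fin n} (ha : a ≠ T.root) : ¬ T.Mem a 0 := by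
  intro h
  have := (mem_iff h.lt).1 h
  rw [T.endAt_zero.2] at this
  exact ha (this.eq_of_depth_le (by rw [T.depth_eq_zero.2 rfl]; omega)).symm

/-- A line end other than the root has no children, so its subtree contains no second end. -/
theorem strand_endAt {g : ℕ} (hg : g < T.numEnds) (h0 : g ≠ 0) : T.Strand (T.endAt g) g := by
  refine ⟨(mem_iff hg).2 (Anc.refl _), fun h => ?_⟩
  have hr : T.endAt g ≠ T.root := fun h' =>
    h0 (endAt_inj hg T.endAt_zero.1 (h'.trans T.endAt_zero.2.symm))
  have hm := mate_lt hg
  rw [mem_iff hm, anc_child] at h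
  rcases h with h | ⟨c, hc, -⟩
  · exact mate_ne hg (endAt_inj hm hg h)
  · exact not_isEnd_of_child hr hc (isEnd_endAt hg)

noncomputable def cost (T : TreeNetwork n m) (a : Fin n) : ℕ := (T.seq a).length - 1

theorem cost_lt {a : Fin n} (hne : ∃ g, T.Strand a g) (hnew : ∀ g, T.Strand a g → T.IsNew a g) :
    T.cost a + 1 ≤ numNew (T.strands a) (T.key a) := by
  refine (good a).length_orders_lt ?_ ?_
  · obtain ⟨g, hg⟩ := hne
    exact List.ne_nil_of_mem (mem_strands.2 hg)
  · intro g hg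
    have hs := mem_strands.1 hg
    exact (key_pos_iff hs.1.lt).2 (hnew g hs).2

variable (T)

open Classical in
theorem numNew_eq (a : Fin n) : numNew (T.strands a) (T.key a) =
    ((Finset.range T.numEnds).filter fun g => T.IsNew a g).card := by
  unfold numNew
  rw [List.countP_eq_length_filter, ← List.toFinset_card_of_nodup ((good a).nodup.filter _)]
  congr 1
  ext g
  rw [List.mem_toFinset, List.mem_filter, mem_strands, Finset.mem_filter, Finset.mem_range,
    decide_eq_true_eq]
  constructor
  · rintro ⟨h1, h2⟩
    exact ⟨h1.1.lt, h1, (key_pos_iff h1.1.lt).1 h2⟩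
  · rintro ⟨h1, h2⟩
    exact ⟨h2.1, (key_pos_iff h1).2 h2.2⟩

-- By `IsNew.unique` the sets of new strands of different edges are disjoint, and end `0`, the root,
-- lies in the subtree of no other vertex.
open Classical in
theorem sum_numNew_le :
    ∑ a ∈ Finset.univ.erase T.root, numNew (T.strands a) (T.key a) + 1 ≤ T.numEnds := by
  have h : ∑ a ∈ Finset.univ.erase T.root, numNew (T.strands a) (T.key a) ≤
      ((Finset.range T.numEnds).erase 0).card := by
    rw [Finset.sum_congr rfl fun a _ => T.numNew_eq a, ← Finset.card_biUnion]
    · apply Finset.card_le_card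
      intro g hg
      obtain ⟨a, ha, hg⟩ := Finset.mem_biUnion.1 hg
      rw [Finset.mem_filter] at hg
      refine Finset.mem_erase.2 ⟨?_, hg.1⟩
      rintro rfl
      exact not_mem_zero (Finset.mem_erase.1 ha).1 hg.2.1.1
    · intro a _ b _ hab
      rw [Function.onFun, Finset.disjoint_left]
      intro g hg hg'
      exact hab ((Finset.mem_filter.1 hg).2.unique (Finset.mem_filter.1 hg').2)
  have h0 := T.endAt_zero.1
  rw [Finset.card_erase_of_mem (Finset.mem_range.2 h0), Finset.card_range] at h
  omega

/-- There are two edges on which all strands are new. -/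
theorem exists_two_free : ∃ x a, x ≠ T.root ∧ a ≠ T.root ∧ x ≠ a ∧
    ((∃ g, T.Strand x g) ∧ ∀ g, T.Strand x g → T.IsNew x g) ∧
    ((∃ g, T.Strand a g) ∧ ∀ g, T.Strand a g → T.IsNew a g) := by
  classical
  obtain ⟨x, hx⟩ := T.exists_children_root
  have hxc : x ∈ T.children T.root := by simp [hx]
  obtain ⟨hxr, hxp⟩ := T.mem_children.1 hxc
  have h0 := T.endAt_zero.1
  have hm0 := mate_lt h0
  have hx1 : T.Strand x (T.mate 0) := by
    refine ⟨(mem_root_child hxc).2 ⟨hm0, mate_ne h0⟩, ?_⟩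
    rw [mate_mate h0]
    exact not_mem_zero hxr
  have hx2 : ∀ g, T.Strand x g → T.IsNew x g := by
    intro g hg
    refine ⟨hg, ?_⟩
    rw [hxp]
    exact mem_root.2 (mate_lt hg.1.lt)
  -- a topmost edge on which a line other than the root line is new
  have hex : ∃ d a g, T.depth a = d ∧ a ≠ T.root ∧ T.IsNew a g ∧ T.lineAt g ≠ T.rootLine := by
    have h1 : 1 < m := T.two_le
    obtain ⟨g, hg, hl, -⟩ := exists_lineAt (T := T) ⟨1, h1⟩
    have hlr : T.lineAt g ≠ T.rootLine := by
      rw [hl]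
      unfold rootLine
      simp
    have hg0 : g ≠ 0 := by
      rintro rfl
      exact hlr lineAt_zero
    obtain ⟨c, -, hc, hn⟩ := exists_new_above (strand_endAt hg hg0)
    exact ⟨_, c, g, rfl, hc, hn, hlr⟩
  obtain ⟨a, g, hd, ha, hn, hl⟩ := Nat.find_spec hex
  have hmin : ∀ b h, b ≠ T.root → T.IsNew b h → T.lineAt h ≠ T.rootLine →
      T.depth a ≤ T.depth b := by
    intro b h hb hbn hbl
    rw [hd]
    exact Nat.find_min' hex ⟨b, h, rfl, hb, hbn, hbl⟩
  have hg := hn.1.1.lt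
  -- The edge at the root carries only the root line, since end `0` is the only one on its upper
  -- side.
  have hpr : T.par a ≠ T.root := by
    intro hp
    have hax : a ∈ T.children T.root := T.mem_children.2 ⟨ha, hp⟩
    have hm : T.mate g = 0 := by
      by_contra hne
      exact hn.1.2 ((mem_root_child hax).2 ⟨mate_lt hg, hne⟩)
    have := lineAt_mate hg
    rw [hm, lineAt_zero] at this
    exact hl this.symm
  have hac := (T.mem_children (v := T.par a)).2 ⟨ha, rfl⟩
  obtain ⟨b, hbc, hbm⟩ := hn.2.exists_child hpr hac
  obtain ⟨hb, hbp⟩ := T.mem_children.1 hbc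
  have hba : b ≠ a := by rintro rfl; exact hn.1.2 hbm
  have hbn := (isNew_of_siblings hac hbc hba hn.1.1 hbm).2
  -- only the root line comes from above
  have hold : ∀ c ∈ T.children (T.par a), ∀ h, T.Strand c h → ¬ T.IsNew c h → h = T.mate 0 := by
    intro c hc h hs hnn
    have hcp := (T.mem_children.1 hc).2
    have hsp : T.Strand (T.par a) h := by
      refine ⟨hs.1.of_child hc, fun h' => hnn ⟨hs, by rwa [hcp]⟩⟩
    obtain ⟨c', hc', hr', hn'⟩ := exists_new_above hsp
    have hlh : T.lineAt h = T.rootLine := by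
      by_contra hne
      have h1 := hmin c' h hr' hn' hne
      have h2 := hc'.depth_le
      have h3 := T.depth_par ha
      omega
    have hne : h ≠ 0 := by
      rintro rfl
      exact not_mem_zero (T.mem_children.1 hc).1 hs.1
    rw [← lineAt_zero] at hlh
    exact (eq_or_eq_mate h0 hs.1.lt hlh).resolve_left hne
  have hdx : ∀ c ∈ T.children (T.par a), x ≠ c := by
    rintro c hc rfl
    exact hpr ((T.mem_children.1 hc).2.symm.trans hxp)
  -- The only possible old strand is `mate 0`, and it lies below at most one of the siblings `a` and
  -- `b`; the other one is free of old strands.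
  by_cases hall : ∀ h, T.Strand a h → T.IsNew a h
  · exact ⟨x, a, hxr, ha, hdx a hac, ⟨⟨_, hx1⟩, hx2⟩, ⟨⟨g, hn.1⟩, hall⟩⟩
  · refine ⟨x, b, hxr, hb, hdx b hbc, ⟨⟨_, hx1⟩, hx2⟩, ⟨⟨_, hbn.1⟩, ?_⟩⟩
    push Not at hall
    obtain ⟨h, hs, hnn⟩ := hall
    have e1 := hold a hac h hs hnn
    intro h' hs'
    by_contra hnn'
    have e2 := hold b hbc h' hs' hnn'
    rw [e1] at hs
    rw [e2] at hs'
    exact hs.1.not_sibling hac hbc hba.symm hs'.1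

theorem length_solution {e : Fin n × Fin n} (he : e ∈ T.net.edges) :
    (T.solution e.1 e.2).length - 1 = T.cost (T.child e) := by
  unfold cost
  rcases (T.solution_edge he).1 with h | h <;> rw [h] <;> simp [lineSeq]

theorem blockCrossings_solution : T.net.blockCrossings T.solution ≤ 2 * m - 3 := by
  classical
  have h1 : T.net.blockCrossings T.solution ≤ ∑ a ∈ Finset.univ.erase T.root, T.cost a := by
    have hmap : T.net.edges.map (fun e => (T.solution e.1 e.2).length - 1) =
        (T.net.edges.map T.child).map T.cost := by
      rw [List.map_map]
      exact List.map_congr_left fun e he => T.length_solution he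
    have hnd : (T.net.edges.map T.child).Nodup :=
      T.nodup_edges.map_on fun e he e' he' h => T.child_inj he he' h
    unfold Network.blockCrossings
    rw [hmap, ← List.sum_toFinset _ hnd]
    apply Finset.sum_le_sum_of_subset
    intro a ha
    obtain ⟨e, he, rfl⟩ := List.mem_map.1 (List.mem_toFinset.1 ha)
    exact Finset.mem_erase.2 ⟨(T.edge_cases he).1, Finset.mem_univ _⟩
  obtain ⟨x, a, hx, ha, hxa, fx, fa⟩ := T.exists_two_free
  -- The indicators record the insertion saved on each of the two edges of `exists_two_free`.
  have h2 : ∑ b ∈ Finset.univ.erase T.root, (T.cost b + ((if b = x then 1 else 0) +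
      if b = a then 1 else 0)) ≤
      ∑ b ∈ Finset.univ.erase T.root, numNew (T.strands b) (T.key b) := by
    apply Finset.sum_le_sum
    intro b _
    by_cases hbx : b = x
    · subst hbx
      rw [if_pos rfl, if_neg hxa]
      exact cost_lt fx.1 fx.2
    · rw [if_neg hbx]
      by_cases hba : b = a
      · subst hba
        rw [if_pos rfl]
        simpa using cost_lt fa.1 fa.2
      · rw [if_neg hba, add_zero, add_zero]
        exact length_orders_le
  rw [Finset.sum_add_distrib, Finset.sum_add_distrib, Finset.sum_ite_eq', Finset.sum_ite_eq',
    if_pos (Finset.mem_erase.2 ⟨hx, Finset.mem_univ _⟩),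
    if_pos (Finset.mem_erase.2 ⟨ha, Finset.mem_univ _⟩)] at h2
  have h3 := T.sum_numNew_le
  have h4 := T.numEnds_le
  omega

end TreeNetwork
end BlockCrossing

namespace BlockCrossing

/-! ### Forced crossings -/

theorem Network.EdgeValid.mem_outOrder {n m : ℕ} {N : Network n m} {S : LineOrders n m}
    (hS : N.EdgeValid S) {u x : Fin n} (hx : x ∈ N.rot u) (i : Fin m) :
    i ∈ Network.outOrder S u x ↔ N.OnEdge i u x := by
  have hadj := (N.mem_rot u x).1 hx
  unfold Network.outOrder
  split_ifs with h
  · have he : (u, x) ∈ N.edges := by unfold Network.edges; simp [hx, h]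
    obtain ⟨h1, -, h2⟩ := hS _ he
    rw [List.head?_eq_some_head h1]
    exact (h2 _ (List.head_mem h1)).2 i
  · have hlt : x < u := lt_of_le_of_ne (not_lt.1 h) hadj.ne'
    have he : (x, u) ∈ N.edges := by
      unfold Network.edges
      simp [(N.mem_rot x u).2 hadj.symm, hlt]
    obtain ⟨h1, -, h2⟩ := hS _ he
    rw [List.getLast?_eq_some_getLast h1, Option.getD_some, List.mem_reverse,
      (h2 _ (List.getLast_mem h1)).2 i]
    exact Or.comm

/-- By consistency the continuing lines are a concatenation over the exits in cyclic order, so a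
line through an earlier exit stands before a line through a later one. -/
theorem Network.Feasible.sublist_inOrder {n m : ℕ} {N : Network n m} {S : LineOrders n m}
    (hS : N.Feasible S) {u v x y : Fin n} {i j : Fin m} (hv : v ∈ N.rot u)
    (hxy : [x, y].Sublist (N.others u v)) (hi : N.OnEdge i v u) (hix : N.OnEdge i u x)
    (hj : N.OnEdge j v u) (hjy : N.OnEdge j u y) :
    [i, j].Sublist (Network.inOrder S v u) := by
  have h := hS.2 u v hv
  refine List.Sublist.trans ?_ (List.filter_sublist (p := fun i => ∃ x ∈ N.others u v, N.OnEdge i u x))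
  rw [h]
  refine List.Sublist.trans ?_ (List.Sublist.flatMap hxy _)
  have hsub : ∀ z ∈ N.others u v, z ∈ N.rot u := by
    intro z hz
    unfold Network.others at hz
    exact List.mem_rotate.1 (List.mem_of_mem_tail hz)
  have hx := hsub x (hxy.subset (by simp))
  have hy := hsub y (hxy.subset (by simp))
  have e1 : [i].Sublist ((Network.outOrder S u x).filter fun i => N.OnEdge i v u) := by
    rw [List.singleton_sublist, List.mem_filter, hS.1.mem_outOrder hx]
    exact ⟨hix, by simpa using hi⟩
  have e2 : [j].Sublist ((Network.outOrder S u y).filter fun i => N.OnEdge i v u) := by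
    rw [List.singleton_sublist, List.mem_filter, hS.1.mem_outOrder hy]
    exact ⟨hjy, by simpa using hj⟩
  simpa using e1.append e2

theorem not_sublist_swap {α : Type*} {l : List α} (hl : l.Nodup) {i j : α} (h : [i, j].Sublist l)
    (h' : [j, i].Sublist l) : False := by
  induction l with
  | nil => simp at h
  | cons a l ih =>
    rw [List.nodup_cons] at hl
    rw [List.sublist_cons_iff] at h h'
    rcases h with h | ⟨r, hr, h⟩ <;> rcases h' with h' | ⟨r', hr', h'⟩
    · exact ih hl.2 h h'
    · simp only [List.cons.injEq] at hr'
      obtain ⟨rfl, rfl⟩ := hr'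
      exact hl.1 (h.subset (by simp))
    · simp only [List.cons.injEq] at hr
      obtain ⟨rfl, rfl⟩ := hr
      exact hl.1 (h'.subset (by simp))
    · simp only [List.cons.injEq] at hr hr'
      obtain ⟨rfl, rfl⟩ := hr
      obtain ⟨rfl, rfl⟩ := hr'
      exact hl.1 (h.subset (by simp))

/-- Two lines that leave an edge in the same cyclic order at both ends cross on this edge. -/
theorem Network.Feasible.one_le_length {n m : ℕ} {N : Network n m} {S : LineOrders n m}
    (hS : N.Feasible S) {u v x y x' y' : Fin n} {i j : Fin m} (huv : u < v) (hv : v ∈ N.rot u)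
    (hxy : [x, y].Sublist (N.others u v)) (hxy' : [x', y'].Sublist (N.others v u))
    (hi : N.OnEdge i u v) (hix : N.OnEdge i u x) (hix' : N.OnEdge i v x')
    (hj : N.OnEdge j u v) (hjy : N.OnEdge j u y) (hjy' : N.OnEdge j v y') :
    1 ≤ (S u v).length - 1 := by
  have he : (u, v) ∈ N.edges := by unfold Network.edges; simp [hv, huv]
  have hu : u ∈ N.rot v := (N.mem_rot _ _).2 ((N.mem_rot _ _).1 hv).symm
  obtain ⟨h1, -, h2⟩ := hS.1 _ he
  by_contra hlen
  obtain ⟨π, hπ⟩ : ∃ π, S u v = [π] := by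
    rw [← List.length_eq_one_iff]
    have := List.length_pos_iff.2 h1
    simp only at this
    omega
  have hnd := (h2 π (by simp [hπ])).1
  have e1 := hS.sublist_inOrder hv hxy (Or.symm hi) hix (Or.symm hj) hjy
  have e2 := hS.sublist_inOrder hu hxy' hi hix' hj hjy'
  -- A single order is read in opposite directions by the travellers arriving at the two ends, so
  -- the two lines would have to precede each other.
  unfold Network.inOrder Network.outOrder at e1 e2
  rw [if_pos huv, hπ] at e1
  rw [if_neg (not_lt.2 huv.le), hπ] at e2
  simp only [List.head?_cons, Option.getD_some, List.getLast?_singleton, List.reverse_reverse] at e1 e2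
  have e3 := List.reverse_sublist.2 e1
  rw [List.reverse_reverse] at e3
  exact not_sublist_swap hnd e2 e3

theorem Network.others_three {n m : ℕ} (N : Network n m) {v a b c : Fin n} (h : N.rot v = [a, b, c]) :
    N.others v a = [b, c] ∧ N.others v b = [c, a] ∧ N.others v c = [a, b] := by
  have hn := N.rot_nodup v
  rw [h] at hn
  simp only [List.nodup_cons, List.mem_cons, List.not_mem_nil, or_false, not_or,
    not_false_eq_true, List.nodup_nil, and_true] at hn
  obtain ⟨⟨h1, h2⟩, h3⟩ := hn
  unfold Network.others
  rw [h]
  refine ⟨?_, ?_, ?_⟩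
  · simp
  · rw [List.idxOf_cons_ne _ h1, List.idxOf_cons_self]
    rfl
  · rw [List.idxOf_cons_ne _ h2, List.idxOf_cons_ne _ h3, List.idxOf_cons_self]
    rfl

/-! ### Trees given by parents -/

/-- Following `p` decreases the number until `r` is reached, so the graph is connected. Two vertices
cannot be parents of each other, so `v ↦ {v, p v}` is injective and there are `n - 1` edges. -/
theorem isTree_of_parent {n : ℕ} {G : SimpleGraph (Fin n)} (p : Fin n → Fin n) (r : Fin n)
    (hr : ∀ v, v ≠ r → p v < v) (hadj : ∀ u v, G.Adj u v ↔ (u ≠ r ∧ p u = v) ∨ (v ≠ r ∧ p v = u)) :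
    G.IsTree := by
  classical
  rw [SimpleGraph.isTree_iff_connected_and_card]
  constructor
  · have hreach : ∀ v, G.Reachable v r := by
      intro v
      induction v using WellFoundedLT.induction with
      | _ v ih =>
        by_cases hv : v = r
        · rw [hv]
        · exact ((hadj v (p v)).2 (Or.inl ⟨hv, rfl⟩)).reachable.trans (ih _ (hr v hv))
    have : Nonempty (Fin n) := ⟨r⟩
    exact ⟨fun u v => (hreach u).trans (hreach v).symm⟩
  · have himg : G.edgeSet = (fun v => s(v, p v)) '' {v | v ≠ r} := by
      ext e
      induction e using Sym2.ind with
      | _ u v =>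
        rw [SimpleGraph.mem_edgeSet, hadj, Set.mem_image]
        constructor
        · rintro (⟨h, rfl⟩ | ⟨h, rfl⟩)
          · exact ⟨u, h, rfl⟩
          · exact ⟨v, h, Sym2.eq_swap⟩
        · rintro ⟨w, hw, he⟩
          rw [Sym2.eq_iff] at he
          rcases he with ⟨rfl, rfl⟩ | ⟨rfl, rfl⟩
          · exact Or.inl ⟨hw, rfl⟩
          · exact Or.inr ⟨hw, rfl⟩
    have hinj : Set.InjOn (fun v => s(v, p v)) {v | v ≠ r} := by
      intro v hv w hw he
      simp only [Sym2.eq_iff] at he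
      rcases he with ⟨h, -⟩ | ⟨h1, h2⟩
      · exact h
      · have e1 := hr v hv
        have e2 := hr w hw
        rw [h2] at e1
        rw [← h1] at e2
        exact absurd e1 (lt_asymm e2)
    rw [himg, Nat.card_image_of_injOn hinj]
    have hset : {v : Fin n | v ≠ r} = ((Finset.univ.erase r : Finset (Fin n)) : Set (Fin n)) := by
      ext; simp
    rw [hset, Nat.card_coe_set_eq, Set.ncard_coe_finset,
      Finset.card_erase_of_mem (Finset.mem_univ r), Finset.card_univ, Fintype.card_fin,
      Nat.card_eq_fintype_card, Fintype.card_fin]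
    have := r.pos
    omega

theorem infix_of_getElem {α : Type*} {l : List α} {k : ℕ} (h : k + 1 < l.length) :
    [l[k], l[k + 1]] <:+: l := by
  refine ⟨l.take k, l.drop (k + 2), ?_⟩
  conv_rhs => rw [← List.take_append_drop k l, List.drop_eq_getElem_cons (by omega),
    List.drop_eq_getElem_cons h]
  simp

/-! ### The fan -/

namespace Fan

/-- The parent of a vertex. The spine consists of `4 i` for `i < m`; at `4 i` hangs the vertex
`4 i + 1` with two leaves `4 i + 2` and `4 i + 3`; the spine has leaves `4 m` and `4 m + 1`. -/
def parent (m v : ℕ) : ℕ :=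
  if v = 4 * m then 0 else if v = 4 * m + 1 then 4 * (m - 1) else
    if v % 4 = 0 then v - 4 else if v % 4 = 3 then v - 2 else v - 1

def prev (m i : ℕ) : ℕ := if i = 0 then 4 * m else 4 * (i - 1)

def next (m i : ℕ) : ℕ := if i = m - 1 then 4 * m + 1 else 4 * (i + 1)

/-- The side vertices lie alternately on the two sides of the spine, and the order of the two leaves
alternates with them; this forces crossings both on the spine and on the side edges. -/
def rot (m v : ℕ) : List ℕ :=
  if v = 4 * m then [0] else if v = 4 * m + 1 then [4 * (m - 1)] else
    if v % 4 = 0 then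
      if (v / 4) % 2 = 0 then [prev m (v / 4), v + 1, next m (v / 4)]
      else [prev m (v / 4), next m (v / 4), v + 1]
    else if v % 4 = 1 then
      if (v / 4) % 2 = 0 then [v - 1, v + 2, v + 1] else [v - 1, v + 1, v + 2]
    else [v / 4 * 4 + 1]

def spineLine (m k : ℕ) : ℕ := if k = 0 then 4 * m else if k = m + 1 then 4 * m + 1 else 4 * (k - 1)

/-- Line `0` runs along the whole spine. Each other line goes from a leaf of one side vertex over a
single spine edge to a leaf of the next side vertex, so it shares a spine edge with line `0` and a
side edge with the next short line. The leaves `2` and `4 m - 1` remain unused. -/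
def line (m i : ℕ) : List ℕ :=
  if i = 0 then (List.range (m + 2)).map (spineLine m)
  else [4 * i - 1, 4 * i - 3, 4 * i - 4, 4 * i, 4 * i + 1, 4 * i + 2]

theorem mem_rot_iff {m u v : ℕ} (hm : 2 ≤ m) (hu : u < 4 * m + 2) (hv : v < 4 * m + 2) :
    v ∈ rot m u ↔ (u ≠ 0 ∧ parent m u = v) ∨ (v ≠ 0 ∧ parent m v = u) := by
  unfold rot parent prev next
  split_ifs <;> simp only [List.mem_cons, List.not_mem_nil, or_false] <;> omega

theorem rot_lt {m u v : ℕ} (hm : 2 ≤ m) (hu : u < 4 * m + 2) (hv : v ∈ rot m u) : v < 4 * m + 2 := by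
  revert hv
  unfold rot prev next
  split_ifs <;> simp only [List.mem_cons, List.not_mem_nil, or_false] <;> omega

theorem nodup_rot {m u : ℕ} (hm : 2 ≤ m) : (rot m u).Nodup := by
  unfold rot prev next
  split_ifs <;> simp only [List.nodup_cons, List.mem_cons, List.not_mem_nil, or_false,
    List.nodup_nil, not_false_eq_true, and_true] <;> omega

theorem parent_lt {m v : ℕ} (hm : 2 ≤ m) (hv : v ≠ 0) : parent m v < v := by
  unfold parent
  split_ifs <;> omega

theorem line_lt {m i v : ℕ} (hi : i < m) (hv : v ∈ line m i) : v < 4 * m + 2 := by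
  revert hv
  unfold line spineLine
  split_ifs
  · simp only [List.mem_map, List.mem_range]
    rintro ⟨k, hk, rfl⟩
    split_ifs <;> omega
  · simp only [List.mem_cons, List.not_mem_nil, or_false]
    omega

theorem nodup_line {m i : ℕ} : (line m i).Nodup := by
  unfold line
  split_ifs
  · refine List.Nodup.map_on ?_ List.nodup_range
    intro a ha b hb
    rw [List.mem_range] at ha hb
    unfold spineLine
    split_ifs <;> omega
  · simp only [List.nodup_cons, List.mem_cons, List.not_mem_nil, or_false,
      List.nodup_nil, not_false_eq_true, and_true]
    omega

theorem parent_mem_rot {m u v : ℕ} (hm : 2 ≤ m) (hv : v < 4 * m + 2) (h0 : v ≠ 0)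
    (h : parent m v = u) : v ∈ rot m u ∧ u ∈ rot m v := by
  have := parent_lt hm h0
  exact ⟨(mem_rot_iff hm (by omega) hv).2 (Or.inr ⟨h0, h⟩),
    (mem_rot_iff hm hv (by omega)).2 (Or.inl ⟨h0, h⟩)⟩

theorem spineLine_of_pos {m k : ℕ} (h0 : k ≠ 0) (hk : k < m + 1) : spineLine m k = 4 * (k - 1) := by
  unfold spineLine
  rw [if_neg h0, if_neg (by omega)]

theorem spineLine_zero (m : ℕ) : spineLine m 0 = 4 * m := by simp [spineLine]

theorem spineLine_last (m : ℕ) : spineLine m (m + 1) = 4 * m + 1 := by simp [spineLine]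

theorem spineLine_mem_rot {m k : ℕ} (hm : 2 ≤ m) (hk : k < m + 1) :
    spineLine m (k + 1) ∈ rot m (spineLine m k) := by
  by_cases h0 : k = 0
  · subst h0
    rw [spineLine_zero, spineLine_of_pos (by omega) (by omega)]
    exact (parent_mem_rot hm (by omega) (by omega) (by simp [parent])).2
  · rw [spineLine_of_pos h0 hk]
    by_cases h1 : k = m
    · subst h1
      rw [spineLine_last]
      exact (parent_mem_rot hm (by omega) (by omega) (by simp [parent])).1
    · rw [spineLine_of_pos (by omega) (by omega)]
      refine (parent_mem_rot hm (by omega) (by omega) ?_).1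
      unfold parent
      rw [if_neg (by omega), if_neg (by omega), if_pos (by omega)]
      omega

theorem isChain_line {m i : ℕ} (hm : 2 ≤ m) (hi : i < m) :
    (line m i).IsChain fun u v => v ∈ rot m u := by
  unfold line
  split_ifs with h0
  · rw [List.isChain_iff_getElem]
    intro k hk
    simp only [List.length_map, List.length_range] at hk
    simp only [List.getElem_map, List.getElem_range]
    exact spineLine_mem_rot hm (by omega)
  · simp only [List.isChain_cons_cons, List.isChain_singleton, and_true]
    refine ⟨(parent_mem_rot hm (by omega) (by omega) ?_).2,
      (parent_mem_rot hm (by omega) (by omega) ?_).2, (parent_mem_rot hm (by omega) (by omega) ?_).1,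
      (parent_mem_rot hm (by omega) (by omega) ?_).1, (parent_mem_rot hm (by omega) (by omega) ?_).1⟩ <;>
    · unfold parent
      split_ifs <;> omega

/-- The minimum only makes the function total; see `vtx_val`. -/
def vtx (m k : ℕ) : Fin (4 * m + 2) := ⟨min k (4 * m + 1), by omega⟩

theorem vtx_val {m k : ℕ} (h : k < 4 * m + 2) : (vtx m k : ℕ) = k := by
  unfold vtx
  simp only
  omega

theorem vtx_inj {m k l : ℕ} (hk : k < 4 * m + 2) (hl : l < 4 * m + 2) (h : vtx m k = vtx m l) : k = l := by
  rw [← vtx_val hk, ← vtx_val hl, h]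

theorem vtx_coe {m : ℕ} (v : Fin (4 * m + 2)) : vtx m v = v := Fin.ext (vtx_val v.2)

theorem mem_rot_map {m : ℕ} (hm : 2 ≤ m) (u v : Fin (4 * m + 2)) :
    v ∈ (rot m u).map (vtx m) ↔ (v : ℕ) ∈ rot m u := by
  rw [List.mem_map]
  constructor
  · rintro ⟨k, hk, rfl⟩
    rwa [vtx_val (rot_lt hm u.2 hk)]
  · exact fun h => ⟨v, h, vtx_coe v⟩

def graph (m : ℕ) (hm : 2 ≤ m) : SimpleGraph (Fin (4 * m + 2)) where
  Adj u v := (v : ℕ) ∈ rot m u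
  symm := ⟨fun u v h => by
    rw [mem_rot_iff hm u.2 v.2] at h
    rw [mem_rot_iff hm v.2 u.2]
    exact h.symm⟩
  loopless := ⟨fun v h => by
    rw [mem_rot_iff hm v.2 v.2] at h
    have := fun h0 => (parent_lt (v := v) hm h0).ne
    tauto⟩

def network (m : ℕ) (hm : 2 ≤ m) : Network (4 * m + 2) m where
  graph := graph m hm
  rot v := (rot m v).map (vtx m)
  rot_nodup v := (nodup_rot hm).map_on fun _ ha _ hb h =>
    vtx_inj (rot_lt hm v.2 ha) (rot_lt hm v.2 hb) h
  mem_rot u v := mem_rot_map hm u v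
  line i := (line m i).map (vtx m)
  line_nodup i := nodup_line.map_on fun _ ha _ hb h => vtx_inj (line_lt i.2 ha) (line_lt i.2 hb) h
  line_chain i := by
    rw [List.isChain_map]
    refine List.IsChain.imp_of_mem_imp ?_ (isChain_line hm i.2)
    intro a b ha hb h
    change (vtx m b : ℕ) ∈ rot m (vtx m a)
    rwa [vtx_val (line_lt i.2 ha), vtx_val (line_lt i.2 hb)]
  line_length i := by
    rw [List.length_map]
    unfold line
    split_ifs <;> simp

theorem isTree {m : ℕ} (hm : 2 ≤ m) : (network m hm).graph.IsTree := by
  refine isTree_of_parent (fun v => vtx m (parent m v)) (vtx m 0) ?_ ?_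
  · intro v hv
    have h0 : (v : ℕ) ≠ 0 := fun h => hv (by rw [← vtx_coe v, h])
    have := parent_lt hm h0
    rw [Fin.lt_def, vtx_val (by omega)]
    exact this
  · intro u v
    change (v : ℕ) ∈ rot m u ↔ _
    have hp : ∀ w : Fin (4 * m + 2), parent m w < 4 * m + 2 := by
      intro w
      by_cases h0 : (w : ℕ) = 0
      · rw [h0]; unfold parent; split_ifs <;> omega
      · have := parent_lt hm h0; omega
    simp only [mem_rot_iff hm u.2 v.2, ne_eq, Fin.ext_iff, vtx_val (hp u), vtx_val (hp v),
      vtx_val (show 0 < 4 * m + 2 by omega)]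

theorem terminal_iff {m : ℕ} (hm : 2 ≤ m) (i : Fin m) (v : Fin (4 * m + 2)) :
    (network m hm).IsTerminal i v ↔
      ((i : ℕ) = 0 ∧ ((v : ℕ) = 4 * m ∨ (v : ℕ) = 4 * m + 1)) ∨
      ((i : ℕ) ≠ 0 ∧ ((v : ℕ) = 4 * i - 1 ∨ (v : ℕ) = 4 * i + 2)) := by
  have hi := i.2
  have hv : ∀ k, k < 4 * m + 2 → (vtx m k = v ↔ (v : ℕ) = k) := by
    intro k hk
    rw [Fin.ext_iff, vtx_val hk, eq_comm]
  unfold Network.IsTerminal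
  change ((line m i).map (vtx m)).head? = some v ∨ ((line m i).map (vtx m)).getLast? = some v ↔ _
  by_cases h0 : (i : ℕ) = 0
  · have e1 : ((line m i).map (vtx m)).head? = some (vtx m (4 * m)) := by
      rw [line, if_pos h0, List.range_succ_eq_map]
      simp [spineLine]
    have e2 : ((line m i).map (vtx m)).getLast? = some (vtx m (4 * m + 1)) := by
      rw [line, if_pos h0, List.range_succ]
      simp [spineLine]
    rw [e1, e2, Option.some_inj, Option.some_inj, hv _ (by omega), hv _ (by omega)]
    simp [h0]
  · rw [line, if_neg h0]
    simp only [List.map_cons, List.map_nil, List.head?_cons, List.getLast?_cons_cons,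
      List.getLast?_singleton, Option.some_inj]
    rw [hv _ (by omega), hv _ (by omega)]
    simp [h0]

theorem pathTerminal {m : ℕ} (hm : 2 ≤ m) : (network m hm).PathTerminal := by
  constructor
  · intro i v h
    rw [terminal_iff] at h
    have hi := i.2
    have hrot : ∃ w, rot m v = [w] := by
      unfold rot
      split_ifs <;> first | exact ⟨_, rfl⟩ | (exfalso; omega)
    obtain ⟨w, hw⟩ := hrot
    have hwl := rot_lt (v := w) hm v.2 (by simp [hw])
    refine ⟨vtx m w, ?_, ?_⟩
    · change (vtx m w : ℕ) ∈ rot m v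
      rw [vtx_val hwl, hw]
      simp
    · intro y hy
      change (y : ℕ) ∈ rot m v at hy
      rw [hw, List.mem_singleton] at hy
      rw [← hy, vtx_coe]
  · intro i j v hi hj
    rw [terminal_iff] at hi hj
    have := i.2
    have := j.2
    apply Fin.ext
    omega

theorem onEdge_spine {m k : ℕ} (hm : 2 ≤ m) (hk : k < m + 1) :
    (network m hm).OnEdge ⟨0, by omega⟩ (vtx m (spineLine m k)) (vtx m (spineLine m (k + 1))) := by
  left
  change _ <:+: (line m 0).map (vtx m)
  have : [spineLine m k, spineLine m (k + 1)] <:+: line m 0 := by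
    unfold line
    rw [if_pos rfl]
    have := infix_of_getElem (l := (List.range (m + 2)).map (spineLine m)) (k := k) (by simp; omega)
    simpa using this
  exact this.map _

theorem onEdge_line {m i a b : ℕ} (hm : 2 ≤ m) (hi : i < m) (h0 : i ≠ 0)
    (h : [a, b] <:+: [4 * i - 1, 4 * i - 3, 4 * i - 4, 4 * i, 4 * i + 1, 4 * i + 2]) :
    (network m hm).OnEdge ⟨i, hi⟩ (vtx m a) (vtx m b) := by
  left
  change _ <:+: (line m i).map (vtx m)
  unfold line
  rw [if_neg h0]
  exact h.map _

theorem onEdge_symm {m : ℕ} {N : Network (4 * m + 2) m} {i : Fin m} {u v : Fin (4 * m + 2)}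
    (h : N.OnEdge i u v) : N.OnEdge i v u := Or.symm h

theorem rot_spine_even {m i : ℕ} (hm : 2 ≤ m) (hi : i < m) (h : i % 2 = 0) :
    (network m hm).rot (vtx m (4 * i)) = [vtx m (prev m i), vtx m (4 * i + 1), vtx m (next m i)] := by
  change (rot m (vtx m (4 * i) : ℕ)).map (vtx m) = _
  rw [vtx_val (by omega), rot, if_neg (by omega), if_neg (by omega), if_pos (by omega),
    if_pos (by omega), Nat.mul_div_cancel_left _ (by omega)]
  rfl

theorem rot_spine_odd {m i : ℕ} (hm : 2 ≤ m) (hi : i < m) (h : ¬ i % 2 = 0) :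
    (network m hm).rot (vtx m (4 * i)) = [vtx m (prev m i), vtx m (next m i), vtx m (4 * i + 1)] := by
  change (rot m (vtx m (4 * i) : ℕ)).map (vtx m) = _
  rw [vtx_val (by omega), rot, if_neg (by omega), if_neg (by omega), if_pos (by omega),
    if_neg (by omega), Nat.mul_div_cancel_left _ (by omega)]
  rfl

theorem rot_side {m i : ℕ} (hm : 2 ≤ m) (hi : i < m) :
    (network m hm).rot (vtx m (4 * i + 1)) = if i % 2 = 0
      then [vtx m (4 * i), vtx m (4 * i + 3), vtx m (4 * i + 2)]
      else [vtx m (4 * i), vtx m (4 * i + 2), vtx m (4 * i + 3)] := by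
  change (rot m (vtx m (4 * i + 1) : ℕ)).map (vtx m) = _
  have : (4 * i + 1) / 4 = i := by omega
  rw [vtx_val (by omega), rot, if_neg (by omega), if_neg (by omega), if_neg (by omega),
    if_pos (by omega), this]
  split_ifs <;> rfl

/-- Lines `0` and `i` share this edge. As the side vertices alternate, the exit along the spine and
the exit to the side come in the same cyclic order at both ends; the parity of `i - 1` decides which
of them is first. -/
theorem cross_spine {m i : ℕ} (hm : 2 ≤ m) (h1 : 1 ≤ i) (hi : i < m) {S : LineOrders (4 * m + 2) m}
    (hS : (network m hm).Feasible S) :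
    1 ≤ (S (vtx m (4 * (i - 1))) (vtx m (4 * i))).length - 1 := by
  have hlt : vtx m (4 * (i - 1)) < vtx m (4 * i) := by
    rw [Fin.lt_def, vtx_val (by omega), vtx_val (by omega)]; omega
  have en : next m (i - 1) = 4 * i := by unfold next; split_ifs <;> omega
  have ep : prev m i = 4 * (i - 1) := by unfold prev; split_ifs <;> omega
  have s0 : (network m hm).OnEdge ⟨0, by omega⟩ (vtx m (4 * (i - 1))) (vtx m (4 * i)) := by
    have := onEdge_spine (k := i) hm (by omega)
    unfold spineLine at this
    rwa [if_neg (by omega), if_neg (by omega), if_neg (by omega), if_neg (by omega)] at this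
  have s1 : (network m hm).OnEdge ⟨0, by omega⟩ (vtx m (4 * (i - 1))) (vtx m (prev m (i - 1))) := by
    have h := onEdge_spine (k := i - 1) hm (by omega)
    rw [spineLine_of_pos (k := i - 1 + 1) (by omega) (by omega), Nat.add_sub_cancel] at h
    refine onEdge_symm ?_
    unfold prev
    split_ifs with h0
    · rw [h0] at h ⊢
      rwa [spineLine_zero] at h
    · rwa [spineLine_of_pos h0 (by omega)] at h
  have s2 : (network m hm).OnEdge ⟨0, by omega⟩ (vtx m (4 * i)) (vtx m (next m i)) := by
    have h := onEdge_spine (k := i + 1) hm (by omega)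
    rw [spineLine_of_pos (k := i + 1) (by omega) (by omega)] at h
    unfold next
    split_ifs with h0
    · rw [h0, Nat.sub_add_cancel (by omega), spineLine_last] at h
      rw [h0]
      exact h
    · rwa [spineLine_of_pos (by omega) (by omega)] at h
  have hi0 : i ≠ 0 := by omega
  have e4 : 4 * i - 4 = 4 * (i - 1) := by omega
  have e3 : 4 * i - 3 = 4 * (i - 1) + 1 := by omega
  have t0 : (network m hm).OnEdge ⟨i, hi⟩ (vtx m (4 * (i - 1))) (vtx m (4 * i)) := by
    rw [← e4]
    exact onEdge_line hm hi hi0 ⟨[_, _], [_, _], rfl⟩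
  have t1 : (network m hm).OnEdge ⟨i, hi⟩ (vtx m (4 * (i - 1))) (vtx m (4 * (i - 1) + 1)) := by
    rw [← e3, ← e4]
    exact onEdge_symm (onEdge_line hm hi hi0 ⟨[_], [_, _, _], rfl⟩)
  have t2 : (network m hm).OnEdge ⟨i, hi⟩ (vtx m (4 * i)) (vtx m (4 * i + 1)) :=
    onEdge_line hm hi hi0 ⟨[_, _, _], [_], rfl⟩
  by_cases hpar : (i - 1) % 2 = 0
  · have r1 := rot_spine_even (i := i - 1) hm (by omega) hpar
    have r2 := rot_spine_odd (i := i) hm hi (by omega)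
    rw [en] at r1
    rw [ep] at r2
    have o1 := ((network m hm).others_three r1).2.2
    have o2 := ((network m hm).others_three r2).1
    exact hS.one_le_length hlt (by simp [r1]) (by rw [o1]) (by rw [o2]) s0 s1 s2 t0 t1 t2
  · have r1 := rot_spine_odd (i := i - 1) hm (by omega) hpar
    have r2 := rot_spine_even (i := i) hm hi (by omega)
    rw [en] at r1
    rw [ep] at r2
    have o1 := ((network m hm).others_three r1).2.1
    have o2 := ((network m hm).others_three r2).1
    exact hS.one_le_length hlt (by simp [r1]) (by rw [o1]) (by rw [o2]) t0 t1 t2 s0 s1 s2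

/-- Lines `i` and `i + 1` come from opposite directions of the spine and part again towards the two
leaves, whose order in `rot` is made to agree with that of the two directions. -/
theorem cross_side {m i : ℕ} (hm : 2 ≤ m) (h1 : 1 ≤ i) (hi : i + 1 < m)
    {S : LineOrders (4 * m + 2) m} (hS : (network m hm).Feasible S) :
    1 ≤ (S (vtx m (4 * i)) (vtx m (4 * i + 1))).length - 1 := by
  have hlt : vtx m (4 * i) < vtx m (4 * i + 1) := by
    rw [Fin.lt_def, vtx_val (by omega), vtx_val (by omega)]; omega
  have ep : prev m i = 4 * i - 4 := by unfold prev; split_ifs <;> omega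
  have en : next m i = 4 * (i + 1) := by unfold next; split_ifs <;> omega
  have hi' : i < m := by omega
  have hi0 : i ≠ 0 := by omega
  have s0 : (network m hm).OnEdge ⟨i, hi'⟩ (vtx m (4 * i)) (vtx m (4 * i + 1)) :=
    onEdge_line hm hi' hi0 ⟨[_, _, _], [_], rfl⟩
  have s1 : (network m hm).OnEdge ⟨i, hi'⟩ (vtx m (4 * i)) (vtx m (prev m i)) := by
    rw [ep]
    exact onEdge_symm (onEdge_line hm hi' hi0 ⟨[_, _], [_, _], rfl⟩)
  have s2 : (network m hm).OnEdge ⟨i, hi'⟩ (vtx m (4 * i + 1)) (vtx m (4 * i + 2)) :=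
    onEdge_line hm hi' hi0 ⟨[_, _, _, _], [], rfl⟩
  have e4 : 4 * (i + 1) - 4 = 4 * i := by omega
  have e3 : 4 * (i + 1) - 3 = 4 * i + 1 := by omega
  have e1 : 4 * (i + 1) - 1 = 4 * i + 3 := by omega
  have t0 : (network m hm).OnEdge ⟨i + 1, hi⟩ (vtx m (4 * i)) (vtx m (4 * i + 1)) := by
    rw [← e3, ← e4]
    exact onEdge_symm (onEdge_line hm hi (by omega) ⟨[_], [_, _, _], rfl⟩)
  have t1 : (network m hm).OnEdge ⟨i + 1, hi⟩ (vtx m (4 * i)) (vtx m (next m i)) := by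
    rw [en, ← e4]
    exact onEdge_line hm hi (by omega) ⟨[_, _], [_, _], rfl⟩
  have t2 : (network m hm).OnEdge ⟨i + 1, hi⟩ (vtx m (4 * i + 1)) (vtx m (4 * i + 3)) := by
    rw [← e3, ← e1]
    exact onEdge_symm (onEdge_line hm hi (by omega) ⟨[], [_, _, _, _], rfl⟩)
  have r2 := rot_side (i := i) hm hi'
  by_cases hpar : i % 2 = 0
  · have r1 := rot_spine_even (i := i) hm hi' hpar
    rw [if_pos hpar] at r2
    have o1 := ((network m hm).others_three r1).2.1
    have o2 := ((network m hm).others_three r2).1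
    exact hS.one_le_length hlt (by simp [r1]) (by rw [o1]) (by rw [o2]) t0 t1 t2 s0 s1 s2
  · have r1 := rot_spine_odd (i := i) hm hi' hpar
    rw [if_neg hpar] at r2
    have o1 := ((network m hm).others_three r1).2.2
    have o2 := ((network m hm).others_three r2).1
    exact hS.one_le_length hlt (by simp [r1]) (by rw [o1]) (by rw [o2]) s0 s1 s2 t0 t1 t2

theorem le_blockCrossings {m : ℕ} (hm : 2 ≤ m) {S : LineOrders (4 * m + 2) m}
    (hS : (network m hm).Feasible S) : 2 * m - 3 ≤ (network m hm).blockCrossings S := by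
  classical
  let T : TreeNetwork (4 * m + 2) m := ⟨network m hm, hm, isTree hm, pathTerminal hm⟩
  have hnd : (network m hm).edges.Nodup := T.nodup_edges
  have hmem : ∀ {u v}, (u, v) ∈ (network m hm).edges ↔ v ∈ (network m hm).rot u ∧ u < v :=
    T.mem_edges
  unfold Network.blockCrossings
  rw [← List.sum_toFinset _ hnd]
  -- All `m - 1` spine edges and `m - 2` side edges; the side edges at the two ends of the spine are
  -- omitted, as each carries a single line.
  let A := (Finset.Ico 1 m).image fun i => (vtx m (4 * (i - 1)), vtx m (4 * i))
  let B := (Finset.Ico 1 (m - 1)).image fun i => (vtx m (4 * i), vtx m (4 * i + 1))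
  have hA : A.card = m - 1 := by
    rw [Finset.card_image_of_injOn, Nat.card_Ico]
    intro i hi j hj h
    simp only [Finset.coe_Ico, Set.mem_Ico] at hi hj
    have := vtx_inj (by omega) (by omega) (Prod.mk.inj h).2
    omega
  have hB : B.card = m - 2 := by
    rw [Finset.card_image_of_injOn, Nat.card_Ico]
    · omega
    intro i hi j hj h
    simp only [Finset.coe_Ico, Set.mem_Ico] at hi hj
    have := vtx_inj (by omega) (by omega) (Prod.mk.inj h).2
    omega
  have hAB : Disjoint A B := by
    rw [Finset.disjoint_left]
    intro e he he'
    obtain ⟨i, hi, rfl⟩ := Finset.mem_image.1 he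
    obtain ⟨j, hj, h⟩ := Finset.mem_image.1 he'
    rw [Finset.mem_Ico] at hi hj
    have := vtx_inj (by omega) (by omega) (Prod.mk.inj h).2
    omega
  have hone : ∀ e ∈ A ∪ B, 1 ≤ (S e.1 e.2).length - 1 := by
    intro e he
    rcases Finset.mem_union.1 he with he | he
    · obtain ⟨i, hi, rfl⟩ := Finset.mem_image.1 he
      rw [Finset.mem_Ico] at hi
      exact cross_spine hm hi.1 hi.2 hS
    · obtain ⟨i, hi, rfl⟩ := Finset.mem_image.1 he
      rw [Finset.mem_Ico] at hi
      exact cross_side hm hi.1 (by omega) hS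
  have hsub : A ∪ B ⊆ (network m hm).edges.toFinset := by
    intro e he
    rw [List.mem_toFinset]
    rcases Finset.mem_union.1 he with he | he
    · obtain ⟨i, hi, rfl⟩ := Finset.mem_image.1 he
      rw [Finset.mem_Ico] at hi
      rw [hmem]
      constructor
      · rw [(network m hm).mem_rot]
        change (vtx m (4 * i) : ℕ) ∈ rot m (vtx m (4 * (i - 1)) : ℕ)
        rw [vtx_val (by omega), vtx_val (by omega), mem_rot_iff hm (by omega) (by omega)]
        unfold parent
        split_ifs <;> omega
      · rw [Fin.lt_def, vtx_val (by omega), vtx_val (by omega)]; omega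
    · obtain ⟨i, hi, rfl⟩ := Finset.mem_image.1 he
      rw [Finset.mem_Ico] at hi
      rw [hmem]
      constructor
      · rw [(network m hm).mem_rot]
        change (vtx m (4 * i + 1) : ℕ) ∈ rot m (vtx m (4 * i) : ℕ)
        rw [vtx_val (by omega), vtx_val (by omega), mem_rot_iff hm (by omega) (by omega)]
        unfold parent
        split_ifs <;> omega
      · rw [Fin.lt_def, vtx_val (by omega), vtx_val (by omega)]; omega
  calc 2 * m - 3 = (A ∪ B).card := by rw [Finset.card_union_of_disjoint hAB, hA, hB]; omega
    _ = ∑ e ∈ A ∪ B, 1 := by simp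
    _ ≤ ∑ e ∈ A ∪ B, ((S e.1 e.2).length - 1) := Finset.sum_le_sum hone
    _ ≤ _ := Finset.sum_le_sum_of_subset hsub

end Fan

theorem exists_lower_bound (m : ℕ) (hm : 2 ≤ m) :
    ∃ (n : ℕ) (N : Network n m), N.graph.IsTree ∧ N.PathTerminal ∧
      ∀ S : LineOrders n m, N.Feasible S → 2 * m - 3 ≤ N.blockCrossings S :=
  ⟨_, Fan.network m hm, Fan.isTree hm, Fan.pathTerminal hm, fun _ => Fan.le_blockCrossings hm⟩

end BlockCrossing

namespace BlockCrossing
namespace RAM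

/-! ### Verification of programs -/

namespace State

/-- Assignment to a register. -/
def set (s : State) (x v : ℕ) : State := { s with reg := Function.update s.reg x v }

/-- Writing to the memory. -/
def put (s : State) (A i v : ℕ) : State :=
  { s with mem := Function.update s.mem A (Function.update (s.mem A) i v) }

/-- Output of a word. -/
def push (s : State) (v : ℕ) : State := { s with out := s.out ++ [v] }

variable (s : State) (x y A B i j v : ℕ)

theorem set_reg : (s.set x v).reg y = if y = x then v else s.reg y := Function.update_apply ..

theorem set_mem : (s.set x v).mem = s.mem := rfl

theorem set_out : (s.set x v).out = s.out := rfl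

theorem put_reg : (s.put A i v).reg = s.reg := rfl

theorem put_mem : (s.put A i v).mem B =
    if B = A then Function.update (s.mem A) i v else s.mem B := Function.update_apply ..

theorem push_out : (s.push v).out = s.out ++ [v] := rfl

end State

namespace Prog

/-- The registers that are written. -/
def regs : Prog → List ℕ
  | .assign x _ => [x]
  | .seq p q => p.regs ++ q.regs
  | .cond _ p q => p.regs ++ q.regs
  | .loop _ p => p.regs
  | _ => []

/-- The arrays that are written. -/
def arrays : Prog → List ℕ
  | .write A _ _ => [A]
  | .seq p q => p.arrays ++ q.arrays
  | .cond _ p q => p.arrays ++ q.arrays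
  | .loop _ p => p.arrays
  | _ => []

/-- There is no output. -/
def silent : Prog → Bool
  | .emit _ => false
  | .seq p q => p.silent && q.silent
  | .cond _ p q => p.silent && q.silent
  | .loop _ p => p.silent
  | _ => true

/-- A bound for the running time of programs without loops. -/
def cost : Prog → ℕ
  | .skip => 1
  | .assign _ e => e.cost + 1
  | .write _ i e => i.cost + e.cost + 1
  | .emit e => e.cost + 1
  | .seq p q => p.cost + q.cost
  | .cond b p q => b.cost + max p.cost q.cost
  | .loop b _ => b.cost

end Prog

/-- What does not change in an execution of `p`. -/
structure Frame (p : Prog) (s s' : State) : Prop where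
  reg : ∀ x, x ∉ p.regs → s'.reg x = s.reg x
  mem : ∀ A, A ∉ p.arrays → s'.mem A = s.mem A
  out : p.silent = true → s'.out = s.out

theorem Frame.refl (p : Prog) (s : State) : Frame p s s :=
  ⟨fun _ _ => rfl, fun _ _ => rfl, fun _ => rfl⟩

theorem Frame.trans {p : Prog} {s s' s'' : State} (h : Frame p s s') (h' : Frame p s' s'') :
    Frame p s s'' :=
  ⟨fun x hx => (h'.reg x hx).trans (h.reg x hx), fun A hA => (h'.mem A hA).trans (h.mem A hA),
    fun ho => (h'.out ho).trans (h.out ho)⟩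

theorem Frame.mono {p q : Prog} {s s' : State} (h : Frame p s s') (hr : p.regs ⊆ q.regs)
    (ha : p.arrays ⊆ q.arrays) (ho : q.silent = true → p.silent = true) : Frame q s s' :=
  ⟨fun x hx => h.reg x fun h' => hx (hr h'), fun A hA => h.mem A fun h' => hA (ha h'),
    fun h' => h.out (ho h')⟩

theorem Frame.seq_left {p q : Prog} {s s' : State} (h : Frame p s s') : Frame (.seq p q) s s' :=
  h.mono (List.subset_append_left ..) (List.subset_append_left ..) fun h' => by
    simp only [Prog.silent, Bool.and_eq_true] at h'; exact h'.1

theorem Frame.seq_right {p q : Prog} {s s' : State} (h : Frame q s s') : Frame (.seq p q) s s' :=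
  h.mono (List.subset_append_right ..) (List.subset_append_right ..) fun h' => by
    simp only [Prog.silent, Bool.and_eq_true] at h'; exact h'.2

/-- What a program can change is read off its text, so that later the preservation of a register or
an array is settled by `decide`. -/
theorem Exec.frame {W : ℕ} {p : Prog} {s s' : State} {t : ℕ} (h : Exec W p s s' t) :
    Frame p s s' := by
  induction h with
  | skip s => exact Frame.refl _ _
  | assign s x e he =>
    refine ⟨fun y hy => ?_, fun _ _ => rfl, fun _ => rfl⟩
    exact Function.update_of_ne (by simpa [Prog.regs] using hy) ..
  | write s A i e hi he =>
    refine ⟨fun _ _ => rfl, fun B hB => ?_, fun _ => rfl⟩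
    exact Function.update_of_ne (by simpa [Prog.arrays] using hB) ..
  | emit s e he => exact ⟨fun _ _ => rfl, fun _ _ => rfl, fun h => by simp [Prog.silent] at h⟩
  | seq p q s s' s'' t t' hp hq ihp ihq => exact ihp.seq_left.trans ihq.seq_right
  | cond_true b p q s s' t hf hb hp ih =>
    exact ih.mono (List.subset_append_left ..) (List.subset_append_left ..) fun h' => by
      simp only [Prog.silent, Bool.and_eq_true] at h'; exact h'.1
  | cond_false b p q s s' t hf hb hp ih =>
    exact ih.mono (List.subset_append_right ..) (List.subset_append_right ..) fun h' => by
      simp only [Prog.silent, Bool.and_eq_true] at h'; exact h'.2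
  | loop_done b p s hf hb => exact Frame.refl _ _
  | loop_step b p s s' s'' t t' hf hb hp hl ihp ihl =>
    exact (ihp.mono (q := .loop b p) (List.Subset.refl _) (List.Subset.refl _) id).trans ihl

/-- Started in `s`, the program `p` halts after at most `t` steps in a state with the
property `Q`, and it handles only words less than `W`. -/
def Spec (W : ℕ) (p : Prog) (s : State) (t : ℕ) (Q : State → Prop) : Prop :=
  ∃ s' t', Exec W p s s' t' ∧ t' ≤ t ∧ Q s'

/-- The weakest precondition of programs without loops. -/
def wp (W : ℕ) : Prog → (State → Prop) → State → Prop
  | .skip, Q, s => Q s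
  | .assign x e, Q, s => e.Fits W s ∧ Q (s.set x (e.val s))
  | .write A i e, Q, s => (i.Fits W s ∧ e.Fits W s) ∧ Q (s.put A (i.val s) (e.val s))
  | .emit e, Q, s => e.Fits W s ∧ Q (s.push (e.val s))
  | .seq p q, Q, s => wp W p (fun s' => wp W q Q s') s
  | .cond b p q, Q, s => b.Fits W s ∧ (b.Holds s → wp W p Q s) ∧ (¬ b.Holds s → wp W q Q s)
  | .loop _ _, _, _ => False

variable {W : ℕ} {p q : Prog} {s : State} {t t' : ℕ} {Q Q' : State → Prop}

theorem Spec.of_wp (h : wp W p Q s) (ht : p.cost ≤ t) : Spec W p s t Q := by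
  suffices h : Spec W p s p.cost Q by
    obtain ⟨s', t', h1, h2, h3⟩ := h
    exact ⟨s', t', h1, h2.trans ht, h3⟩
  clear ht
  induction p generalizing s Q with
  | skip => exact ⟨_, _, .skip s, le_rfl, h⟩
  | assign x e => exact ⟨_, _, .assign s x e h.1, le_rfl, h.2⟩
  | write A i e => exact ⟨_, _, .write s A i e h.1.1 h.1.2, le_rfl, h.2⟩
  | emit e => exact ⟨_, _, .emit s e h.1, le_rfl, h.2⟩
  | seq p q ihp ihq =>
    obtain ⟨s1, t1, h1, h2, h3⟩ := ihp h
    obtain ⟨s2, t2, h1', h2', h3'⟩ := ihq h3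
    exact ⟨s2, _, .seq p q s s1 s2 t1 t2 h1 h1', Nat.add_le_add h2 h2', h3'⟩
  | cond b p q ihp ihq =>
    obtain ⟨hf, hp, hq⟩ := h
    by_cases hb : b.Holds s
    · obtain ⟨s1, t1, h1, h2, h3⟩ := ihp (hp hb)
      exact ⟨s1, _, .cond_true b p q s s1 t1 hf hb h1,
        Nat.add_le_add_left (h2.trans (le_max_left ..)) _, h3⟩
    · obtain ⟨s1, t1, h1, h2, h3⟩ := ihq (hq hb)
      exact ⟨s1, _, .cond_false b p q s s1 t1 hf hb h1,
        Nat.add_le_add_left (h2.trans (le_max_right ..)) _, h3⟩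
  | loop b p ih => exact h.elim

/-- The frame is supplied in the implication, so postconditions and invariants need to speak only of
what changes. -/
theorem Spec.mono (h : Spec W p s t Q) (ht : t ≤ t') (hQ : ∀ s', Frame p s s' → Q s' → Q' s') :
    Spec W p s t' Q' := by
  obtain ⟨s', t1, h1, h2, h3⟩ := h
  exact ⟨s', t1, h1, h2.trans ht, hQ s' h1.frame h3⟩

theorem Spec.seq (hp : Spec W p s t Q) (hq : ∀ s', Frame p s s' → Q s' → Spec W q s' t' Q') {u : ℕ}
    (hu : t + t' ≤ u) : Spec W (.seq p q) s u Q' := by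
  obtain ⟨s1, t1, h1, h2, h3⟩ := hp
  obtain ⟨s2, t2, h1', h2', h3'⟩ := hq s1 h1.frame h3
  exact ⟨s2, _, .seq p q s s1 s2 t1 t2 h1 h1', (Nat.add_le_add h2 h2').trans hu, h3'⟩

theorem Spec.cond {b : Test} (hf : b.Fits W s) (hp : b.Holds s → Spec W p s t Q)
    (hq : ¬ b.Holds s → Spec W q s t Q) {u : ℕ} (hu : b.cost + t ≤ u) :
    Spec W (.cond b p q) s u Q := by
  by_cases hb : b.Holds s
  · obtain ⟨s1, t1, h1, h2, h3⟩ := hp hb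
    exact ⟨s1, _, .cond_true b p q s s1 t1 hf hb h1, (Nat.add_le_add_left h2 _).trans hu, h3⟩
  · obtain ⟨s1, t1, h1, h2, h3⟩ := hq hb
    exact ⟨s1, _, .cond_false b p q s s1 t1 hf hb h1, (Nat.add_le_add_left h2 _).trans hu, h3⟩

/-- A loop with the steps `a, …, b - 1`. -/
theorem Spec.loop {c : Test} {a b : ℕ} (d : ℕ → ℕ) (Inv : ℕ → State → Prop) (hab : a ≤ b)
    (h0 : Inv a s)
    (hstep : ∀ s' k, Frame p s s' → a ≤ k → k < b → Inv k s' →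
      c.Fits W s' ∧ c.Holds s' ∧ Spec W p s' (d k) (Inv (k + 1)))
    (hend : ∀ s', Frame p s s' → Inv b s' → c.Fits W s' ∧ ¬ c.Holds s')
    (ht : (b - a + 1) * c.cost + ∑ k ∈ Finset.Ico a b, d k ≤ t) :
    Spec W (.loop c p) s t (Inv b) := by
  suffices h : ∀ i a s', b - a = i → a ≤ b → Frame p s s' → Inv a s' →
      (∀ s' k, Frame p s s' → a ≤ k → k < b → Inv k s' →
        c.Fits W s' ∧ c.Holds s' ∧ Spec W p s' (d k) (Inv (k + 1))) →
      Spec W (.loop c p) s' ((b - a + 1) * c.cost + ∑ k ∈ Finset.Ico a b, d k) (Inv b) from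
    (h _ a s rfl hab (Frame.refl _ _) h0 hstep).mono ht fun _ _ h => h
  intro i
  induction i with
  | zero =>
    intro a s' hi hab hF hI _
    obtain rfl : a = b := by omega
    obtain ⟨h1, h2⟩ := hend s' hF hI
    exact ⟨s', _, .loop_done c p s' h1 h2, by simp, hI⟩
  | succ i ih =>
    intro a s' hi hab hF hI hstep
    obtain ⟨h1, h2, s1, t1, h3, h4, h5⟩ := hstep s' a hF le_rfl (by omega) hI
    obtain ⟨s2, t2, h6, h7, h8⟩ := ih (a + 1) s1 (by omega) (by omega) (hF.trans h3.frame) h5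
      fun s' k hF hk => hstep s' k hF (by omega)
    refine ⟨s2, _, .loop_step c p s' s1 s2 t1 t2 h1 h2 h3 h6, ?_, h8⟩
    rw [Finset.sum_eq_sum_Ico_succ_bot (by omega)]
    have : b - a + 1 = b - (a + 1) + 1 + 1 := by omega
    rw [this, Nat.add_mul _ 1, Nat.one_mul]
    omega

/-- Repeat `p` while the register `x` is less than `e`, increasing `x` after each step. -/
def Prog.forUpTo (x : ℕ) (e : Exp) (p : Prog) : Prog :=
  .loop (.lt (.reg x) e) (.seq p (.assign x (.add (.reg x) (.const 1))))

/-- Besides the body, a round costs `e.cost + 2` for the test and `4` for the increment. The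
invariant is required in the state after the counter has been increased, hence the `set` in the
hypothesis on the body. -/
theorem Spec.forUpTo {x : ℕ} {e : Exp} {a b : ℕ} (d : ℕ → ℕ) (Inv : ℕ → State → Prop)
    (hab : a ≤ b) (hb : b < W) (hW : 1 < W) (hx : s.reg x = a) (hxp : x ∉ p.regs) (h0 : Inv a s)
    (he : ∀ s' k, Frame (.forUpTo x e p) s s' → k ≤ b → Inv k s' → e.Fits W s' ∧ e.val s' = b)
    (hstep : ∀ s' k, Frame (.forUpTo x e p) s s' → a ≤ k → k < b → s'.reg x = k → Inv k s' →
      Spec W p s' (d k) fun s'' => Inv (k + 1) (s''.set x (k + 1)))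
    (ht : (b - a + 1) * (e.cost + 6) + ∑ k ∈ Finset.Ico a b, d k ≤ t) :
    Spec W (.forUpTo x e p) s t fun s' => s'.reg x = b ∧ Inv b s' := by
  refine Spec.loop (fun k => d k + 4) (fun k s' => s'.reg x = k ∧ Inv k s') hab ⟨hx, h0⟩ ?_ ?_ ?_
  · rintro s' k hF hak hkb ⟨hxk, hI⟩
    replace hF : Frame (.forUpTo x e p) s s' := ⟨hF.reg, hF.mem, hF.out⟩
    obtain ⟨he1, he2⟩ := he s' k hF hkb.le hI
    refine ⟨⟨by simp only [Exp.Fits]; omega, he1⟩, by simp only [Test.Holds, Exp.val]; omega, ?_⟩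
    refine (hstep s' k hF hak hkb hxk hI).seq (t' := 4) ?_ le_rfl
    intro s'' hF' hI'
    have hx'' : s''.reg x = k := (hF'.reg x hxp).trans hxk
    refine Spec.of_wp ?_ (by simp [Prog.cost, Exp.cost])
    simp only [wp, Exp.Fits, Exp.val, hx'', State.set_reg, if_true, true_and]
    exact ⟨by omega, hI'⟩
  · rintro s' hF ⟨hxk, hI⟩
    replace hF : Frame (.forUpTo x e p) s s' := ⟨hF.reg, hF.mem, hF.out⟩
    obtain ⟨he1, he2⟩ := he s' b hF le_rfl hI
    refine ⟨⟨by simp only [Exp.Fits]; omega, he1⟩, by simp only [Test.Holds, Exp.val]; omega⟩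
  · rw [Finset.sum_add_distrib, Finset.sum_const, Nat.card_Ico, smul_eq_mul]
    simp only [Test.cost, Exp.cost]
    refine le_trans ?_ ht
    rw [show e.cost + 6 = 1 + e.cost + 1 + 4 by omega, Nat.mul_add (b - a + 1) _ 4]
    omega

/-! ### Lists in memory -/

/-- The list `l` stands in the cells `p, p + 1, …` of the array `f`. -/
def Seg (f : ℕ → ℕ) : ℕ → List ℕ → Prop
  | _, [] => True
  | p, x :: l => f p = x ∧ Seg f (p + 1) l

theorem seg_append {f : ℕ → ℕ} {p : ℕ} {l l' : List ℕ} :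
    Seg f p (l ++ l') ↔ Seg f p l ∧ Seg f (p + l.length) l' := by
  induction l generalizing p with
  | nil => simp [Seg]
  | cons x l ih =>
    simp only [List.cons_append, Seg, ih, List.length_cons, and_assoc]
    rw [show p + (l.length + 1) = p + 1 + l.length by omega]

theorem seg_iff {f : ℕ → ℕ} {p : ℕ} {l : List ℕ} :
    Seg f p l ↔ ∀ i (h : i < l.length), f (p + i) = l[i] := by
  induction l generalizing p with
  | nil => simp [Seg]
  | cons x l ih =>
    rw [Seg, ih]
    constructor
    · rintro ⟨h1, h2⟩ (_ | i) hi
      · exact h1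
      · rw [show p + (i + 1) = p + 1 + i by omega]
        exact h2 i (by simpa using hi)
    · intro h
      refine ⟨h 0 (by simp), fun i hi => ?_⟩
      rw [show p + 1 + i = p + (i + 1) by omega]
      exact h (i + 1) (by simpa using hi)

theorem Seg.get {f : ℕ → ℕ} {p : ℕ} {l : List ℕ} (h : Seg f p l) {i : ℕ} (hi : i < l.length) :
    f (p + i) = l[i] := seg_iff.1 h i hi

theorem Seg.get_zero {f : ℕ → ℕ} {l : List ℕ} (h : Seg f 0 l) {i : ℕ} (hi : i < l.length) :
    f i = l[i] := by simpa using h.get hi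

theorem Seg.update {f : ℕ → ℕ} {p i v : ℕ} {l : List ℕ} (h : Seg f p l)
    (hi : i < p ∨ p + l.length ≤ i) : Seg (Function.update f i v) p l := by
  rw [seg_iff] at h ⊢
  intro j hj
  rw [Function.update_of_ne (by omega), h j hj]

theorem Seg.snoc {f : ℕ → ℕ} {p i v : ℕ} {l : List ℕ} (h : Seg f p l) (hi : i = p + l.length) :
    Seg (Function.update f i v) p (l ++ [v]) := by
  subst hi
  exact seg_append.2 ⟨h.update (Or.inr le_rfl), by simp [Seg]⟩

end RAM
end BlockCrossing

/-! ### Computing the ranks of the strands of one edge. -/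

namespace BlockCrossing

theorem Sorting.below_append (D : List ℕ) (key : ℕ → ℕ) (t y : ℕ) :
    below (D ++ [y]) key t = below D key t + if 0 < key y ∧ key y ≤ t then 1 else 0 := by
  simp [below, List.countP_append, List.countP_cons]

theorem Sorting.moved_append (D : List ℕ) (key : ℕ → ℕ) (P x y : ℕ) :
    moved (D ++ [y]) key P x = (moved D key P x ||
      decide (key y < key x ∧ if key x ≤ P then y < x else x < y)) := by
  unfold moved
  split_ifs <;> simp [or_and_right, exists_or]

namespace RAM

open Sorting

local infixr:60 " ;; " => Prog.seq

/-- Computes the rank of `D[i]` in register 17 and the indicator of `moved` in register 18.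
Array 11 holds `D`, array 12 the keys, register 10 the length of `D`, register 3 the bound for
left keys. -/
def rankBody : Prog :=
  .cond (.lt (.const 0) (.read 12 (.reg 16)))
    (.cond (.lt (.read 12 (.reg 24)) (.read 12 (.reg 16))) .skip
      (.assign 17 (.add (.reg 17) (.const 1)))) .skip ;;
  .cond (.lt (.read 12 (.reg 16)) (.read 12 (.reg 24)))
    (.cond (.lt (.reg 3) (.read 12 (.reg 24)))
      (.cond (.lt (.read 11 (.reg 24)) (.read 11 (.reg 16))) (.assign 18 (.const 1)) .skip)
      (.cond (.lt (.read 11 (.reg 16)) (.read 11 (.reg 24))) (.assign 18 (.const 1)) .skip)) .skip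

def rankInner : Prog := .assign 16 (.const 0) ;; .forUpTo 16 (.reg 10) rankBody

/-- For all `i`: the rank of `D[i]` goes to array 13, and for positive keys `D[i]` and the indicator
of `moved` go to the cell given by the rank in the arrays 15 and 14. -/
def ranks : Prog :=
  .assign 24 (.const 0) ;; .forUpTo 24 (.reg 10)
    (.assign 17 (.const 0) ;; .assign 18 (.const 0) ;;
      .cond (.lt (.const 0) (.read 12 (.reg 24)))
        (rankInner ;; .write 14 (.reg 17) (.reg 18) ;; .write 15 (.reg 17) (.read 11 (.reg 24))) .skip ;;
      .write 13 (.reg 24) (.reg 17))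

/-- The list `D` with its keys is in memory. -/
structure Table (W : ℕ) (D : List ℕ) (key : ℕ → ℕ) (P : ℕ) (s : State) : Prop where
  list : Seg (s.mem 11) 0 D
  keys : Seg (s.mem 12) 0 (D.map key)
  length : s.reg 10 = D.length
  bound : s.reg 3 = P
  length_lt : D.length + 1 < W
  bound_lt : P + 1 < W
  lt : ∀ x ∈ D, x < W ∧ key x < W

theorem Table.congr {W : ℕ} {D : List ℕ} {key : ℕ → ℕ} {P : ℕ} {s s' : State}
    (h : Table W D key P s) (h1 : s'.mem 11 = s.mem 11) (h2 : s'.mem 12 = s.mem 12)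
    (h3 : s'.reg 10 = s.reg 10) (h4 : s'.reg 3 = s.reg 3) : Table W D key P s' :=
  ⟨h1 ▸ h.list, h2 ▸ h.keys, h3.trans h.length, h4.trans h.bound, h.length_lt, h.bound_lt, h.lt⟩

theorem Table.get {W : ℕ} {D : List ℕ} {key : ℕ → ℕ} {P : ℕ} {s : State} (h : Table W D key P s)
    {i : ℕ} (hi : i < D.length) : s.mem 11 i = D[i] ∧ s.mem 12 i = key D[i] ∧ D[i] < W ∧
      key D[i] < W := by
  refine ⟨h.list.get_zero hi, ?_, h.lt _ (List.getElem_mem _)⟩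
  rw [h.keys.get_zero (by simpa using hi), List.getElem_map]

variable {W : ℕ} {D : List ℕ} {key : ℕ → ℕ} {P : ℕ} {s : State}

theorem rankInner_spec (hT : Table W D key P s) {i : ℕ} (hi : i < D.length) (hr : s.reg 24 = i)
    (h17 : s.reg 17 = 0) (h18 : s.reg 18 = 0) :
    Spec W rankInner s (40 * D.length + 20) fun s' => s'.reg 17 = rank D key D[i] ∧
      s'.reg 18 = if moved D key P D[i] then 1 else 0 := by
  obtain ⟨hi1, hi2, hi3, hi4⟩ := hT.get hi
  have hL := hT.length_lt
  have hP := hT.bound_lt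
  unfold rankInner
  refine Spec.seq (t := 2) (t' := 40 * D.length + 18)
    (Q := fun s' => s'.reg 16 = 0 ∧ s'.reg 17 = 0 ∧ s'.reg 18 = 0)
    (Spec.of_wp (by simp [wp, Exp.Fits, Exp.val, State.set_reg, h17, h18]; omega)
      (by simp [Prog.cost, Exp.cost])) ?_ (by omega)
  rintro s1 F1 ⟨h1, h2, h3⟩
  replace hT := hT.congr (F1.mem 11 (by decide)) (F1.mem 12 (by decide)) (F1.reg 10 (by decide))
    (F1.reg 3 (by decide))
  replace hr := (F1.reg 24 (by decide)).trans hr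
  rw [← F1.mem 11 (by decide)] at hi1
  rw [← F1.mem 12 (by decide)] at hi2
  refine (Spec.forUpTo (a := 0) (b := D.length) (fun _ => 32)
    (fun j s' => s'.reg 17 = below (D.take j) key (key D[i]) ∧
      s'.reg 18 = if moved (D.take j) key P D[i] then 1 else 0)
    (Nat.zero_le _) (by omega) (by omega) h1 (by decide) ?_ ?_ ?_ le_rfl).mono ?_ ?_
  · simp [h2, h3, below, moved]
  · intro s' k F hk hI
    have := (F.reg 10 (by decide)).trans hT.length
    exact ⟨by simp only [Exp.Fits]; omega, this⟩
  · rintro s' j F - hj h16 ⟨hI1, hI2⟩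
    replace hT := hT.congr (F.mem 11 (by decide)) (F.mem 12 (by decide)) (F.reg 10 (by decide))
      (F.reg 3 (by decide))
    replace hr := (F.reg 24 (by decide)).trans hr
    rw [← F.mem 11 (by decide)] at hi1
    rw [← F.mem 12 (by decide)] at hi2
    obtain ⟨hj1, hj2, hj3, hj4⟩ := hT.get hj
    have hb : below (D.take j) key (key D[i]) ≤ D.length :=
      List.countP_le_length.trans (by simp)
    have h3 := hT.bound
    rw [← List.take_concat_get' _ _ hj, below_append, moved_append]
    generalize below (D.take j) key (key D[i]) = r at *
    generalize moved (D.take j) key P D[i] = v at *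
    generalize key D[i] = kx at *
    generalize key D[j] = ky at *
    generalize D[i] = x at *
    generalize D[j] = y at *
    refine Spec.of_wp ?_ (by decide)
    simp only [rankBody, wp, Exp.Fits, Exp.val, Test.Fits, Test.Holds, State.set_reg, State.set_mem,
      h16, hr, hi1, hi2, hj1, hj2, h3, hI1, hI2]
    cases v <;> simp [hi1, hi2, hj1, hj2] <;> (try split_ifs) <;> omega
  · simp [Exp.cost]; omega
  · rintro s' - ⟨-, h⟩
    rw [List.take_length] at h
    exact h

/-- Charges the cost `c` of the inner scan only to the elements that need it. -/
theorem sum_countP (p : ℕ → Bool) (c : ℕ) (D : List ℕ) :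
    ∑ i ∈ Finset.range D.length, (if p (D.getD i 0) then c else 0) = D.countP p * c := by
  induction D with
  | nil => simp
  | cons x D ih =>
    rw [List.length_cons, Finset.sum_range_succ', List.countP_cons, Nat.add_mul, ← ih]
    simp

/-- Only an element with a positive key causes a scan of the whole list, so the time is the length
times the number of new strands and not the square of the length. Positive keys have distinct ranks,
so no cell of the arrays 14 and 15 in use is overwritten. -/
theorem ranks_spec {M : ℕ} (hT : Table W D key P s) (hG : Good D key M) :
    Spec W ranks s (80 * (D.length + 1) * (numNew D key + 1)) fun s' =>
      Seg (s'.mem 13) 0 (D.map (rank D key)) ∧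
      ∀ t, 1 ≤ t → t ≤ numNew D key → s'.mem 15 t = atRank D key t ∧
        s'.mem 14 t = if moved D key P (atRank D key t) then 1 else 0 := by
  have hL := hT.length_lt
  have hP := hT.bound_lt
  unfold ranks
  refine Spec.seq (t := 2) (t' := 80 * (D.length + 1) * (numNew D key + 1) - 2)
    (Q := fun s' => s'.reg 24 = 0)
    (Spec.of_wp (by simp [wp, Exp.Fits, Exp.val, State.set_reg]; omega)
      (by simp [Prog.cost, Exp.cost])) ?_ ?_
  swap
  · have : 0 < (D.length + 1) * (numNew D key + 1) := by positivity
    rw [Nat.mul_assoc]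
    omega
  rintro s1 F1 h1
  replace hT := hT.congr (F1.mem 11 (by decide)) (F1.mem 12 (by decide)) (F1.reg 10 (by decide))
    (F1.reg 3 (by decide))
  refine (Spec.forUpTo (a := 0) (b := D.length)
    (fun i => 20 + if 0 < key (D.getD i 0) then 40 * D.length + 40 else 0)
    (fun i s' => Seg (s'.mem 13) 0 ((D.take i).map (rank D key)) ∧
      ∀ x ∈ D.take i, 0 < key x → s'.mem 15 (rank D key x) = x ∧
        s'.mem 14 (rank D key x) = if moved D key P x then 1 else 0)
    (Nat.zero_le _) (by omega) (by omega) h1 (by decide) ?_ ?_ ?_ le_rfl).mono ?_ ?_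
  · simp [Seg]
  · intro s' k F hk hI
    have := (F.reg 10 (by decide)).trans hT.length
    exact ⟨by simp only [Exp.Fits]; omega, this⟩
  · rintro s' i F - hi h24 ⟨hI1, hI2⟩
    replace hT := hT.congr (F.mem 11 (by decide)) (F.mem 12 (by decide)) (F.reg 10 (by decide))
      (F.reg 3 (by decide))
    have hg : D.getD i 0 = D[i] := List.getD_eq_getElem _ _ hi
    have hx : D[i] ∈ D := List.getElem_mem hi
    have hrk : rank D key D[i] ≤ D.length := List.countP_le_length
    rw [hg]
    refine Spec.seq (t := 2) (Q := fun s' => s'.reg 17 = 0)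
      (Spec.of_wp (by simp [wp, Exp.Fits, Exp.val, State.set_reg]; omega)
        (by simp [Prog.cost, Exp.cost])) ?_ (t' := 18 + if 0 < key D[i] then 40 * D.length + 40 else 0)
      (by omega)
    intro s2 F2 h17
    refine Spec.seq (t := 2) (Q := fun s' => s'.reg 18 = 0)
      (Spec.of_wp (by simp [wp, Exp.Fits, Exp.val, State.set_reg]; omega)
        (by simp [Prog.cost, Exp.cost])) ?_ (t' := 16 + if 0 < key D[i] then 40 * D.length + 40 else 0)
      (by omega)
    intro s3 F3 h18
    replace h17 := (F3.reg 17 (by decide)).trans h17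
    replace hT := hT.congr ((F3.mem 11 (by decide)).trans (F2.mem 11 (by decide)))
      ((F3.mem 12 (by decide)).trans (F2.mem 12 (by decide)))
      ((F3.reg 10 (by decide)).trans (F2.reg 10 (by decide)))
      ((F3.reg 3 (by decide)).trans (F2.reg 3 (by decide)))
    replace h24 : s3.reg 24 = i := by rw [F3.reg 24 (by decide), F2.reg 24 (by decide), h24]
    have e13 : s3.mem 13 = s'.mem 13 := by rw [F3.mem 13 (by decide), F2.mem 13 (by decide)]
    have e14 : s3.mem 14 = s'.mem 14 := by rw [F3.mem 14 (by decide), F2.mem 14 (by decide)]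
    have e15 : s3.mem 15 = s'.mem 15 := by rw [F3.mem 15 (by decide), F2.mem 15 (by decide)]
    rw [← e13] at hI1
    rw [← e14, ← e15] at hI2
    clear e13 e14 e15 F2 F3
    obtain ⟨hi1, hi2, hi3, hi4⟩ := hT.get hi
    refine Spec.seq (t := 8 + if 0 < key D[i] then 40 * D.length + 40 else 0) (t' := 8)
      (Q := fun s' => s'.reg 17 = rank D key D[i] ∧
        ∀ x ∈ D.take (i + 1), 0 < key x → s'.mem 15 (rank D key x) = x ∧
        s'.mem 14 (rank D key x) = if moved D key P x then 1 else 0) ?_ ?_ (by omega)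
    · refine Spec.cond (t := 2 + if 0 < key D[i] then 40 * D.length + 40 else 0) ?_ ?_ ?_ ?_
      · simp only [Test.Fits, Exp.Fits, Exp.val, h24, hi2]; omega
      · intro hh
        simp only [Test.Holds, Exp.val, h24, hi2] at hh
        rw [if_pos hh]
        refine (rankInner_spec hT hi h24 h17 h18).seq (t' := 12) ?_ (by omega)
        rintro s4 F4 ⟨h1, h2⟩
        rw [← F4.mem 14 (by decide), ← F4.mem 15 (by decide)] at hI2
        rw [← F4.mem 11 (by decide)] at hi1
        rw [← F4.reg 24 (by decide)] at h24
        refine Spec.of_wp ?_ (by decide)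
        simp only [wp, Exp.Fits, Exp.val, h1, h2, h24, State.put_mem, State.put_reg]
        simp [hi1]
        refine ⟨⟨by omega, by split_ifs <;> omega⟩, by omega, ?_⟩
        intro x hx' h0
        rw [← List.take_concat_get' _ _ hi, List.mem_append, List.mem_singleton] at hx'
        by_cases hxi : x = D[i]
        · subst hxi
          rw [Function.update_self, Function.update_self]
          exact ⟨rfl, rfl⟩
        · have hxD := List.mem_of_mem_take (hx'.resolve_right hxi)
          have hne : rank D key x ≠ rank D key D[i] := fun h =>
            hxi (hG.eq_of_rank_eq hxD hx hh h)
          rw [Function.update_of_ne hne, Function.update_of_ne hne]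
          exact hI2 x (hx'.resolve_right hxi) h0
      · intro hh
        simp only [Test.Holds, Exp.val, h24, hi2] at hh
        refine Spec.of_wp ?_ (by simp [Prog.cost]; omega)
        refine ⟨by rw [h17, rank_eq_zero (by omega)], fun x hx' h0 => ?_⟩
        rw [← List.take_concat_get' _ _ hi, List.mem_append, List.mem_singleton] at hx'
        exact hI2 x (hx'.resolve_right fun h => hh (h ▸ h0)) h0
      · simp only [Test.cost, Exp.cost]; omega
    · rintro s4 F4 ⟨h1, h2⟩
      rw [← F4.mem 13 (by decide)] at hI1
      rw [← F4.reg 24 (by decide)] at h24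
      refine Spec.of_wp ?_ (by decide)
      simp only [wp, Exp.Fits, Exp.val, h1, h24, State.put_mem, State.set_mem]
      simp only [Nat.reduceEqDiff, if_false, if_true]
      refine ⟨by omega, ?_, h2⟩
      rw [← List.take_concat_get' _ _ hi, List.map_append]
      exact hI1.snoc (by simp; omega)
  · rw [Finset.sum_add_distrib, Nat.Ico_zero_eq_range, Finset.sum_const, Finset.card_range,
      smul_eq_mul]
    have := sum_countP (fun y => 0 < key y) (40 * D.length + 40) D
    simp only [decide_eq_true_eq] at this
    rw [this]
    simp only [Exp.cost, Nat.sub_zero]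
    unfold numNew
    generalize (List.countP _ _) = q
    have : 80 * (D.length + 1) * (q + 1) = 80 * (D.length * q) + 80 * D.length + 80 * q + 80 := by ring
    have h2 : q * (40 * D.length + 40) = 40 * (D.length * q) + 40 * q := by ring
    omega
  · rintro s' - ⟨-, h1, h2⟩
    rw [List.take_length] at h1 h2
    refine ⟨h1, fun t ht1 ht2 => ?_⟩
    obtain ⟨h3, h4, h5⟩ := hG.atRank_spec ht1 ht2
    have := h2 _ h3 h4
    rwa [h5] at this

end RAM
end BlockCrossing

/-! ### Writing out the orders of one edge. -/

namespace BlockCrossing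

theorem Sorting.Good.length_order {D : List ℕ} {key : ℕ → ℕ} {P M : ℕ} (hG : Good D key M) (k : ℕ) :
    (order D key P k).length = D.length :=
  ((List.perm_ext_iff_of_nodup (hG.nodup_order k) hG.nodup).2 fun _ => hG.mem_order).length_eq

theorem Sorting.numNew_le {D : List ℕ} {key : ℕ → ℕ} : numNew D key ≤ D.length :=
  List.countP_le_length

namespace RAM

open Sorting

local infixr:60 " ;; " => Prog.seq

/-- Emits the number of orders. The indicators of `moved` are in array 14, register 12 holds the
number of new lines. -/
def emitCount : Prog :=
  .assign 19 (.const 1) ;; .assign 22 (.const 1) ;;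
  .forUpTo 22 (.add (.reg 12) (.const 1)) (.assign 19 (.add (.reg 19) (.read 14 (.reg 22)))) ;;
  .emit (.reg 19)

/-- Appends the line of the line end `e` to the buffer in array 16, whose length is in
register 23. -/
def append (e : Exp) : Prog :=
  .write 16 (.reg 23) (.read 8 e) ;; .assign 23 (.add (.reg 23) (.const 1))

/-- Register 22 runs downwards, because on the left the largest rank stands outermost. -/
def fillLeft : Prog :=
  .loop (.lt (.reg 21) (.reg 22)) (append (.read 15 (.reg 22)) ;; .assign 22 (.sub (.reg 22) (.const 1)))

def fillMiddle : Prog :=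
  .forUpTo 24 (.reg 10) (.cond (.lt (.reg 21) (.read 13 (.reg 24))) .skip (append (.read 11 (.reg 24))))

def fillRight : Prog :=
  .forUpTo 22 (.add (.reg 12) (.const 1)) (append (.read 15 (.reg 22)))

/-- Writes the lines in the order number `k`, for `k` in register 21, to the buffer. -/
def fill : Prog :=
  (.assign 23 (.const 0) ;; .assign 24 (.const 0) ;; .assign 22 (.reg 11)) ;; fillLeft ;; fillMiddle ;;
  (.cond (.lt (.reg 21) (.reg 11)) (.assign 22 (.add (.reg 11) (.const 1)))
    (.assign 22 (.add (.reg 21) (.const 1)))) ;; fillRight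

/-- Emits the buffer, backwards if register 5 is not zero. -/
def emitBuffer : Prog :=
  (.emit (.reg 23) ;; .assign 24 (.const 0)) ;;
  .forUpTo 24 (.reg 23) (.cond (.eq (.reg 5) (.const 0)) (.emit (.read 16 (.reg 24)))
    (.emit (.read 16 (.sub (.sub (.reg 23) (.const 1)) (.reg 24)))))

/-- Emits all orders, backwards if register 5 is not zero. -/
def emitOrders : Prog :=
  .assign 20 (.const 0) ;;
  .forUpTo 20 (.add (.reg 12) (.const 1))
    ((.cond (.eq (.reg 5) (.const 0)) (.assign 21 (.reg 20)) (.assign 21 (.sub (.reg 12) (.reg 20)))) ;;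
    .cond (.lt (.const 0) (.read 14 (.reg 21))) (fill ;; emitBuffer) .skip)

/-- The list `D` with keys, ranks and lines is in memory. -/
structure Ranked (W : ℕ) (D : List ℕ) (key : ℕ → ℕ) (P : ℕ) (ln : ℕ → ℕ) (s : State) : Prop where
  table : Table W D key P s
  ranks : Seg (s.mem 13) 0 (D.map (rank D key))
  numLeft : s.reg 11 = numLeft D key P
  numNew : s.reg 12 = numNew D key
  atRank : ∀ t, 1 ≤ t → t ≤ Sorting.numNew D key → s.mem 15 t = Sorting.atRank D key t
  moved : ∀ t, 1 ≤ t → t ≤ Sorting.numNew D key →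
    s.mem 14 t = if moved D key P (Sorting.atRank D key t) then 1 else 0
  moved_zero : s.mem 14 0 = 1
  line : ∀ x ∈ D, s.mem 8 x = ln x ∧ ln x < W

variable {W : ℕ} {D : List ℕ} {key : ℕ → ℕ} {P M : ℕ} {ln : ℕ → ℕ} {s : State}

theorem Ranked.frame {p : Prog} {s' : State} (h : Ranked W D key P ln s) (F : Frame p s s')
    (hr : ∀ x ∈ [3, 10, 11, 12], x ∉ p.regs) (ha : ∀ A ∈ [8, 11, 12, 13, 14, 15], A ∉ p.arrays) :
    Ranked W D key P ln s' := by
  obtain ⟨h1, h2, h3, h4, h5, h6, h7, h8⟩ := h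
  refine ⟨h1.congr (F.mem _ (ha _ (by decide))) (F.mem _ (ha _ (by decide)))
    (F.reg _ (hr _ (by decide))) (F.reg _ (hr _ (by decide))), ?_, ?_, ?_, ?_, ?_, ?_, ?_⟩
  · rwa [F.mem _ (ha _ (by decide))]
  · rwa [F.reg _ (hr _ (by decide))]
  · rwa [F.reg _ (hr _ (by decide))]
  · rwa [F.mem _ (ha _ (by decide))]
  · rwa [F.mem _ (ha _ (by decide))]
  · rwa [F.mem _ (ha _ (by decide))]
  · rwa [F.mem _ (ha _ (by decide))]

theorem emitCount_spec (hR : Ranked W D key P ln s) :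
    Spec W emitCount s (30 * (D.length + 1)) fun s' =>
      s'.out = s.out ++ [(orders D key P).length] := by
  have hL := hR.table.length_lt
  have hq : numNew D key ≤ D.length := numNew_le
  -- The running count is expressed as the length of a sieve with trivial values; it starts at one
  -- for the initial order, which is always kept.
  have hlen : ∀ t, (sieve (fun _ => ()) (fun k => moved D key P (atRank D key k)) t).length ≤ t + 1 := by
    intro t
    rw [length_sieve]
    have := List.countP_le_length (p := fun k => moved D key P (atRank D key (k + 1))) (l := List.range t)
    rw [List.length_range] at this
    omega
  refine Spec.seq (t := 2) (t' := 30 * D.length + 28) (Q := fun s' => s'.reg 19 = 1)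
    (Spec.of_wp (by simp [wp, Exp.Fits, Exp.val, State.set_reg]; omega)
      (by simp [Prog.cost, Exp.cost])) ?_ (by omega)
  intro s1 F1 h19
  replace hR := hR.frame F1 (by decide) (by decide)
  refine Spec.seq (t := 2) (t' := 30 * D.length + 26) (Q := fun s' => s'.reg 22 = 1)
    (Spec.of_wp (by simp [wp, Exp.Fits, Exp.val, State.set_reg]; omega)
      (by simp [Prog.cost, Exp.cost])) ?_ (by omega)
  intro s2 F2 h22
  replace hR := hR.frame F2 (by decide) (by decide)
  rw [← F2.reg 19 (by decide)] at h19
  have ho : s2.out = s.out := (F2.out rfl).trans (F1.out rfl)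
  refine Spec.seq (t := 20 * D.length + 20) (t' := 2) (Spec.forUpTo (a := 1) (b := numNew D key + 1)
    (fun _ => 5) (fun t s' => s'.reg 19 =
      (sieve (fun _ => ()) (fun k => moved D key P (atRank D key k)) (t - 1)).length)
    (by omega) (by omega) (by omega) h22 (by decide) ?_ ?_ ?_ ?_) ?_ (by omega)
  · rw [sieve_zero]; exact h19
  · intro s' k F hk hI
    have := (hR.frame F (by decide) (by decide)).numNew
    exact ⟨by simp only [Exp.Fits, Exp.val]; omega, by simp only [Exp.val]; omega⟩
  · intro s' k F hk1 hk2 hk hI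
    have hm := (hR.frame F (by decide) (by decide)).moved k hk1 (by omega)
    have h1 := hlen (k - 1)
    refine Spec.of_wp ?_ (by decide)
    obtain ⟨j, rfl⟩ : ∃ j, k = j + 1 := ⟨k - 1, by omega⟩
    simp only [wp, Exp.Fits, Exp.val, State.set_reg, hm, hk, hI, Nat.add_sub_cancel, sieve_succ] at h1 ⊢
    refine ⟨⟨by omega, ⟨by omega, ?_⟩, ?_⟩, ?_⟩ <;> split_ifs <;>
      (try simp only [List.length_append, List.length_cons, List.length_nil]) <;> omega
  · simp [Exp.cost]; omega
  · rintro s3 F3 ⟨-, h3⟩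
    have h1 := hlen (numNew D key)
    rw [Nat.add_sub_cancel] at h3
    refine Spec.of_wp ?_ (by decide)
    simp only [wp, Exp.Fits, Exp.val, State.push_out]
    rw [h3, F3.out rfl, ho]
    refine ⟨by omega, ?_⟩
    rw [orders, length_sieve, length_sieve]

/-- The buffer in array 16. -/
def Buffer (s : State) (l : List ℕ) : Prop := Seg (s.mem 16) 0 l ∧ s.reg 23 = l.length

theorem append_spec {e : Exp} {l : List ℕ} {x : ℕ} (hB : Buffer s l) (he : e.Fits W s)
    (hx : e.val s = x) (hl : s.mem 8 x = ln x ∧ ln x < W) (hW : l.length + 1 < W) {t : ℕ}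
    (ht : e.cost + 7 ≤ t) :
    Spec W (append e) s t fun s' => Buffer s' (l ++ [ln x]) := by
  obtain ⟨h1, h2⟩ := hB
  refine Spec.of_wp ?_ (le_trans ?_ ht)
  · simp only [append, wp, Exp.Fits, Exp.val, hx, hl.1, h2, State.put_reg, State.set_reg, State.put_mem,
      State.set_mem, Buffer, if_true]
    exact ⟨⟨by omega, he, hl.2⟩, by omega, h1.snoc (by simp), by simp⟩
  · simp only [append, Prog.cost, Exp.cost]; omega

theorem fillLeft_spec (hR : Ranked W D key P ln s) (hG : Good D key M) {k : ℕ} (hk : s.reg 21 = k)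
    (hkW : k < W) (h22 : s.reg 22 = numLeft D key P) (hB : Buffer s []) :
    Spec W fillLeft s (20 * D.length + 20) fun s' => Buffer s'
      (((List.range' (k + 1) (numLeft D key P - k)).reverse.map (atRank D key)).map ln) := by
  have hL := hR.table.length_lt
  have hq : numNew D key ≤ D.length := numNew_le
  have hp : numLeft D key P ≤ numNew D key := numLeft_le
  generalize hpp : numLeft D key P = p at *
  refine (Spec.loop (a := 0) (b := p - k) (fun _ => 14)
    (fun j s' => s'.reg 22 = p - j ∧
      Buffer s' (((List.range j).map fun j => atRank D key (p - j)).map ln))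
    (by omega) ⟨h22, hB⟩ ?_ ?_ ?_).mono le_rfl ?_
  · rintro s' j F - hj ⟨h1, h2⟩
    replace hR := hR.frame F (by decide) (by decide)
    have h21 := (F.reg 21 (by decide)).trans hk
    refine ⟨by simp only [Test.Fits, Exp.Fits]; omega, by simp only [Test.Holds, Exp.val]; omega, ?_⟩
    have hat := hR.atRank (p - j) (by omega) (by omega)
    obtain ⟨hmem, -, -⟩ := hG.atRank_spec (t := p - j) (by omega) (by omega)
    refine Spec.seq (t := 10) (t' := 4) (append_spec (x := atRank D key (p - j)) h2 ?_ ?_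
      (hR.line _ hmem) ?_ ?_) ?_ le_rfl
    · simp only [Exp.Fits, Exp.val, h1, hat]
      exact ⟨by omega, (hR.table.lt _ hmem).1⟩
    · simp only [Exp.val, h1, hat]
    · simp; omega
    · decide
    · intro s'' F'' hB''
      rw [← F''.reg 22 (by decide)] at h1
      refine Spec.of_wp ?_ (by decide)
      simp only [wp, Exp.Fits, Exp.val, State.set_reg, State.set_mem, Buffer, h1, List.range_succ,
        List.map_append]
      exact ⟨by omega, by simp; omega, hB''.1, by simpa using hB''.2⟩
  · rintro s' F ⟨h1, h2⟩
    have h21 := (F.reg 21 (by decide)).trans hk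
    exact ⟨by simp only [Test.Fits, Exp.Fits]; omega, by simp only [Test.Holds, Exp.val]; omega⟩
  · simp [Test.cost, Exp.cost]; omega
  · rintro s' - ⟨-, h⟩
    have : (List.range' (k + 1) (p - k)).reverse.map (atRank D key) =
        (List.range (p - k)).map fun j => atRank D key (p - j) := by
      rw [List.reverse_range', List.map_map]
      refine List.map_congr_left fun j hj => ?_
      rw [List.mem_range] at hj
      exact congrArg (atRank D key) (by dsimp only; omega)
    rwa [this]

theorem fillMiddle_spec (hR : Ranked W D key P ln s) {k : ℕ} (hk : s.reg 21 = k)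
    (hkW : k < W) (h24 : s.reg 24 = 0) {A : List ℕ} (hB : Buffer s A)
    (hA : A.length + (D.filter fun y => rank D key y ≤ k).length + 1 < W) :
    Spec W fillMiddle s (30 * D.length + 20) fun s' => Buffer s'
      (A ++ (D.filter fun y => rank D key y ≤ k).map ln) := by
  have hL := hR.table.length_lt
  refine (Spec.forUpTo (a := 0) (b := D.length) (fun _ => 20)
    (fun i s' => Buffer s' (A ++ ((D.take i).filter fun y => rank D key y ≤ k).map ln))
    (Nat.zero_le _) (by omega) (by omega) h24 (by decide) ?_ ?_ ?_ le_rfl).mono ?_ ?_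
  · simpa using hB
  · intro s' i F hi hI
    have := (hR.frame F (by decide) (by decide)).table.length
    exact ⟨by simp only [Exp.Fits]; omega, this⟩
  · rintro s' i F - hi h24 hI
    replace hR := hR.frame F (by decide) (by decide)
    have h21 := (F.reg 21 (by decide)).trans hk
    obtain ⟨hi1, hi2, hi3, hi4⟩ := hR.table.get hi
    have hr : s'.mem 13 i = rank D key D[i] := by
      rw [hR.ranks.get_zero (by simpa using hi), List.getElem_map]
    have hrk : rank D key D[i] ≤ D.length := List.countP_le_length
    have hlen : ((D.take i).filter fun y => rank D key y ≤ k).length ≤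
        (D.filter fun y => rank D key y ≤ k).length :=
      ((List.take_sublist i D).filter _).length_le
    have key : Spec W (.cond (.lt (.reg 21) (.read 13 (.reg 24))) .skip (append (.read 11 (.reg 24))))
        s' 20 fun s'' =>
        Buffer s'' (A ++ ((D.take (i + 1)).filter fun y => rank D key y ≤ k).map ln) := by
      rw [← List.take_concat_get' _ _ hi, List.filter_append, List.map_append, ← List.append_assoc]
      refine Spec.cond (t := 10) ?_ ?_ ?_ (by decide)
      · simp only [Test.Fits, Exp.Fits, Exp.val, h24, hr]; omega
      · intro h
        simp only [Test.Holds, Exp.val, h24, hr, h21] at h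
        rw [List.filter_singleton, decide_eq_false (by omega)]
        exact Spec.of_wp (by simpa [wp] using hI) (by decide)
      · intro h
        simp only [Test.Holds, Exp.val, h24, hr, h21] at h
        rw [List.filter_singleton, decide_eq_true (by omega)]
        refine append_spec (x := D[i]) hI ?_ ?_ (hR.line _ (List.getElem_mem _)) ?_ (by decide)
        · simp only [Exp.Fits, Exp.val, h24, hi1]; omega
        · simp only [Exp.val, h24, hi1]
        · rw [List.length_append, List.length_map]
          omega
    refine key.mono le_rfl fun s'' _ h => ?_
    exact ⟨h.1, h.2⟩
  · simp [Exp.cost]; omega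
  · rintro s' - ⟨-, h⟩
    rwa [List.take_length] at h

theorem fillRight_spec (hR : Ranked W D key P ln s) (hG : Good D key M) {a : ℕ}
    (h22 : s.reg 22 = a + 1) (haq : a ≤ numNew D key) {A : List ℕ} (hB : Buffer s A)
    (hA : A.length + (numNew D key - a) + 1 < W) :
    Spec W fillRight s (30 * D.length + 20) fun s' => Buffer s'
      (A ++ ((List.range' (a + 1) (numNew D key - a)).map (atRank D key)).map ln) := by
  have hL := hR.table.length_lt
  have hq : numNew D key ≤ D.length := numNew_le
  refine (Spec.forUpTo (a := a + 1) (b := numNew D key + 1) (fun _ => 20)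
    (fun t s' => Buffer s' (A ++ ((List.range' (a + 1) (t - (a + 1))).map (atRank D key)).map ln))
    (by omega) (by omega) (by omega) h22 (by decide) ?_ ?_ ?_ le_rfl).mono ?_ ?_
  · simpa using hB
  · intro s' i F hi hI
    have := (hR.frame F (by decide) (by decide)).numNew
    exact ⟨by simp only [Exp.Fits, Exp.val]; omega, by simp only [Exp.val]; omega⟩
  · rintro s' t F ht1 ht2 h22 hI
    replace hR := hR.frame F (by decide) (by decide)
    have hat := hR.atRank t (by omega) (by omega)
    obtain ⟨hmem, -, -⟩ := hG.atRank_spec (t := t) (by omega) (by omega)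
    refine (append_spec (x := atRank D key t) (ln := ln) hI ?_ ?_ (hR.line _ hmem) ?_
      (by decide)).mono le_rfl ?_
    · simp only [Exp.Fits, Exp.val, h22, hat]
      exact ⟨by omega, (hR.table.lt _ hmem).1⟩
    · simp only [Exp.val, h22, hat]
    · simp; omega
    · intro s'' _ h
      rw [show t + 1 - (a + 1) = t - (a + 1) + 1 by omega, List.range'_1_concat, List.map_append,
        List.map_append, ← List.append_assoc, show a + 1 + (t - (a + 1)) = t by omega]
      exact ⟨h.1, h.2⟩
  · simp [Exp.cost]; omega
  · rintro s' - ⟨-, h⟩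
    rwa [show numNew D key + 1 - (a + 1) = numNew D key - a by omega] at h

theorem fill_spec (hR : Ranked W D key P ln s) (hG : Good D key M) {k : ℕ} (hk : s.reg 21 = k)
    (hkq : k ≤ numNew D key) :
    Spec W fill s (80 * D.length + 80) fun s' => Buffer s' ((order D key P k).map ln) := by
  have hL := hR.table.length_lt
  have hq : numNew D key ≤ D.length := numNew_le
  have hp : numLeft D key P ≤ numNew D key := numLeft_le
  have hlen := hG.length_order (P := P) k
  simp only [order, List.length_append, List.length_map, List.length_reverse, List.length_range']
    at hlen
  refine Spec.seq (t := 6) (t' := 80 * D.length + 74)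
    (Q := fun s' => Buffer s' [] ∧ s'.reg 24 = 0 ∧ s'.reg 22 = numLeft D key P)
    (Spec.of_wp (by
      simp [wp, Exp.Fits, Exp.val, State.set_reg, Buffer, Seg, hR.numLeft]; omega)
      (by simp [Prog.cost, Exp.cost])) ?_ (by omega)
  rintro s1 F1 ⟨h1, h2, h3⟩
  replace hR := hR.frame F1 (by decide) (by decide)
  rw [← F1.reg 21 (by decide)] at hk
  refine Spec.seq (fillLeft_spec hR hG hk (by omega) h3 h1) (t' := 60 * D.length + 54) ?_ (by omega)
  intro s2 F2 hB
  replace hR := hR.frame F2 (by decide) (by decide)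
  rw [← F2.reg 21 (by decide)] at hk
  rw [← F2.reg 24 (by decide)] at h2
  refine Spec.seq (fillMiddle_spec hR hk (by omega) h2 hB
    (by simp only [List.length_map, List.length_reverse, List.length_range']; omega))
    (t' := 30 * D.length + 34) ?_ (by omega)
  intro s3 F3 hB
  replace hR := hR.frame F3 (by decide) (by decide)
  rw [← F3.reg 21 (by decide)] at hk
  have h11 := hR.numLeft
  refine Spec.seq (t := 8) (t' := 30 * D.length + 20)
    (Q := fun s' => s'.reg 22 = max k (numLeft D key P) + 1) (Spec.of_wp ?_ (by decide)) ?_ (by omega)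
  · simp only [wp, Exp.Fits, Exp.val, State.set_reg, Test.Fits, Test.Holds, hk, h11]
    simp
    omega
  intro s4 F4 h22
  replace hR := hR.frame F4 (by decide) (by decide)
  have hB4 : Buffer s4 _ := ⟨F4.mem 16 (by decide) ▸ hB.1, (F4.reg 23 (by decide)).trans hB.2⟩
  refine (fillRight_spec hR hG h22 (by omega) hB4 ?_).mono le_rfl ?_
  · simp only [List.length_map, List.length_reverse, List.length_range', List.length_append]
    omega
  · intro s5 _ h
    simpa only [order, List.map_append] using h

theorem emitBuffer_spec {l : List ℕ} (hB : Buffer s l) (hl : l.length + 1 < W) (hx : ∀ x ∈ l, x < W)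
    (h5 : s.reg 5 < W) :
    Spec W emitBuffer s (30 * l.length + 20) fun s' =>
      s'.out = s.out ++ l.length :: if s.reg 5 = 0 then l else l.reverse := by
  obtain ⟨hB1, hB2⟩ := hB
  refine Spec.seq (t := 4) (t' := 30 * l.length + 16)
    (Q := fun s' => s'.out = s.out ++ [l.length] ∧ s'.reg 24 = 0)
    (Spec.of_wp (by simp [wp, Exp.Fits, Exp.val, State.set_reg, State.set_out, State.push_out, hB2]; omega)
      (by simp [Prog.cost, Exp.cost])) ?_ (by omega)
  rintro s1 F1 ⟨h1, h2⟩
  rw [← F1.reg 23 (by decide)] at hB2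
  rw [← F1.mem 16 (by decide)] at hB1
  rw [← F1.reg 5 (by decide)] at h5 ⊢
  refine (Spec.forUpTo (a := 0) (b := l.length) (fun _ => 15)
    (fun i s' => s'.out = s1.out ++ if s1.reg 5 = 0 then l.take i else l.reverse.take i)
    (Nat.zero_le _) (by omega) (by omega) h2 (by decide) ?_ ?_ ?_ le_rfl).mono ?_ ?_
  · simp
  · intro s' i F hi hI
    have := (F.reg 23 (by decide)).trans hB2
    exact ⟨by simp only [Exp.Fits]; omega, this⟩
  · rintro s' i F - hi h24 hI
    have e5 := F.reg 5 (by decide)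
    have e23 := (F.reg 23 (by decide)).trans hB2
    rw [← F.mem 16 (by decide)] at hB1
    have g1 := hB1.get_zero hi
    have g2 := hB1.get_zero (i := l.length - 1 - i) (by omega)
    have m1 := hx _ (List.getElem_mem hi)
    have m2 := hx _ (List.getElem_mem (l := l) (n := l.length - 1 - i) (by omega))
    refine Spec.of_wp ?_ (by decide)
    simp only [wp, Exp.Fits, Exp.val, Test.Fits, Test.Holds, State.push_out, State.set_out, h24, e5, e23,
      g1, g2, hI]
    refine ⟨by omega, fun h => ⟨by omega, ?_⟩, fun h => ⟨by omega, ?_⟩⟩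
    · rw [if_pos h, if_pos h, ← List.take_concat_get' _ _ hi, List.append_assoc]
    · rw [if_neg h, if_neg h, ← List.take_concat_get' _ i (by simpa using hi), List.getElem_reverse,
        List.append_assoc]
  · simp [Exp.cost]; omega
  · rintro s' - ⟨-, h⟩
    rw [h, h1]
    split_ifs <;> simp

theorem emitOrders_spec (hR : Ranked W D key P ln s) (hG : Good D key M) (h5 : s.reg 5 < W) :
    Spec W emitOrders s (200 * ((D.length + 1) * (numNew D key + 1))) fun s' =>
      s'.out = s.out ++ (if s.reg 5 = 0 then (orders D key P).map fun π => π.map ln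
        else (orders D key P).reverse.map fun π => (π.map ln).reverse).flatMap
          fun π => π.length :: π := by
  have hL := hR.table.length_lt
  have hq : numNew D key ≤ D.length := numNew_le
  set q := numNew D key with hqdef
  -- The counter runs upwards in both modes; `σ` gives the number of the order treated in round `j`,
  -- `c` tells whether this order is kept, and `E` is what is then written.
  set σ : ℕ → ℕ := fun j => if s.reg 5 = 0 then j else q - j with hσ
  set c : ℕ → Prop := fun k => k = 0 ∨ moved D key P (atRank D key k) = true with hc
  set E : ℕ → List ℕ := fun k => D.length :: if s.reg 5 = 0 then (order D key P k).map ln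
    else ((order D key P k).map ln).reverse with hE
  classical
  refine Spec.seq (t := 2) (t' := 180 * ((D.length + 1) * (q + 1))) (Q := fun s' => s'.reg 20 = 0)
    (Spec.of_wp (by simp [wp, Exp.Fits, Exp.val, State.set_reg]; omega)
      (by simp [Prog.cost, Exp.cost])) ?_ (by
        have : 0 < (D.length + 1) * (q + 1) := by positivity
        omega)
  intro s1 F1 h20
  replace hR := hR.frame F1 (by decide) (by decide)
  have e5 := F1.reg 5 (by decide)
  have eo := F1.out rfl
  refine (Spec.forUpTo (a := 0) (b := q + 1) (fun _ => 130 * D.length + 130)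
    (fun i s' => s'.out = s.out ++ (List.range i).flatMap fun j => if c (σ j) then E (σ j) else [])
    (Nat.zero_le _) (by omega) (by omega) h20 (by decide) ?_ ?_ ?_ le_rfl).mono ?_ ?_
  · simpa using eo
  · intro s' i F hi hI
    have := (hR.frame F (by decide) (by decide)).numNew
    exact ⟨by simp only [Exp.Fits, Exp.val]; omega, by simp only [Exp.val]; omega⟩
  · rintro s' i F - hi h20 hI
    replace hR := hR.frame F (by decide) (by decide)
    replace e5 := (F.reg 5 (by decide)).trans e5
    have hn := hR.numNew
    refine Spec.seq (t := 8) (t' := 130 * D.length + 122) (Q := fun s' => s'.reg 21 = σ i)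
      (Spec.of_wp ?_ (by decide)) ?_ (by omega)
    · simp only [wp, Exp.Fits, Exp.val, Test.Fits, Test.Holds, State.set_reg, h20, e5, hn, hσ]
      refine ⟨by omega, fun h => ⟨by omega, ?_⟩, fun h => ⟨by omega, ?_⟩⟩
      · rw [if_pos trivial, if_pos h]
      · rw [if_pos trivial, if_neg h]
    intro s2 F2 h21
    have hk : σ i ≤ q := by simp only [hσ]; split_ifs <;> omega
    replace hR := hR.frame F2 (by decide) (by decide)
    replace e5 := (F2.reg 5 (by decide)).trans e5
    rw [← F2.out rfl] at hI
    have hch : s2.mem 14 (σ i) = if c (σ i) then 1 else 0 := by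
      simp only [hc]
      by_cases h0 : σ i = 0
      · rw [h0, hR.moved_zero, if_pos (Or.inl rfl)]
      · rw [hR.moved _ (by omega) hk]
        simp only [h0, false_or]
    simp only [State.set_out, List.range_succ, List.flatMap_append, List.flatMap_cons, List.flatMap_nil,
      List.append_nil, ← List.append_assoc, ← hI]
    refine Spec.cond (t := 130 * D.length + 110) ?_ ?_ ?_ (by simp [Test.cost, Exp.cost]; omega)
    · simp only [Test.Fits, Exp.Fits, Exp.val, h21, hch]
      exact ⟨by omega, by omega, by split_ifs <;> omega⟩
    · intro h
      simp only [Test.Holds, Exp.val, h21, hch] at h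
      have hcσ : c (σ i) := by by_contra h'; rw [if_neg h'] at h; omega
      rw [if_pos hcσ]
      refine Spec.seq (fill_spec hR hG h21 hk) (t' := 30 * D.length + 20) ?_ (by omega)
      intro s3 F3 hB
      have h5' := (F3.reg 5 (by decide)).trans e5
      have hlen : ((order D key P (σ i)).map ln).length = D.length := by
        rw [List.length_map, hG.length_order]
      refine (emitBuffer_spec hB (by omega) ?_ (by omega)).mono (by omega) ?_
      · intro x hx
        obtain ⟨y, hy, rfl⟩ := List.mem_map.1 hx
        exact (hR.line y (hG.mem_order.1 hy)).2
      · intro s4 _ h4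
        rw [h4, F3.out rfl, hlen, h5', hE]
    · intro h
      simp only [Test.Holds, Exp.val, h21, hch] at h
      have hcσ : ¬ c (σ i) := by intro h'; rw [if_pos h'] at h; omega
      rw [if_neg hcσ]
      exact Spec.of_wp (by simp [wp]) (by simp [Prog.cost])
  · simp only [Exp.cost, Finset.sum_const, Nat.card_Ico, smul_eq_mul, Nat.sub_zero]
    have h1 : (q + 1) * (130 * D.length + 130) = 130 * ((D.length + 1) * (q + 1)) := by ring
    have h2 : (D.length + 1) * (q + 1) = D.length * (q + 1) + (q + 1) := by ring
    have h3 : 0 ≤ D.length * (q + 1) := Nat.zero_le _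
    omega
  · rintro s' - ⟨-, h⟩
    rw [h]
    refine congrArg (s.out ++ ·) ?_
    have hflat : ∀ (l : List ℕ), (l.flatMap fun k => if c k then E k else []) =
        (l.filter fun k => decide (c k)).flatMap E := by
      intro l
      induction l with
      | nil => rfl
      | cons a l ih =>
        rw [List.flatMap_cons, ih]
        by_cases h : c a
        · rw [List.filter_cons_of_pos (by simpa using h), if_pos h, List.flatMap_cons]
        · rw [List.filter_cons_of_neg (by simpa using h), if_neg h, List.nil_append]
    have hords : orders D key P = ((List.range (q + 1)).filter fun k => decide (c k)).map
      (order D key P) := rfl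
    by_cases h0 : s.reg 5 = 0
    · simp only [hσ, if_pos h0]
      rw [hflat, hords, List.map_map, List.flatMap_map]
      refine List.flatMap_congr fun k _ => ?_
      simp only [hE, Function.comp, if_pos h0, List.length_map, hG.length_order]
    · simp only [hσ, if_neg h0]
      have hrev : (List.range (q + 1)).reverse = (List.range (q + 1)).map fun j => q - j := by
        rw [List.range_eq_range', List.reverse_range', ← List.range_eq_range']
        exact List.map_congr_left fun j _ => by omega
      have : ((List.range (q + 1)).flatMap fun j => if c (q - j) then E (q - j) else []) =
          ((List.range (q + 1)).reverse.flatMap fun k => if c k then E k else []) := by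
        rw [hrev, List.flatMap_map]
      rw [this, hflat, hords, List.filter_reverse, ← List.map_reverse, List.map_map, List.flatMap_map]
      refine List.flatMap_congr fun k _ => ?_
      simp only [hE, Function.comp, if_neg h0, List.length_map, List.length_reverse, hG.length_order]

end RAM
end BlockCrossing

/-! ### Building the table of strands and keys for one edge. -/

namespace BlockCrossing

theorem TreeNetwork.length_strands_le {n m : ℕ} (T : TreeNetwork n m) (a : Fin n) :
    (T.strands a).length ≤ T.numEnds := by
  have := (List.filter_sublist (p := fun g => decide (T.mate g < T.lo a ∨ T.hi a ≤ T.mate g))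
    (l := List.range' (T.lo a) (T.hi a - T.lo a))).length_le
  rw [List.length_range'] at this
  have := T.hi_le a
  unfold strands
  omega

namespace RAM

open Sorting

local infixr:60 " ;; " => Prog.seq

/-- The data of the tree is in memory: the number of line ends in register 2, its square in
register 3, the parents in array 2 (and `n` for the root), the intervals of line ends in the arrays 6 and 7, the
lines, mates and values of `topLo` of the line ends in the arrays 8, 9 and 10. -/
structure Ready (W : ℕ) {n m : ℕ} (T : TreeNetwork n m) (s : State) : Prop where
  ends : s.reg 2 = T.numEnds
  bound : s.reg 3 = T.bound
  par : ∀ v, v ≠ T.root → s.mem 2 v = T.par v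
  par_root : s.mem 2 T.root = n
  lo : ∀ v : Fin n, s.mem 6 v = T.lo v
  hi : ∀ v : Fin n, s.mem 7 v = T.hi v
  line : ∀ g < T.numEnds, s.mem 8 g = T.lineAt g
  mate : ∀ g < T.numEnds, s.mem 9 g = T.mate g
  topLo : ∀ g < T.numEnds, s.mem 10 g = T.topLo g
  bound_lt : T.bound + 2 * T.numEnds + 2 * n + m + 10 < W

theorem Ready.frame {W n m : ℕ} {T : TreeNetwork n m} {p : Prog} {s s' : State} (h : Ready W T s)
    (F : Frame p s s') (hr : ∀ x ∈ [2, 3], x ∉ p.regs)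
    (ha : ∀ A ∈ [2, 6, 7, 8, 9, 10], A ∉ p.arrays) : Ready W T s' := by
  obtain ⟨h1, h2, h3, h3', h4, h5, h6, h7, h8, h9⟩ := h
  refine ⟨?_, ?_, ?_, ?_, ?_, ?_, ?_, ?_, ?_, h9⟩
  · rwa [F.reg _ (hr _ (by decide))]
  · rwa [F.reg _ (hr _ (by decide))]
  · rwa [F.mem _ (ha _ (by decide))]
  · rwa [F.mem _ (ha _ (by decide))]
  · rwa [F.mem _ (ha _ (by decide))]
  · rwa [F.mem _ (ha _ (by decide))]
  · rwa [F.mem _ (ha _ (by decide))]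
  · rwa [F.mem _ (ha _ (by decide))]
  · rwa [F.mem _ (ha _ (by decide))]

/-- The key of the line end in register 13, whose mate is in register 14. -/
def computeKey : Prog :=
  .cond (.lt (.reg 14) (.reg 8)) (.assign 15 (.const 0))
    (.cond (.lt (.reg 14) (.reg 9))
      (.assign 12 (.add (.reg 12) (.const 1)) ;;
        .cond (.lt (.reg 14) (.reg 6))
          (.assign 15 (.add (.mul (.read 10 (.reg 14)) (.reg 2)) (.sub (.reg 2) (.reg 13))) ;;
            .assign 11 (.add (.reg 11) (.const 1)))
          (.assign 15 (.add (.reg 3) (.sub (.reg 2) (.reg 14)))))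
      (.assign 15 (.const 0)))

/-- The table of the strands and their keys for the vertex in register 4. -/
def buildInit : Prog :=
  .assign 6 (.read 6 (.reg 4)) ;; .assign 7 (.read 7 (.reg 4)) ;;
  .assign 8 (.read 6 (.read 2 (.reg 4))) ;; .assign 9 (.read 7 (.read 2 (.reg 4))) ;;
  .assign 10 (.const 0) ;; .assign 11 (.const 0) ;; .assign 12 (.const 0) ;; .assign 13 (.reg 6)

def isStrand : Prog :=
  .assign 14 (.read 9 (.reg 13)) ;; .assign 18 (.const 0) ;;
  .cond (.lt (.reg 14) (.reg 6)) (.assign 18 (.const 1))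
    (.cond (.lt (.reg 14) (.reg 7)) .skip (.assign 18 (.const 1)))

def addStrand : Prog :=
  computeKey ;; .write 11 (.reg 10) (.reg 13) ;; .write 12 (.reg 10) (.reg 15) ;;
  .assign 10 (.add (.reg 10) (.const 1))

def build : Prog :=
  buildInit ;; .forUpTo 13 (.reg 7) (isStrand ;; .cond (.lt (.const 0) (.reg 18)) addStrand .skip)

variable {W n m : ℕ} {T : TreeNetwork n m} {s : State}

theorem numNew_append (D : List ℕ) (key : ℕ → ℕ) (y : ℕ) :
    numNew (D ++ [y]) key = numNew D key + if 0 < key y then 1 else 0 := by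
  simp [numNew, List.countP_append, List.countP_cons]

/-- The counters for `numLeft` and `numNew` are kept up to date along the way: left keys are
positive and at most `bound`, right keys exceed it. -/
theorem computeKey_spec (hR : Ready W T s) {a : Fin n} {g : ℕ} (hg : g < T.numEnds)
    (h6 : s.reg 6 = T.lo a) (h8 : s.reg 8 = T.lo (T.par a)) (h9 : s.reg 9 = T.hi (T.par a))
    (h13 : s.reg 13 = g) (h14 : s.reg 14 = T.mate g) {D : List ℕ} (hD : D.length ≤ T.numEnds)
    (h11 : s.reg 11 = numLeft D (T.key a) T.bound) (h12 : s.reg 12 = numNew D (T.key a)) :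
    Spec W computeKey s 40 fun s' => s'.reg 15 = T.key a g ∧
      s'.reg 11 = numLeft (D ++ [g]) (T.key a) T.bound ∧
      s'.reg 12 = numNew (D ++ [g]) (T.key a) := by
  have hW := hR.bound_lt
  have h2 := hR.ends
  have h3 := hR.bound
  have hmt := TreeNetwork.mate_lt hg
  have htop := hR.topLo _ hmt
  have hlo := T.lo_le_hi a
  have hhi := T.hi_le a
  have hlo' := T.lo_le_hi (T.par a)
  have hhi' := T.hi_le (T.par a)
  have hk1 := TreeNetwork.key_left_le (T := T) (g := T.mate g) (h := g)
  have hn : numNew D (T.key a) ≤ T.numEnds := numNew_le.trans hD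
  have hl : numLeft D (T.key a) T.bound ≤ numNew D (T.key a) := numLeft_le
  have hkey : T.key a g = if T.mate g < T.lo (T.par a) ∨ T.hi (T.par a) ≤ T.mate g then 0
    else if T.mate g < T.lo a then T.topLo (T.mate g) * T.numEnds + (T.numEnds - g)
    else T.bound + (T.numEnds - T.mate g) := rfl
  have ht := T.topLo_lt (T.mate g)
  unfold numLeft at *
  rw [below_append, numNew_append]
  generalize below D (T.key a) T.bound = p at *
  generalize numNew D (T.key a) = q at *
  refine Spec.of_wp ?_ (by decide)
  simp only [computeKey, wp, Exp.Fits, Exp.val, Test.Fits, Test.Holds, State.set_reg, State.set_mem,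
    h2, h3, h6, h8, h9, h11, h12, h13, h14, hkey]
  simp only [Nat.reduceEqDiff, if_false, htop]
  -- With the product opaque everything is linear; `hk1` is all that is needed about it.
  generalize T.topLo (T.mate g) * T.numEnds = z at *
  by_cases c1 : T.mate g < T.lo (T.par a)
  · simp [c1]; omega
  by_cases c2 : T.mate g < T.hi (T.par a)
  · have c3 : ¬ (T.mate g < T.lo (T.par a) ∨ T.hi (T.par a) ≤ T.mate g) := by omega
    rw [if_neg c3]
    by_cases c4 : T.mate g < T.lo a
    · simp [c1, c2, c4]; omega
    · simp [c1, c2, c4]; omega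
  · simp [c1, c2]; omega

theorem build_spec (hR : Ready W T s) {a : Fin n} (ha : a ≠ T.root) (h4 : s.reg 4 = a) :
    Spec W build s (120 * (T.numEnds + 1)) fun s' => Table W (T.strands a) (T.key a) T.bound s' ∧
      s'.reg 11 = numLeft (T.strands a) (T.key a) T.bound ∧
      s'.reg 12 = numNew (T.strands a) (T.key a) := by
  have hW := hR.bound_lt
  have hlo := T.lo_le_hi a
  have hhi := T.hi_le a
  have hlo' := T.lo_le_hi (T.par a)
  have hhi' := T.hi_le (T.par a)
  refine Spec.seq (t := 40) (t' := 120 * T.numEnds + 80)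
    (Q := fun s' => s'.reg 6 = T.lo a ∧ s'.reg 7 = T.hi a ∧ s'.reg 8 = T.lo (T.par a) ∧
      s'.reg 9 = T.hi (T.par a) ∧ s'.reg 10 = 0 ∧ s'.reg 11 = 0 ∧ s'.reg 12 = 0 ∧ s'.reg 13 = T.lo a)
    (Spec.of_wp ?_ (by decide)) ?_ (by omega)
  · have e1 := hR.par a ha
    have e2 := hR.lo a
    have e3 := hR.hi a
    have e4 := hR.lo (T.par a)
    have e5 := hR.hi (T.par a)
    have := a.2
    have := (T.par a).2
    simp [buildInit, wp, Exp.Fits, Exp.val, State.set_reg, State.set_mem, h4, e1, e2, e3, e4, e5]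
    omega
  rintro s1 F1 ⟨h6, h7, h8, h9, h10, h11, h12, h13⟩
  replace hR := hR.frame F1 (by decide) (by decide)
  -- The strands among the ends before `g`; for `g = hi a` this is `strands a`.
  set D : ℕ → List ℕ := fun g => (List.range' (T.lo a) (g - T.lo a)).filter fun g =>
    T.mate g < T.lo a ∨ T.hi a ≤ T.mate g with hD
  have hDlen : ∀ g, (D g).length ≤ g - T.lo a := fun g => by
    simpa only [List.length_range'] using (List.filter_sublist (p := fun g => decide (T.mate g < T.lo a ∨ T.hi a ≤ T.mate g))
      (l := List.range' (T.lo a) (g - T.lo a))).length_le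
  refine (Spec.forUpTo (a := T.lo a) (b := T.hi a) (fun _ => 90)
    (fun g s' => Seg (s'.mem 11) 0 (D g) ∧ Seg (s'.mem 12) 0 ((D g).map (T.key a)) ∧
      s'.reg 10 = (D g).length ∧ s'.reg 11 = numLeft (D g) (T.key a) T.bound ∧
      s'.reg 12 = numNew (D g) (T.key a))
    hlo (by omega) (by omega) h13 (by decide) ?_ ?_ ?_ le_rfl).mono ?_ ?_
  · simp [hD, Seg, h10, h11, h12, numLeft, below, numNew]
  · intro s' g F hg hI
    have := (F.reg 7 (by decide)).trans h7
    exact ⟨by simp only [Exp.Fits]; omega, this⟩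
  · rintro s' g F hg1 hg2 h13 ⟨i1, i2, i3, i4, i5⟩
    replace hR := hR.frame F (by decide) (by decide)
    rw [← F.reg 6 (by decide)] at h6
    rw [← F.reg 7 (by decide)] at h7
    rw [← F.reg 8 (by decide)] at h8
    rw [← F.reg 9 (by decide)] at h9
    have hg : g < T.numEnds := by omega
    have hmt := TreeNetwork.mate_lt hg
    have e9 := hR.mate g hg
    refine Spec.seq (t := 30) (t' := 60)
      (Q := fun s' => s'.reg 14 = T.mate g ∧
        s'.reg 18 = if T.mate g < T.lo a ∨ T.hi a ≤ T.mate g then 1 else 0)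
      (Spec.of_wp ?_ (by decide)) ?_ le_rfl
    · simp only [isStrand, wp, Exp.Fits, Exp.val, Test.Fits, Test.Holds, State.set_reg, h13, e9, h6, h7]
      simp
      omega
    rintro s2 F2 ⟨h14, h18⟩
    replace hR := hR.frame F2 (by decide) (by decide)
    rw [← F2.reg 6 (by decide)] at h6
    rw [← F2.reg 8 (by decide)] at h8
    rw [← F2.reg 9 (by decide)] at h9
    rw [← F2.reg 13 (by decide)] at h13
    rw [← F2.reg 10 (by decide)] at i3
    rw [← F2.reg 11 (by decide)] at i4
    rw [← F2.reg 12 (by decide)] at i5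
    rw [← F2.mem 11 (by decide)] at i1
    rw [← F2.mem 12 (by decide)] at i2
    have hDg : D (g + 1) = D g ++ if T.mate g < T.lo a ∨ T.hi a ≤ T.mate g then [g] else [] := by
      simp only [hD]
      rw [show g + 1 - T.lo a = g - T.lo a + 1 by omega, List.range'_1_concat, List.filter_append,
        show T.lo a + (g - T.lo a) = g by omega, List.filter_singleton, Bool.cond_decide]
    have hlen := hDlen g
    rw [hDg]
    refine Spec.cond (t := 56) ?_ ?_ ?_ (by decide)
    · simp only [Test.Fits, Exp.Fits, h18]
      exact ⟨by omega, by split_ifs <;> omega⟩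
    · intro h
      simp only [Test.Holds, Exp.val, h18] at h
      have hc : T.mate g < T.lo a ∨ T.hi a ≤ T.mate g := by by_contra h'; rw [if_neg h'] at h; omega
      rw [if_pos hc]
      refine (computeKey_spec hR hg h6 h8 h9 h13 h14 (by omega) i4 i5).seq (t' := 16) ?_ le_rfl
      rintro s3 F3 ⟨j1, j2, j3⟩
      rw [← F3.reg 13 (by decide)] at h13
      rw [← F3.reg 10 (by decide)] at i3
      rw [← F3.mem 11 (by decide)] at i1
      rw [← F3.mem 12 (by decide)] at i2
      have hkW : T.key a g < W := by
        have hk1 := TreeNetwork.key_left_le (T := T) (g := T.mate g) (h := g)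
        unfold TreeNetwork.key
        split_ifs <;> omega
      refine Spec.of_wp ?_ (by decide)
      simp only [wp, Exp.Fits, Exp.val, State.set_reg, State.set_mem, State.put_reg, State.put_mem,
        h13, i3, j1, j2, j3]
      simp only [Nat.reduceEqDiff, if_false, if_true, List.map_append, List.map_cons, List.map_nil]
      refine ⟨by omega, by omega, by omega, i1.snoc (by simp), i2.snoc (by simp), by simp, trivial, trivial⟩
    · intro h
      simp only [Test.Holds, Exp.val, h18] at h
      have hc : ¬ (T.mate g < T.lo a ∨ T.hi a ≤ T.mate g) := by intro h'; rw [if_pos h'] at h; omega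
      rw [if_neg hc, List.append_nil]
      refine Spec.of_wp ?_ (by decide)
      simp only [wp, State.set_reg, State.set_mem]
      exact ⟨i1, i2, i3, i4, i5⟩
  · simp [Exp.cost]
    have : T.hi a - T.lo a ≤ T.numEnds := by omega
    omega
  · rintro s' F ⟨-, i1, i2, i3, i4, i5⟩
    have hS : D (T.hi a) = T.strands a := rfl
    rw [hS] at i1 i2 i3 i4 i5
    have := T.length_strands_le a
    have h3 := (hR.frame F (by decide) (by decide)).bound
    refine ⟨⟨i1, i2, i3, h3, by omega, by omega, fun x hx => ?_⟩, i4, i5⟩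
    have hx' := (TreeNetwork.mem_strands.1 hx).1.lt
    have hmt := TreeNetwork.mate_lt hx'
    refine ⟨by omega, ?_⟩
    have hk1 := TreeNetwork.key_left_le (T := T) (g := T.mate x) (h := x)
    unfold TreeNetwork.key
    split_ifs <;> omega

end RAM
end BlockCrossing

/-! ### Output for all edges. -/

namespace BlockCrossing

namespace TreeNetwork

variable {n m : ℕ} (T : TreeNetwork n m)

theorem solution_down_edge {e : Fin n × Fin n} (h : e.2 ≠ T.root ∧ T.par e.2 = e.1) :
    T.child e = e.2 ∧ T.solution e.1 e.2 = T.lineSeq e.2 := by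
  unfold child solution
  rw [if_pos h, if_pos h]
  exact ⟨rfl, rfl⟩

theorem solution_up_edge {e : Fin n × Fin n} (h : ¬ (e.2 ≠ T.root ∧ T.par e.2 = e.1)) :
    T.child e = e.1 ∧ T.solution e.1 e.2 = (T.lineSeq e.1).reverse.map List.reverse := by
  unfold child solution
  rw [if_neg h, if_neg h]
  exact ⟨rfl, rfl⟩

theorem encode_lineSeq (a : Fin n) : (T.lineSeq a).flatMap Network.encodeList =
    ((T.seq a).map fun π => π.map fun g => (T.lineAt g : ℕ)).flatMap fun π => π.length :: π := by
  unfold lineSeq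
  rw [List.flatMap_map, List.flatMap_map]
  refine List.flatMap_congr fun π _ => ?_
  simp [Network.encodeList]

theorem encode_lineSeq_reverse (a : Fin n) :
    ((T.lineSeq a).reverse.map List.reverse).flatMap Network.encodeList =
    ((T.seq a).reverse.map fun π => (π.map fun g => (T.lineAt g : ℕ)).reverse).flatMap
      fun π => π.length :: π := by
  unfold lineSeq
  rw [← List.map_reverse, List.map_map, List.flatMap_map, List.flatMap_map]
  refine List.flatMap_congr fun π _ => ?_
  simp [Network.encodeList]

end TreeNetwork

namespace RAM

open Sorting

local infixr:60 " ;; " => Prog.seq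

/-- The embedded graph is in memory: the number of vertices in register 0, the
positions of the adjacency lists (with their lengths in front) within array 0 in array 1. -/
structure Adjacency (W : ℕ) {n m : ℕ} (N : Network n m) (s : State) : Prop where
  size : s.reg 0 = n
  degree : ∀ v : Fin n, s.mem 0 (s.mem 1 v) = (N.rot v).length
  list : ∀ v : Fin n, Seg (s.mem 0) (s.mem 1 v + 1) ((N.rot v).map Fin.val)
  lt : ∀ v : Fin n, s.mem 1 v + 1 + (N.rot v).length < W
  size_lt : 2 * n + 10 < W

theorem Adjacency.frame {W n m : ℕ} {N : Network n m} {p : Prog} {s s' : State} (h : Adjacency W N s)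
    (F : Frame p s s') (hr : 0 ∉ p.regs) (h0 : 0 ∉ p.arrays) (h1 : 1 ∉ p.arrays) :
    Adjacency W N s' := by
  obtain ⟨a, b, c, d, e⟩ := h
  refine ⟨?_, ?_, ?_, ?_, e⟩
  · rwa [F.reg _ hr]
  · rwa [F.mem _ h0, F.mem _ h1]
  · rwa [F.mem _ h0, F.mem _ h1]
  · rwa [F.mem _ h1]

theorem Adjacency.get {W n m : ℕ} {N : Network n m} {s : State} (h : Adjacency W N s) {v : Fin n}
    {i : ℕ} (hi : i < (N.rot v).length) : s.mem 0 (s.mem 1 v + 1 + i) = (N.rot v)[i] := by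
  rw [(h.list v).get (by simpa using hi), List.getElem_map]

/-- The solution on the edge above the vertex in register 4, backwards if register 5 is not
zero. -/
def emitEdge : Prog :=
  build ;; ranks ;; .write 14 (.const 0) (.const 1) ;; emitCount ;; emitOrders

/-- The entry of array 2 at the root is `n`, which is no vertex, so a single comparison decides
which of the two vertices is the lower one. -/
def chooseChild : Prog :=
  .cond (.eq (.read 2 (.reg 28)) (.reg 25))
    (.assign 4 (.reg 28) ;; .assign 5 (.const 0)) (.assign 4 (.reg 25) ;; .assign 5 (.const 1))

def emitVertex : Prog :=
  (.assign 26 (.const 0) ;; .assign 27 (.read 0 (.read 1 (.reg 25)))) ;;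
  .forUpTo 26 (.reg 27)
    (.assign 28 (.read 0 (.add (.add (.read 1 (.reg 25)) (.const 1)) (.reg 26))) ;;
      .cond (.lt (.reg 25) (.reg 28)) (chooseChild ;; emitEdge) .skip)

/-- The whole output. -/
def emitAll : Prog := .assign 25 (.const 0) ;; .forUpTo 25 (.reg 0) emitVertex

variable {W n m : ℕ} {T : TreeNetwork n m} {s : State}

/-- Building the table takes time linear in the number of ends, computing the ranks one scan per new
strand, and there are at most `numNew + 1` orders to write. -/
theorem emitEdge_spec (hR : Ready W T s) {a : Fin n} (ha : a ≠ T.root) (h4 : s.reg 4 = a)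
    (h5 : s.reg 5 ≤ 1) :
    Spec W emitEdge s (450 * ((T.numEnds + 1) * (numNew (T.strands a) (T.key a) + 1))) fun s' =>
      s'.out = s.out ++ (T.lineSeq a).length ::
        (if s.reg 5 = 0 then T.lineSeq a else (T.lineSeq a).reverse.map List.reverse).flatMap
          Network.encodeList := by
  have hW := hR.bound_lt
  have hL := T.length_strands_le a
  have hG := TreeNetwork.good (T := T) a
  have hx : ((T.strands a).length + 1) * (numNew (T.strands a) (T.key a) + 1) ≤
      (T.numEnds + 1) * (numNew (T.strands a) (T.key a) + 1) := Nat.mul_le_mul_right _ (by omega)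
  have hM : T.numEnds + 1 ≤ (T.numEnds + 1) * (numNew (T.strands a) (T.key a) + 1) :=
    Nat.le_mul_of_pos_right _ (by omega)
  generalize (T.numEnds + 1) * (numNew (T.strands a) (T.key a) + 1) = Z at *
  refine Spec.seq (t' := 330 * Z) (build_spec hR ha h4) ?_ (by omega)
  rintro s1 F1 ⟨hT, h11, h12⟩
  refine Spec.seq (ranks_spec hT hG) (t' := 250 * Z) ?_ (by rw [Nat.mul_assoc]; omega)
  rintro s2 F2 ⟨hr1, hr2⟩
  have e8 : s2.mem 8 = s.mem 8 := (F2.mem 8 (by decide)).trans (F1.mem 8 (by decide))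
  replace hT := hT.congr (F2.mem 11 (by decide)) (F2.mem 12 (by decide)) (F2.reg 10 (by decide))
    (F2.reg 3 (by decide))
  rw [← F2.reg 11 (by decide)] at h11
  rw [← F2.reg 12 (by decide)] at h12
  -- Cell `0` marks the initial order as one to be written; no rank of a new strand is `0`, so the
  -- cell is free.
  have hk : Spec W (.write 14 (.const 0) (.const 1)) s2 3
      (Ranked W (T.strands a) (T.key a) T.bound fun g => (T.lineAt g : ℕ)) := by
    refine Spec.of_wp ?_ (by decide)
    simp only [wp, Exp.Fits, Exp.val]
    refine ⟨by omega, hT.congr rfl rfl rfl rfl, hr1, h11, h12, fun t h1 h2 => (hr2 t h1 h2).1,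
      fun t h1 h2 => ?_, ?_, fun g hg => ?_⟩
    · rw [State.put_mem, if_pos rfl, Function.update_of_ne (by omega)]
      exact (hr2 t h1 h2).2
    · rw [State.put_mem, if_pos rfl, Function.update_self]
    · rw [State.put_mem, if_neg (by decide), e8]
      have := (T.lineAt g).2
      exact ⟨hR.line g (TreeNetwork.mem_strands.1 hg).1.lt, by omega⟩
  refine hk.seq (t' := 240 * Z) ?_ (by omega)
  intro s3 F3 hR3
  refine Spec.seq (emitCount_spec hR3) (t' := 200 * Z) ?_ (by omega)
  intro s4 F4 ho
  have e5 : s4.reg 5 = s.reg 5 := by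
    rw [F4.reg 5 (by decide), F3.reg 5 (by decide), F2.reg 5 (by decide), F1.reg 5 (by decide)]
  refine (emitOrders_spec (hR3.frame F4 (by decide) (by decide)) hG (by omega)).mono ?_ ?_
  · exact Nat.mul_le_mul_left _ hx
  · intro s5 _ h
    rw [h, ho, F3.out rfl, F2.out rfl, F1.out rfl, e5]
    have hlen : (orders (T.strands a) (T.key a) T.bound).length = (T.lineSeq a).length := by
      rw [TreeNetwork.lineSeq, List.length_map]; rfl
    rw [hlen, List.append_assoc, List.singleton_append]
    split_ifs
    · rw [T.encode_lineSeq]; rfl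
    · rw [T.encode_lineSeq_reverse]; rfl

/-- The output for one edge. -/
noncomputable def edgeOutput (T : TreeNetwork n m) (e : Fin n × Fin n) : List ℕ :=
  (T.solution e.1 e.2).length :: (T.solution e.1 e.2).flatMap Network.encodeList

noncomputable def edgeCost (T : TreeNetwork n m) (e : Fin n × Fin n) : ℕ :=
  450 * ((T.numEnds + 1) * (numNew (T.strands (T.child e)) (T.key (T.child e)) + 1)) + 20

theorem sum_getD (l : List ℕ) : ∑ i ∈ Finset.range l.length, l.getD i 0 = l.sum := by
  induction l with
  | nil => simp
  | cons x l ih =>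
    rw [List.length_cons, Finset.sum_range_succ', List.sum_cons, ← ih]
    simp [add_comm]

theorem flatMap_filter_take_succ {α β : Type*} (l : List α) (p : α → Bool) (f : α → List β) {i : ℕ}
    (hi : i < l.length) : ((l.take (i + 1)).filter p).flatMap f =
      ((l.take i).filter p).flatMap f ++ if p l[i] then f l[i] else [] := by
  rw [← List.take_concat_get' _ _ hi, List.filter_append, List.flatMap_append, List.filter_singleton]
  cases p l[i] <;> simp

noncomputable def vertexCost (T : TreeNetwork n m) (u : Fin n) : ℕ :=
  ((T.net.rot u).map fun v => 30 + if u < v then edgeCost T (u, v) else 0).sum +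
    20 * (T.net.rot u).length + 20

theorem emitVertex_spec (hR : Ready W T s) (hA : Adjacency W T.net s) {u : Fin n} (hu : s.reg 25 = u) :
    Spec W emitVertex s (vertexCost T u) fun s' => s'.out = s.out ++
      ((T.net.rot u).filter fun v => u < v).flatMap fun v => edgeOutput T (u, v) := by
  have hW := hA.size_lt
  have hun := u.2
  refine Spec.seq (t := 8) (Q := fun s' => s'.reg 26 = 0 ∧ s'.reg 27 = (T.net.rot u).length)
    (Spec.of_wp ?_ (by decide)) ?_
    (t' := ((T.net.rot u).map fun v => 30 + if u < v then edgeCost T (u, v) else 0).sum +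
      20 * (T.net.rot u).length + 12) (by unfold vertexCost; omega)
  · have := hA.lt u
    have := hA.degree u
    simp [wp, Exp.Fits, Exp.val, State.set_reg, State.set_mem, hu, this]
    omega
  rintro s1 F1 ⟨h26, h27⟩
  replace hR := hR.frame F1 (by decide) (by decide)
  replace hA := hA.frame F1 (by decide) (by decide) (by decide)
  rw [← F1.reg 25 (by decide)] at hu
  have ho := F1.out rfl
  have hlt := hA.lt u
  refine (Spec.forUpTo (a := 0) (b := (T.net.rot u).length)
    (fun i => ((T.net.rot u).map fun v => 30 + if u < v then edgeCost T (u, v) else 0).getD i 0)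
    (fun i s' => s'.out = s.out ++
      (((T.net.rot u).take i).filter fun v => u < v).flatMap fun v => edgeOutput T (u, v))
    (Nat.zero_le _) (by omega) (by omega) h26 (by decide) ?_ ?_ ?_ le_rfl).mono ?_ ?_
  · simpa using ho
  · intro s' i F hi hI
    have := (F.reg 27 (by decide)).trans h27
    exact ⟨by simp only [Exp.Fits]; omega, this⟩
  · rintro s' i F - hi h26 hI
    replace hR := hR.frame F (by decide) (by decide)
    replace hA := hA.frame F (by decide) (by decide) (by decide)
    rw [← F.reg 25 (by decide)] at hu
    have hlt := hA.lt u
    have hv := hA.get hi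
    have hmem : (T.net.rot u)[i] ∈ T.net.rot u := List.getElem_mem hi
    rw [List.getD_eq_getElem _ _ (by simpa using hi), List.getElem_map, flatMap_filter_take_succ _ _ _ hi]
    generalize (T.net.rot u)[i] = v at *
    have hvn := v.2
    refine Spec.seq (t := 10) (Q := fun s' => s'.reg 28 = v) (Spec.of_wp ?_ (by decide)) ?_
      (t' := 20 + if u < v then edgeCost T (u, v) else 0) (by omega)
    · simp [wp, Exp.Fits, Exp.val, State.set_reg, hu, h26, hv]
      omega
    intro s2 F2 h28
    replace hR := hR.frame F2 (by decide) (by decide)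
    rw [← F2.reg 25 (by decide)] at hu
    rw [← F2.out rfl] at hI
    simp only [State.set_out, ← List.append_assoc, ← hI, decide_eq_true_eq]
    refine Spec.cond (t := 10 + if u < v then edgeCost T (u, v) else 0) ?_ ?_ ?_
      (by simp only [Test.cost, Exp.cost]; omega)
    · simp only [Test.Fits, Exp.Fits, hu, h28]; omega
    · intro h
      simp only [Test.Holds, Exp.val, hu, h28] at h
      have huv : u < v := h
      rw [if_pos huv, if_pos huv]
      have he : (u, v) ∈ T.net.edges := T.mem_edges.2 ⟨hmem, huv⟩
      obtain ⟨hroot, -⟩ := T.edge_cases he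
      refine Spec.seq (t := 10) (Q := fun s' => s'.reg 4 = T.child (u, v) ∧
        ((s'.reg 5 = 0 ∧ T.solution u v = T.lineSeq (T.child (u, v))) ∨ (s'.reg 5 = 1 ∧
          T.solution u v = (T.lineSeq (T.child (u, v))).reverse.map List.reverse)))
        (Spec.of_wp ?_ (by decide)) ?_ (t' := edgeCost T (u, v)) (by omega)
      · have hpar : s2.mem 2 v < W ∧
            (s2.mem 2 v = u ↔ (u, v).2 ≠ T.root ∧ T.par (u, v).2 = (u, v).1) := by
          by_cases hvr : v = T.root
          · rw [hvr, hR.par_root]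
            simp
            omega
          · rw [hR.par v hvr]
            have := (T.par v).2
            refine ⟨by omega, ?_⟩
            rw [← Fin.ext_iff]
            simp [hvr]
        simp only [chooseChild, wp, Exp.Fits, Exp.val, Test.Fits, Test.Holds, State.set_reg, hu, h28]
        refine ⟨⟨⟨by omega, hpar.1⟩, by omega⟩, fun h => ?_, fun h => ?_⟩
        · obtain ⟨h1, h2⟩ := T.solution_down_edge (hpar.2.1 h)
          rw [h1]
          refine ⟨by omega, by omega, by simp, Or.inl ⟨by simp, h2⟩⟩
        · obtain ⟨h1, h2⟩ := T.solution_up_edge fun h' => h (hpar.2.2 h')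
          rw [h1]
          refine ⟨by simpa [hu] using (by omega), by omega, by simp, Or.inr ⟨by simp, h2⟩⟩
      · rintro s3 F3 ⟨h4, h5⟩
        replace hR := hR.frame F3 (by decide) (by decide)
        refine (emitEdge_spec hR hroot h4 (by omega)).mono (by unfold edgeCost; omega) ?_
        intro s4 _ h
        rw [h, F3.out rfl, edgeOutput]
        rcases h5 with ⟨h5, hs⟩ | ⟨h5, hs⟩
        · simp only [hs, h5, if_true]
        · simp only [hs, h5, one_ne_zero, if_false, List.length_map, List.length_reverse]
    · intro h
      simp only [Test.Holds, Exp.val, hu, h28] at h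
      have huv : ¬ u < v := h
      rw [if_neg huv, if_neg huv]
      exact Spec.of_wp (by simp [wp]) (by simp [Prog.cost])
  · have := sum_getD ((T.net.rot u).map fun v => 30 + if u < v then edgeCost T (u, v) else 0)
    rw [List.length_map] at this
    rw [Nat.Ico_zero_eq_range, this]
    simp only [Exp.cost, Nat.sub_zero]
    omega
  · rintro s' - ⟨-, h⟩
    rwa [List.take_length] at h

theorem encodeOrders_eq (T : TreeNetwork n m) : T.net.encodeOrders T.solution =
    (List.finRange n).flatMap fun u =>
      ((T.net.rot u).filter fun v => u < v).flatMap fun v => edgeOutput T (u, v) := by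
  unfold Network.encodeOrders Network.edges
  rw [List.flatMap_assoc]
  refine List.flatMap_congr fun u _ => ?_
  rw [List.flatMap_map]
  rfl

theorem emitAll_spec (hR : Ready W T s) (hA : Adjacency W T.net s) :
    Spec W emitAll s (((List.finRange n).map (vertexCost T)).sum + 20 * n + 20) fun s' => s'.out = s.out ++
      T.net.encodeOrders T.solution := by
  have hW := hA.size_lt
  refine Spec.seq (t := 2) (Q := fun s' => s'.reg 25 = 0) (Spec.of_wp ?_ (by decide)) ?_
    (t' := ((List.finRange n).map (vertexCost T)).sum + 20 * n + 18) (by omega)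
  · simp [wp, Exp.Fits, Exp.val, State.set_reg]
    omega
  rintro s1 F1 h25
  replace hR := hR.frame F1 (by decide) (by decide)
  replace hA := hA.frame F1 (by decide) (by decide) (by decide)
  have ho := F1.out rfl
  refine (Spec.forUpTo (a := 0) (b := n)
    (fun i => ((List.finRange n).map (vertexCost T)).getD i 0)
    (fun i s' => s'.out = s.out ++ ((List.finRange n).take i).flatMap fun u =>
      ((T.net.rot u).filter fun v => u < v).flatMap fun v => edgeOutput T (u, v))
    (Nat.zero_le _) (by omega) (by omega) h25 (by decide) ?_ ?_ ?_ le_rfl).mono ?_ ?_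
  · simpa using ho
  · intro s' i F hi hI
    have := (F.reg 0 (by decide)).trans hA.size
    exact ⟨by simp only [Exp.Fits]; omega, this⟩
  · rintro s' i F - hi h25 hI
    replace hR := hR.frame F (by decide) (by decide)
    replace hA := hA.frame F (by decide) (by decide) (by decide)
    have hi' : i < (List.finRange n).length := by simpa using hi
    rw [List.getD_eq_getElem _ _ (by simpa using hi), List.getElem_map, ← List.take_concat_get' _ _ hi']
    have hu : (List.finRange n)[i] = ⟨i, hi⟩ := by simp
    rw [hu]
    refine (emitVertex_spec hR hA h25).mono le_rfl fun s2 _ h => ?_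
    rw [State.set_out, h, hI, List.flatMap_append, List.flatMap_singleton, List.append_assoc]
  · have := sum_getD ((List.finRange n).map (vertexCost T))
    rw [List.length_map, List.length_finRange] at this
    rw [Nat.Ico_zero_eq_range, this]
    simp only [Exp.cost, Nat.sub_zero]
    omega
  · rintro s' - ⟨-, h⟩
    rw [encodeOrders_eq, h, List.take_of_length_le (by simp)]

end RAM
end BlockCrossing

/-! ### Reading the input. -/

namespace BlockCrossing
namespace RAM

local infixr:60 " ;; " => Prog.seq

theorem Seg.flatMap {α : Type*} {f : ℕ → ℕ} {p : ℕ} {l : List α} {e : α → List ℕ}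
    (h : Seg f p (l.flatMap e)) {k : ℕ} (hk : k < l.length) :
    Seg f (p + ((l.take k).flatMap e).length) (e l[k]) := by
  have hl : l = l.take k ++ l[k] :: l.drop (k + 1) := by
    rw [← List.drop_eq_getElem_cons hk, List.take_append_drop]
  rw [hl, List.flatMap_append, List.flatMap_cons, seg_append, seg_append] at h
  exact h.2.1

theorem length_flatMap_take_succ {α : Type*} {l : List α} {e : α → List ℕ} {k : ℕ}
    (hk : k < l.length) : ((l.take (k + 1)).flatMap e).length =
      ((l.take k).flatMap e).length + (e l[k]).length := by
  rw [← List.take_concat_get' _ _ hk, List.flatMap_append, List.length_append, List.flatMap_singleton]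

theorem length_le_length_flatMap {α β : Type*} {l : List α} {e : α → List β} (c : ℕ)
    (he : ∀ x ∈ l, c ≤ (e x).length) : c * l.length ≤ (l.flatMap e).length := by
  induction l with
  | nil => simp
  | cons x l ih =>
    have h1 := he x List.mem_cons_self
    have h2 := ih fun y hy => he y (List.mem_cons_of_mem _ hy)
    rw [List.flatMap_cons, List.length_append, List.length_cons, Nat.mul_add_one]
    omega

/-- The position of the adjacency list of `v`. -/
def rotPos {n m : ℕ} (N : Network n m) (v : ℕ) : ℕ :=
  2 + (((List.finRange n).take v).flatMap fun v => Network.encodeList (N.rot v)).length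

/-- The position of the vertex sequence of line `i`. -/
def linePos {n m : ℕ} (N : Network n m) (i : ℕ) : ℕ :=
  rotPos N n + (((List.finRange m).take i).flatMap fun i => Network.encodeList (N.line i)).length

def parseRots : Prog :=
  .assign 0 (.read 0 (.const 0)) ;; .assign 1 (.read 0 (.const 1)) ;; .assign 30 (.const 2) ;;
  .assign 31 (.const 0)

def parseRot : Prog :=
  .write 1 (.reg 31) (.reg 30) ;;
  .assign 30 (.add (.add (.reg 30) (.read 0 (.reg 30))) (.const 1))

/-- Only the two ends of a line are read, at offsets `1` and its length, so the time per line is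
constant. Line numbers are stored plus one, as `0` in fresh memory means that no line ends there.
The first vertex of line `0` becomes the root. -/
def parseLine : Prog :=
  .assign 33 (.read 0 (.reg 30)) ;; .assign 34 (.read 0 (.add (.reg 30) (.const 1))) ;;
  .assign 35 (.read 0 (.add (.reg 30) (.reg 33))) ;;
  .assign 30 (.add (.add (.reg 30) (.reg 33)) (.const 1)) ;;
  .cond (.eq (.reg 32) (.const 0)) (.assign 36 (.reg 34)) .skip ;;
  .write 3 (.reg 34) (.add (.reg 32) (.const 1)) ;; .write 3 (.reg 35) (.add (.reg 32) (.const 1))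

/-- Finds the positions of the adjacency lists, the root (in register 36) and the line
of every line end (plus one, in array 3). -/
def parse : Prog :=
  parseRots ;; .forUpTo 31 (.reg 0) parseRot ;; .assign 32 (.const 0) ;; .forUpTo 32 (.reg 1) parseLine

section

variable {n m : ℕ} (N : Network n m)

theorem rotPos_succ {v : ℕ} (hv : v < n) :
    rotPos N (v + 1) = rotPos N v + (N.rot ⟨v, hv⟩).length + 1 := by
  unfold rotPos
  rw [length_flatMap_take_succ (by simpa using hv)]
  simp [Network.encodeList]
  omega

theorem linePos_succ {i : ℕ} (hi : i < m) :
    linePos N (i + 1) = linePos N i + (N.line ⟨i, hi⟩).length + 1 := by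
  unfold linePos
  rw [length_flatMap_take_succ (by simpa using hi)]
  simp [Network.encodeList]
  omega

theorem rotPos_mono {a b : ℕ} (h : a ≤ b) : rotPos N a ≤ rotPos N b := by
  unfold rotPos
  have : List.Sublist ((List.finRange n).take a) ((List.finRange n).take b) := List.take_sublist_take_left h
  have := (this.flatMap fun v => Network.encodeList (N.rot v)).length_le
  omega

theorem linePos_mono {a b : ℕ} (h : a ≤ b) : linePos N a ≤ linePos N b := by
  unfold linePos
  have : List.Sublist ((List.finRange m).take a) ((List.finRange m).take b) := List.take_sublist_take_left h
  have := (this.flatMap fun v => Network.encodeList (N.line v)).length_le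
  omega

theorem linePos_eq : linePos N m = N.encode.length := by
  unfold linePos rotPos Network.encode
  rw [List.take_of_length_le (by simp), List.take_of_length_le (by simp)]
  simp
  omega

/-- Each vertex contributes at least the length of its list, each line its length and two vertices.
This makes all words polynomial in the length of the input. -/
theorem size_le : n + 3 * m + 2 ≤ N.encode.length := by
  rw [← linePos_eq]
  unfold linePos rotPos
  rw [List.take_of_length_le (by simp), List.take_of_length_le (by simp)]
  have h1 := length_le_length_flatMap (l := List.finRange n)
    (e := fun v => Network.encodeList (N.rot v)) 1 (by simp [Network.encodeList])
  have h2 := length_le_length_flatMap (l := List.finRange m)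
    (e := fun v => Network.encodeList (N.line v)) 3
    (by simp only [Network.encodeList, List.length_cons, List.length_map]
        intro i _
        have := N.line_length i
        omega)
  rw [List.length_finRange] at h1 h2
  omega

variable {N} {f : ℕ → ℕ}

theorem seg_rot (h : Seg f 0 N.encode) (v : Fin n) :
    Seg f (rotPos N v) (Network.encodeList (N.rot v)) := by
  unfold Network.encode at h
  rw [List.cons_append, List.cons_append] at h
  have := (seg_append.1 h.2.2).1.flatMap (k := v) (by simp)
  simpa [rotPos] using this

theorem seg_line (h : Seg f 0 N.encode) (i : Fin m) :
    Seg f (linePos N i) (Network.encodeList (N.line i)) := by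
  unfold Network.encode at h
  rw [List.cons_append, List.cons_append] at h
  have := (seg_append.1 h.2.2).2.flatMap (k := i) (by simp)
  unfold linePos rotPos
  rw [List.take_of_length_le (i := n) (by simp)]
  simpa using this

end

variable {W n m : ℕ} {T : TreeNetwork n m} {s : State}

theorem parse_spec (h0 : Seg (s.mem 0) 0 T.net.encode) (h3 : ∀ v, s.mem 3 v = 0)
    (hW : 4 * T.net.encode.length + 20 < W) :
    Spec W parse s (50 * (n + m) + 50) fun s' => Adjacency W T.net s' ∧ s'.reg 36 = T.root ∧
      ∀ v : Fin n, (∀ i, T.net.IsTerminal i v → s'.mem 3 v = i + 1) ∧ (¬ T.IsEnd v → s'.mem 3 v = 0) := by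
  have hsize := size_le T.net
  have hlast := linePos_eq T.net
  have hm := T.two_le
  have e0 : s.mem 0 0 = n := h0.1
  have e1 : s.mem 0 1 = m := h0.2.1
  refine Spec.seq (t := 12) (Q := fun s' => s'.reg 0 = n ∧ s'.reg 1 = m ∧ s'.reg 30 = rotPos T.net 0 ∧
    s'.reg 31 = 0) (Spec.of_wp ?_ (by decide)) ?_ (t' := 50 * (n + m) + 38) (by omega)
  · simp [parseRots, wp, Exp.Fits, Exp.val, State.set_reg, State.set_mem, e0, e1, rotPos]
    omega
  rintro s1 F1 ⟨i1, i2, i3, i4⟩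
  rw [← F1.mem 0 (by decide)] at h0
  rw [← F1.mem 3 (by decide)] at h3
  refine Spec.seq (Spec.forUpTo (a := 0) (b := n) (fun _ => 20) (fun v s' => s'.reg 30 = rotPos T.net v ∧
    ∀ u < v, s'.mem 1 u = rotPos T.net u) (Nat.zero_le _) (by omega) (by omega) i4 (by decide)
    ⟨i3, by omega⟩ ?_ ?_ (t := 30 * n + 10) ?_) ?_ (t' := 50 * m + 28) (by omega)
  · intro s' k F hk hI
    have := (F.reg 0 (by decide)).trans i1
    exact ⟨by simp only [Exp.Fits]; omega, this⟩
  · rintro s' v F - hv h31 ⟨j1, j2⟩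
    rw [← F.mem 0 (by decide)] at h0
    have hseg := seg_rot h0 ⟨v, hv⟩
    have hlen : s'.mem 0 (rotPos T.net v) = (T.net.rot ⟨v, hv⟩).length := hseg.1
    have hsucc := rotPos_succ T.net hv
    have hle : rotPos T.net (v + 1) ≤ linePos T.net m :=
      (rotPos_mono _ (by omega)).trans (Nat.le_add_right _ _)
    refine Spec.of_wp ?_ (by decide)
    simp only [parseRot, wp, Exp.Fits, Exp.val, State.set_reg, State.set_mem, State.put_reg,
      State.put_mem, h31, j1]
    simp [hlen]
    refine ⟨by omega, by omega, by omega, fun u hu => ?_⟩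
    by_cases huv : u = v
    · rw [huv, Function.update_self]
    · rw [Function.update_of_ne huv]
      exact j2 u (by omega)
  · simp [Exp.cost]; omega
  rintro s2 F2 ⟨-, j1, j2⟩
  rw [← F2.mem 0 (by decide)] at h0
  rw [← F2.mem 3 (by decide)] at h3
  rw [← F2.reg 0 (by decide)] at i1
  rw [← F2.reg 1 (by decide)] at i2
  refine Spec.seq (t := 2) (Q := fun s' => s'.reg 32 = 0) (Spec.of_wp ?_ (by decide)) ?_
    (t' := 50 * m + 26) (by omega)
  · simp [wp, Exp.Fits, Exp.val, State.set_reg]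
    omega
  rintro s3 F3 h32
  rw [← F3.mem 0 (by decide)] at h0
  rw [← F3.mem 3 (by decide)] at h3
  rw [← F3.mem 1 (by decide)] at j2
  rw [← F3.reg 0 (by decide)] at i1
  rw [← F3.reg 1 (by decide)] at i2
  rw [← F3.reg 30 (by decide)] at j1
  refine (Spec.forUpTo (a := 0) (b := m) (fun _ => 43)
    (fun i s' => s'.reg 30 = linePos T.net i ∧ (0 < i → s'.reg 36 = T.root) ∧
      ∀ v : Fin n, (∀ j : Fin m, (j : ℕ) < i → T.net.IsTerminal j v → s'.mem 3 v = j + 1) ∧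
        ((∀ j : Fin m, (j : ℕ) < i → ¬ T.net.IsTerminal j v) → s'.mem 3 v = 0))
    (Nat.zero_le _) (by omega) (by omega) h32 (by decide) ?_ ?_ ?_ le_rfl).mono ?_ ?_
  · refine ⟨by rw [j1]; simp [linePos], by omega, fun v => ⟨fun j hj => by omega, fun _ => h3 v⟩⟩
  · intro s' k F hk hI
    have := (F.reg 1 (by decide)).trans i2
    exact ⟨by simp only [Exp.Fits]; omega, this⟩
  · rintro s' i F - hi h32 ⟨k1, k2, k3⟩
    rw [← F.mem 0 (by decide)] at h0
    have hseg := seg_line h0 ⟨i, hi⟩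
    have hlen : s'.mem 0 (linePos T.net i) = (T.net.line ⟨i, hi⟩).length := hseg.1
    have hl2 := T.net.line_length ⟨i, hi⟩
    have hsucc := linePos_succ T.net hi
    have hle : linePos T.net (i + 1) ≤ linePos T.net m := linePos_mono _ (by omega)
    have hfst : s'.mem 0 (linePos T.net i + 1) = T.fst ⟨i, hi⟩ := by
      have := hseg.2.get (i := 0) (by rw [List.length_map]; omega)
      rw [List.getElem_map] at this
      rw [TreeNetwork.fst, List.head_eq_getElem]
      exact this
    have hlst : s'.mem 0 (linePos T.net i + (T.net.line ⟨i, hi⟩).length) = T.lst ⟨i, hi⟩ := by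
      have := hseg.2.get (i := (T.net.line ⟨i, hi⟩).length - 1) (by rw [List.length_map]; omega)
      rw [List.getElem_map] at this
      rw [TreeNetwork.lst, List.getLast_eq_getElem, ← this]
      refine congrArg _ ?_
      change _ = linePos T.net i + 1 + _
      omega
    have hf := (T.fst ⟨i, hi⟩).2
    have hl := (T.lst ⟨i, hi⟩).2
    refine Spec.of_wp ?_ (by decide)
    simp only [parseLine, wp, Exp.Fits, Exp.val, Test.Fits, Test.Holds, State.set_reg, State.set_mem,
      State.put_reg, State.put_mem, h32, k1]
    simp [hlen, hfst, hlst]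
    classical
    have hterm : ∀ v : Fin n, (∀ j : Fin m, (j : ℕ) < i + 1 → T.net.IsTerminal j v →
        Function.update (Function.update (s'.mem 3) (T.fst ⟨i, hi⟩) (i + 1)) (T.lst ⟨i, hi⟩) (i + 1) v =
          j + 1) ∧ ((∀ j : Fin m, (j : ℕ) < i + 1 → ¬ T.net.IsTerminal j v) →
        Function.update (Function.update (s'.mem 3) (T.fst ⟨i, hi⟩) (i + 1)) (T.lst ⟨i, hi⟩) (i + 1) v =
          0) := by
      intro v
      have hupd : Function.update (Function.update (s'.mem 3) (T.fst ⟨i, hi⟩) (i + 1))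
          (T.lst ⟨i, hi⟩) (i + 1) v = if T.net.IsTerminal ⟨i, hi⟩ v then i + 1 else s'.mem 3 v := by
        rw [Function.update_apply, Function.update_apply]
        simp only [T.isTerminal_iff, ← Fin.ext_iff]
        by_cases h1 : v = T.fst ⟨i, hi⟩ <;> by_cases h2 : v = T.lst ⟨i, hi⟩ <;> simp [h1, h2]
      rw [hupd]
      constructor
      · intro j hj hjt
        split_ifs with ht
        · rw [T.eq_of_isTerminal hjt ht]
        · have : (j : ℕ) ≠ i := fun h => ht (by rwa [show (⟨i, hi⟩ : Fin m) = j from Fin.ext h.symm])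
          exact (k3 v).1 j (by omega) hjt
      · intro hn
        rw [if_neg (hn ⟨i, hi⟩ (by simp))]
        exact (k3 v).2 fun j hj => hn j (by omega)
    simp only [Order.lt_add_one_iff] at hterm
    refine ⟨by omega, by omega, by omega, by omega, by omega, ?_, ?_⟩
    · rintro rfl
      exact ⟨by omega, by omega, by omega, by omega, rfl, hterm⟩
    · exact fun h => ⟨by omega, by omega, by omega, k2 (by omega), hterm⟩
  · simp [Exp.cost]; omega
  · rintro s4 F4 ⟨-, -, k2, k3⟩
    rw [← F4.mem 0 (by decide)] at h0
    rw [← F4.mem 1 (by decide)] at j2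
    refine ⟨⟨(F4.reg 0 (by decide)).trans i1, fun v => ?_, fun v => ?_, fun v => ?_, by omega⟩,
      k2 (by omega), fun v => ⟨fun i => (k3 v).1 i i.2, fun h => (k3 v).2 fun j _ hj => h ⟨j, hj⟩⟩⟩
    · rw [j2 v v.2]
      exact (seg_rot h0 v).1
    · rw [j2 v v.2]
      exact (seg_rot h0 v).2
    · rw [j2 v v.2]
      have := rotPos_succ T.net v.2
      rw [Fin.eta] at this
      have := rotPos_mono T.net (a := v + 1) (b := n) v.2
      have : rotPos T.net n ≤ linePos T.net m := Nat.le_add_right _ _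
      omega

end RAM
end BlockCrossing

/-! ### Listing the children of a vertex. -/

namespace BlockCrossing
namespace RAM

local infixr:60 " ;; " => Prog.seq

/-- Finds the index of the parent of the vertex in register 42 in its adjacency list, which
starts in the cell given by register 44. -/
def findParent : Prog :=
  -- The sum of the two truncated differences is positive exactly if the two numbers differ.
  .loop (.lt (.const 0) (.add (.sub (.read 0 (.add (.reg 44) (.reg 45))) (.read 2 (.reg 42)))
    (.sub (.read 2 (.reg 42)) (.read 0 (.add (.reg 44) (.reg 45))))))
    (.assign 45 (.add (.reg 45) (.const 1)))

/-- The child number `j`, counted from `1`, stands `j` places after the parent in the cyclic list.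
The sum of the two indices is less than twice the degree, or equals the degree one at the root, so
one subtraction replaces the remainder. -/
def pushChild : Prog :=
  (.assign 47 (.add (.reg 45) (.reg 46)) ;;
    .cond (.lt (.reg 47) (.reg 43)) .skip (.assign 47 (.sub (.reg 47) (.reg 43)))) ;;
  .assign 48 (.read 0 (.add (.reg 44) (.reg 47))) ;; .write 5 (.reg 40) (.reg 48) ;;
  .write 2 (.reg 48) (.reg 42) ;; .assign 40 (.add (.reg 40) (.const 1)) ;;
  .assign 46 (.sub (.reg 46) (.const 1))

/-- Pushes the children of the vertex in register 42 to the stack in array 5, with the first one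
on top. -/
def pushChildren : Prog :=
  (.assign 43 (.read 0 (.read 1 (.reg 42))) ;; .assign 44 (.add (.read 1 (.reg 42)) (.const 1)) ;;
    .assign 45 (.const 0)) ;;
  .cond (.eq (.reg 42) (.reg 36)) (.assign 46 (.reg 43))
    (findParent ;; .assign 46 (.sub (.reg 43) (.const 1))) ;;
  .loop (.lt (.const 0) (.reg 46)) pushChild

variable {W n m : ℕ} {T : TreeNetwork n m} {s : State}

theorem findParent_spec (hA : Adjacency W T.net s) {v : Fin n} (hv : v ≠ T.root) (h42 : s.reg 42 = v)
    (hpar : s.mem 2 v = T.par v) (h44 : s.reg 44 = s.mem 1 v + 1) (h45 : s.reg 45 = 0) :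
    Spec W findParent s (25 * (T.net.rot v).length + 25) fun s' =>
      s'.reg 45 = (T.net.rot v).idxOf (T.par v) := by
  have hW := hA.size_lt
  have hlt := hA.lt v
  have hmem := T.par_mem_rot hv
  have hidx := List.idxOf_lt_length_of_mem hmem
  have hp := (T.par v).2
  have hvn := v.2
  refine (Spec.loop (a := 0) (b := (T.net.rot v).idxOf (T.par v)) (fun _ => 4)
    (fun k s' => s'.reg 45 = k) (Nat.zero_le _) h45 ?_ ?_ ?_)
  · intro s' k F _ hk h45
    replace hA := hA.frame F (by decide) (by decide) (by decide)
    rw [← F.reg 42 (by decide)] at h42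
    rw [← F.mem 2 (by decide)] at hpar
    rw [← F.mem 1 (by decide), ← F.reg 44 (by decide)] at h44
    have hlt := hA.lt v
    have hget := hA.get (v := v) (i := k) (by omega)
    have hne : (T.net.rot v)[k] ≠ T.par v := fun h => by
      have := (T.net.rot_nodup v).idxOf_getElem k (by omega)
      rw [h] at this
      omega
    have hne' := Fin.val_ne_of_ne hne
    have hx := ((T.net.rot v)[k]).2
    refine ⟨?_, ?_, ?_⟩
    · simp only [Test.Fits, Exp.Fits, Exp.val, h44, h45, h42, hpar, hget]
      omega
    · simp only [Test.Holds, Exp.val, h44, h45, h42, hpar, hget]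
      omega
    · refine Spec.of_wp ?_ (by decide)
      simp only [wp, Exp.Fits, Exp.val, State.set_reg, h45]
      exact ⟨by omega, if_pos trivial⟩
  · intro s' F h45
    replace hA := hA.frame F (by decide) (by decide) (by decide)
    rw [← F.reg 42 (by decide)] at h42
    rw [← F.mem 2 (by decide)] at hpar
    rw [← F.mem 1 (by decide), ← F.reg 44 (by decide)] at h44
    have hlt := hA.lt v
    have hget := hA.get (v := v) hidx
    rw [List.getElem_idxOf] at hget
    constructor
    · simp only [Test.Fits, Exp.Fits, Exp.val, h44, h45, h42, hpar, hget]
      omega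
    · simp only [Test.Holds, Exp.val, h44, h45, h42, hpar, hget]
      omega
  · simp [Test.cost, Exp.cost]; omega

theorem pushChildren_spec (hA : Adjacency W T.net s) {v : Fin n} (h42 : s.reg 42 = v)
    (h36 : s.reg 36 = T.root) (hpar : v ≠ T.root → s.mem 2 v = T.par v) {l : List ℕ}
    (hl : Seg (s.mem 5) 0 l) (h40 : s.reg 40 = l.length)
    (hlen : l.length + (T.children v).length < W) :
    Spec W pushChildren s (80 * (T.net.rot v).length + 60) fun s' =>
      Seg (s'.mem 5) 0 (l ++ (T.children v).reverse.map Fin.val) ∧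
      s'.reg 40 = l.length + (T.children v).length ∧
      ∀ u : Fin n, s'.mem 2 u = if u ∈ T.children v then (v : ℕ) else s.mem 2 u := by
  have hW := hA.size_lt
  have hlt := hA.lt v
  have hvn := v.2
  have hrn := T.root.2
  refine Spec.seq (t := 20) (Q := fun s' => s'.reg 43 = (T.net.rot v).length ∧
    s'.reg 44 = s'.mem 1 v + 1 ∧ s'.reg 45 = 0) (Spec.of_wp ?_ (by decide)) ?_
    (t' := 80 * (T.net.rot v).length + 40) (by omega)
  · simp [wp, Exp.Fits, Exp.val, State.set_reg, State.set_mem, h42, hA.degree v]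
    omega
  rintro s1 F1 ⟨h43, h44, h45⟩
  replace hA := hA.frame F1 (by decide) (by decide) (by decide)
  have hlt := hA.lt v
  rw [← F1.reg 42 (by decide)] at h42
  rw [← F1.reg 36 (by decide)] at h36
  rw [← F1.reg 40 (by decide)] at h40
  rw [← F1.mem 5 (by decide)] at hl
  have em2 := F1.mem 2 (by decide)
  rw [← em2] at hpar
  refine Spec.seq (t := 25 * (T.net.rot v).length + 34)
    (Q := fun s' => s'.reg 46 = (T.children v).length ∧ s'.reg 45 ≤ (T.net.rot v).length ∧
      ∀ c (hc : c < (T.children v).length), ∃ j, ∃ hj : j < (T.net.rot v).length,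
        (T.net.rot v)[j] = (T.children v)[c] ∧
        j = if s'.reg 45 + (c + 1) < (T.net.rot v).length then s'.reg 45 + (c + 1)
          else s'.reg 45 + (c + 1) - (T.net.rot v).length)
    ?_ ?_ (t' := 55 * (T.net.rot v).length + 6) (by omega)
  · refine Spec.cond (t := 25 * (T.net.rot v).length + 30) ?_ ?_ ?_
      (by simp only [Test.cost, Exp.cost]; omega)
    · simp only [Test.Fits, Exp.Fits, h42, h36]
      omega
    · intro h
      simp only [Test.Holds, Exp.val, h42, h36] at h
      obtain rfl : v = T.root := Fin.ext h
      obtain ⟨x, hx⟩ := T.exists_children_root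
      have hrot : T.net.rot T.root = [x] := by
        rw [← hx, TreeNetwork.children, if_pos rfl]
      -- The root has no parent to start after. With start `0` and degree one, child number `1`
      -- wraps around to index `0`, as it should.
      refine Spec.of_wp ?_ (by simp only [Prog.cost, Exp.cost]; omega)
      simp only [wp, Exp.Fits, Exp.val, State.set_reg, h43]
      refine ⟨by omega, ?_⟩
      simp [hrot, hx, h45]
    · intro h
      simp only [Test.Holds, Exp.val, h42, h36] at h
      have hv : v ≠ T.root := fun h' => h (by rw [h'])
      refine Spec.seq (findParent_spec hA hv h42 (hpar hv) h44 h45) (t' := 4) ?_ (by omega)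
      intro s2 F2 h45
      rw [← F2.reg 43 (by decide)] at h43
      have hmem := T.par_mem_rot hv
      have hidx := List.idxOf_lt_length_of_mem hmem
      have hrot := T.rot_rotate hmem
      have hch : T.children v = T.net.others v (T.par v) := by
        rw [TreeNetwork.children, if_neg hv]
      rw [← hch] at hrot
      have hclen : (T.net.rot v).length = (T.children v).length + 1 := by
        rw [← List.length_rotate (T.net.rot v), hrot, List.length_cons]
      refine Spec.of_wp ?_ (by decide)
      simp only [wp, Exp.Fits, Exp.val, State.set_reg, h43, h45]
      refine ⟨by omega, by simp; omega, by simp; omega, fun c hc => ?_⟩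
      have hmod := List.getElem_rotate (T.net.rot v) ((T.net.rot v).idxOf (T.par v)) (c + 1)
        (by rw [List.length_rotate]; omega)
      simp only [hrot, List.getElem_cons_succ] at hmod
      refine ⟨_, Nat.mod_lt _ (by omega), hmod.symm, ?_⟩
      simp only [Nat.reduceEqDiff, if_false]
      split_ifs with h'
      · rw [Nat.mod_eq_of_lt (by omega)]; omega
      · rw [Nat.mod_eq_sub_mod (by omega), Nat.mod_eq_of_lt (by omega)]; omega
  rintro s2 F2 ⟨h46, h45, hget⟩
  replace hA := hA.frame F2 (by decide) (by decide) (by decide)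
  have hlt := hA.lt v
  rw [← F2.reg 42 (by decide)] at h42
  rw [← F2.reg 43 (by decide)] at h43
  rw [← F2.reg 40 (by decide)] at h40
  rw [← F2.reg 44 (by decide), ← F2.mem 1 (by decide)] at h44
  rw [← F2.mem 5 (by decide)] at hl
  replace em2 := (F2.mem 2 (by decide)).trans em2
  rw [← em2]
  have hCd : (T.children v).length ≤ (T.net.rot v).length := by
    rw [TreeNetwork.children]
    split_ifs
    · rfl
    · rw [Network.others, List.length_tail, List.length_rotate]; omega
  refine (Spec.loop (a := 0) (b := (T.children v).length) (fun _ => 50)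
    (fun j s' => s'.reg 46 = (T.children v).length - j ∧
      Seg (s'.mem 5) 0 (l ++ ((T.children v).drop ((T.children v).length - j)).reverse.map Fin.val) ∧
      s'.reg 40 = l.length + j ∧
      ∀ u : Fin n, s'.mem 2 u = if u ∈ (T.children v).drop ((T.children v).length - j) then (v : ℕ)
        else s2.mem 2 u) (Nat.zero_le _) ⟨h46, by simpa using hl, h40, by simp⟩ ?_ ?_ ?_).mono le_rfl ?_
  · rintro s' j F - hj ⟨j1, j2, j3, j4⟩
    replace hA := hA.frame F (by decide) (by decide) (by decide)
    rw [← F.reg 42 (by decide)] at h42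
    rw [← F.reg 43 (by decide)] at h43
    rw [← F.reg 45 (by decide)] at h45 hget
    rw [← F.reg 44 (by decide), ← F.mem 1 (by decide)] at h44
    have hlt := hA.lt v
    refine ⟨by simp only [Test.Fits, Exp.Fits]; omega, by simp only [Test.Holds, Exp.val]; omega, ?_⟩
    obtain ⟨c, hc⟩ : ∃ c, (T.children v).length = c + 1 + j := ⟨(T.children v).length - j - 1, by omega⟩
    obtain ⟨i, hi, hi1, hi2⟩ := hget c (by omega)
    have hgi := hA.get hi
    rw [hi1] at hgi
    rw [show (T.children v).length - j = c + 1 by omega] at j1 j2 j4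
    rw [show (T.children v).length - (j + 1) = c by omega, List.drop_eq_getElem_cons (by omega)]
    generalize (T.children v)[c] = w at *
    have hwn := w.2
    obtain ⟨k, hk'⟩ : ∃ k, s'.reg 45 = k := ⟨_, rfl⟩
    rw [hk'] at h45 hi2
    have hupd : ∀ u : Fin n, Function.update (s'.mem 2) w v u =
        if u ∈ w :: (T.children v).drop (c + 1) then (v : ℕ) else s2.mem 2 u := by
      intro u
      rw [Function.update_apply, j4 u]
      by_cases huw : u = w
      · simp [huw]
      · simp [huw, Fin.val_ne_of_ne huw]
    have hseg : Seg (Function.update (s'.mem 5) (l.length + j) w) 0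
        (l ++ (w :: (T.children v).drop (c + 1)).reverse.map Fin.val) := by
      rw [List.reverse_cons, List.map_append, ← List.append_assoc]
      refine j2.snoc ?_
      simp
      omega
    have hkc : k + (c + 1) < W := by
      have : (T.net.rot v).length ≤ n := by
        simpa using List.Nodup.length_le_card (T.net.rot_nodup v)
      omega
    refine Spec.seq (t := 15) (Q := fun s' => s'.reg 47 = i) (Spec.of_wp ?_ (by decide)) ?_
      (t' := 35) (by omega)
    · simp only [wp, Exp.Fits, Exp.val, Test.Fits, Test.Holds, State.set_reg, h43, hk', j1]
      simp
      split_ifs at hi2 <;> omega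
    intro s3 F3 h47
    rw [← F3.reg 42 (by decide)] at h42
    rw [← F3.reg 44 (by decide), ← F3.mem 1 (by decide)] at h44
    rw [← F3.reg 46 (by decide)] at j1
    rw [← F3.reg 40 (by decide)] at j3
    rw [← F3.mem 0 (by decide), ← F3.mem 1 (by decide)] at hgi
    rw [← F3.mem 5 (by decide)] at hseg
    rw [← F3.mem 2 (by decide)] at hupd
    rw [← F3.mem 1 (by decide)] at hlt
    refine Spec.of_wp ?_ (by decide)
    simp only [wp, Exp.Fits, Exp.val, State.set_reg, State.set_mem, State.put_reg, State.put_mem,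
      h42, h44, j1, j3, h47, hgi]
    simp
    refine ⟨by omega, by omega, by omega, by omega, by omega, by simpa using hseg, by omega, ?_⟩
    simpa using hupd
  · rintro s' F ⟨j1, -⟩
    exact ⟨by simp only [Test.Fits, Exp.Fits]; omega, by simp only [Test.Holds, Exp.val]; omega⟩
  · simp [Test.cost, Exp.cost]; omega
  · rintro s' - ⟨-, j2, j3, j4⟩
    rw [Nat.sub_self, List.drop_zero] at j2 j4
    exact ⟨j2, j3, j4⟩

end RAM
end BlockCrossing

/-! ### The tour with an explicit stack. -/

namespace BlockCrossing

namespace TreeNetwork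

variable {n m : ℕ} (T : TreeNetwork n m)

theorem length_tour : (T.tour T.root).length ≤ 2 * n := by
  simpa using (T.nodup_tour T.root).length_le_card

/-- The part of the tour that is still to come when `e` is next on the stack. -/
noncomputable def expand (e : Bool × Fin n) : List (Bool × Fin n) :=
  if e.1 then T.tour e.2 else [e]

theorem expand_ne_nil (e : Bool × Fin n) : T.expand e ≠ [] := by
  unfold expand
  split_ifs
  · rw [tour_eq]; simp
  · simp

/-- Every entry of the stack stands for a nonempty part of the tour, so the stack is never larger
than the tour. -/
theorem length_le_flatMap_expand (l : List (Bool × Fin n)) :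
    l.length ≤ (l.flatMap T.expand).length := by
  simpa using RAM.length_le_length_flatMap (l := l) (e := T.expand) 1 fun e _ =>
    List.length_pos_of_ne_nil (T.expand_ne_nil e)

/-- Entering `v` consumes one event of the tour; pushing its leaving event and its children
preserves the remainder. -/
theorem expand_enter (v : Fin n) (l : List (Bool × Fin n)) :
    ((true, v) :: l).flatMap T.expand = (true, v) ::
      ((T.children v).map (Prod.mk true) ++ (false, v) :: l).flatMap T.expand := by
  have h1 : T.expand (true, v) = T.tour v := by simp [expand]
  have h2 : T.expand (false, v) = [(false, v)] := by simp [expand]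
  rw [List.flatMap_cons, h1, tour_eq, List.flatMap_append, List.flatMap_cons, h2, List.flatMap_map]
  simp [expand]

theorem endsIn_snoc_false (E : List (Bool × Fin n)) (v : Fin n) :
    T.endsIn (E ++ [(false, v)]) = T.endsIn E := by
  simp [endsIn]

theorem endsIn_snoc_not {E : List (Bool × Fin n)} {v : Fin n} (h : ¬ T.IsEnd v) :
    T.endsIn (E ++ [(true, v)]) = T.endsIn E := by
  simp [endsIn, h]

theorem endsIn_snoc {E : List (Bool × Fin n)} {v : Fin n} (h : T.IsEnd v) :
    T.endsIn (E ++ [(true, v)]) = T.endsIn E ++ [v] := by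
  simp [endsIn, h]

/-- The number of ends met so far is the number of the end met next, so a counter suffices to number
them. -/
theorem endAt_length {E Y : List (Bool × Fin n)} {v : Fin n} (h : T.tour T.root = E ++ (true, v) :: Y)
    (hv : T.IsEnd v) : (T.endsIn E).length < T.numEnds ∧ T.endAt (T.endsIn E).length = v := by
  have hE : T.ends = T.endsIn E ++ v :: T.endsIn Y := by
    unfold ends
    rw [h, List.append_cons, endsIn_append, endsIn_snoc T hv]
    simp
  constructor
  · rw [numEnds, hE]; simp
  · rw [endAt, hE]; simp

theorem length_endsIn_le {E Y : List (Bool × Fin n)} (h : T.tour T.root = E ++ Y) :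
    (T.endsIn E).length ≤ T.numEnds := by
  rw [numEnds, ends, h, endsIn_append, List.length_append]
  omega

end TreeNetwork

namespace RAM

local infixr:60 " ;; " => Prog.seq

/-- Registers the line end in register 42. -/
def addEnd : Prog :=
  .assign 49 (.sub (.read 3 (.reg 42)) (.const 1)) ;; .write 8 (.reg 41) (.reg 49) ;;
  .cond (.eq (.read 4 (.reg 49)) (.const 0)) (.write 4 (.reg 49) (.add (.reg 41) (.const 1)))
    (.assign 50 (.sub (.read 4 (.reg 49)) (.const 1)) ;; .write 9 (.reg 41) (.reg 50) ;;
      .write 9 (.reg 50) (.reg 41)) ;;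
  .assign 41 (.add (.reg 41) (.const 1))

def enter : Prog :=
  -- `lo` is stored before the vertex itself is counted as an end, so that it belongs to its own
  -- interval.
  .write 6 (.reg 42) (.reg 41) ;; .cond (.lt (.const 0) (.read 3 (.reg 42))) addEnd .skip ;;
  (.write 5 (.reg 40) (.add (.reg 0) (.reg 42)) ;; .assign 40 (.add (.reg 40) (.const 1))) ;;
  pushChildren

/-- A step of the tour, from the stack in array 5 with its size in register 40; entering `v`
stands as `v` on the stack, leaving `v` as `n + v`. The number of line ends met so far is in
register 41. -/
def tourStep : Prog :=
  (.assign 40 (.sub (.reg 40) (.const 1)) ;; .assign 42 (.read 5 (.reg 40))) ;;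
  .cond (.lt (.reg 42) (.reg 0)) enter (.write 7 (.sub (.reg 42) (.reg 0)) (.reg 41))

def traverse : Prog :=
  (.write 5 (.const 0) (.reg 36) ;; .write 2 (.reg 36) (.reg 0) ;; .assign 40 (.const 1) ;;
    .assign 41 (.const 0)) ;;
  .loop (.lt (.const 0) (.reg 40)) tourStep

/-- An event of the tour as a number. -/
def code {n : ℕ} (e : Bool × Fin n) : ℕ := if e.1 then e.2 else n + e.2

/-- The line ends before the number `k` are registered in the arrays: their lines in `f`, their mates
in `f'`, and for every line its first end (plus one) in `f₀`. -/
structure EndsDone {n m : ℕ} (T : TreeNetwork n m) (k : ℕ) (f₀ f f' : ℕ → ℕ) : Prop where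
  line : ∀ g < k, f g = T.lineAt g
  mate : ∀ g < k, T.mate g < k → f' g = T.mate g
  first : ∀ i : Fin m, (f₀ i = 0 ∧ ∀ g < k, T.lineAt g ≠ i) ∨ ∃ g < k, f₀ i = g + 1 ∧ T.lineAt g = i

theorem EndsDone.line_succ {n m : ℕ} {T : TreeNetwork n m} {k : ℕ} {f₀ f f' : ℕ → ℕ}
    (h : EndsDone T k f₀ f f') : ∀ g < k + 1, Function.update f k (T.lineAt k) g = T.lineAt g := by
  intro g hg
  by_cases hgk : g = k
  · rw [hgk, Function.update_self]
  · rw [Function.update_of_ne hgk]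
    exact h.line g (by omega)

/-- The end `k` is the first one of its line, so it completes no pair of mates. -/
theorem EndsDone.of_new {n m : ℕ} {T : TreeNetwork n m} {k : ℕ} {f₀ f f' : ℕ → ℕ}
    (h : EndsDone T k f₀ f f') (hk : k < T.numEnds) (hno : ∀ g < k, T.lineAt g ≠ T.lineAt k) :
    EndsDone T (k + 1) (Function.update f₀ (T.lineAt k) (k + 1)) (Function.update f k (T.lineAt k)) f' := by
  refine ⟨h.line_succ, fun g hg hg' => ?_, fun i => ?_⟩
  · have hgn : g < T.numEnds := by omega
    have hne := TreeNetwork.mate_ne hgn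
    have hl := TreeNetwork.lineAt_mate hgn
    have h1 : g ≠ k := by
      rintro rfl
      exact hno _ (by omega) hl
    have h2 : T.mate g ≠ k := fun h2 => hno g (by omega) (by rw [← hl, h2])
    exact h.mate g (by omega) (by omega)
  · by_cases hi : i = T.lineAt k
    · subst hi
      exact Or.inr ⟨k, by omega, Function.update_self .., rfl⟩
    · rw [Function.update_of_ne (Fin.val_ne_of_ne hi)]
      rcases h.first i with ⟨h1, h2⟩ | ⟨g, h1, h2⟩
      · refine Or.inl ⟨h1, fun g hg => ?_⟩
        by_cases hgk : g = k
        · subst hgk; exact Ne.symm hi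
        · exact h2 g (by omega)
      · exact Or.inr ⟨g, by omega, h2⟩

/-- A line has only two ends, so the earlier end `j` must be the mate of `k`, and both entries
become known at once. -/
theorem EndsDone.of_old {n m : ℕ} {T : TreeNetwork n m} {k : ℕ} {f₀ f f' : ℕ → ℕ}
    (h : EndsDone T k f₀ f f') (hk : k < T.numEnds) {j : ℕ} (hj : j < k)
    (hl : T.lineAt j = T.lineAt k) : EndsDone T (k + 1) f₀ (Function.update f k (T.lineAt k))
      (Function.update (Function.update f' k j) j k) := by
  have hjn : j < T.numEnds := hj.trans hk
  have hm : k = T.mate j := (TreeNetwork.eq_or_eq_mate hjn hk hl.symm).resolve_left (by omega)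
  refine ⟨h.line_succ, fun g hg hg' => ?_, fun i => ?_⟩
  · by_cases hgj : g = j
    · rw [hgj, Function.update_self]; exact hm
    rw [Function.update_of_ne hgj]
    by_cases hgk : g = k
    · rw [hgk, Function.update_self, hm, TreeNetwork.mate_mate hjn]
    rw [Function.update_of_ne hgk]
    refine h.mate g (by omega) ?_
    by_contra hge
    have h1 : T.mate g = T.mate j := by omega
    apply hgj
    rw [← TreeNetwork.mate_mate (T := T) (g := g) (by omega), h1, TreeNetwork.mate_mate hjn]
  · rcases h.first i with ⟨h1, h2⟩ | ⟨g, h1, h2⟩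
    · refine Or.inl ⟨h1, fun g hg => ?_⟩
      by_cases hgk : g = k
      · rw [hgk, ← hl]; exact h2 j hj
      · exact h2 g (by omega)
    · exact Or.inr ⟨g, by omega, h2⟩

/-- The tour has been processed up to the events `E`, and `l` is the stack (the top first). -/
structure Touring {n m : ℕ} (T : TreeNetwork n m) (E l : List (Bool × Fin n)) (s : State) : Prop where
  split : T.tour T.root = E ++ l.flatMap T.expand
  stack : Seg (s.mem 5) 0 (l.reverse.map code)
  size : s.reg 40 = l.length
  count : s.reg 41 = (T.endsIn E).length
  par : ∀ v, v ≠ T.root → (true, v) ∈ E ∨ (true, v) ∈ l → s.mem 2 v = T.par v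
  par_root : s.mem 2 T.root = n
  lo : ∀ v, (true, v) ∈ E → s.mem 6 v = T.lo v
  hi : ∀ v, (false, v) ∈ E → s.mem 7 v = T.hi v
  ends : EndsDone T (T.endsIn E).length (s.mem 4) (s.mem 8) (s.mem 9)

/-- What the tour relies on. -/
structure Parsed (W : ℕ) {n m : ℕ} (T : TreeNetwork n m) (s : State) : Prop where
  adj : Adjacency W T.net s
  root : s.reg 36 = T.root
  ends : ∀ v : Fin n, (∀ i, T.net.IsTerminal i v → s.mem 3 v = i + 1) ∧ (¬ T.IsEnd v → s.mem 3 v = 0)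
  lt : 2 * n + m + T.numEnds + 10 < W

theorem Parsed.frame {W n m : ℕ} {T : TreeNetwork n m} {p : Prog} {s s' : State} (h : Parsed W T s)
    (F : Frame p s s') (hr : ∀ x ∈ [0, 36], x ∉ p.regs) (ha : ∀ A ∈ [0, 1, 3], A ∉ p.arrays) :
    Parsed W T s' := by
  obtain ⟨h1, h2, h3, h4⟩ := h
  refine ⟨h1.frame F (hr _ (by decide)) (ha _ (by decide)) (ha _ (by decide)), ?_, ?_, h4⟩
  · rwa [F.reg _ (hr _ (by decide))]
  · rwa [F.mem _ (ha _ (by decide))]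

variable {W n m : ℕ} {T : TreeNetwork n m} {s : State}

theorem addEnd_spec (hP : Parsed W T s) {v : Fin n} (h42 : s.reg 42 = v) {k : ℕ} (hk : k < T.numEnds)
    (h41 : s.reg 41 = k) (hv : T.endAt k = v) (hE : EndsDone T k (s.mem 4) (s.mem 8) (s.mem 9)) :
    Spec W addEnd s 40 fun s' => s'.reg 41 = k + 1 ∧
      EndsDone T (k + 1) (s'.mem 4) (s'.mem 8) (s'.mem 9) := by
  have hW := hP.lt
  have hvn := v.2
  have hterm := TreeNetwork.isTerminal_lineAt hk
  rw [hv] at hterm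
  have h3 := (hP.ends v).1 _ hterm
  have him := (T.lineAt k).2
  refine Spec.of_wp ?_ (by decide)
  rcases hE.first (T.lineAt k) with ⟨h4, hno⟩ | ⟨g, hg, h4, hgi⟩
  · simp only [addEnd, wp, Exp.Fits, Exp.val, Test.Fits, Test.Holds, State.set_reg, State.set_mem,
      State.put_reg, State.put_mem, h42, h3, h41]
    simp [h4]
    exact ⟨by omega, by omega, by omega, by omega, by omega, hE.of_new hk hno⟩
  · simp only [addEnd, wp, Exp.Fits, Exp.val, Test.Fits, Test.Holds, State.set_reg, State.set_mem,
      State.put_reg, State.put_mem, h42, h3, h41]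
    simp [h4]
    exact ⟨by omega, by omega, by omega, by omega, by omega, by omega, by omega, hE.of_old hk hg hgi⟩

theorem Touring.length_le {E l : List (Bool × Fin n)} (h : Touring T E l s) : l.length ≤ 2 * n := by
  have h1 := T.length_tour
  have h2 := T.length_le_flatMap_expand l
  rw [h.split, List.length_append] at h1
  omega

theorem exit_spec {E l : List (Bool × Fin n)} {v : Fin n} (hP : Parsed W T s)
    (hT : T.tour T.root = E ++ ((false, v) :: l).flatMap T.expand)
    (stack : Seg (s.mem 5) 0 (l.reverse.map code)) (size : s.reg 40 = l.length)
    (count : s.reg 41 = (T.endsIn E).length)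
    (par : ∀ v, v ≠ T.root → (true, v) ∈ E ∨ (true, v) ∈ l → s.mem 2 v = T.par v)
    (par_root : s.mem 2 T.root = n) (lo : ∀ v, (true, v) ∈ E → s.mem 6 v = T.lo v)
    (hi : ∀ v, (false, v) ∈ E → s.mem 7 v = T.hi v)
    (ends : EndsDone T (T.endsIn E).length (s.mem 4) (s.mem 8) (s.mem 9)) (h42 : s.reg 42 = n + v) :
    Spec W (.write 7 (.sub (.reg 42) (.reg 0)) (.reg 41)) s 10 (Touring T (E ++ [(false, v)]) l) := by
  have hW := hP.lt
  have hsize := hP.adj.size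
  have hvn := v.2
  have hx : T.expand (false, v) = [(false, v)] := by simp [TreeNetwork.expand]
  rw [List.flatMap_cons, hx, List.singleton_append] at hT
  have hlen := T.length_endsIn_le hT
  refine Spec.of_wp ?_ (by decide)
  simp only [wp, Exp.Fits, Exp.val, h42, count, hsize, Nat.add_sub_cancel_left]
  refine ⟨by omega, ⟨by rw [hT]; simp, stack, size, ?_, fun u hu h => par u hu ?_, par_root,
    fun u hu => lo u ?_, fun u hu => ?_, ?_⟩⟩
  · rw [T.endsIn_snoc_false]; exact count
  · simpa using h
  · simpa using hu
  · rw [State.put_mem, if_pos rfl]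
    by_cases huv : u = v
    · rw [huv, Function.update_self, T.hi_eq hT]
    · rw [Function.update_of_ne (Fin.val_ne_of_ne huv)]
      refine hi u ?_
      simpa [huv] using hu
  · rw [T.endsIn_snoc_false]; exact ends

theorem enter_spec {E l : List (Bool × Fin n)} {v : Fin n} (hP : Parsed W T s)
    (hT : T.tour T.root = E ++ ((true, v) :: l).flatMap T.expand)
    (stack : Seg (s.mem 5) 0 (l.reverse.map code)) (size : s.reg 40 = l.length)
    (count : s.reg 41 = (T.endsIn E).length)
    (par : ∀ u, u ≠ T.root → (true, u) ∈ E ∨ (true, u) ∈ (true, v) :: l → s.mem 2 u = T.par u)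
    (par_root : s.mem 2 T.root = n) (lo : ∀ v, (true, v) ∈ E → s.mem 6 v = T.lo v)
    (hi : ∀ v, (false, v) ∈ E → s.mem 7 v = T.hi v)
    (ends : EndsDone T (T.endsIn E).length (s.mem 4) (s.mem 8) (s.mem 9)) (h42 : s.reg 42 = v) :
    Spec W enter s (80 * (T.net.rot v).length + 130) (Touring T (E ++ [(true, v)])
      ((T.children v).map (Prod.mk true) ++ (false, v) :: l)) := by
  have hW := hP.lt
  have hsize := hP.adj.size
  have hvn := v.2
  rw [T.expand_enter] at hT
  have hlen := T.length_endsIn_le hT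
  have hlen2 : (T.children v).length + 1 + l.length ≤ 2 * n := by
    have h1 := T.length_tour
    have h2 := T.length_le_flatMap_expand ((T.children v).map (Prod.mk true) ++ (false, v) :: l)
    rw [hT] at h1
    simp only [List.length_append, List.length_cons, List.length_map] at h1 h2
    omega
  refine Spec.seq (t := 4) (Q := fun s' => ∀ u, (true, u) ∈ E ++ [(true, v)] → s'.mem 6 u = T.lo u)
    (Spec.of_wp ?_ (by decide)) ?_ (t' := 80 * (T.net.rot v).length + 126) (by omega)
  · simp only [wp, Exp.Fits, Exp.val, h42, count]
    refine ⟨by omega, fun u hu => ?_⟩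
    rw [State.put_mem, if_pos rfl]
    by_cases huv : u = v
    · rw [huv, Function.update_self, T.lo_eq hT]
    · rw [Function.update_of_ne (Fin.val_ne_of_ne huv)]
      refine lo u ?_
      simpa [huv] using hu
  intro s1 F1 lo
  replace hP := hP.frame F1 (by decide) (by decide)
  rw [← F1.mem 5 (by decide)] at stack
  rw [← F1.reg 40 (by decide)] at size
  rw [← F1.reg 41 (by decide)] at count
  rw [← F1.mem 2 (by decide)] at par par_root
  rw [← F1.mem 7 (by decide)] at hi
  rw [← F1.mem 4 (by decide), ← F1.mem 8 (by decide), ← F1.mem 9 (by decide)] at ends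
  rw [← F1.reg 42 (by decide)] at h42
  refine Spec.seq (t := 50) (Q := fun s' => s'.reg 41 = (T.endsIn (E ++ [(true, v)])).length ∧
    EndsDone T (T.endsIn (E ++ [(true, v)])).length (s'.mem 4) (s'.mem 8) (s'.mem 9)) ?_ ?_
    (t' := 80 * (T.net.rot v).length + 76) (by omega)
  · have h3 := hP.ends v
    refine Spec.cond (t := 40) ?_ ?_ ?_ (by decide)
    · have : s1.mem 3 v ≤ m := by
        by_cases hv : T.IsEnd v
        · obtain ⟨i, hi⟩ := hv
          have := i.2
          rw [h3.1 i hi]; omega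
        · rw [h3.2 hv]; omega
      simp only [Test.Fits, Exp.Fits, Exp.val, h42]
      omega
    · intro h
      simp only [Test.Holds, Exp.val, h42] at h
      have hv : T.IsEnd v := by
        by_contra hv
        rw [h3.2 hv] at h
        omega
      obtain ⟨h5, h6⟩ := T.endAt_length hT hv
      rw [T.endsIn_snoc hv, List.length_append]
      exact addEnd_spec hP h42 h5 count h6 ends
    · intro h
      simp only [Test.Holds, Exp.val, h42] at h
      have hv : ¬ T.IsEnd v := by
        rintro ⟨i, hi⟩
        rw [h3.1 i hi] at h
        omega
      rw [T.endsIn_snoc_not hv]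
      exact Spec.of_wp ⟨count, ends⟩ (by decide)
  rintro s2 F2 ⟨count, ends⟩
  replace hP := hP.frame F2 (by decide) (by decide)
  rw [← F2.mem 5 (by decide)] at stack
  rw [← F2.reg 40 (by decide)] at size
  rw [← F2.mem 2 (by decide)] at par par_root
  rw [← F2.mem 6 (by decide)] at lo
  rw [← F2.mem 7 (by decide)] at hi
  rw [← F2.reg 42 (by decide)] at h42
  refine Spec.seq (t := 12) (Q := fun s' => s'.reg 40 = l.length + 1 ∧
    Seg (s'.mem 5) 0 (l.reverse.map code ++ [n + (v : ℕ)])) (Spec.of_wp ?_ (by decide)) ?_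
    (t' := 80 * (T.net.rot v).length + 60) (by omega)
  · simp only [wp, Exp.Fits, Exp.val, State.put_reg, State.put_mem, State.set_reg, State.set_mem, h42, size,
      hP.adj.size, if_true]
    exact ⟨by omega, by omega, trivial, stack.snoc (by simp)⟩
  rintro s3 F3 ⟨size, stack⟩
  replace hP := hP.frame F3 (by decide) (by decide)
  rw [← F3.reg 41 (by decide)] at count
  rw [← F3.mem 2 (by decide)] at par par_root
  rw [← F3.mem 6 (by decide)] at lo
  rw [← F3.mem 7 (by decide)] at hi
  rw [← F3.mem 4 (by decide), ← F3.mem 8 (by decide), ← F3.mem 9 (by decide)] at ends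
  rw [← F3.reg 42 (by decide)] at h42
  refine (pushChildren_spec hP.adj h42 hP.root (fun hv => par v hv (Or.inr (by simp))) stack
    (by rw [size]; simp) (by simp; omega)).mono le_rfl ?_
  rintro s4 F4 ⟨stack, size, par'⟩
  rw [← F4.reg 41 (by decide)] at count
  rw [← F4.mem 6 (by decide)] at lo
  rw [← F4.mem 7 (by decide)] at hi
  rw [← F4.mem 4 (by decide), ← F4.mem 8 (by decide), ← F4.mem 9 (by decide)] at ends
  refine ⟨by rw [hT]; simp, ?_, ?_, count, fun u hu h => ?_, ?_, lo, fun u hu => hi u ?_, ends⟩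
  · convert stack using 1
    simp [code, Function.comp_def]
  · rw [size]; simp; omega
  · rw [par' u]
    split_ifs with hc
    · rw [(T.mem_children.1 hc).2]
    · refine par u hu ?_
      simp only [List.mem_append, List.mem_map, List.mem_cons, Prod.mk.injEq,
        true_and, exists_eq_right, hc, false_or] at h ⊢
      simp at h
      rcases h with (h | h) | h
      · exact Or.inl h
      · exact Or.inr (Or.inl h)
      · exact Or.inr (Or.inr h)
  · rw [par' T.root, if_neg fun h => (T.mem_children.1 h).1 rfl, par_root]
  · simpa using hu

end RAM
end BlockCrossing

namespace BlockCrossing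
namespace RAM

local infixr:60 " ;; " => Prog.seq

variable {W n m : ℕ} {T : TreeNetwork n m} {s : State}

theorem tourStep_spec (hP : Parsed W T s) {E l : List (Bool × Fin n)} {e : Bool × Fin n}
    (h : Touring T E (e :: l) s) :
    Spec W tourStep s (80 * (T.net.rot e.2).length + 150)
      fun s' => ∃ l', Touring T (E ++ [e]) l' s' := by
  have hW := hP.lt
  have hen := e.2.2
  have hlen := h.length_le
  obtain ⟨split, stack, size, count, par, par_root, lo, hi, ends⟩ := h
  simp only [List.length_cons] at size hlen
  rw [List.reverse_cons, List.map_append, seg_append] at stack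
  obtain ⟨stack, htop, -⟩ := stack
  simp only [List.length_map, List.length_reverse, Nat.zero_add] at htop
  have hcode : code e < 2 * n := by unfold code; split_ifs <;> omega
  refine Spec.seq (t := 7) (Q := fun s' => s'.reg 40 = l.length ∧ s'.reg 42 = code e)
    (Spec.of_wp ?_ (by decide)) ?_ (t' := 80 * (T.net.rot e.2).length + 133) (by omega)
  · simp only [wp, Exp.Fits, Exp.val, State.set_reg, State.set_mem, size, Nat.add_sub_cancel]
    simp only [Nat.reduceEqDiff, if_false, if_true, htop]
    exact ⟨⟨by omega, by omega⟩, ⟨by omega, by omega⟩, trivial, trivial⟩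
  rintro s1 F ⟨size, h42⟩
  replace hP := hP.frame F (by decide) (by decide)
  rw [← F.mem 5 (by decide)] at stack
  rw [← F.reg 41 (by decide)] at count
  rw [← F.mem 2 (by decide)] at par par_root
  rw [← F.mem 6 (by decide)] at lo
  rw [← F.mem 7 (by decide)] at hi
  rw [← F.mem 4 (by decide), ← F.mem 8 (by decide), ← F.mem 9 (by decide)] at ends
  have hsize := hP.adj.size
  obtain ⟨b, v⟩ := e
  refine Spec.cond (t := 80 * (T.net.rot v).length + 130) ?_ ?_ ?_
    (by simp only [Test.cost, Exp.cost]; omega)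
  · simp only [Test.Fits, Exp.Fits, h42, hsize]
    omega
  · intro hlt
    simp only [Test.Holds, Exp.val, h42, hsize] at hlt
    cases b with
    | false => simp [code] at hlt
    | true =>
      exact (enter_spec hP split stack size count par par_root lo hi ends (by simpa [code] using h42)).mono
        le_rfl fun s' _ h => ⟨_, h⟩
  · intro hlt
    simp only [Test.Holds, Exp.val, h42, hsize] at hlt
    cases b with
    | true => simp [code] at hlt
    | false =>
      refine (exit_spec hP split stack size count (fun u hu hu' => par u hu ?_) par_root lo hi ends
        (by simpa [code] using h42)).mono (by omega) fun s' _ h => ⟨_, h⟩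
      simpa using hu'

/-- Each vertex occurs in the tour at most once as entered and once as left. -/
theorem sum_tour_le (f : Fin n → ℕ) :
    ((T.tour T.root).map fun e => f e.2).sum ≤ 2 * ∑ v, f v := by
  rw [← List.sum_toFinset _ (T.nodup_tour T.root)]
  refine (Finset.sum_le_univ_sum_of_nonneg fun _ => Nat.zero_le _).trans ?_
  rw [Fintype.sum_prod_type]
  simp

/-- The outcome of the tour. -/
structure Toured (T : TreeNetwork n m) (s : State) : Prop where
  count : s.reg 41 = T.numEnds
  par : ∀ v, v ≠ T.root → s.mem 2 v = T.par v
  par_root : s.mem 2 T.root = n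
  lo : ∀ v : Fin n, s.mem 6 v = T.lo v
  hi : ∀ v : Fin n, s.mem 7 v = T.hi v
  line : ∀ g < T.numEnds, s.mem 8 g = T.lineAt g
  mate : ∀ g < T.numEnds, s.mem 9 g = T.mate g

theorem Toured.frame {p : Prog} {s' : State} (h : Toured T s)
    (F : Frame p s s') (hr : 41 ∉ p.regs) (ha : ∀ A ∈ [2, 6, 7, 8, 9], A ∉ p.arrays) :
    Toured T s' := by
  obtain ⟨h1, h2, h3, h4, h5, h6, h7⟩ := h
  refine ⟨?_, ?_, ?_, ?_, ?_, ?_, ?_⟩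
  · rwa [F.reg _ hr]
  · rwa [F.mem _ (ha _ (by decide))]
  · rwa [F.mem _ (ha _ (by decide))]
  · rwa [F.mem _ (ha _ (by decide))]
  · rwa [F.mem _ (ha _ (by decide))]
  · rwa [F.mem _ (ha _ (by decide))]
  · rwa [F.mem _ (ha _ (by decide))]

/-- Round `k` treats the `k`-th event of the tour in time linear in the degree of its vertex, so the
total is governed by the sum of the degrees. -/
theorem traverse_spec (hP : Parsed W T s) (h4 : ∀ i, s.mem 4 i = 0) :
    Spec W traverse s (20 + ∑ v, (160 * (T.net.rot v).length + 320)) (Toured T) := by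
  have hW := hP.lt
  have hrn := T.root.2
  refine Spec.seq (t := 10) (Q := Touring T [] [(true, T.root)])
    (Spec.of_wp ?_ (by decide)) ?_ (t' := 10 + ∑ v, (160 * (T.net.rot v).length + 320)) (by omega)
  · simp only [wp, Exp.Fits, Exp.val, hP.root, hP.adj.size, State.put_reg]
    refine ⟨⟨by omega, by omega⟩, ⟨by omega, by omega⟩, by omega, by omega, ?_⟩
    constructor
    · simp [TreeNetwork.expand]
    · simp [Seg, code, State.set_mem, State.put_mem]
    · simp [State.set_reg]
    · simp [State.set_reg, TreeNetwork.endsIn]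
    · intro v hv h
      simp [hv] at h
    · simp [State.set_mem, State.put_mem]
    · simp
    · simp
    · refine ⟨by simp [TreeNetwork.endsIn], by simp [TreeNetwork.endsIn], fun i => Or.inl ⟨?_, ?_⟩⟩
      · simpa [State.set_mem, State.put_mem] using h4 i
      · simp [TreeNetwork.endsIn]
  intro s1 F1 hT
  replace hP := hP.frame F1 (by decide) (by decide)
  refine (Spec.loop (a := 0) (b := (T.tour T.root).length)
    (fun k => ((T.tour T.root).map fun e => 80 * (T.net.rot e.2).length + 150).getD k 0)
    (fun k s' => ∃ E l, E.length = k ∧ Touring T E l s') (Nat.zero_le _) ⟨[], _, rfl, hT⟩ ?_ ?_ ?_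
    (t := 10 + ∑ v, (160 * (T.net.rot v).length + 320))).mono le_rfl ?_
  · rintro s2 k F2 - hk ⟨E, l, hE, hT⟩
    have F2' : Frame tourStep s1 s2 := ⟨F2.reg, F2.mem, F2.out⟩
    replace hP := hP.frame F2' (by decide) (by decide)
    have hlen := hT.length_le
    have hsize := hT.size
    cases l with
    | nil =>
      have := congrArg List.length hT.split
      simp at this
      omega
    | cons e l =>
      refine ⟨?_, ?_, (tourStep_spec hP hT).mono ?_ ?_⟩
      · simp only [Test.Fits, Exp.Fits, hsize]
        omega
      · simp [Test.Holds, Exp.val, hsize]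
      · have hsplit := hT.split
        rw [List.flatMap_cons] at hsplit
        -- The top of the stack is the next event of the tour, so the cost of this round is entry
        -- `k` of the list of costs.
        obtain ⟨Y, hY⟩ : ∃ Y, T.expand e = e :: Y := by
          unfold TreeNetwork.expand
          split_ifs with he
          · rw [TreeNetwork.tour_eq]
            exact ⟨_, by rw [← he]⟩
          · exact ⟨[], rfl⟩
        rw [hsplit, hY, ← hE]
        simp
      · rintro s3 - ⟨l', h⟩
        exact ⟨_, l', by simp [hE], h⟩
  · rintro s2 F2 ⟨E, l, hE, hT⟩
    have hlen := hT.length_le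
    have hsize := hT.size
    have h1 := congrArg List.length hT.split
    have h2 := T.length_le_flatMap_expand l
    rw [List.length_append] at h1
    simp only [Test.Fits, Test.Holds, Exp.Fits, Exp.val, hsize]
    omega
  · have h1 := sum_getD ((T.tour T.root).map fun e => 80 * (T.net.rot e.2).length + 150)
    rw [List.length_map, Finset.range_eq_Ico] at h1
    rw [h1]
    have h2 := sum_tour_le (T := T) fun v => 80 * (T.net.rot v).length + 150
    have h3 := T.length_tour
    have h4 : ∑ v, (160 * (T.net.rot v).length + 320) =
        2 * ∑ v, (80 * (T.net.rot v).length + 150) + 20 * n := by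
      have h5 : ∑ _v : Fin n, 20 = 20 * n := by simp [mul_comm]
      rw [← h5, Finset.mul_sum, ← Finset.sum_add_distrib]
      refine Finset.sum_congr rfl fun v _ => ?_
      ring
    simp only [Test.cost, Exp.cost]
    omega
  · rintro s2 F2 ⟨E, l, hE, hT⟩
    obtain ⟨split, stack, size, count, par, par_root, lo, hi, ends⟩ := hT
    have h1 := congrArg List.length split
    rw [List.length_append] at h1
    have h2 : l.flatMap T.expand = [] := List.eq_nil_of_length_eq_zero (by omega)
    rw [h2, List.append_nil] at split
    subst split
    have hmem : ∀ b v, (b, v) ∈ T.tour T.root := fun b v => T.mem_tour.2 (T.root_anc v)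
    exact ⟨count, fun v hv => par v hv (Or.inl (hmem _ _)), par_root, fun v => lo v (hmem _ _),
      fun v => hi v (hmem _ _), ends.line, fun g hg => ends.mate g hg (TreeNetwork.mate_lt hg)⟩

end RAM
end BlockCrossing

/-! ### Finding the topmost edge on each side of a line. -/

namespace BlockCrossing
namespace RAM

local infixr:60 " ;; " => Prog.seq

/-- Compares the mate of the line end in register 52 with the intervals of a vertex (registers 53
and 54) and of its parent (registers 55 and 56). -/
def topLoStep : Prog :=
  .assign 57 (.read 9 (.reg 52)) ;;
  .cond (.lt (.reg 57) (.reg 53)) (.cond (.lt (.reg 57) (.reg 55)) .skip (.write 10 (.reg 52) (.reg 53)))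
    (.cond (.lt (.reg 57) (.reg 54)) .skip
      (.cond (.lt (.reg 57) (.reg 56)) (.write 10 (.reg 52) (.reg 53)) .skip))

def topLoInit : Prog :=
  .assign 52 (.read 6 (.reg 51)) ;; .assign 53 (.read 6 (.reg 51)) ;; .assign 54 (.read 7 (.reg 51)) ;;
  .assign 55 (.read 6 (.read 2 (.reg 51))) ;; .assign 56 (.read 7 (.read 2 (.reg 51)))

/-- Computes `topLo` for all line ends. -/
def topLoAll : Prog :=
  (.assign 2 (.reg 41) ;; .assign 3 (.mul (.reg 2) (.reg 2)) ;; .assign 51 (.const 0)) ;;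
  .forUpTo 51 (.reg 0)
    (.cond (.eq (.reg 51) (.reg 36)) .skip (topLoInit ;; .forUpTo 52 (.reg 54) topLoStep))

variable {W n m : ℕ} {T : TreeNetwork n m} {s : State}

open Classical in
/-- The table `f` holds the values of `topLo` for the line ends that are new at some vertex in the
range `p`, and `0` for the others. -/
def TopLoTable (T : TreeNetwork n m) (p : Fin n → ℕ → Prop) (f : ℕ → ℕ) : Prop :=
  ∀ g < T.numEnds, f g = if ∃ b, b ≠ T.root ∧ T.IsNew b g ∧ p b g then T.topLo g else 0

theorem TopLoTable.congr {p q : Fin n → ℕ → Prop} {f : ℕ → ℕ} (h : TopLoTable T p f)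
    (hpq : ∀ b g, b ≠ T.root → T.IsNew b g → (p b g ↔ q b g)) : TopLoTable T q f := by
  intro g hg
  rw [h g hg]
  congr 1
  refine propext (exists_congr fun b => and_congr_right fun hb => and_congr_right fun hn => hpq b g hb hn)

theorem TopLoTable.update {p : Fin n → ℕ → Prop} {f : ℕ → ℕ} (h : TopLoTable T p f) {a : Fin n} {j : ℕ}
    (ha : a ≠ T.root) (hj : T.IsNew a j) :
    TopLoTable T (fun b g => p b g ∨ b = a ∧ g = j) (Function.update f j (T.lo a)) := by
  intro g hg
  by_cases hgj : g = j
  · subst hgj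
    rw [Function.update_self, if_pos ⟨a, ha, hj, Or.inr ⟨rfl, rfl⟩⟩, T.topLo_eq ha hj]
  · rw [Function.update_of_ne hgj, h g hg]
    congr 1
    simp [hgj]

/-- An end that is new on no edge has the default value `0` of `topLo`, which agrees with the fresh
memory. -/
theorem TopLoTable.topLo {p : Fin n → ℕ → Prop} {f : ℕ → ℕ} (h : TopLoTable T p f) (hp : ∀ b g, p b g)
    {g : ℕ} (hg : g < T.numEnds) : f g = T.topLo g := by
  rw [h g hg]
  split_ifs with hc
  · rfl
  · rw [TreeNetwork.topLo, dif_neg]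
    rintro ⟨b, hb, hn⟩
    exact hc ⟨b, hb, hn, hp b g⟩

theorem topLoStep_spec (hT : Toured T s) (hW : 2 * n + T.numEnds < W) {a : Fin n} {g : ℕ}
    (hg : T.Mem a g) (h52 : s.reg 52 = g) (h53 : s.reg 53 = T.lo a) (h54 : s.reg 54 = T.hi a)
    (h55 : s.reg 55 = T.lo (T.par a)) (h56 : s.reg 56 = T.hi (T.par a)) :
    Spec W topLoStep s 20 fun s' => (T.IsNew a g → s'.mem 10 = Function.update (s.mem 10) g (T.lo a)) ∧
      (¬ T.IsNew a g → s'.mem 10 = s.mem 10) := by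
  have hgn := hg.lt
  have hmt := TreeNetwork.mate_lt hgn
  have h9 := hT.mate g hgn
  have hlo := T.lo_le_hi a
  have hhi := T.hi_le a
  have hlo' := T.lo_le_hi (T.par a)
  have hhi' := T.hi_le (T.par a)
  have hp := hg.par
  -- Given that `g` lies below `a`, newness is a matter of comparing the mate with the two nested
  -- intervals.
  have hnew : T.IsNew a g ↔ (T.mate g < T.lo a ∧ T.lo (T.par a) ≤ T.mate g) ∨
      (T.hi a ≤ T.mate g ∧ T.mate g < T.hi (T.par a)) := by
    simp only [TreeNetwork.IsNew, TreeNetwork.Strand, TreeNetwork.Mem] at hg hp ⊢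
    omega
  rw [hnew]
  refine Spec.of_wp ?_ (by decide)
  simp only [topLoStep, wp, Exp.Fits, Exp.val, Test.Fits, Test.Holds, State.set_reg, State.set_mem,
    State.put_mem, Nat.reduceEqDiff, if_false, if_true, h52, h53, h54, h55, h56, h9]
  generalize s.mem 10 = f
  refine ⟨by omega, by omega, fun h1 => ⟨by omega, fun h2 => ?_, fun h2 => ⟨by omega, ?_⟩⟩,
    fun h1 => ⟨by omega, fun h2 => ?_, fun h2 => ⟨by omega, fun h3 => ⟨by omega, ?_⟩, fun h3 => ?_⟩⟩⟩
  · exact ⟨fun h => by omega, fun _ => trivial⟩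
  · exact ⟨fun _ => trivial, fun h => by omega⟩
  · exact ⟨fun h => by omega, fun _ => trivial⟩
  · exact ⟨fun _ => trivial, fun h => by omega⟩
  · exact ⟨fun h => by omega, fun _ => trivial⟩

/-- Every vertex other than the root scans its own interval, which has at most `numEnds` elements.
An end is new on at most one edge, so no correct value is overwritten. -/
theorem topLoAll_spec (hT : Toured T s) (h0 : s.reg 0 = n) (h36 : s.reg 36 = T.root)
    (hW : T.bound + 2 * T.numEnds + 2 * n + m + 10 < W) (h10 : ∀ g, s.mem 10 g = 0) :
    Spec W topLoAll s (100 * ((n + 1) * (T.numEnds + 1))) (Ready W T) := by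
  have hb : T.bound = T.numEnds * T.numEnds := rfl
  refine Spec.seq (t := 10) (Q := fun s' => s'.reg 2 = T.numEnds ∧ s'.reg 3 = T.bound ∧ s'.reg 51 = 0)
    (Spec.of_wp ?_ (by decide)) ?_ (t' := (n + 1) * 7 + n * (50 + 30 * (T.numEnds + 1))) ?_
  · simp only [wp, Exp.Fits, Exp.val, State.set_reg, hT.count, Nat.reduceEqDiff, if_false, if_true, hb]
    rw [hb] at hW
    exact ⟨by omega, ⟨by omega, by omega, by omega⟩, by omega, trivial, trivial, trivial⟩
  · rintro s1 F1 ⟨h2, h3, h51⟩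
    replace hT := hT.frame F1 (by decide) (by decide)
    rw [← F1.reg 0 (by decide)] at h0
    rw [← F1.reg 36 (by decide)] at h36
    rw [← F1.mem 10 (by decide)] at h10
    refine (Spec.forUpTo (a := 0) (b := n) (fun _ => 50 + 30 * (T.numEnds + 1))
      (fun k s' => TopLoTable T (fun b _ => b < k) (s'.mem 10)) (Nat.zero_le _) (by omega) (by omega)
      h51 (by decide) ?_ ?_ ?_ (t := (n + 1) * 7 + n * (50 + 30 * (T.numEnds + 1)))
      (by simp [Exp.cost])).mono le_rfl ?_
    · intro g _
      rw [h10]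
      simp
    · intro s2 k F2 _ _
      simp only [Exp.Fits, Exp.val]
      rw [F2.reg 0 (by decide), h0]
      omega
    · intro s2 k F2 _ hk h51 hI
      replace hT := hT.frame F2 (by decide) (by decide)
      rw [← F2.reg 36 (by decide)] at h36
      have hrn := T.root.2
      refine Spec.cond (t := 46 + 30 * (T.numEnds + 1)) ?_ ?_ ?_ (by simp only [Test.cost, Exp.cost]; omega)
      · simp only [Test.Fits, Exp.Fits, h51, h36]
        omega
      · intro h
        simp only [Test.Holds, Exp.val, h51, h36] at h
        refine Spec.of_wp (hI.congr fun b g hb _ => ?_) (by simp only [Prog.cost]; omega)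
        have : (b : ℕ) ≠ T.root := Fin.val_ne_of_ne hb
        show (b : ℕ) < k ↔ (b : ℕ) < k + 1
        omega
      · intro h
        simp only [Test.Holds, Exp.val, h51, h36] at h
        obtain ⟨a, rfl⟩ : ∃ a : Fin n, k = a := ⟨⟨k, hk⟩, rfl⟩
        have ha : a ≠ T.root := fun h' => h (by rw [h'])
        have hpar := hT.par a ha
        have hpn := (T.par a).2
        have hlo := T.lo_le_hi a
        have hhi := T.hi_le a
        have hlo' := T.lo_le_hi (T.par a)
        have hhi' := T.hi_le (T.par a)
        refine Spec.seq (t := 30) (Q := fun s' => s'.reg 52 = T.lo a ∧ s'.reg 53 = T.lo a ∧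
          s'.reg 54 = T.hi a ∧ s'.reg 55 = T.lo (T.par a) ∧ s'.reg 56 = T.hi (T.par a))
          (Spec.of_wp ?_ (by decide)) ?_ (t' := (T.hi a - T.lo a + 1) * 7 + (T.hi a - T.lo a) * 20) ?_
        · simp only [topLoInit, wp, Exp.Fits, Exp.val, State.set_reg, State.set_mem, h51, hpar, hT.lo, hT.hi,
            Nat.reduceEqDiff, if_false, if_true]
          simp only [and_true]
          omega
        · rintro s3 F3 ⟨h52, h53, h54, h55, h56⟩
          replace hT := hT.frame F3 (by decide) (by decide)
          rw [← F3.mem 10 (by decide)] at hI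
          refine (Spec.forUpTo (a := T.lo a) (b := T.hi a) (fun _ => 20)
            (fun j s' => TopLoTable T (fun b g => b < a ∨ b = a ∧ g < j) (s'.mem 10)) hlo (by omega)
            (by omega) h52 (by decide) ?_ ?_ ?_ ?_).mono le_rfl ?_
          · refine hI.congr fun b g hb hn => ?_
            show (b : ℕ) < a ↔ _
            rw [← Fin.lt_def]
            refine ⟨Or.inl, ?_⟩
            rintro (h | ⟨rfl, h⟩)
            · exact h
            · have := hn.1.1.1
              omega
          · intro s4 j F4 _ _
            simp only [Exp.Fits, Exp.val]
            rw [F4.reg 54 (by decide), h54]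
            omega
          · intro s4 j F4 hj1 hj2 hj hI
            replace hT := hT.frame F4 (by decide) (by decide)
            rw [← F4.reg 53 (by decide)] at h53
            rw [← F4.reg 54 (by decide)] at h54
            rw [← F4.reg 55 (by decide)] at h55
            rw [← F4.reg 56 (by decide)] at h56
            refine (topLoStep_spec hT (by omega) ⟨hj1, hj2⟩ hj h53 h54 h55 h56).mono le_rfl ?_
            rintro s5 - ⟨hs1, hs2⟩
            show TopLoTable _ _ (s5.mem 10)
            by_cases hn : T.IsNew a j
            · rw [hs1 hn]
              refine (hI.update ha hn).congr fun b g _ _ => ?_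
              rw [or_assoc, ← and_or_left, Nat.lt_succ_iff_lt_or_eq]
            · rw [hs2 hn]
              refine hI.congr fun b g _ hbn => ?_
              refine or_congr_right (and_congr_right ?_)
              rintro rfl
              have : g ≠ j := by
                rintro rfl
                exact hn hbn
              omega
          · simp [Exp.cost]
          · rintro s4 - ⟨-, hI⟩
            show TopLoTable _ _ (s4.mem 10)
            refine hI.congr fun b g _ hn => ?_
            rw [Nat.lt_succ_iff_lt_or_eq, ← Fin.lt_def, Fin.val_inj]
            refine or_congr_right ⟨And.left, ?_⟩
            rintro rfl
            exact ⟨rfl, hn.1.1.2⟩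
        · omega
    · rintro s2 F2 ⟨-, hI⟩
      replace hT := hT.frame F2 (by decide) (by decide)
      rw [← F2.reg 2 (by decide)] at h2
      rw [← F2.reg 3 (by decide)] at h3
      exact ⟨h2, h3, hT.par, hT.par_root, hT.lo, hT.hi, hT.line, hT.mate,
        fun g hg => hI.topLo (fun b _ => b.2) hg, hW⟩
  · generalize T.numEnds = e
    nlinarith [Nat.zero_le (n * e), Nat.zero_le n, Nat.zero_le e]

end RAM
end BlockCrossing

/-! ### The whole program and its running time. -/

namespace BlockCrossing

namespace TreeNetwork

variable {n m : ℕ} (T : TreeNetwork n m)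

theorem ncard_edgeSet : T.net.graph.edgeSet.ncard + 1 = n := by
  classical
  rw [Set.ncard_eq_toFinset_card']
  exact T.isTree.card_edgeFinset.trans (Fintype.card_fin n)

theorem sum_length_rot : ∑ v, (T.net.rot v).length = 2 * T.net.graph.edgeSet.ncard := by
  classical
  rw [Set.ncard_eq_toFinset_card']
  refine Eq.trans (Finset.sum_congr rfl fun v _ => ?_) T.net.graph.sum_degrees_eq_twice_card_edges
  rw [← List.toFinset_card_of_nodup (T.net.rot_nodup v), ← SimpleGraph.card_neighborFinset_eq_degree]
  congr 1
  ext w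
  rw [List.mem_toFinset, T.net.mem_rot, SimpleGraph.mem_neighborFinset]

theorem sum_edges_le (f : Fin n → ℕ) :
    (T.net.edges.map fun e => f (T.child e)).sum ≤ ∑ a ∈ Finset.univ.erase T.root, f a := by
  classical
  have hmap : T.net.edges.map (fun e => f (T.child e)) = (T.net.edges.map T.child).map f := by
    rw [List.map_map]
    rfl
  have hnd : (T.net.edges.map T.child).Nodup :=
    T.nodup_edges.map_on fun e he e' he' h => T.child_inj he he' h
  rw [hmap, ← List.sum_toFinset _ hnd]
  apply Finset.sum_le_sum_of_subset
  intro a ha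
  obtain ⟨e, he, rfl⟩ := List.mem_map.1 (List.mem_toFinset.1 ha)
  exact Finset.mem_erase.2 ⟨(T.edge_cases he).1, Finset.mem_univ _⟩

end TreeNetwork

namespace RAM

open Sorting

local infixr:60 " ;; " => Prog.seq

/-- Reads a tree with lines and writes a solution. -/
def solve : Prog := parse ;; traverse ;; topLoAll ;; emitAll

variable {n m : ℕ} (T : TreeNetwork n m)

/-- The factors `numNew + 1` sum to at most `numEnds + n` over all edges, since every end is new
only once. This is the amortization behind the time bound. -/
theorem sum_edgeCost_le : (T.net.edges.map (edgeCost T)).sum ≤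
    450 * ((T.numEnds + 1) * (T.numEnds + n)) + 20 * n := by
  refine (T.sum_edges_le fun a =>
    450 * ((T.numEnds + 1) * (numNew (T.strands a) (T.key a) + 1)) + 20).trans ?_
  have h1 := T.sum_numNew_le
  have h2 : (Finset.univ.erase T.root).card ≤ n := by
    simp
  rw [Finset.sum_add_distrib, ← Finset.mul_sum, ← Finset.mul_sum, Finset.sum_add_distrib, Finset.sum_const,
    Finset.sum_const, smul_eq_mul, smul_eq_mul, mul_one]
  have h3 := Nat.mul_le_mul_left (T.numEnds + 1) (Nat.add_le_add (Nat.le_of_succ_le h1) h2)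
  omega

theorem sum_ite_eq_sum_filter {α : Type*} (l : List α) (p : α → Prop) [DecidablePred p] (f : α → ℕ) :
    (l.map fun x => 30 + if p x then f x else 0).sum = 30 * l.length + ((l.filter p).map f).sum := by
  induction l with
  | nil => rfl
  | cons x l ih =>
    rw [List.map_cons, List.sum_cons, ih, List.filter_cons, List.length_cons]
    by_cases hx : p x
    · simp [hx]; ring
    · simp [hx]; ring

theorem sum_vertexCost_le : ((List.finRange n).map (vertexCost T)).sum ≤
    450 * ((T.numEnds + 1) * (T.numEnds + n)) + 40 * n + 50 * (2 * T.net.graph.edgeSet.ncard) := by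
  have h1 : ((List.finRange n).map (vertexCost T)).sum = (T.net.edges.map (edgeCost T)).sum +
      ∑ v, (50 * (T.net.rot v).length + 20) := by
    rw [Network.edges, List.map_flatMap, List.flatMap_def, List.sum_flatten, List.map_map, ← List.sum_ofFn, List.ofFn_eq_map]
    rw [← List.sum_map_add]
    congr 1
    refine List.map_congr_left fun u _ => ?_
    rw [vertexCost, sum_ite_eq_sum_filter, Function.comp_apply, List.map_map, Function.comp_def]
    omega
  rw [h1, Finset.sum_add_distrib, ← Finset.mul_sum, T.sum_length_rot]
  have h2 := sum_edgeCost_le T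
  simp
  omega

theorem solve_time :
    50 * (n + m) + 50 + (20 + ∑ v, (160 * (T.net.rot v).length + 320) +
      (100 * ((n + 1) * (T.numEnds + 1)) + (((List.finRange n).map (vertexCost T)).sum + 20 * n + 20))) ≤
    6000 * (m * (m + T.net.graph.edgeSet.ncard)) := by
  have h1 := sum_vertexCost_le T
  have h2 : ∑ v, (160 * (T.net.rot v).length + 320) = 160 * (2 * T.net.graph.edgeSet.ncard) + n * 320 := by
    rw [Finset.sum_add_distrib, ← Finset.mul_sum, T.sum_length_rot]
    simp
  have h3 := T.ncard_edgeSet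
  have h4 := T.numEnds_le
  have h5 := T.two_le
  rw [h2]
  generalize T.net.graph.edgeSet.ncard = e at *
  generalize ((List.finRange n).map (vertexCost T)).sum = c at *
  generalize T.numEnds = k at *
  obtain rfl : n = e + 1 := h3.symm
  have h6 : (k + 1) * (k + (e + 1)) ≤ (2 * m + 1) * (2 * m + (e + 1)) := by gcongr
  have h7 : (e + 1 + 1) * (k + 1) ≤ (e + 1 + 1) * (2 * m + 1) := by gcongr
  -- As `m` is at least two, these absorb the lower order terms into `m * (m + e)`.
  have h8 : 2 * m ≤ m * m := by gcongr
  have h9 : 2 * e ≤ m * e := by gcongr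
  nlinarith

/-- The largest words are of the order of `numEnds ^ 2`, so the cube of the input length suffices
for them. The exponent is `6000` only because the same constant serves for the time. -/
theorem solve_spec : ∃ t ≤ 6000 * (m * (m + T.net.graph.edgeSet.ncard)),
    solve.Computes (T.net.encode.length ^ 6000) T.net.encode (T.net.encodeOrders T.solution) t := by
  suffices h : Spec (T.net.encode.length ^ 6000) solve (State.init T.net.encode)
      (6000 * (m * (m + T.net.graph.edgeSet.ncard))) fun s' => s'.out = T.net.encodeOrders T.solution by
    obtain ⟨s', t, h1, h2, h3⟩ := h
    exact ⟨t, h2, s', h1, h3⟩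
  have hsize := size_le T.net
  have hm := T.two_le
  have hk := T.numEnds_le
  have hW3 := Nat.pow_le_pow_right (n := T.net.encode.length) (by omega) (show 3 ≤ 6000 by decide)
  have hseg : Seg ((State.init T.net.encode).mem 0) 0 T.net.encode := by
    rw [seg_iff]
    intro i hi
    simp [State.init, hi]
  have hzero : ∀ A ≠ 0, ∀ i, (State.init T.net.encode).mem A i = 0 := by
    intro A hA i
    simp [State.init, hA]
  have hout : (State.init T.net.encode).out = [] := rfl
  have hparse : 4 * T.net.encode.length + 20 < T.net.encode.length ^ 6000 := by
    refine lt_of_lt_of_le ?_ hW3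
    generalize T.net.encode.length = L at *
    nlinarith [Nat.mul_le_mul (show 8 ≤ L by omega) (show 8 ≤ L by omega),
      Nat.mul_le_mul_right L (Nat.mul_le_mul (show 8 ≤ L by omega) (show 8 ≤ L by omega))]
  have hbound : T.bound + 2 * T.numEnds + 2 * n + m + 10 < T.net.encode.length ^ 6000 := by
    refine lt_of_lt_of_le ?_ hW3
    have hb : T.bound = T.numEnds * T.numEnds := rfl
    rw [hb]
    generalize T.net.encode.length = L at *
    have h1 : T.numEnds * T.numEnds ≤ L * L := Nat.mul_le_mul (by omega) (by omega)
    nlinarith [Nat.mul_le_mul_right L (show 8 ≤ L by omega),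
      Nat.mul_le_mul_right (L * L) (show 8 ≤ L by omega)]
  generalize T.net.encode.length ^ 6000 = W at *
  generalize State.init T.net.encode = s at *
  refine (parse_spec hseg (hzero 3 (by decide)) hparse).seq ?_ (solve_time T)
  rintro s1 F1 ⟨hA, h36, hends⟩
  refine (traverse_spec ⟨hA, h36, hends, by omega⟩ fun i => ?_).seq ?_ le_rfl
  · rw [F1.mem 4 (by decide), hzero 4 (by decide)]
  intro s2 F2 hT
  replace hA := hA.frame F2 (by decide) (by decide) (by decide)
  rw [← F2.reg 36 (by decide)] at h36
  refine (topLoAll_spec hT hA.size h36 hbound fun i => ?_).seq ?_ le_rfl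
  · rw [F2.mem 10 (by decide), F1.mem 10 (by decide), hzero 10 (by decide)]
  intro s3 F3 hR
  replace hA := hA.frame F3 (by decide) (by decide) (by decide)
  refine (emitAll_spec hR hA).mono le_rfl ?_
  intro s4 _ h
  rw [h, F3.out (by decide), F2.out (by decide), F1.out (by decide), hout, List.nil_append]

end RAM
end BlockCrossing

theorem mainTheorem3 :
    (∃ (p : BlockCrossing.RAM.Prog) (C : ℕ),
      ∀ (n m : ℕ) (N : BlockCrossing.Network n m),
        2 ≤ m → N.graph.IsTree → N.PathTerminal →
        ∃ (S : BlockCrossing.LineOrders n m) (t : ℕ),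
          N.Feasible S ∧ N.Monotone S ∧ N.blockCrossings S ≤ 2 * m - 3 ∧
          t ≤ C * (m * (m + N.graph.edgeSet.ncard)) ∧
          p.Computes (N.encode.length ^ C) N.encode (N.encodeOrders S) t) ∧
    (∀ m : ℕ, 2 ≤ m →
      ∃ (n : ℕ) (N : BlockCrossing.Network n m),
        N.graph.IsTree ∧ N.PathTerminal ∧
        ∀ S : BlockCrossing.LineOrders n m, N.Feasible S → 2 * m - 3 ≤ N.blockCrossings S) := by
  refine ⟨⟨BlockCrossing.RAM.solve, 6000, fun n m N hm hN hP => ?_⟩,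
    fun m hm => BlockCrossing.exists_lower_bound m hm⟩
  let T : BlockCrossing.TreeNetwork n m := ⟨N, hm, hN, hP⟩
  obtain ⟨t, ht, h⟩ := BlockCrossing.RAM.solve_spec T
  exact ⟨T.solution, t, T.feasible_solution, T.monotone_solution, T.blockCrossings_solution, ht, h⟩
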